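/- **Conventions.** For $p=(c_1,r_1)$, $q=(c_2,r_2)\in\mathbb C\times\mathbb C$ put $p\odot q=(c_1+r_1c_2,\;r_1r_2)$; $\mathrm{Aff}(\mathbb C)$ is the group of pairs $(c,r)$ with $r\neq0$ under $\odot$. Operads are symmetric and unital, indexed by finite sets, with partial compositions $\circ_s$; in a topological operad relabelings and partial compositions are continuous. Let $\mathrm{Conf}^0(E)$ be the set of families $(c_e,r_e)_{e\in E}$ in $\mathbb C\times\mathbb C$ with $|c_e-c_{e'}|>|r_e|+|r_{e'}|$ for $e\ne e'$. Say that $(c,r)$ *lies in the disk* if $|c|+|r|\le1$, with strict inequality unless $c=0$. * $FLD(S)$, for $S\neq\emptyset$, consists of the elements of $\mathrm{Conf}^0(S)$ with all $r_s\ne0$ and all $(c_s,r_s)$ in the disk; $FLD(\emptyset)=\emptyset$. The composition $x\circ_s y$ replaces $(c_s,r_s)$ by the family $(c_s,r_s)\odot y$. $FLD_1$ is the arity one part of $FLD$. $An^{\mathrm{triv}}(S)$ is the set of $(c,r)$ in the disk, $r=0$ allowed, if $|S|=1$, and is empty otherwise; composition is $\odot$. All three carry the subspace topologies from $(\mathbb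 C\times\mathbb C)^S$. * An *$S$-tree* is a finite rooted tree with at least one vertex, with leaf set $S$, in which every vertex has at least one incoming edge. $E(v)$ is the set of incoming edges of the vertex $v$; an edge in $E(v)$ is external if it ends in a leaf and internal otherwise. The tree is *nearly stable* if every vertex with exactly one incoming edge is the root or is adjacent to a leaf. * The augmented marking space $\widehat{\mathrm{Mark}}_v$ of the root is the space of elements of $\mathrm{Conf}^0(E(v))$ with $r_e\neq0$ at external edges and all $(c_e,r_e)$ in the disk. For another vertex it is the quotient by $\mathrm{Aff}(\mathbb C)$ (acting on the left by $\odot$) of the space of elements of $\mathrm{Conf}^0(E(v))$ with $r_e\ne0$ at external edges. $\mathrm{Mark}_v\subset\widehat{\mathrm{Mark}}_v$ is the subset where $r_e=0$ at all internal edges. * $\overline{\mathbb M}(S)=\coprod_T\prod_{v\in V(T)}\mathrm{Mark}_v$, over the isomorphism classes of nearly stable $S$-trees $T$. The composition $x\circ_s y$ grafts the tree of $y$ to the leaf $s$ of the tree of $x$, and merges the root of $y$ with the vertex $v$ carrying $s$ by replacing $(c_s,r_s)$ in a representative of the decoration of $v$ by $(c_s,r_s)\odot y_{\mathrm{root}}$;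 if $v$ is not the root and the resulting configuration is a single point ($v$ has a single incoming edge, and it is internal), then $v$ is forgotten. The unit is the corolla decorated by $(0,1)$. * The map $FLD\to\overline{\mathbb M}$ sends $x$ to the corolla decorated by $x$. The map $An^{\mathrm{triv}}\to\overline{\mathbb M}$ sends $(c,r)$ with $r\ne0$ to the corolla decorated by $(c,r)$, and $(c,0)$ to the tree with one leaf and two vertices whose root is decorated by $(c,0)$ (the other vertex carries no information). * Fix a linear order of $S$; it orders each $E(v)$ by the least leaf above an edge. A point of $\widehat{\mathrm{Mark}}_v$, $v$ not the root, has a unique normalized representative: $(0,1)$ if $|E(v)|=1$, and otherwise the one with first center $0$, second center in $\mathbb R_{>0}$, and union of the disks of center $c_e$ and radius $|r_e|$ of diameter $\tfrac12$. For a nearly stable $S$-tree $T$ let $\Phi_T:\prod_{v\in V(T)}\widehat{\mathrm{Mark}}_v\to\overline{\mathbb M}(S)$ be the map that contracts all internal edges $e$ with $r_e\neq0$, composing the normalized representatives by $\odot$. **Proposition.** 1. $\overline{\mathbb M}$ is an operad of sets, and it is the pushout of $FLD\leftarrow FLD_1\to An^{\mathrm{triv}}$ (the inclusions) in the category of operads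 of sets, with the above maps $FLD\to\overline{\mathbb M}\leftarrow An^{\mathrm{triv}}$. 2. There is a (necessarily unique) topology on every set $\overline{\mathbb M}(S)$ such that, for every point $x=(x_v)_{v\in V(T)}$ with underlying tree $T$ and for every linear order of $S$, the sets $\Phi_T\left(\prod_vU_v\right)$, with $U_v$ an open neighborhood of $x_v$ in $\widehat{\mathrm{Mark}}_v$, form a neighborhood basis at $x$. 3. With these topologies $\overline{\mathbb M}$ is a topological operad (all structure maps are continuous), the maps $FLD\to\overline{\mathbb M}$ and $An^{\mathrm{triv}}\to\overline{\mathbb M}$ are injective and continuous, and $\overline{\mathbb M}$ is the pushout of $FLD\leftarrow FLD_1\to An^{\mathrm{triv}}$ in the category of topological operads. -/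

import Mathlib

universe u v w

namespace TrivDisks

/-! ## Symmetric operads indexed by finite sets, with partial compositions -/

/-- The leaves of a partial composition: the elements of `S` other than `s`, together with `S'`. -/
abbrev Ins {S : Type} (s : S) (S' : Type) : Type := {x : S // x ≠ s} ⊕ S'

/-- The structure maps of a symmetric operad of sets: relabelling along bijections, a unit in
arity one, and the partial compositions `x ∘_s y`. The axioms are in `IsOperad`. -/
structure OperadData where
  obj : (S : Type) → [Finite S] → Type u
  relabel : {S T : Type} → [Finite S] → [Finite T] → (S ≃ T) → obj S → obj T
  one : obj Unit
  comp : {S S' : Type} → [Finite S] → [Finite S'] → (s : S) → obj S → obj S' → obj (Ins s S')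

/-- Bijections `S ≃ T` and `S' ≃ T'` induce a bijection between the leaves of partial
compositions. -/
def Ins.congr {S T S' T' : Type} (σ : S ≃ T) (τ : S' ≃ T') (s : S) : Ins s S' ≃ Ins (σ s) T' :=
  Equiv.sumCongr (σ.subtypeEquiv fun x => by simp) τ

/-- Inserting the one-element set at `s` gives back `S`. -/
noncomputable def Ins.right {S : Type} (s : S) : Ins s Unit ≃ S :=
  Equiv.ofBijective (Sum.elim (fun x => x.1) (fun _ => s)) (by
    constructor
    · rintro (⟨x, hx⟩ | ⟨⟩) (⟨y, hy⟩ | ⟨⟩) h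
      · simp only [Sum.elim_inl] at h
        subst h
        rfl
      · exact absurd h hx
      · exact absurd h.symm hy
      · rfl
    · intro x
      by_cases h : x = s
      · exact ⟨Sum.inr (), by simp [h]⟩
      · exact ⟨Sum.inl ⟨x, h⟩, rfl⟩)

/-- Inserting `S'` in the one-element set gives back `S'`. -/
def Ins.left (S' : Type) : Ins () S' ≃ S' :=
  haveI : IsEmpty {x : Unit // x ≠ ()} := ⟨fun x => x.2 rfl⟩
  Equiv.emptySum _ _

/-- Inserting `S'` at `s` and then `S''` at `t ∈ S'` is the same as inserting at `s` the result
of inserting `S''` at `t`. -/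
def Ins.seq {S S' : Type} (S'' : Type) (s : S) (t : S') :
    Ins (Sum.inr t : Ins s S') S'' ≃ Ins s (Ins t S'') where
  toFun
    | Sum.inl ⟨Sum.inl x, _⟩ => Sum.inl x
    | Sum.inl ⟨Sum.inr y, h⟩ => Sum.inr (Sum.inl ⟨y, fun e => h (congrArg Sum.inr e)⟩)
    | Sum.inr r => Sum.inr (Sum.inr r)
  invFun
    | Sum.inl x => Sum.inl ⟨Sum.inl x, Sum.inl_ne_inr⟩
    | Sum.inr (Sum.inl y) => Sum.inl ⟨Sum.inr y.1, fun e => y.2 (Sum.inr_injective e)⟩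
    | Sum.inr (Sum.inr r) => Sum.inr r
  left_inv := by rintro (⟨x | y, h⟩ | r) <;> rfl
  right_inv := by rintro (x | y | r) <;> rfl

/-- Insertions at two different elements `s`, `t` of `S` commute. -/
def Ins.par {S : Type} (S' S'' : Type) (s t : S) (h : t ≠ s) :
    Ins (Sum.inl ⟨t, h⟩ : Ins s S') S'' ≃ Ins (Sum.inl ⟨s, h.symm⟩ : Ins t S'') S' where
  toFun
    | Sum.inl ⟨Sum.inl x, hx⟩ =>
      Sum.inl ⟨Sum.inl ⟨x.1, fun e => hx (congrArg Sum.inl (Subtype.ext e))⟩,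
        fun e => x.2 (congrArg Subtype.val (Sum.inl_injective e))⟩
    | Sum.inl ⟨Sum.inr y, _⟩ => Sum.inr y
    | Sum.inr r => Sum.inl ⟨Sum.inr r, Sum.inr_ne_inl⟩
  invFun
    | Sum.inl ⟨Sum.inl x, hx⟩ =>
      Sum.inl ⟨Sum.inl ⟨x.1, fun e => hx (congrArg Sum.inl (Subtype.ext e))⟩,
        fun e => x.2 (congrArg Subtype.val (Sum.inl_injective e))⟩
    | Sum.inl ⟨Sum.inr r, _⟩ => Sum.inr r
    | Sum.inr y => Sum.inl ⟨Sum.inr y, Sum.inr_ne_inl⟩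
  left_inv := by rintro (⟨x | y, h⟩ | r) <;> rfl
  right_inv := by rintro (⟨x | y, h⟩ | r) <;> rfl

/-- The axioms of a symmetric unital operad (of sets). -/
structure IsOperad (P : OperadData.{u}) : Prop where
  relabel_refl : ∀ {S : Type} [Finite S] (x : P.obj S), P.relabel (Equiv.refl S) x = x
  relabel_trans : ∀ {S T U : Type} [Finite S] [Finite T] [Finite U] (σ : S ≃ T) (τ : T ≃ U)
    (x : P.obj S), P.relabel (σ.trans τ) x = P.relabel τ (P.relabel σ x)
  equivariant : ∀ {S T S' T' : Type} [Finite S] [Finite T] [Finite S'] [Finite T']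
    (σ : S ≃ T) (τ : S' ≃ T') (s : S) (x : P.obj S) (y : P.obj S'),
    P.comp (σ s) (P.relabel σ x) (P.relabel τ y) = P.relabel (Ins.congr σ τ s) (P.comp s x y)
  one_comp : ∀ {S : Type} [Finite S] (x : P.obj S),
    P.relabel (Ins.left S) (P.comp () P.one x) = x
  comp_one : ∀ {S : Type} [Finite S] (s : S) (x : P.obj S),
    P.relabel (Ins.right s) (P.comp s x P.one) = x
  assoc_seq : ∀ {S S' S'' : Type} [Finite S] [Finite S'] [Finite S''] (s : S) (t : S')
    (x : P.obj S) (y : P.obj S') (r : P.obj S''),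
    P.relabel (Ins.seq S'' s t) (P.comp (Sum.inr t : Ins s S') (P.comp s x y) r) =
      P.comp s x (P.comp t y r)
  assoc_par : ∀ {S S' S'' : Type} [Finite S] [Finite S'] [Finite S''] (s t : S) (h : t ≠ s)
    (x : P.obj S) (y : P.obj S') (r : P.obj S''),
    P.relabel (Ins.par S' S'' s t h) (P.comp (Sum.inl ⟨t, h⟩ : Ins s S') (P.comp s x y) r) =
      P.comp (Sum.inl ⟨s, h.symm⟩ : Ins t S'') (P.comp t x r) y

/-- A family of maps `P(S) → Q(S)`, one for every finite set `S`. -/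
abbrev Family (P : OperadData.{u}) (Q : OperadData.{v}) : Type (max 1 u v) :=
  ∀ (S : Type) [Finite S], P.obj S → Q.obj S

/-- Morphisms of operads: families of maps that commute with all structure maps. -/
structure IsOperadHom {P : OperadData.{u}} {Q : OperadData.{v}} (f : Family P Q) : Prop where
  map_relabel : ∀ {S T : Type} [Finite S] [Finite T] (σ : S ≃ T) (x : P.obj S),
    f T (P.relabel σ x) = Q.relabel σ (f S x)
  map_one : f Unit P.one = Q.one
  map_comp : ∀ {S S' : Type} [Finite S] [Finite S'] (s : S) (x : P.obj S) (y : P.obj S'),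
    f (Ins s S') (P.comp s x y) = Q.comp s (f S x) (f S' y)

/-- A topology on each of the sets `P(S)`. -/
abbrev OperadTop (P : OperadData.{u}) : Type (max 1 u) :=
  ∀ (S : Type) [Finite S], TopologicalSpace (P.obj S)

/-- `P` is a topological operad for the given topologies: it is an operad, and all relabelling
maps and all partial compositions are continuous. -/
structure IsTopOperad (P : OperadData.{u}) (t : OperadTop P) : Prop where
  isOperad : IsOperad P
  continuous_relabel : ∀ {S T : Type} [Finite S] [Finite T] (σ : S ≃ T),
    @Continuous _ _ (t S) (t T) (P.relabel σ)
  continuous_comp : ∀ {S S' : Type} [Finite S] [Finite S'] (s : S),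
    @Continuous (P.obj S × P.obj S') (P.obj (Ins s S'))
      (@instTopologicalSpaceProd _ _ (t S) (t S')) (t (Ins s S')) (fun p => P.comp s p.1 p.2)

/-- Morphisms of topological operads: morphisms of operads that are continuous in each arity. -/
structure IsTopOperadHom {P : OperadData.{u}} {Q : OperadData.{v}} (tP : OperadTop P)
    (tQ : OperadTop Q) (f : Family P Q) : Prop where
  isOperadHom : IsOperadHom f
  continuous : ∀ (S : Type) [Finite S], @Continuous _ _ (tP S) (tQ S) (f S)

/-- The commutative square formed by `i : A → B`, `j : A → C`, `k : B → D`, `l : C → D` is a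
pushout in the category of operads of sets. -/
structure IsPushoutOfOperads {A : OperadData.{u}} {B : OperadData.{u}} {C : OperadData.{u}}
    {D : OperadData.{v}} (i : Family A B) (j : Family A C) (k : Family B D) (l : Family C D) :
    Prop where
  isOperad : IsOperad A ∧ IsOperad B ∧ IsOperad C ∧ IsOperad D
  isHom : IsOperadHom i ∧ IsOperadHom j ∧ IsOperadHom k ∧ IsOperadHom l
  comm : ∀ (S : Type) [Finite S] (a : A.obj S), k S (i S a) = l S (j S a)
  universal : ∀ (P : OperadData.{w}), IsOperad P → ∀ (f : Family B P) (g : Family C P),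
    IsOperadHom f → IsOperadHom g →
    (∀ (S : Type) [Finite S] (a : A.obj S), f S (i S a) = g S (j S a)) →
    ∃! h : Family D P, IsOperadHom h ∧
      (∀ (S : Type) [Finite S] (b : B.obj S), h S (k S b) = f S b) ∧
      (∀ (S : Type) [Finite S] (c : C.obj S), h S (l S c) = g S c)

/-- The commutative square formed by `i : A → B`, `j : A → C`, `k : B → D`, `l : C → D` is a
pushout in the category of topological operads. -/
structure IsPushoutOfTopOperads {A : OperadData.{u}} {B : OperadData.{u}} {C : OperadData.{u}}
    {D : OperadData.{v}} (tA : OperadTop A) (tB : OperadTop B) (tC : OperadTop C)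
    (tD : OperadTop D) (i : Family A B) (j : Family A C) (k : Family B D) (l : Family C D) :
    Prop where
  isTopOperad : IsTopOperad A tA ∧ IsTopOperad B tB ∧ IsTopOperad C tC ∧ IsTopOperad D tD
  isTopHom : IsTopOperadHom tA tB i ∧ IsTopOperadHom tA tC j ∧ IsTopOperadHom tB tD k ∧
    IsTopOperadHom tC tD l
  comm : ∀ (S : Type) [Finite S] (a : A.obj S), k S (i S a) = l S (j S a)
  universal : ∀ (P : OperadData.{w}) (tP : OperadTop P), IsTopOperad P tP →
    ∀ (f : Family B P) (g : Family C P), IsTopOperadHom tB tP f → IsTopOperadHom tC tP g →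
    (∀ (S : Type) [Finite S] (a : A.obj S), f S (i S a) = g S (j S a)) →
    ∃! h : Family D P, IsTopOperadHom tD tP h ∧
      (∀ (S : Type) [Finite S] (b : B.obj S), h S (k S b) = f S b) ∧
      (∀ (S : Type) [Finite S] (c : C.obj S), h S (l S c) = g S c)

/-! ## Configurations of framed disks and points, framed little disks, trivialized annuli -/

/-- The composition `(c₁, r₁) ⊙ (c₂, r₂) = (c₁ + r₁ c₂, r₁ r₂)`. The group `Aff(ℂ)` consists of
the pairs `(c, r)` with `r ≠ 0`. -/
def odot (p q : ℂ × ℂ) : ℂ × ℂ := (p.1 + p.2 * q.1, p.2 * q.2)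

/-- Configurations of pairwise disjoint framed disks (`r ≠ 0`) or points (`r = 0`) in the
plane. -/
def Conf0 (E : Type) : Set (E → ℂ × ℂ) :=
  {a | ∀ i j, i ≠ j → ‖(a i).2‖ + ‖(a j).2‖ < ‖(a i).1 - (a j).1‖}

/-- The framed disks or points `(c, r)` inside the unit disk: `|c| + |r| ≤ 1`, and this
inequality is strict unless `c = 0`. -/
def InDisk : Set (ℂ × ℂ) := {p | ‖p.1‖ + ‖p.2‖ ≤ 1 ∧ (p.1 ≠ 0 → ‖p.1‖ + ‖p.2‖ < 1)}

theorem one_odot (p : ℂ × ℂ) : odot (0, 1) p = p := by simp [odot]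

theorem odot_one (p : ℂ × ℂ) : odot p (0, 1) = p := by simp [odot]

theorem odot_assoc (p q r : ℂ × ℂ) : odot (odot p q) r = odot p (odot q r) := by
  simp only [odot, Prod.mk.injEq]
  constructor <;> ring

/-- A disk in the unit disk stays inside `p` after being transported by `p`. -/
theorem odot_le {p q : ℂ × ℂ} (hq : q ∈ InDisk) :
    ‖p.2 * q.1‖ + ‖p.2 * q.2‖ ≤ ‖p.2‖ := by
  rw [norm_mul, norm_mul, ← mul_add]
  exact mul_le_of_le_one_right (norm_nonneg _) hq.1

theorem odot_mem {p q : ℂ × ℂ} (hp : p ∈ InDisk) (hq : q ∈ InDisk) : odot p q ∈ InDisk := by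
  have h1 := odot_le (p := p) hq
  have h2 : ‖p.1 + p.2 * q.1‖ ≤ ‖p.1‖ + ‖p.2 * q.1‖ := norm_add_le _ _
  refine ⟨?_, ?_⟩
  · have := hp.1
    simp only [odot]
    linarith
  · intro hne
    simp only [odot] at hne ⊢
    by_cases h0 : p.1 = 0
    · have hq0 : q.1 ≠ 0 := by
        rintro e
        exact hne (by simp [h0, e])
      have hr0 : p.2 ≠ 0 := by
        rintro e
        exact hne (by simp [h0, e])
      have h3 := hq.2 hq0
      have h4 : ‖p.2‖ ≤ 1 := by
        have := hp.1
        have := norm_nonneg p.1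
        linarith
      have h5 : ‖p.2‖ * (‖q.1‖ + ‖q.2‖) < ‖p.2‖ :=
        mul_lt_of_lt_one_right (norm_pos_iff.2 hr0) h3
      rw [h0, zero_add, norm_mul, norm_mul, ← mul_add]
      linarith
    · have := hp.2 h0
      linarith

/-- Disjointness of transported configurations. -/
theorem odot_disjoint_left {p q a : ℂ × ℂ} (hq : ‖p.2 * q.1‖ + ‖p.2 * q.2‖ ≤ ‖p.2‖)
    (h : ‖p.2‖ + ‖a.2‖ < ‖p.1 - a.1‖) :
    ‖(odot p q).2‖ + ‖a.2‖ < ‖(odot p q).1 - a.1‖ := by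
  have h2 : ‖p.1 - a.1‖ ≤ ‖(odot p q).1 - a.1‖ + ‖p.2 * q.1‖ := by
    have : p.1 - a.1 = ((odot p q).1 - a.1) - p.2 * q.1 := by
      simp only [odot]
      ring
    rw [this]
    exact norm_sub_le _ _
  simp only [odot] at h2 ⊢
  linarith

theorem odot_disjoint_both {p a b : ℂ × ℂ} (hp : p.2 ≠ 0)
    (h : ‖a.2‖ + ‖b.2‖ < ‖a.1 - b.1‖) :
    ‖(odot p a).2‖ + ‖(odot p b).2‖ < ‖(odot p a).1 - (odot p b).1‖ := by
  have : (odot p a).1 - (odot p b).1 = p.2 * (a.1 - b.1) := by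
    simp only [odot]
    ring
  rw [this]
  simp only [odot, norm_mul]
  rw [← mul_add]
  exact mul_lt_mul_of_pos_left h (norm_pos_iff.2 hp)

/-- Replacing `x s` by the configuration `x s ⊙ y`. -/
def insConf {S S' : Type} (s : S) (x : S → ℂ × ℂ) (y : S' → ℂ × ℂ) : Ins s S' → ℂ × ℂ :=
  Sum.elim (fun a => x a.1) (fun b => odot (x s) (y b))

theorem insConf_mem {S S' : Type} (s : S) {x : S → ℂ × ℂ} {y : S' → ℂ × ℂ}
    (hx : x ∈ Conf0 S) (hy : y ∈ Conf0 S') (h : ∀ b, y b ∈ InDisk)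
    (h0 : (x s).2 ≠ 0 ∨ Subsingleton S') : insConf s x y ∈ Conf0 (Ins s S') := by
  rintro (a | a) (b | b) hab
  · exact hx _ _ fun e => hab (by rw [Subtype.ext e])
  · have := odot_disjoint_left (odot_le (h b)) (hx s a.1 (Ne.symm a.2))
    simp only [insConf, Sum.elim_inl, Sum.elim_inr]
    rw [norm_sub_rev, add_comm]
    exact this
  · exact odot_disjoint_left (odot_le (h a)) (hx s b.1 (Ne.symm b.2))
  · have hne : a ≠ b := fun e => hab (by rw [e])
    rcases h0 with h0 | h0
    · exact odot_disjoint_both h0 (hy a b hne)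
    · exact absurd (Subsingleton.elim a b) hne

theorem insConf_inDisk {S S' : Type} (s : S) {x : S → ℂ × ℂ} {y : S' → ℂ × ℂ}
    (hx : ∀ a, x a ∈ InDisk) (hy : ∀ b, y b ∈ InDisk) : ∀ e, insConf s x y e ∈ InDisk := by
  rintro (a | b)
  · exact hx _
  · exact odot_mem (hx s) (hy b)

/-- The operad `FLD` of framed little disks, with `FLD(∅)` empty. -/
def FLD : OperadData.{0} where
  obj S _ := {x : S → ℂ × ℂ // Nonempty S ∧ x ∈ Conf0 S ∧ (∀ s, (x s).2 ≠ 0) ∧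
    ∀ s, x s ∈ InDisk}
  relabel σ x := ⟨fun t => x.1 (σ.symm t), x.2.1.map σ,
    fun i j h => x.2.2.1 _ _ fun e => h (σ.symm.injective e),
    fun _ => x.2.2.2.1 _, fun _ => x.2.2.2.2 _⟩
  one := ⟨fun _ => (0, 1), ⟨()⟩, fun i j h => absurd (Subsingleton.elim i j) h,
    fun _ => one_ne_zero, fun _ => ⟨by simp, fun h => absurd rfl h⟩⟩
  comp s x y := ⟨insConf s x.1 y.1, y.2.1.map Sum.inr,
    insConf_mem s x.2.2.1 y.2.2.1 y.2.2.2.2 (Or.inl (x.2.2.2.1 s)), by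
      rintro (a | b)
      · exact x.2.2.2.1 _
      · exact mul_ne_zero (x.2.2.2.1 _) (y.2.2.2.1 _),
    insConf_inDisk s x.2.2.2.2 y.2.2.2.2⟩

theorem card_ins {S S' : Type} [Finite S] [Finite S'] (s : S) (h : Nat.card S = 1)
    (h' : Nat.card S' = 1) : Nat.card (Ins s S') = 1 := by
  have hs : Subsingleton S := (Nat.card_eq_one_iff_unique.1 h).1
  have : IsEmpty {x : S // x ≠ s} := ⟨fun x => x.2 (Subsingleton.elim _ _)⟩
  rw [Nat.card_congr (Equiv.emptySum {x : S // x ≠ s} S'), h']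

/-- The arity one part `FLD₁` of `FLD`. -/
def FLD1 : OperadData.{0} where
  obj S _ := {_x : FLD.obj S // Nat.card S = 1}
  relabel σ x := ⟨FLD.relabel σ x.1, (Nat.card_congr σ).symm.trans x.2⟩
  one := ⟨FLD.one, Nat.card_unique⟩
  comp s x y := ⟨FLD.comp s x.1 y.1, card_ins s x.2 y.2⟩

/-- The operad `An^triv` of trivialized annuli: annuli `(c, r)` whose radius may be zero,
concentrated in arity one. -/
def AnTriv : OperadData.{0} where
  obj S _ := {x : S → ℂ × ℂ // Nat.card S = 1 ∧ x ∈ Conf0 S ∧ ∀ s, x s ∈ InDisk}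
  relabel σ x := ⟨fun t => x.1 (σ.symm t), (Nat.card_congr σ).symm.trans x.2.1,
    fun i j h => x.2.2.1 _ _ fun e => h (σ.symm.injective e), fun _ => x.2.2.2 _⟩
  one := ⟨fun _ => (0, 1), Nat.card_unique, fun i j h => absurd (Subsingleton.elim i j) h,
    fun _ => ⟨by simp, fun h => absurd rfl h⟩⟩
  comp s x y := ⟨insConf s x.1 y.1, card_ins s x.2.1 y.2.1,
    insConf_mem s x.2.2.1 y.2.2.1 y.2.2.2
      (Or.inr (Nat.card_eq_one_iff_unique.1 y.2.1).1),
    insConf_inDisk s x.2.2.2 y.2.2.2⟩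

/-- The inclusion `FLD₁ → FLD`. -/
def fld1ToFLD : Family FLD1 FLD := fun _ _ x => x.1

/-- The inclusion `FLD₁ → An^triv`. -/
def fld1ToAnTriv : Family FLD1 AnTriv :=
  fun _ _ x => ⟨x.1.1, x.2, x.1.2.2.1, x.1.2.2.2.2⟩

/-- The subspace topology of `(ℂ × ℂ)^S` on `FLD(S)`. -/
@[reducible] def FLD.top : OperadTop FLD := fun S _ =>
  inferInstanceAs (TopologicalSpace {x : S → ℂ × ℂ // Nonempty S ∧ x ∈ Conf0 S ∧
    (∀ s, (x s).2 ≠ 0) ∧ ∀ s, x s ∈ InDisk})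

/-- The subspace topology of `FLD(S)` on `FLD₁(S)`. -/
@[reducible] def FLD1.top : OperadTop FLD1 := fun S _ => (FLD.top S).induced Subtype.val

/-- The subspace topology of `(ℂ × ℂ)^S` on `An^triv(S)`. -/
@[reducible] def AnTriv.top : OperadTop AnTriv := fun S _ =>
  inferInstanceAs (TopologicalSpace {x : S → ℂ × ℂ // Nat.card S = 1 ∧ x ∈ Conf0 S ∧
    ∀ s, x s ∈ InDisk})

/-! ## Trees -/

/-- Nontrivial (non-planar, unreduced) rooted trees with leaf set `S`: a finite set `V` of
vertices, one of them the root; the nodes are the vertices and the leaves, and `succ x` is the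
successor vertex of the node `x`. Only the values of `succ` on the nodes other than the root
matter. Following successors leads from every node to the root, and every vertex has an input.
Every node `x` other than the root stands for its output edge, the edge `{x, succ x}`. -/
structure RTree (S : Type) where
  V : Type
  finite : Finite V
  root : V
  succ : V ⊕ S → V
  acyclic : ∃ d : V → ℕ, ∀ a, a ≠ root → d (succ (Sum.inl a)) < d a
  input : ∀ a, ∃ x, x ≠ Sum.inl root ∧ succ x = a

namespace RTree

variable {S : Type}

/-- `x` is a node directly above the vertex `a`. -/
def IsInput (T : RTree S) (x : T.V ⊕ S) (a : T.V) : Prop := x ≠ Sum.inl T.root ∧ T.succ x = a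

/-- The set `E(a)` of incoming edges of the vertex `a`; an edge is identified with its upper
node. It is an external edge if that node is a leaf, and internal if it is a vertex. -/
def E (T : RTree S) (a : T.V) : Type := {x : T.V ⊕ S // T.IsInput x a}

/-- A vertex is bivalent if it has exactly one incoming edge. -/
def Bivalent (T : RTree S) (a : T.V) : Prop := ∃! x, T.IsInput x a

/-- Each bivalent vertex is the root or shares an edge with a leaf. -/
def NearlyStable (T : RTree S) : Prop :=
  ∀ a, T.Bivalent a → a = T.root ∨ ∃ s, T.succ (Sum.inr s) = a

/-- The leaf `s` lies above the node `x` (or is equal to it). -/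
def LeafAbove (T : RTree S) (s : S) (x : T.V ⊕ S) : Prop :=
  Relation.ReflTransGen (fun y y' => y ≠ Sum.inl T.root ∧ y' = Sum.inl (T.succ y)) (Sum.inr s) x

/-- An order of the leaves induces an order of the incoming edges of every vertex, by the least
leaf above an edge. -/
def Before (T : RTree S) (ord : LinearOrder S) (x y : T.V ⊕ S) : Prop :=
  ∃ s, T.LeafAbove s x ∧ ∀ t, T.LeafAbove t y → ord.lt s t

theorem succ_ne (T : RTree S) {a : T.V} (h : a ≠ T.root) : T.succ (Sum.inl a) ≠ a := by
  obtain ⟨d, hd⟩ := T.acyclic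
  intro e
  have := hd a h
  rw [e] at this
  exact lt_irrefl _ this

/-- The augmented marking space of a vertex, before the quotient by `Aff(ℂ)`: configurations
indexed by the incoming edges, with nonzero radii at external edges; at the root, the
configuration lies in the unit disk. -/
def AugConf (T : RTree S) (a : T.V) : Set (T.E a → ℂ × ℂ) :=
  {m | m ∈ Conf0 (T.E a) ∧ (∀ (e : T.E a) (s : S), e.1 = Sum.inr s → (m e).2 ≠ 0) ∧
    (a = T.root → ∀ e, m e ∈ InDisk)}

/-- The marking set of a vertex, before the quotient by `Aff(ℂ)`: the radius vanishes at internal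
edges. -/
def MarkConf (T : RTree S) (a : T.V) : Set (T.E a → ℂ × ℂ) :=
  {m | m ∈ T.AugConf a ∧ ∀ (e : T.E a) (b : T.V), e.1 = Sum.inl b → (m e).2 = 0}

/-- The action of `Aff(ℂ)` on the configurations at a vertex other than the root. There is no
identification at the root. -/
def affSetoid (T : RTree S) (a : T.V) : Setoid (T.AugConf a) where
  r m m' := ∃ g : ℂ × ℂ, g.2 ≠ 0 ∧ (a = T.root → g = (0, 1)) ∧ ∀ e, m'.1 e = odot g (m.1 e)
  iseqv := by
    refine ⟨fun m => ⟨(0, 1), one_ne_zero, fun _ => rfl, fun e => (one_odot _).symm⟩, ?_, ?_⟩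
    · rintro m m' ⟨g, hg, hr, h⟩
      refine ⟨(-(g.1 / g.2), g.2⁻¹), inv_ne_zero hg, ?_, ?_⟩
      · intro e
        simp [hr e]
      · intro e
        rw [h e, ← odot_assoc]
        have : odot (-(g.1 / g.2), g.2⁻¹) g = (0, 1) := by
          simp only [odot, Prod.mk.injEq]
          refine ⟨?_, inv_mul_cancel₀ hg⟩
          rw [div_eq_inv_mul, neg_add_cancel]
        rw [this, one_odot]
    · rintro m m' m'' ⟨g, hg, hr, h⟩ ⟨g', hg', hr', h'⟩
      refine ⟨odot g' g, mul_ne_zero hg' hg, ?_, ?_⟩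
      · intro e
        rw [hr e, hr' e, one_odot]
      · intro e
        rw [h' e, h e, odot_assoc]

/-- The augmented marking space of a vertex: the space of configurations in the disk for the
root, and the space of configurations in the plane modulo `Aff(ℂ)` for the other vertices. -/
def AugMark (T : RTree S) (a : T.V) : Type := Quotient (T.affSetoid a)

/-- The quotient topology. -/
instance (T : RTree S) (a : T.V) : TopologicalSpace (T.AugMark a) :=
  inferInstanceAs (TopologicalSpace (Quotient (T.affSetoid a)))

/-- The class of a configuration in the augmented marking space. -/
def toAugMark (T : RTree S) (a : T.V) (m : T.E a → ℂ × ℂ) (h : m ∈ T.AugConf a) : T.AugMark a :=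
  Quotient.mk (T.affSetoid a) ⟨m, h⟩

/-- The normalized representatives of the points of the augmented marking space of a vertex other
than the root: for a bivalent vertex the configuration `(0, 1)`; otherwise the first center is
`0`, the second center is on the positive real line, and the union of all disks has diameter
`1/2`. -/
def Normalized (T : RTree S) (ord : LinearOrder S) (a : T.V) (m : T.E a → ℂ × ℂ) : Prop :=
  (T.Bivalent a → ∀ e, m e = (0, 1)) ∧
  ∀ e₁ e₂ : T.E a, e₁ ≠ e₂ → (∀ e, e ≠ e₁ → T.Before ord e₁.1 e.1) →
    (∀ e, e ≠ e₁ → e ≠ e₂ → T.Before ord e₂.1 e.1) →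
    (m e₁).1 = 0 ∧ (m e₂).1.im = 0 ∧ 0 < (m e₂).1.re ∧
      Metric.diam (⋃ e, Metric.closedBall (m e).1 ‖(m e).2‖) = 1 / 2

end RTree

/-! ## Decorated trees -/

/-- A tree together with a pair `(c, r)` for every edge `{x, succ x}`; the value of `dec` at the
root does not matter. -/
structure DTree (S : Type) extends RTree S where
  dec : V ⊕ S → ℂ × ℂ

namespace DTree

variable {S S' T T' : Type}

/-- The configuration at a vertex. -/
def conf (X : DTree S) (a : X.V) : X.E a → ℂ × ℂ := fun e => X.dec e.1

/-- The tree is nearly stable and all its vertices are decorated by points of their marking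
sets. -/
structure Valid (X : DTree S) : Prop where
  nearlyStable : X.NearlyStable
  mark : ∀ a, X.conf a ∈ X.MarkConf a

/-- The bijection `φ` of vertices is an isomorphism of trees that carries the decoration of every
vertex `a` to the corresponding one, up to the action of `g a ∈ Aff(ℂ)`, which is the identity for
the root. -/
structure IsIso (X Y : DTree S) (φ : X.V ≃ Y.V) (g : X.V → ℂ × ℂ) : Prop where
  root : φ X.root = Y.root
  g_root : g X.root = (0, 1)
  g_ne : ∀ a, (g a).2 ≠ 0
  succ : ∀ x, x ≠ Sum.inl X.root → Y.succ (Sum.map φ id x) = φ (X.succ x)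
  dec : ∀ x, x ≠ Sum.inl X.root → Y.dec (Sum.map φ id x) = odot (g (X.succ x)) (X.dec x)

/-- Two decorated trees define the same element if there is an isomorphism of trees, compatible
with the leaves, that carries the decoration of every vertex to the corresponding one, up to the
action of `Aff(ℂ)` for vertices other than the root. -/
def Equivalent (X Y : DTree S) : Prop :=
  ∃ (φ : X.V ≃ Y.V) (g : X.V → ℂ × ℂ), IsIso X Y φ g

/-- Relabelling of the leaves. -/
def relabel (σ : S ≃ T) (X : DTree S) : DTree T where
  V := X.V
  finite := X.finite
  root := X.root
  succ x := X.succ (Sum.map id σ.symm x)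
  acyclic := X.acyclic
  input a := by
    obtain ⟨x, hx, e⟩ := X.input a
    rcases x with b | s
    · exact ⟨Sum.inl b, fun h => hx (congrArg Sum.inl (Sum.inl_injective h)), e⟩
    · exact ⟨Sum.inr (σ s), Sum.inr_ne_inl, by simpa using e⟩
  dec x := X.dec (Sum.map id σ.symm x)

open Classical in
/-- The successor map of a grafted tree. -/
noncomputable def graftSucc (s : S) (X : DTree S) (Y : DTree S') :
    (X.V ⊕ Y.V) ⊕ Ins s S' → X.V ⊕ Y.V
  | Sum.inl (Sum.inl a) => Sum.inl (X.succ (Sum.inl a))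
  | Sum.inl (Sum.inr b) =>
    if b = Y.root then Sum.inl (X.succ (Sum.inr s)) else Sum.inr (Y.succ (Sum.inl b))
  | Sum.inr (Sum.inl x) => Sum.inl (X.succ (Sum.inr x.1))
  | Sum.inr (Sum.inr y) => Sum.inr (Y.succ (Sum.inr y))

open Classical in
/-- The decorations of a grafted tree. -/
noncomputable def graftDec (s : S) (X : DTree S) (Y : DTree S') :
    (X.V ⊕ Y.V) ⊕ Ins s S' → ℂ × ℂ
  | Sum.inl (Sum.inl a) => X.dec (Sum.inl a)
  | Sum.inl (Sum.inr b) => if b = Y.root then X.dec (Sum.inr s) else Y.dec (Sum.inl b)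
  | Sum.inr (Sum.inl x) => X.dec (Sum.inr x.1)
  | Sum.inr (Sum.inr y) => Y.dec (Sum.inr y)

/-- Grafting of `Y` to `X` at the leaf `s`. The new internal edge between the root of `Y` and the
successor of `s` keeps the decoration of `s`. -/
noncomputable def graft (s : S) (X : DTree S) (Y : DTree S') : DTree (Ins s S') where
  V := X.V ⊕ Y.V
  finite := haveI := X.finite; haveI := Y.finite; inferInstance
  root := Sum.inl X.root
  succ := graftSucc s X Y
  acyclic := by
    obtain ⟨d, hd⟩ := X.acyclic
    obtain ⟨d', hd'⟩ := Y.acyclic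
    refine ⟨Sum.elim d fun b => d (X.succ (Sum.inr s)) + 1 + d' b, ?_⟩
    rintro (a | b) h
    · exact hd a fun e => h (by rw [e])
    · by_cases hb : b = Y.root
      · simp only [graftSucc, hb, if_true, Sum.elim_inl, Sum.elim_inr]
        omega
      · simp only [graftSucc, hb, if_false, Sum.elim_inr]
        have := hd' b hb
        omega
  input := by
    rintro (a | b)
    · obtain ⟨x, hx, e⟩ := X.input a
      rcases x with a' | s'
      · exact ⟨Sum.inl (Sum.inl a'), fun h => hx (by simpa using h), by simp [graftSucc, e]⟩
      · by_cases h : s' = s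
        · subst h
          exact ⟨Sum.inl (Sum.inr Y.root), by simp, by simp [graftSucc, e]⟩
        · exact ⟨Sum.inr (Sum.inl ⟨s', h⟩), by simp, by simp [graftSucc, e]⟩
    · obtain ⟨y, hy, e⟩ := Y.input b
      rcases y with b' | s'
      · have : b' ≠ Y.root := fun h => hy (by rw [h])
        exact ⟨Sum.inl (Sum.inr b'), by simp, by simp [graftSucc, this, e]⟩
      · exact ⟨Sum.inr (Sum.inr s'), by simp, by simp [graftSucc, e]⟩
  dec := graftDec s X Y

/-- The nodes that remain when the vertex `w` is removed. -/
def incl {X : DTree S} (w : X.V) : {a : X.V // a ≠ w} ⊕ S → X.V ⊕ S := Sum.map Subtype.val id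

open Classical in
/-- The successor map after the contraction of the output edge of `w`. -/
noncomputable def contractSucc (X : DTree S) (w : X.V) (hw : w ≠ X.root)
    (x : {a : X.V // a ≠ w} ⊕ S) : {a : X.V // a ≠ w} :=
  if h : X.succ (incl w x) = w then ⟨X.succ (Sum.inl w), X.succ_ne hw⟩
  else ⟨X.succ (incl w x), h⟩

open Classical in
/-- The decorations after the contraction of the output edge of `w`. -/
noncomputable def contractDec (X : DTree S) (w : X.V) (x : {a : X.V // a ≠ w} ⊕ S) : ℂ × ℂ :=
  if X.succ (incl w x) = w then odot (X.dec (Sum.inl w)) (X.dec (incl w x))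
  else X.dec (incl w x)

section

variable {X : DTree S} {w : X.V} {hw : w ≠ X.root} {x : {a : X.V // a ≠ w} ⊕ S}

theorem contractSucc_eq (h : X.succ (incl w x) = w) :
    (contractSucc X w hw x).1 = X.succ (Sum.inl w) := by
  rw [contractSucc, dif_pos h]

theorem contractSucc_ne (h : X.succ (incl w x) ≠ w) :
    (contractSucc X w hw x).1 = X.succ (incl w x) := by
  rw [contractSucc, dif_neg h]

theorem contractDec_eq (h : X.succ (incl w x) = w) :
    contractDec X w x = odot (X.dec (Sum.inl w)) (X.dec (incl w x)) := by
  rw [contractDec, if_pos h]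

theorem contractDec_ne (h : X.succ (incl w x) ≠ w) :
    contractDec X w x = X.dec (incl w x) := by
  rw [contractDec, if_neg h]

theorem incl_ne_root (hw : w ≠ X.root) (hx : x ≠ Sum.inl ⟨X.root, hw.symm⟩) :
    incl w x ≠ Sum.inl X.root := by
  rcases x with a | s
  · exact fun e => hx (congrArg Sum.inl (Subtype.ext (Sum.inl_injective e)))
  · exact Sum.inr_ne_inl

theorem incl_ne (x : {a : X.V // a ≠ w} ⊕ S) : incl w x ≠ Sum.inl w := by
  rcases x with a | s
  · exact fun e => a.2 (Sum.inl_injective e)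
  · exact Sum.inr_ne_inl

theorem incl_injective (w : X.V) : Function.Injective (incl (S := S) w) :=
  Subtype.val_injective.sumMap Function.injective_id

theorem exists_incl {y : X.V ⊕ S} (hw : w ≠ X.root) (h1 : y ≠ Sum.inl w)
    (h2 : y ≠ Sum.inl X.root) :
    ∃ z : {a : X.V // a ≠ w} ⊕ S, z ≠ Sum.inl ⟨X.root, hw.symm⟩ ∧ incl w z = y := by
  rcases y with b | s
  · exact ⟨Sum.inl ⟨b, fun e => h1 (by rw [e])⟩,
      fun e => h2 (by simpa [Subtype.ext_iff] using e), rfl⟩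
  · exact ⟨Sum.inr s, Sum.inr_ne_inl, rfl⟩

end

/-- Contraction of the output edge of a vertex `w` other than the root: `w` is identified with its
successor, and its configuration is composed into that of the successor by `⊙`. -/
noncomputable def contract (X : DTree S) (w : X.V) (hw : w ≠ X.root) : DTree S where
  V := {a : X.V // a ≠ w}
  finite := haveI := X.finite; inferInstance
  root := ⟨X.root, hw.symm⟩
  succ := contractSucc X w hw
  acyclic := by
    obtain ⟨d, hd⟩ := X.acyclic
    refine ⟨fun a => d a.1, ?_⟩
    intro a h
    have h1 : a.1 ≠ X.root := fun e => h (Subtype.ext e)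
    have h2 := hd a.1 h1
    by_cases h3 : X.succ (incl w (Sum.inl a)) = w
    · have e : (contractSucc X w hw (Sum.inl a)).1 = X.succ (Sum.inl w) := contractSucc_eq h3
      rw [show X.succ (Sum.inl a.1) = w from h3] at h2
      exact (congrArg d e).trans_lt ((hd w hw).trans h2)
    · have e : (contractSucc X w hw (Sum.inl a)).1 = X.succ (Sum.inl a.1) := contractSucc_ne h3
      exact (congrArg d e).trans_lt h2
  input := by
    rintro ⟨a, ha⟩
    obtain ⟨x, hx, e⟩ := X.input a
    by_cases h : x = Sum.inl w
    · obtain ⟨y, hy, e'⟩ := X.input w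
      obtain ⟨z, hz, hzy⟩ := exists_incl hw (fun h' => X.succ_ne hw (by rw [← h', e'])) hy
      refine ⟨z, hz, Subtype.ext ?_⟩
      rw [contractSucc_eq (by rw [hzy, e']), ← h, e]
    · obtain ⟨z, hz, hzy⟩ := exists_incl hw h hx
      refine ⟨z, hz, Subtype.ext ?_⟩
      rw [contractSucc_ne (by rw [hzy, e]; exact ha), hzy, e]
  dec := contractDec X w

/-- `a` is not the root, and the configuration at `a` is a single point: `a` has a single incoming
edge, and this edge is internal. -/
def Unstable (X : DTree S) (a : X.V) : Prop :=
  a ≠ X.root ∧ ∃ b : X.V, ∀ x, X.IsInput x a ↔ x = Sum.inl b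

open Classical in
/-- Forget the vertex `a` if it is unstable. -/
noncomputable def forget (X : DTree S) (a : X.V) : DTree S :=
  if h : X.Unstable a then X.contract a h.1 else X

/-- The root of `Y` after the grafting of `Y` to `X`. -/
theorem graft_root_ne (s : S) (X : DTree S) (Y : DTree S') :
    (Sum.inr Y.root : (graft s X Y).V) ≠ (graft s X Y).root := Sum.inr_ne_inl

/-- Composition of decorated trees: graft, compose the configuration at the root of `Y` into the
disk `s` of `X`, and forget the resulting vertex if its configuration is a single point (and it is
not the root). -/
noncomputable def comp (s : S) (X : DTree S) (Y : DTree S') : DTree (Ins s S') :=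
  ((graft s X Y).contract (Sum.inr Y.root) (graft_root_ne s X Y)).forget
    ⟨Sum.inl (X.succ (Sum.inr s)), Sum.inl_ne_inr⟩

/-! ### Well-definedness -/

theorem odot_inv {g : ℂ × ℂ} (hg : g.2 ≠ 0) : odot (-(g.1 / g.2), g.2⁻¹) g = (0, 1) := by
  simp only [odot, Prod.mk.injEq]
  refine ⟨?_, inv_mul_cancel₀ hg⟩
  rw [div_eq_inv_mul, neg_add_cancel]

theorem map_ne_root {X Y : DTree S} {φ : X.V ≃ Y.V} (h : φ X.root = Y.root) {x : X.V ⊕ S}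
    (hx : x ≠ Sum.inl X.root) : Sum.map φ id x ≠ Sum.inl Y.root := by
  rcases x with a | s
  · intro e
    have : φ a = φ X.root := by rw [h]; exact Sum.inl_injective e
    exact hx (by rw [φ.injective this])
  · exact Sum.inr_ne_inl

theorem equivalent_iseqv : _root_.Equivalence (Equivalent (S := S)) := by
  refine ⟨fun X => ⟨Equiv.refl _, fun _ => (0, 1), rfl, rfl, fun _ => one_ne_zero, ?_, ?_⟩, ?_, ?_⟩
  · rintro (a | s) _ <;> rfl
  · rintro (a | s) _ <;> simp [one_odot]
  · rintro X Y ⟨φ, g, hr, hgr, hg, hs, hd⟩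
    have hroot : φ.symm Y.root = X.root := by rw [← hr, φ.symm_apply_apply]
    have key : ∀ y : Y.V ⊕ S, y ≠ Sum.inl Y.root → ∃ x, x ≠ Sum.inl X.root ∧
        Sum.map φ id x = y ∧ Sum.map φ.symm id y = x := by
      intro y hy
      refine ⟨Sum.map φ.symm id y, map_ne_root (φ := φ.symm) hroot hy, ?_, rfl⟩
      rcases y with b | s <;> simp
    refine ⟨φ.symm, fun b => (-((g (φ.symm b)).1 / (g (φ.symm b)).2), (g (φ.symm b)).2⁻¹),
      hroot, ?_, fun b => inv_ne_zero (hg _), ?_, ?_⟩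
    · simp [hroot, hgr]
    · intro y hy
      obtain ⟨x, hx, h1, h2⟩ := key y hy
      rw [h2, ← h1, hs x hx, φ.symm_apply_apply]
    · intro y hy
      obtain ⟨x, hx, h1, h2⟩ := key y hy
      rw [h2, ← h1, hs x hx, hd x hx, φ.symm_apply_apply, ← odot_assoc, odot_inv (hg _), one_odot]
  · rintro X Y Z ⟨φ, g, hr, hgr, hg, hs, hd⟩ ⟨ψ, k, hr', hkr, hk, hs', hd'⟩
    have hm : ∀ x : X.V ⊕ S, Sum.map (φ.trans ψ) id x = Sum.map ψ id (Sum.map φ id x) := by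
      rintro (a | s) <;> rfl
    refine ⟨φ.trans ψ, fun a => odot (k (φ a)) (g a), by simp [hr, hr'], ?_,
      fun a => mul_ne_zero (hk _) (hg _), ?_, ?_⟩
    · rw [hr, hkr, hgr, one_odot]
    · intro x hx
      rw [hm, hs' _ (map_ne_root hr hx), hs x hx]
      rfl
    · intro x hx
      rw [hm, hd' _ (map_ne_root hr hx), hs x hx, hd x hx, odot_assoc]

theorem IsIso.relabel {X Y : DTree S} {φ : X.V ≃ Y.V} {g : X.V → ℂ × ℂ} (h : IsIso X Y φ g)
    (σ : S ≃ T) : IsIso (X.relabel σ) (Y.relabel σ) φ g := by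
  have key : ∀ x : X.V ⊕ T, x ≠ Sum.inl X.root → Sum.map id σ.symm x ≠ Sum.inl X.root := by
    rintro (a | t) hx
    · exact fun e => hx (congrArg Sum.inl (Sum.inl_injective e))
    · exact Sum.inr_ne_inl
  have hm : ∀ x : X.V ⊕ T, Sum.map id σ.symm (Sum.map φ id x) =
      Sum.map φ id (Sum.map id σ.symm x) := by
    rintro (a | t) <;> rfl
  refine ⟨h.root, h.g_root, h.g_ne, ?_, ?_⟩
  · intro x hx
    exact (congrArg Y.succ (hm x)).trans (h.succ _ (key x hx))
  · intro x hx
    exact (congrArg Y.dec (hm x)).trans (h.dec _ (key x hx))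

theorem IsIso.graft {X Y : DTree S} {X' Y' : DTree S'} {φ : X.V ≃ Y.V} {g : X.V → ℂ × ℂ}
    {ψ : X'.V ≃ Y'.V} {k : X'.V → ℂ × ℂ} (h : IsIso X Y φ g) (h' : IsIso X' Y' ψ k) (s : S) :
    IsIso (DTree.graft s X X') (DTree.graft s Y Y') (Equiv.sumCongr φ ψ) (Sum.elim g k) := by
  have hroot : ∀ b, ψ b = Y'.root ↔ b = X'.root := fun b => by
    rw [← h'.root, ψ.injective.eq_iff]
  refine ⟨congrArg Sum.inl h.root, h.g_root, ?_, ?_, ?_⟩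
  · rintro (a | b)
    · exact h.g_ne a
    · exact h'.g_ne b
  · rintro ((a | b) | (x | y)) hx
    · exact congrArg Sum.inl (h.succ (Sum.inl a) fun e => hx (by
        rw [Sum.inl_injective e]; rfl))
    · change graftSucc s Y Y' (Sum.inl (Sum.inr (ψ b))) =
        Sum.map φ ψ (graftSucc s X X' (Sum.inl (Sum.inr b)))
      by_cases hb : b = X'.root
      · have := h.succ (Sum.inr s) Sum.inr_ne_inl
        simp only [Sum.map_inr, id] at this
        simp [graftSucc, hb, this, h'.root]
      · have := h'.succ (Sum.inl b) fun e => hb (Sum.inl_injective e)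
        simp only [Sum.map_inl] at this
        simp [graftSucc, hroot, hb, this]
    · exact congrArg Sum.inl (h.succ (Sum.inr x.1) Sum.inr_ne_inl)
    · exact congrArg Sum.inr (h'.succ (Sum.inr y) Sum.inr_ne_inl)
  · rintro ((a | b) | (x | y)) hx
    · exact h.dec (Sum.inl a) fun e => hx (by rw [Sum.inl_injective e]; rfl)
    · change graftDec s Y Y' (Sum.inl (Sum.inr (ψ b))) =
        odot (Sum.elim g k (graftSucc s X X' (Sum.inl (Sum.inr b))))
          (graftDec s X X' (Sum.inl (Sum.inr b)))
      by_cases hb : b = X'.root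
      · have := h.dec (Sum.inr s) Sum.inr_ne_inl
        simp only [Sum.map_inr, id] at this
        simp [graftSucc, graftDec, hb, this, h'.root]
      · have := h'.dec (Sum.inl b) fun e => hb (Sum.inl_injective e)
        simp only [Sum.map_inl] at this
        simp [graftSucc, graftDec, hroot, hb, this]
    · exact h.dec (Sum.inr x.1) Sum.inr_ne_inl
    · exact h'.dec (Sum.inr y) Sum.inr_ne_inl

/-- The isomorphism between the contracted trees. -/
def contractEquiv {X Y : DTree S} (φ : X.V ≃ Y.V) (w : X.V) :
    {a : X.V // a ≠ w} ≃ {b : Y.V // b ≠ φ w} :=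
  φ.subtypeEquiv fun a => by simp

theorem IsIso.contract {X Y : DTree S} {φ : X.V ≃ Y.V} {g : X.V → ℂ × ℂ} (h : IsIso X Y φ g)
    (w : X.V) (hw : w ≠ X.root) (hw' : φ w ≠ Y.root)
    (hg : g w = (0, 1) ∨ (X.dec (Sum.inl w)).2 = 0) :
    IsIso (X.contract w hw) (Y.contract (φ w) hw') (contractEquiv φ w) (fun a => g a.1) := by
  have hm : ∀ x : {a : X.V // a ≠ w} ⊕ S,
      incl (φ w) (Sum.map (contractEquiv φ w) id x) = Sum.map φ id (incl w x) := by
    rintro (a | s) <;> rfl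
  have hwr : (Sum.inl w : X.V ⊕ S) ≠ Sum.inl X.root := fun e => hw (Sum.inl_injective e)
  have hsw : Y.succ (Sum.inl (φ w)) = φ (X.succ (Sum.inl w)) := h.succ _ hwr
  have hdw : Y.dec (Sum.inl (φ w)) = odot (g (X.succ (Sum.inl w))) (X.dec (Sum.inl w)) :=
    h.dec _ hwr
  have hS : ∀ x : {a : X.V // a ≠ w} ⊕ S, x ≠ Sum.inl ⟨X.root, hw.symm⟩ →
      (contractSucc Y (φ w) hw' (Sum.map (contractEquiv φ w) id x)).1 =
        φ (contractSucc X w hw x).1 ∧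
      contractDec Y (φ w) (Sum.map (contractEquiv φ w) id x) =
        odot (g (contractSucc X w hw x).1) (contractDec X w x) := by
    intro x hx
    have h1 := h.succ _ (incl_ne_root hw hx)
    have h2 := h.dec _ (incl_ne_root hw hx)
    by_cases hc : X.succ (incl w x) = w
    · have hc' : Y.succ (incl (φ w) (Sum.map (contractEquiv φ w) id x)) = φ w := by
        rw [hm, h1, hc]
      rw [contractSucc_eq hc, contractSucc_eq hc', contractDec_eq hc, contractDec_eq hc']
      refine ⟨hsw, ?_⟩
      rw [hm, h2, hdw, hc]
      rcases hg with hg | hg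
      · rw [hg, one_odot, odot_assoc]
      · simp [odot, hg]
    · have hc' : Y.succ (incl (φ w) (Sum.map (contractEquiv φ w) id x)) ≠ φ w := by
        rw [hm, h1]
        exact fun e => hc (φ.injective e)
      rw [contractSucc_ne hc, contractSucc_ne hc', contractDec_ne hc, contractDec_ne hc']
      rw [hm]
      exact ⟨h1, h2⟩
  exact ⟨Subtype.ext h.root, h.g_root, fun a => h.g_ne a.1,
    fun x hx => Subtype.ext (hS x hx).1, fun x hx => (hS x hx).2⟩

theorem IsIso.isInput {X Y : DTree S} {φ : X.V ≃ Y.V} {g : X.V → ℂ × ℂ} (h : IsIso X Y φ g)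
    (x : X.V ⊕ S) (a : X.V) : Y.IsInput (Sum.map φ id x) (φ a) ↔ X.IsInput x a := by
  have h0 : Sum.map φ id x = Sum.inl Y.root ↔ x = Sum.inl X.root := by
    constructor
    · intro e
      by_contra hx
      exact map_ne_root h.root hx e
    · rintro rfl
      simp [h.root]
  constructor
  · rintro ⟨h1, h2⟩
    have hx : x ≠ Sum.inl X.root := fun e => h1 (h0.2 e)
    rw [h.succ x hx] at h2
    exact ⟨hx, φ.injective h2⟩
  · rintro ⟨h1, h2⟩
    exact ⟨fun e => h1 (h0.1 e), by rw [h.succ x h1, h2]⟩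

theorem IsIso.unstable {X Y : DTree S} {φ : X.V ≃ Y.V} {g : X.V → ℂ × ℂ} (h : IsIso X Y φ g)
    (a : X.V) : Y.Unstable (φ a) ↔ X.Unstable a := by
  have hr : φ a = Y.root ↔ a = X.root := by rw [← h.root, φ.injective.eq_iff]
  have hs : ∀ y : Y.V ⊕ S, ∃ x, Sum.map φ id x = y := by
    rintro (b | s)
    · exact ⟨Sum.inl (φ.symm b), by simp⟩
    · exact ⟨Sum.inr s, rfl⟩
  have hinj : Function.Injective (Sum.map φ (id : S → S)) :=
    φ.injective.sumMap Function.injective_id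
  constructor
  · rintro ⟨h1, b, hb⟩
    refine ⟨fun e => h1 (hr.2 e), φ.symm b, fun x => ?_⟩
    rw [← h.isInput, hb, ← hinj.eq_iff]
    simp
  · rintro ⟨h1, b, hb⟩
    refine ⟨fun e => h1 (hr.1 e), φ b, fun y => ?_⟩
    obtain ⟨x, rfl⟩ := hs y
    rw [h.isInput, hb, ← hinj.eq_iff]
    simp

theorem IsIso.forget {X Y : DTree S} {φ : X.V ≃ Y.V} {g : X.V → ℂ × ℂ} (h : IsIso X Y φ g)
    (a : X.V) (ha : a ≠ X.root → (X.dec (Sum.inl a)).2 = 0) :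
    Equivalent (X.forget a) (Y.forget (φ a)) := by
  by_cases hu : X.Unstable a
  · have hu' := (h.unstable a).2 hu
    simp only [DTree.forget, dif_pos hu, dif_pos hu']
    exact ⟨_, _, h.contract a hu.1 hu'.1 (Or.inr (ha hu.1))⟩
  · have hu' : ¬ Y.Unstable (φ a) := fun e => hu ((h.unstable a).1 e)
    simp only [DTree.forget, dif_neg hu, dif_neg hu']
    exact ⟨_, _, h⟩

theorem Valid.internal {X : DTree S} (h : X.Valid) {b : X.V} (hb : b ≠ X.root) :
    (X.dec (Sum.inl b)).2 = 0 :=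
  (h.mark (X.succ (Sum.inl b))).2
    ⟨Sum.inl b, fun e => hb (Sum.inl_injective e), rfl⟩ b rfl

theorem comp_equivalent {X Y : DTree S} {X' Y' : DTree S'} (hX : X.Valid)
    (h : Equivalent X Y) (h' : Equivalent X' Y') (s : S) :
    Equivalent (comp s X X') (comp s Y Y') := by
  obtain ⟨φ, g, h⟩ := h
  obtain ⟨ψ, k, h'⟩ := h'
  have h1 := h.graft h' s
  have e : Equiv.sumCongr φ ψ (Sum.inr X'.root) = Sum.inr Y'.root := by simp [h'.root]
  have hne : Equiv.sumCongr φ ψ (Sum.inr X'.root) ≠ (graft s Y Y').root := by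
    rw [e]
    exact graft_root_ne s Y Y'
  have h2 := h1.contract (Sum.inr X'.root) (graft_root_ne s X X') hne (Or.inl h'.g_root)
  have h3 := h2.forget ⟨Sum.inl (X.succ (Sum.inr s)), Sum.inl_ne_inr⟩ (by
    intro hr
    have hr' : X.succ (Sum.inr s) ≠ X.root := fun e => hr (Subtype.ext (congrArg Sum.inl e))
    have hne : (graft s X X').succ (incl (X := graft s X X') (Sum.inr X'.root)
        (Sum.inl ⟨Sum.inl (X.succ (Sum.inr s)), Sum.inl_ne_inr⟩)) ≠ Sum.inr X'.root :=
      Sum.inl_ne_inr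
    have := contractDec_ne hne
    exact (congrArg Prod.snd this).trans (hX.internal hr'))
  have e2 : ∀ (w : (graft s Y Y').V) (_ : w = Sum.inr Y'.root) (hw' : w ≠ (graft s Y Y').root)
      (c : {b : (graft s Y Y').V // b ≠ w}) (_ : c.1 = Sum.inl (Y.succ (Sum.inr s))),
      ((graft s Y Y').contract w hw').forget c = comp s Y Y' := by
    rintro w rfl hw' ⟨c, hc⟩ rfl
    rfl
  have h4 := e2 _ e hne (contractEquiv (X := graft s X X') (Y := graft s Y Y')
    (Equiv.sumCongr φ ψ) (Sum.inr X'.root) ⟨Sum.inl (X.succ (Sum.inr s)), Sum.inl_ne_inr⟩)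
    (congrArg Sum.inl (h.succ (Sum.inr s) Sum.inr_ne_inl).symm)
  exact h4 ▸ h3

/-! ### Validity -/

theorem aug_iff {X : DTree S} : (∀ a, X.conf a ∈ X.AugConf a) ↔
    (∀ x y, x ≠ Sum.inl X.root → y ≠ Sum.inl X.root → x ≠ y → X.succ x = X.succ y →
      ‖(X.dec x).2‖ + ‖(X.dec y).2‖ < ‖(X.dec x).1 - (X.dec y).1‖) ∧
    (∀ s, (X.dec (Sum.inr s)).2 ≠ 0) ∧
    ∀ x, x ≠ Sum.inl X.root → X.succ x = X.root → X.dec x ∈ InDisk := by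
  constructor
  · intro h
    refine ⟨fun x y hx hy hxy e => ?_, fun s => ?_, fun x hx e => ?_⟩
    · exact (h (X.succ y)).1 ⟨x, hx, e⟩ ⟨y, hy, rfl⟩ fun e' => hxy (congrArg Subtype.val e')
    · exact (h _).2.1 ⟨Sum.inr s, Sum.inr_ne_inl, rfl⟩ s rfl
    · exact (h _).2.2 e ⟨x, hx, rfl⟩
  · rintro ⟨h1, h2, h3⟩ a
    refine ⟨fun e e' hne => ?_, ?_, fun ha e => ?_⟩
    · exact h1 e.1 e'.1 e.2.1 e'.2.1 (fun h => hne (Subtype.ext h)) (e.2.2.trans e'.2.2.symm)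
    · rintro ⟨_, he⟩ s rfl
      exact h2 s
    · exact h3 e.1 e.2.1 (e.2.2.trans ha)

theorem valid_iff {X : DTree S} : X.Valid ↔ X.NearlyStable ∧ (∀ a, X.conf a ∈ X.AugConf a) ∧
    ∀ b, b ≠ X.root → (X.dec (Sum.inl b)).2 = 0 := by
  constructor
  · intro h
    exact ⟨h.nearlyStable, fun a => (h.mark a).1, fun b hb => h.internal hb⟩
  · rintro ⟨h1, h2, h3⟩
    refine ⟨h1, fun a => ⟨h2 a, ?_⟩⟩
    rintro ⟨_, he⟩ b rfl
    exact h3 b fun e => he.1 (congrArg Sum.inl e)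

theorem map_symm_ne_root {X : DTree S} (σ : S ≃ T) {x : X.V ⊕ T} (hx : x ≠ Sum.inl X.root) :
    Sum.map id σ.symm x ≠ Sum.inl X.root := by
  rcases x with a | t
  · exact fun e => hx (congrArg Sum.inl (Sum.inl_injective e))
  · exact Sum.inr_ne_inl

theorem Valid.relabel {X : DTree S} (h : X.Valid) (σ : S ≃ T) : (X.relabel σ).Valid := by
  obtain ⟨h1, h2, h3⟩ := valid_iff.1 h
  rw [aug_iff] at h2
  obtain ⟨h2, h4, h5⟩ := h2
  have hinj : Function.Injective (Sum.map id σ.symm : X.V ⊕ T → X.V ⊕ S) :=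
    Function.injective_id.sumMap σ.symm.injective
  refine valid_iff.2 ⟨?_, aug_iff.2 ⟨?_, ?_, ?_⟩, h3⟩
  · rintro a ⟨x, hx, hu⟩
    have hb : X.Bivalent a := by
      refine ⟨Sum.map id σ.symm x, ⟨map_symm_ne_root σ hx.1, hx.2⟩, ?_⟩
      rintro y ⟨hy, hy'⟩
      obtain ⟨z, rfl⟩ : ∃ z, Sum.map id σ.symm z = y := by
        rcases y with b | s
        · exact ⟨Sum.inl b, rfl⟩
        · exact ⟨Sum.inr (σ s), by simp⟩
      rw [hu z ⟨fun e => hy (by rw [e]; rfl), hy'⟩]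
    rcases h1 a hb with h | ⟨s, hs⟩
    · exact Or.inl h
    · exact Or.inr ⟨σ s, by simpa [DTree.relabel] using hs⟩
  · intro x y hx hy hxy e
    exact h2 _ _ (map_symm_ne_root σ hx) (map_symm_ne_root σ hy) (fun e' => hxy (hinj e')) e
  · intro t
    exact h4 _
  · intro x hx e
    exact h5 _ (map_symm_ne_root σ hx) e

theorem graft_aug {X : DTree S} {Y : DTree S'} (hX : ∀ a, X.conf a ∈ X.AugConf a)
    (hY : ∀ a, Y.conf a ∈ Y.AugConf a) (s : S) (a : (graft s X Y).V) :
    (graft s X Y).conf a ∈ (graft s X Y).AugConf a := by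
  rw [aug_iff] at hX hY
  obtain ⟨h1, h2, h3⟩ := hX
  obtain ⟨k1, k2, k3⟩ := hY
  -- the nodes of the graft, other than the root, come from nodes of the two trees
  have key : ∀ x : (graft s X Y).V ⊕ Ins s S', x ≠ Sum.inl (graft s X Y).root →
      (∃ y : X.V ⊕ S, y ≠ Sum.inl X.root ∧ (graft s X Y).succ x = Sum.inl (X.succ y) ∧
        (graft s X Y).dec x = X.dec y ∧
        x = Sum.elim (fun a => Sum.inl (Sum.inl a)) (fun t =>
          open Classical in if h : t = s then Sum.inl (Sum.inr Y.root)
            else Sum.inr (Sum.inl ⟨t, h⟩)) y) ∨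
      (∃ y : Y.V ⊕ S', y ≠ Sum.inl Y.root ∧ (graft s X Y).succ x = Sum.inr (Y.succ y) ∧
        (graft s X Y).dec x = Y.dec y ∧
        x = Sum.map Sum.inr Sum.inr y) := by
    rintro ((a | b) | (x | y)) hx
    · exact Or.inl ⟨Sum.inl a, fun e => hx (by rw [Sum.inl_injective e]; rfl), rfl, rfl, rfl⟩
    · by_cases hb : b = Y.root
      · refine Or.inl ⟨Sum.inr s, Sum.inr_ne_inl, ?_⟩
        exact ⟨by
            simp only [show (graft s X Y).succ = graftSucc s X Y from rfl, graftSucc, hb, if_true]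
            rfl,
          by simp [show (graft s X Y).dec = graftDec s X Y from rfl, graftDec, hb], by
            simp only [Sum.elim_inr, dif_pos, hb]
            rfl⟩
      · refine Or.inr ⟨Sum.inl b, fun e => hb (Sum.inl_injective e), ?_⟩
        exact ⟨by
            simp only [show (graft s X Y).succ = graftSucc s X Y from rfl, graftSucc, hb, if_false]
            rfl,
          by simp [show (graft s X Y).dec = graftDec s X Y from rfl, graftDec, hb], rfl⟩
    · refine Or.inl ⟨Sum.inr x.1, Sum.inr_ne_inl, rfl, rfl, ?_⟩
      simp only [Sum.elim_inr, dif_neg x.2]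
      rfl
    · exact Or.inr ⟨Sum.inr y, Sum.inr_ne_inl, rfl, rfl, rfl⟩
  revert a
  rw [aug_iff]
  refine ⟨?_, ?_, ?_⟩
  · intro x y hx hy hxy e
    rcases key x hx with ⟨x', hx', e1, e2, e3⟩ | ⟨x', hx', e1, e2, e3⟩ <;>
      rcases key y hy with ⟨y', hy', f1, f2, f3⟩ | ⟨y', hy', f1, f2, f3⟩
    · rw [e2, f2]
      exact h1 _ _ hx' hy' (fun h => hxy (by rw [e3, f3, h]))
        (Sum.inl_injective (e1.symm.trans (e.trans f1)))
    · exact absurd (e1.symm.trans (e.trans f1)) Sum.inl_ne_inr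
    · exact absurd (e1.symm.trans (e.trans f1)) Sum.inr_ne_inl
    · rw [e2, f2]
      exact k1 _ _ hx' hy' (fun h => hxy (by rw [e3, f3, h]))
        (Sum.inr_injective (e1.symm.trans (e.trans f1)))
  · rintro (x | y)
    · exact h2 _
    · exact k2 _
  · intro x hx e
    rcases key x hx with ⟨x', hx', e1, e2, e3⟩ | ⟨x', hx', e1, e2, e3⟩
    · rw [e2]
      exact h3 _ hx' (Sum.inl_injective (e1.symm.trans e))
    · exact absurd (e1.symm.trans e) Sum.inr_ne_inl

/-- The configurations stay in the augmented marking spaces when a disk that contains a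
configuration in the unit disk is contracted, and when an unstable vertex is forgotten. -/
theorem contract_aug {X : DTree S} (hX : ∀ a, X.conf a ∈ X.AugConf a) (w : X.V)
    (hw : w ≠ X.root)
    (h : ((X.dec (Sum.inl w)).2 ≠ 0 ∧
        ∀ x, x ≠ Sum.inl X.root → X.succ x = w → X.dec x ∈ InDisk) ∨
      ((X.dec (Sum.inl w)).2 = 0 ∧ X.Unstable w)) (a : (X.contract w hw).V) :
    (X.contract w hw).conf a ∈ (X.contract w hw).AugConf a := by
  rw [aug_iff] at hX
  obtain ⟨h1, h2, h3⟩ := hX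
  have hwr : (Sum.inl w : X.V ⊕ S) ≠ Sum.inl X.root := fun e => hw (Sum.inl_injective e)
  have hle : ∀ x, x ≠ Sum.inl X.root → X.succ x = w →
      ‖(X.dec (Sum.inl w)).2 * (X.dec x).1‖ + ‖(X.dec (Sum.inl w)).2 * (X.dec x).2‖ ≤
        ‖(X.dec (Sum.inl w)).2‖ := by
    intro x hx e
    rcases h with h | h
    · exact odot_le (h.2 x hx e)
    · simp [h.1]
  have hs1 : ∀ x : {a : X.V // a ≠ w} ⊕ S, X.succ (incl w x) = w →
      ((X.contract w hw).succ x).1 = X.succ (Sum.inl w) ∧ (X.contract w hw).dec x =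
        odot (X.dec (Sum.inl w)) (X.dec (incl w x)) :=
    fun x hx => ⟨contractSucc_eq (hw := hw) hx, contractDec_eq hx⟩
  have hs2 : ∀ x : {a : X.V // a ≠ w} ⊕ S, X.succ (incl w x) ≠ w →
      ((X.contract w hw).succ x).1 = X.succ (incl w x) ∧
        (X.contract w hw).dec x = X.dec (incl w x) :=
    fun x hx => ⟨contractSucc_ne (hw := hw) hx, contractDec_ne hx⟩
  revert a
  rw [aug_iff]
  refine ⟨?_, ?_, ?_⟩
  · intro x y hx hy hxy e
    have hx' := incl_ne_root hw hx
    have hy' := incl_ne_root hw hy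
    have hxy' : incl w x ≠ incl w y := fun e => hxy (incl_injective w e)
    have e' := congrArg Subtype.val e
    by_cases cx : X.succ (incl w x) = w <;>
      by_cases cy : X.succ (incl w y) = w
    · rw [(hs1 x cx).2, (hs1 y cy).2]
      rcases h with h | h
      · exact odot_disjoint_both h.1 (h1 _ _ hx' hy' hxy' (cx.trans cy.symm))
      · obtain ⟨-, -, b, hb⟩ := h
        exact absurd (((hb _).1 ⟨hx', cx⟩).trans ((hb _).1 ⟨hy', cy⟩).symm) hxy'
    · rw [(hs1 x cx).1, (hs2 y cy).1] at e'
      rw [(hs1 x cx).2, (hs2 y cy).2]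
      exact odot_disjoint_left (hle _ hx' cx) (h1 _ _ hwr hy' (incl_ne y).symm e')
    · rw [(hs2 x cx).1, (hs1 y cy).1] at e'
      rw [(hs2 x cx).2, (hs1 y cy).2, norm_sub_rev, add_comm]
      exact odot_disjoint_left (hle _ hy' cy) (h1 _ _ hwr hx' (incl_ne x).symm e'.symm)
    · rw [(hs2 x cx).1, (hs2 y cy).1] at e'
      rw [(hs2 x cx).2, (hs2 y cy).2]
      exact h1 _ _ hx' hy' hxy' e'
  · intro s
    by_cases c : X.succ (Sum.inr s) = w
    · have := (hs1 (Sum.inr s) c).2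
      refine (congrArg Prod.snd this).trans_ne ?_
      rcases h with h | h
      · exact mul_ne_zero h.1 (h2 s)
      · obtain ⟨-, -, b, hb⟩ := h
        exact absurd ((hb _).1 ⟨Sum.inr_ne_inl, c⟩) Sum.inr_ne_inl
    · have := (hs2 (Sum.inr s) c).2
      exact (congrArg Prod.snd this).trans_ne (h2 s)
  · intro x hx e
    have hx' := incl_ne_root hw hx
    have e' : ((X.contract w hw).succ x).1 = X.root := congrArg Subtype.val e
    by_cases c : X.succ (incl w x) = w
    · rw [(hs1 x c).1] at e'
      rw [(hs1 x c).2]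
      have hm := h3 _ hwr e'
      rcases h with h | h
      · exact odot_mem hm (h.2 _ hx' c)
      · have h0 : odot (X.dec (Sum.inl w)) (X.dec (incl w x)) =
            X.dec (Sum.inl w) := by
          rw [Prod.ext_iff]
          simp [odot, h.1]
        rw [h0]
        exact hm
    · rw [(hs2 x c).1] at e'
      rw [(hs2 x c).2]
      exact h3 _ hx' e'

theorem bivalent_of {T : RTree S} {T' : RTree S'} {a : T.V} {a' : T'.V}
    (R : T.V ⊕ S → T'.V ⊕ S' → Prop) (hR : ∀ y y' z, R y z → R y' z → y = y')
    (h : ∀ y, T.IsInput y a → ∃ z, R y z ∧ T'.IsInput z a') (hb : T'.Bivalent a') :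
    T.Bivalent a := by
  obtain ⟨z, -, hz⟩ := hb
  obtain ⟨y, hy⟩ := T.input a
  obtain ⟨z₀, h1, h2⟩ := h y hy
  refine ⟨y, hy, fun y' hy' => ?_⟩
  obtain ⟨z₁, h3, h4⟩ := h y' hy'
  rw [hz _ h4, ← hz _ h2] at h3
  exact hR _ _ _ h3 h1

theorem forget_valid {X : DTree S} (v : X.V) (h1 : ∀ a, X.conf a ∈ X.AugConf a)
    (h2 : ∀ b, b ≠ X.root → (X.dec (Sum.inl b)).2 = 0)
    (h3 : ∀ a, a ≠ v → X.Bivalent a → a = X.root ∨ ∃ s, X.succ (Sum.inr s) = a) :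
    (X.forget v).Valid := by
  by_cases hu : X.Unstable v
  · have hf : X.forget v = X.contract v hu.1 := by
      rw [forget, dif_pos hu]
    rw [hf]
    refine valid_iff.2 ⟨?_, contract_aug h1 v hu.1 (Or.inr ⟨h2 v hu.1, hu⟩), ?_⟩
    · intro a ha
      obtain ⟨b, hb⟩ := hu.2
      have hbi := (hb (Sum.inl b)).2 rfl
      have hbv : b ≠ v := by
        rintro rfl
        exact X.succ_ne hu.1 hbi.2
      have hX : X.Bivalent a.1 := by
        refine bivalent_of (T' := (X.contract v hu.1).toRTree) (a' := a)
          (fun y z => (y = Sum.inl v ∧ incl v z = Sum.inl b) ∨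
            (y ≠ Sum.inl b ∧ incl v z = y)) ?_ ?_ ha
        · rintro y y' z (⟨e1, e2⟩ | ⟨e1, e2⟩) (⟨f1, f2⟩ | ⟨f1, f2⟩)
          · rw [e1, f1]
          · exact absurd (f2.symm.trans e2) f1
          · exact absurd (e2.symm.trans f2) e1
          · rw [← e2, ← f2]
        · intro y hy
          by_cases hyv : y = Sum.inl v
          · obtain ⟨z, hz, e⟩ := exists_incl hu.1 (y := Sum.inl b)
              (fun e => hbv (Sum.inl_injective e)) hbi.1
            refine ⟨z, Or.inl ⟨hyv, e⟩, hz, Subtype.ext ?_⟩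
            refine (contractSucc_eq (hw := hu.1) (by rw [e]; exact hbi.2)).trans ?_
            rw [← hyv]
            exact hy.2
          · obtain ⟨z, hz, e⟩ := exists_incl hu.1 hyv hy.1
            have hyb : y ≠ Sum.inl b := by
              rintro rfl
              exact a.2 (hy.2.symm.trans hbi.2)
            refine ⟨z, Or.inr ⟨hyb, e⟩, hz, Subtype.ext ?_⟩
            refine (contractSucc_ne (hw := hu.1) (by rw [e, hy.2]; exact a.2)).trans ?_
            rw [e, hy.2]
      rcases h3 a.1 a.2 hX with h | ⟨s, hs⟩
      · exact Or.inl (Subtype.ext h)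
      · refine Or.inr ⟨s, Subtype.ext ?_⟩
        have hne : X.succ (incl v (Sum.inr s)) ≠ v := by
          intro e
          exact a.2 (hs.symm.trans e)
        exact (contractSucc_ne (hw := hu.1) hne).trans hs
    · intro b hb
      by_cases c : X.succ (incl v (Sum.inl b)) = v
      · refine (congrArg Prod.snd (contractDec_eq c)).trans ?_
        simp [odot, h2 v hu.1]
      · refine (congrArg Prod.snd (contractDec_ne c)).trans ?_
        exact h2 b.1 fun e => hb (Subtype.ext e)
  · have hf : X.forget v = X := by
      rw [forget, dif_neg hu]
    rw [hf]
    refine valid_iff.2 ⟨?_, h1, h2⟩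
    intro a ha
    by_cases hav : a = v
    · subst hav
      by_cases hr : a = X.root
      · exact Or.inl hr
      · obtain ⟨x, hx, hx'⟩ := ha
        rcases x with b | s
        · refine absurd ⟨hr, b, fun y => ⟨hx' y, ?_⟩⟩ hu
          rintro rfl
          exact hx
        · exact Or.inr ⟨s, hx.2⟩
    · exact h3 a hav ha

theorem Valid.comp {X : DTree S} {Y : DTree S'} (hX : X.Valid) (hY : Y.Valid) (s : S) :
    (comp s X Y).Valid := by
  obtain ⟨n1, a1, i1⟩ := valid_iff.1 hX
  obtain ⟨n2, a2, i2⟩ := valid_iff.1 hY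
  have hroot : graftDec s X Y (Sum.inl (Sum.inr Y.root)) = X.dec (Sum.inr s) := by
    simp [graftDec]
  have hS : ∀ b, b ≠ Y.root → graftSucc s X Y (Sum.inl (Sum.inr b)) =
      Sum.inr (Y.succ (Sum.inl b)) := by
    intro b hb
    simp [graftSucc, hb]
  have hD : ∀ b, b ≠ Y.root → graftDec s X Y (Sum.inl (Sum.inr b)) = Y.dec (Sum.inl b) := by
    intro b hb
    simp [graftDec, hb]
  have hdisk : ∀ x, x ≠ Sum.inl (graft s X Y).root →
      (graft s X Y).succ x = Sum.inr Y.root → (graft s X Y).dec x ∈ InDisk := by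
    have k := (aug_iff.1 a2).2.2
    rintro ((a | b) | (x | y)) hx e
    · exact absurd e Sum.inl_ne_inr
    · by_cases hb : b = Y.root
      · have : graftSucc s X Y (Sum.inl (Sum.inr b)) = Sum.inl (X.succ (Sum.inr s)) := by
          simp [graftSucc, hb]
        exact absurd (this.symm.trans e) Sum.inl_ne_inr
      · change graftDec s X Y (Sum.inl (Sum.inr b)) ∈ InDisk
        rw [hD b hb]
        exact k _ (fun e => hb (Sum.inl_injective e))
          (Sum.inr_injective ((hS b hb).symm.trans e))
    · exact absurd e Sum.inl_ne_inr
    · exact k _ Sum.inr_ne_inl (Sum.inr_injective e)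
  have hne := graft_root_ne s X Y
  -- successors and decorations in the contracted tree
  have hc : ∀ x, graftSucc s X Y (incl (X := graft s X Y) (Sum.inr Y.root) x) ≠ Sum.inr Y.root →
      (((graft s X Y).contract (Sum.inr Y.root) hne).succ x).1 =
        graftSucc s X Y (incl (X := graft s X Y) (Sum.inr Y.root) x) :=
    fun x hx => contractSucc_ne (X := graft s X Y) (hw := hne) hx
  refine forget_valid _ (contract_aug (graft_aug a1 a2 s) _ hne (Or.inl ⟨?_, hdisk⟩)) ?_ ?_
  · change (graftDec s X Y (Sum.inl (Sum.inr Y.root))).2 ≠ 0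
    rw [hroot]
    exact (aug_iff.1 a1).2.1 s
  · rintro ⟨b | b, hb⟩ hbr
    · have hn : (graft s X Y).succ (incl (X := graft s X Y) (Sum.inr Y.root)
          (Sum.inl ⟨Sum.inl b, hb⟩)) ≠ Sum.inr Y.root := Sum.inl_ne_inr
      refine (congrArg Prod.snd (contractDec_ne hn)).trans ?_
      exact i1 b fun e => hbr (Subtype.ext (congrArg Sum.inl e))
    · have hb' : b ≠ Y.root := fun e => hb (by rw [e])
      have h0 : ((graft s X Y).dec (Sum.inl (Sum.inr b))).2 = 0 :=
        (congrArg Prod.snd (hD b hb')).trans (i2 b hb')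
      by_cases c : (graft s X Y).succ (incl (X := graft s X Y) (Sum.inr Y.root)
          (Sum.inl ⟨Sum.inr b, hb⟩)) = Sum.inr Y.root
      · refine (congrArg Prod.snd (contractDec_eq c)).trans ?_
        exact mul_eq_zero_of_right _ h0
      · exact (congrArg Prod.snd (contractDec_ne c)).trans h0
  · rintro ⟨a | b, hab⟩ hv hbi
    · have ha : X.succ (Sum.inr s) ≠ a := fun e => hv (Subtype.ext (congrArg Sum.inl e.symm))
      have hXb : X.Bivalent a := by
        refine bivalent_of
          (T' := ((graft s X Y).contract (Sum.inr Y.root) hne).toRTree)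
          (fun y z => (∃ a', y = Sum.inl a' ∧ incl (X := graft s X Y) (Sum.inr Y.root) z =
              Sum.inl (Sum.inl a')) ∨
            (∃ t : {t : S // t ≠ s}, y = Sum.inr t.1 ∧
              incl (X := graft s X Y) (Sum.inr Y.root) z = Sum.inr (Sum.inl t))) ?_ ?_ hbi
        · rintro y y' z (⟨c, e1, e2⟩ | ⟨c, e1, e2⟩) (⟨d, f1, f2⟩ | ⟨d, f1, f2⟩)
          · rw [e1, f1, Sum.inl_injective (Sum.inl_injective (e2.symm.trans f2))]
          · exact absurd (e2.symm.trans f2) Sum.inl_ne_inr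
          · exact absurd (e2.symm.trans f2) Sum.inr_ne_inl
          · rw [e1, f1, Sum.inl_injective (Sum.inr_injective (e2.symm.trans f2))]
        · rintro (c | t) hy
          · refine ⟨Sum.inl ⟨Sum.inl c, Sum.inl_ne_inr⟩, Or.inl ⟨c, rfl, rfl⟩, ?_, ?_⟩
            · intro e
              have e' := congrArg Subtype.val (Sum.inl_injective e)
              exact hy.1 (congrArg Sum.inl (Sum.inl_injective e'))
            · exact Subtype.ext ((hc (Sum.inl ⟨Sum.inl c, Sum.inl_ne_inr⟩) Sum.inl_ne_inr).trans
                (congrArg Sum.inl hy.2))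
          · have ht : t ≠ s := by
              rintro rfl
              exact ha hy.2
            exact ⟨Sum.inr (Sum.inl ⟨t, ht⟩), Or.inr ⟨⟨t, ht⟩, rfl, rfl⟩, Sum.inr_ne_inl,
              Subtype.ext ((hc (Sum.inr (Sum.inl ⟨t, ht⟩)) Sum.inl_ne_inr).trans
                (congrArg Sum.inl hy.2))⟩
      rcases n1 a hXb with h | ⟨t, ht⟩
      · exact Or.inl (Subtype.ext (congrArg Sum.inl h))
      · have hts : t ≠ s := by
          rintro rfl
          exact ha ht
        exact Or.inr ⟨Sum.inl ⟨t, hts⟩,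
          Subtype.ext ((hc (Sum.inr (Sum.inl ⟨t, hts⟩)) Sum.inl_ne_inr).trans
            (congrArg Sum.inl ht))⟩
    · have hb : b ≠ Y.root := fun e => hab (by rw [e])
      have hbY : (Sum.inr b : X.V ⊕ Y.V) ≠ Sum.inr Y.root := hab
      have hYb : Y.Bivalent b := by
        refine bivalent_of
          (T' := ((graft s X Y).contract (Sum.inr Y.root) hne).toRTree)
          (fun y z => incl (X := graft s X Y) (Sum.inr Y.root) z = Sum.map Sum.inr Sum.inr y)
          ?_ ?_ hbi
        · intro y y' z e f
          exact (Sum.inr_injective.sumMap Sum.inr_injective) (e.symm.trans f)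
        · rintro (c | t) hy
          · have hcr : c ≠ Y.root := fun e => hy.1 (congrArg Sum.inl e)
            have e1 : graftSucc s X Y (Sum.inl (Sum.inr c)) = Sum.inr b := by
              rw [hS c hcr, hy.2]
            refine ⟨Sum.inl ⟨Sum.inr c, fun e => hcr (Sum.inr_injective e)⟩, rfl, ?_, ?_⟩
            · intro e
              have e' := congrArg Subtype.val (Sum.inl_injective e)
              exact Sum.inr_ne_inl e'
            · exact Subtype.ext ((hc (Sum.inl ⟨Sum.inr c, fun e => hcr (Sum.inr_injective e)⟩)
                (e1.trans_ne hbY)).trans e1)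
          · have e1 : graftSucc s X Y (Sum.inr (Sum.inr t)) = Sum.inr b :=
              congrArg Sum.inr hy.2
            exact ⟨Sum.inr (Sum.inr t), rfl, Sum.inr_ne_inl,
              Subtype.ext ((hc (Sum.inr (Sum.inr t)) (e1.trans_ne hbY)).trans e1)⟩
      rcases n2 b hYb with h | ⟨t, ht⟩
      · exact absurd h hb
      · have e1 : graftSucc s X Y (Sum.inr (Sum.inr t)) = Sum.inr b := congrArg Sum.inr ht
        exact Or.inr ⟨Sum.inr t, Subtype.ext ((hc (Sum.inr (Sum.inr t)) (e1.trans_ne hbY)).trans e1)⟩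

/-! ### Corollas and annuli of radius zero -/

/-- The tree with a single vertex, decorated by `x`. -/
def corolla [hS : Nonempty S] (x : S → ℂ × ℂ) : DTree S where
  V := Unit
  finite := inferInstance
  root := ()
  succ _ := ()
  acyclic := ⟨fun _ => 0, fun _ h => absurd rfl h⟩
  input _ := hS.elim fun s => ⟨Sum.inr s, Sum.inr_ne_inl, rfl⟩
  dec := Sum.elim (fun _ => (0, 1)) x

theorem corolla_valid [Nonempty S] {x : S → ℂ × ℂ} (h1 : x ∈ Conf0 S)
    (h2 : ∀ s, (x s).2 ≠ 0) (h3 : ∀ s, x s ∈ InDisk) : (corolla x).Valid := by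
  refine valid_iff.2 ⟨fun _ _ => Or.inl rfl, aug_iff.2 ⟨?_, h2, ?_⟩, fun _ h => absurd rfl h⟩
  · rintro (⟨⟩ | s) (⟨⟩ | t) hx hy hxy -
    · exact absurd rfl hx
    · exact absurd rfl hx
    · exact absurd rfl hy
    · exact h1 s t fun e => hxy (congrArg Sum.inr e)
  · rintro (⟨⟩ | s) hx -
    · exact absurd rfl hx
    · exact h3 s

/-- The tree with a single leaf and two vertices, with root decorated by `p = (c, 0)`; the other
vertex is decorated by a single disk. -/
def annulus0 [hS : Nonempty S] (p : ℂ × ℂ) : DTree S where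
  V := Bool
  finite := inferInstance
  root := false
  succ := Sum.elim (fun _ => false) (fun _ => true)
  acyclic := ⟨fun b => if b then 1 else 0, fun b h => by cases b <;> simp_all⟩
  input
    | false => ⟨Sum.inl true, by simp, rfl⟩
    | true => hS.elim fun s => ⟨Sum.inr s, Sum.inr_ne_inl, rfl⟩
  dec := Sum.elim (fun _ => p) (fun _ => (0, 1))

theorem annulus0_valid [Nonempty S] {p : ℂ × ℂ} (hS : Nat.card S = 1) (h : p ∈ InDisk)
    (h0 : p.2 = 0) : (annulus0 (S := S) p).Valid := by
  have hs : Subsingleton S := (Nat.card_eq_one_iff_unique.1 hS).1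
  refine valid_iff.2 ⟨?_, aug_iff.2 ⟨?_, fun _ => one_ne_zero, ?_⟩, fun _ _ => h0⟩
  · rintro (_ | _) -
    · exact Or.inl rfl
    · exact Or.inr ⟨Classical.arbitrary S, rfl⟩
  · rintro (a | s) (b | t) hx hy hxy e
    · cases a
      · exact absurd rfl hx
      · cases b
        · exact absurd rfl hy
        · exact absurd rfl hxy
    · exact absurd e Bool.false_ne_true
    · exact absurd e.symm Bool.false_ne_true
    · exact absurd (congrArg Sum.inr (Subsingleton.elim s t)) hxy
  · rintro (a | s) hx e
    · exact h
    · exact absurd e.symm Bool.false_ne_true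

end DTree

/-! ## The trivialized little disks operad -/

/-- Decorated nearly stable trees, up to isomorphism of trees and up to the action of `Aff(ℂ)` on
the decorations of the vertices other than the root. -/
def mbarSetoid (S : Type) : Setoid {X : DTree S // X.Valid} where
  r X Y := DTree.Equivalent X.1 Y.1
  iseqv := ⟨fun X => DTree.equivalent_iseqv.refl X.1, DTree.equivalent_iseqv.symm,
    DTree.equivalent_iseqv.trans⟩

/-- The set of elements of the trivialized little disks operad: the disjoint union over the
isomorphism classes of nontrivial nearly stable `S`-trees of the products of the marking sets of
the vertices. -/
def MbarObj (S : Type) : Type 1 := Quotient (mbarSetoid S)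

/-- The element given by a decorated tree. -/
def toMbar {S : Type} (X : DTree S) (h : X.Valid) : MbarObj S :=
  Quotient.mk (mbarSetoid S) ⟨X, h⟩

/-- The framed little disks as decorated corollas. -/
def fldToMbarObj (S : Type) [Finite S] (x : FLD.obj S) : MbarObj S :=
  haveI := x.2.1
  toMbar (DTree.corolla x.1) (DTree.corolla_valid x.2.2.1 x.2.2.2.1 x.2.2.2.2)

/-- The trivialized little disks operad `𝕄̄`. -/
noncomputable def Mbar : OperadData.{1} where
  obj S _ := MbarObj S
  relabel σ := Quotient.map (sa := mbarSetoid _) (sb := mbarSetoid _)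
    (fun X => ⟨X.1.relabel σ, X.2.relabel σ⟩)
    (fun _ _ ⟨_, _, h⟩ => ⟨_, _, h.relabel σ⟩)
  one := fldToMbarObj Unit FLD.one
  comp s := Quotient.map₂ (sa := mbarSetoid _) (sb := mbarSetoid _) (sc := mbarSetoid _)
    (fun X Y => ⟨DTree.comp s X.1 Y.1, X.2.comp Y.2 s⟩)
    (fun X _ h _ _ h' => DTree.comp_equivalent X.2 h h' s)

/-- The map `FLD → 𝕄̄`. -/
def fldToMbar : Family FLD Mbar := fldToMbarObj

open Classical in
/-- The map `An^triv → 𝕄̄`: annuli of positive radius are corollas, and the annulus `(c, 0)` is the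
tree with two vertices whose root is decorated by `(c, 0)`. -/
noncomputable def antrivToMbar : Family AnTriv Mbar := fun S _ x =>
  haveI : Nonempty S := (Nat.card_eq_one_iff_unique.1 x.2.1).2
  if h : (x.1 (Classical.arbitrary S)).2 = 0 then
    toMbar (DTree.annulus0 (x.1 (Classical.arbitrary S)))
      (DTree.annulus0_valid x.2.1 (x.2.2.2 _) h)
  else
    haveI : Subsingleton S := (Nat.card_eq_one_iff_unique.1 x.2.1).1
    toMbar (DTree.corolla x.1) (DTree.corolla_valid x.2.2.1
      (fun s => by rwa [Subsingleton.elim s (Classical.arbitrary S)]) x.2.2.2)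

/-! ## The basic neighborhoods -/

/-- One step of the contraction of internal edges of positive radius. -/
def DTree.Contracts {S : Type} (X Y : DTree S) : Prop :=
  ∃ (w : X.V) (hw : w ≠ X.root), (X.dec (Sum.inl w)).2 ≠ 0 ∧ Y = X.contract w hw

/-- The basic neighborhood of the element given by `X` that belongs to subsets `U a` of the augmented
marking spaces of the vertices `a` of the tree underlying `X`: the image of `∏ U a` under the map
from the product of the augmented marking spaces to `𝕄̄(S)` that takes the normalized
representatives `d` at the vertices other than the root, and contracts all internal edges of
positive radius (in any order), composing the decorations by `⊙`. That `Y` is valid means that no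
internal edge of positive radius is left. -/
def basicNbhd {S : Type} (ord : LinearOrder S) (X : DTree S)
    (U : ∀ a : X.V, Set (X.AugMark a)) : Set (MbarObj S) :=
  {p | ∃ (d : X.V ⊕ S → ℂ × ℂ)
    (h : ∀ a, DTree.conf { X with dec := d } a ∈ X.AugConf a),
    (∀ a, X.toAugMark a (DTree.conf { X with dec := d } a) (h a) ∈ U a) ∧
    (∀ a, a ≠ X.root → X.Normalized ord a (DTree.conf { X with dec := d } a)) ∧
    ∃ (Y : DTree S) (hY : Y.Valid),
      Relation.ReflTransGen DTree.Contracts { X with dec := d } Y ∧ p = toMbar Y hY}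

/-- `t` is the topology on the sets `𝕄̄(S)` in which the images of the products `∏ U a` of open
neighborhoods of the decorations of the vertices are a basis of neighborhoods of every element; this
holds for every order of the set of leaves. -/
def HasBasicNbhds (t : OperadTop Mbar) : Prop :=
  ∀ (S : Type) [Finite S] (ord : LinearOrder S) (X : DTree S) (hX : X.Valid),
    (@nhds (MbarObj S) (t S) (toMbar X hX)).HasBasis
      (fun U : ∀ a : X.V, Set (X.AugMark a) =>
        ∀ a, IsOpen (U a) ∧ X.toAugMark a (X.conf a) (hX.mark a).1 ∈ U a)
      (fun U => basicNbhd ord X U)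

end TrivDisks

/-!
The proof embeds each set `𝕄̄(S)` in a Euclidean space. The positions of the leaves relative to a
vertex of a decorated tree are the `⊙`-products of the decorations along the paths. From them one
reads off, for leaves `s`, `t`, `u`, the position `abs s` relative to the root, the quotient
`rho s t = r_s / (c_s - c_t)`, taken at any vertex where the centers differ, and the point
`tri s t u = [c_s - c_t : c_s - c_u]` of the projective line, taken at any vertex where the three
centers are not all equal. These values do not depend on the choice of the vertex. They do not change
under contractions of edges of nonzero radius (`DTree.sim_contract`), and those of a composition
are given by an explicit formula (`crd_comp`). They determine the element (`crd_injective`): a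
terminal vertex can be recognized from the coordinates and pruned, which allows an induction on the
number of vertices.

The topology on `𝕄̄(S)` is the one induced by the coordinates. The coordinates depend continuously
on the decorations, so basic neighborhoods are small (`exists_nbhd_dec`). Conversely, the centers and
radii of the normalized decorations of a tree are continuous functions of the coordinates. For an
element `y` near the element given by a tree `X`, the same functions at the coordinates of `y`
give decorations of `X` from which `y` is obtained by contraction; hence the basic
neighborhoods are neighborhoods (`basicNbhd_mem_nhds`), and the topology is the required one
(`hasBasicNbhds_top`). The formula for the coordinates of a composition shows that composition is
continuous. The image of `FLD` is dense, as the edges of radius zero can be given small radii, and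
the axioms of an operad hold there; since `𝕄̄(S)` is Hausdorff, they hold everywhere
(`isOperad_Mbar`). In this way, no isomorphisms between iterated
grafts of trees have to be constructed.

For the universal property, let `f` and `g` be compatible morphisms from `FLD` and `An^triv` to an
operad `P`. Consider the suboperad of `𝕄̄ × P` that is generated by the graphs of `f` and `g`. Its
elements are obtained from framed little disks by successive insertion of caps, a cap being the
composition of the annulus of radius zero with framed little disks (`Gen`). The suboperad is the
graph of a morphism: it surjects to `𝕄̄`, since each decorated tree is assembled in this way from its
terminal vertices (`OverMbar.exists_gen_mbar`), and it is injective over `𝕄̄` (`OverMbar.gen_unique`):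
if two generated elements have the same image in `𝕄̄`, then both can be presented with the cap of the
same terminal vertex as the outermost factor (`OverMbar.exists_presentation`). A cap absorbs affine
maps on the one side and concentric annuli on the other, which is all the ambiguity of such a
presentation, and the induction proceeds with the remaining factors. Finally, an element near a
given one is the composition of an element near the pruned tree, an annulus and framed little disks,
which depend continuously on the decorations; so the morphism is continuous if `f` and `g` are
(`continuousAt_hom`).
-/

namespace TrivDisks

/-! ### The affine group -/

/-- The inverse of `g` in `Aff(ℂ)`. -/
noncomputable def oinv (g : ℂ × ℂ) : ℂ × ℂ := (-(g.1 / g.2), g.2⁻¹)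

theorem oinv_odot {g : ℂ × ℂ} (hg : g.2 ≠ 0) : odot (oinv g) g = (0, 1) := DTree.odot_inv hg

theorem odot_oinv {g : ℂ × ℂ} (hg : g.2 ≠ 0) : odot g (oinv g) = (0, 1) := by
  simp only [odot, oinv, Prod.mk.injEq]
  exact ⟨by field_simp; ring, mul_inv_cancel₀ hg⟩

theorem oinv_snd_ne {g : ℂ × ℂ} (hg : g.2 ≠ 0) : (oinv g).2 ≠ 0 := inv_ne_zero hg

theorem oinv_odot_cancel {g : ℂ × ℂ} (hg : g.2 ≠ 0) (p : ℂ × ℂ) : odot (oinv g) (odot g p) = p := by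
  rw [← odot_assoc, oinv_odot hg, one_odot]

theorem odot_fst_sub (g p q : ℂ × ℂ) : (odot g p).1 - (odot g q).1 = g.2 * (p.1 - q.1) := by
  simp only [odot]
  ring

theorem one_inDisk : ((0, 1) : ℂ × ℂ) ∈ InDisk := ⟨by simp, fun h => absurd rfl h⟩

/-- In the unit disk, only the annuli with center `0` reach the boundary. -/
theorem norm_fst_lt_one {p : ℂ × ℂ} (h : p ∈ InDisk) : ‖p.1‖ < 1 := by
  by_cases h0 : p.1 = 0
  · simp [h0]
  · have := h.2 h0
    have := norm_nonneg p.2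
    linarith

theorem fst_zero_inDisk {p : ℂ × ℂ} (h : p ∈ InDisk) : ((p.1, 0) : ℂ × ℂ) ∈ InDisk := by
  have := norm_fst_lt_one h
  exact ⟨by simpa using this.le, fun _ => by simpa using this⟩

/-- The disjointness of two disks or points. -/
def Apart (p q : ℂ × ℂ) : Prop := ‖p.2‖ + ‖q.2‖ < ‖p.1 - q.1‖

theorem Apart.ne {p q : ℂ × ℂ} (h : Apart p q) : p.1 ≠ q.1 := by
  intro e
  have : ‖p.2‖ + ‖q.2‖ < 0 := by simpa [Apart, e] using h
  have := norm_nonneg p.2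
  have := norm_nonneg q.2
  linarith

theorem Apart.symm {p q : ℂ × ℂ} (h : Apart p q) : Apart q p := by
  unfold Apart at *
  rw [norm_sub_rev, add_comm]
  exact h

namespace DTree

variable {S S' T : Type}

/-! ### Relative positions in a decorated tree -/

/-- The node `x` lies above the node `y` or is equal to it, and `p` is the `⊙`-product of the
decorations of the edges from `y` up to `x`: the position of `x` in the coordinates of `y`. -/
inductive Pos (X : DTree S) (y : X.V ⊕ S) : X.V ⊕ S → ℂ × ℂ → Prop
  | refl : Pos X y y (0, 1)
  | step {x : X.V ⊕ S} {p : ℂ × ℂ} (hx : x ≠ Sum.inl X.root)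
      (h : Pos X y (Sum.inl (X.succ x)) p) : Pos X y x (odot p (X.dec x))

/-- A function on the vertices that decreases towards the root. -/
noncomputable def depth (X : DTree S) : X.V → ℕ := X.acyclic.choose

theorem depth_lt (X : DTree S) {a : X.V} (h : a ≠ X.root) :
    X.depth (X.succ (Sum.inl a)) < X.depth a := X.acyclic.choose_spec a h

/-- The extension of `depth` to the leaves. -/
noncomputable def ndepth (X : DTree S) : X.V ⊕ S → ℕ :=
  Sum.elim X.depth fun s => X.depth (X.succ (Sum.inr s)) + 1

theorem ndepth_lt (X : DTree S) {x : X.V ⊕ S} (h : x ≠ Sum.inl X.root) :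
    X.ndepth (Sum.inl (X.succ x)) < X.ndepth x := by
  rcases x with a | s
  · exact X.depth_lt fun e => h (by rw [e])
  · exact Nat.lt_succ_self _

variable {X : DTree S}

theorem Pos.eq_or_lt {y x : X.V ⊕ S} {p : ℂ × ℂ} (h : X.Pos y x p) :
    (x = y ∧ p = (0, 1)) ∨ X.ndepth y < X.ndepth x := by
  induction h with
  | refl => exact Or.inl ⟨rfl, rfl⟩
  | step hx _ ih =>
    right
    have := X.ndepth_lt hx
    rcases ih with ⟨e, -⟩ | ih
    · rwa [e] at this
    · exact ih.trans this

theorem Pos.le {y x : X.V ⊕ S} {p : ℂ × ℂ} (h : X.Pos y x p) : X.ndepth y ≤ X.ndepth x := by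
  rcases h.eq_or_lt with ⟨rfl, -⟩ | h
  exacts [le_rfl, h.le]

theorem Pos.self {y : X.V ⊕ S} {p : ℂ × ℂ} (h : X.Pos y y p) : p = (0, 1) := by
  rcases h.eq_or_lt with ⟨-, h⟩ | h
  exacts [h, absurd h (lt_irrefl _)]

theorem Pos.antisymm {y x : X.V ⊕ S} {p q : ℂ × ℂ} (h : X.Pos y x p) (h' : X.Pos x y q) :
    x = y := by
  rcases h.eq_or_lt with ⟨h, -⟩ | h
  exacts [h, absurd h'.le (not_le.2 h)]

theorem Pos.of_ne {y x : X.V ⊕ S} {p : ℂ × ℂ} (h : X.Pos y x p) (hne : x ≠ y) :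
    x ≠ Sum.inl X.root ∧ ∃ q, X.Pos y (Sum.inl (X.succ x)) q ∧ p = odot q (X.dec x) := by
  cases h with
  | refl => exact absurd rfl hne
  | step hx h => exact ⟨hx, _, h, rfl⟩

theorem Pos.unique {y x : X.V ⊕ S} {p q : ℂ × ℂ} (h : X.Pos y x p) (h' : X.Pos y x q) :
    p = q := by
  induction h generalizing q with
  | refl => exact h'.self.symm
  | @step x p hx h ih =>
    have hne : x ≠ y := by
      rintro rfl
      have := h.le
      exact absurd (X.ndepth_lt hx) (not_lt.2 this)
    obtain ⟨-, q', h1, rfl⟩ := h'.of_ne hne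
    rw [ih h1]

theorem Pos.trans {y z x : X.V ⊕ S} {p q : ℂ × ℂ} (h : X.Pos y z p) (h' : X.Pos z x q) :
    X.Pos y x (odot p q) := by
  induction h' with
  | refl => rwa [odot_one]
  | step hx _ ih =>
    rw [← odot_assoc]
    exact ih.step hx

theorem Pos.edge {x : X.V ⊕ S} (hx : x ≠ Sum.inl X.root) :
    X.Pos (Sum.inl (X.succ x)) x (X.dec x) := by
  have := Pos.step hx (Pos.refl (X := X))
  rwa [one_odot] at this

theorem Pos.input {x : X.V ⊕ S} {a : X.V} (hx : X.IsInput x a) : X.Pos (Sum.inl a) x (X.dec x) := by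
  obtain ⟨h, rfl⟩ := hx
  exact Pos.edge h

theorem Pos.total {y z x : X.V ⊕ S} {p q : ℂ × ℂ} (h : X.Pos y x p) (h' : X.Pos z x q) :
    (∃ k, X.Pos y z k) ∨ ∃ k, X.Pos z y k := by
  induction h generalizing q with
  | refl => exact Or.inr ⟨_, h'⟩
  | @step x p hx h ih =>
    by_cases hne : x = z
    · subst hne
      exact Or.inl ⟨_, h.step hx⟩
    · obtain ⟨-, q', h1, rfl⟩ := h'.of_ne hne
      exact ih h1

/-- Two nodes below a common node are comparable, and positions relative to them are related by
an affine map. -/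
theorem Pos.compare {y z x : X.V ⊕ S} {p q : ℂ × ℂ} (h : X.Pos y x p) (h' : X.Pos z x q) :
    ∃ k : ℂ × ℂ, (∀ u p' q', X.Pos y u p' → X.Pos z u q' → p' = odot k q') ∨
      (∀ u p' q', X.Pos y u p' → X.Pos z u q' → q' = odot k p') := by
  rcases h.total h' with ⟨k, hk⟩ | ⟨k, hk⟩
  · exact ⟨k, Or.inl fun u p' q' h1 h2 => h1.unique (hk.trans h2)⟩
  · exact ⟨k, Or.inr fun u p' q' h1 h2 => h2.unique (hk.trans h1)⟩

/-- Above a node `y` other than a leaf, positions factor through an incoming edge. -/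
theorem Pos.first {a : X.V} {x : X.V ⊕ S} {p : ℂ × ℂ} (h : X.Pos (Sum.inl a) x p)
    (hne : x ≠ Sum.inl a) : ∃ y q, X.IsInput y a ∧ X.Pos y x q ∧ p = odot (X.dec y) q := by
  induction h with
  | refl => exact absurd rfl hne
  | @step x p hx h ih =>
    by_cases e : X.succ x = a
    · subst e
      refine ⟨x, (0, 1), ⟨hx, rfl⟩, Pos.refl, ?_⟩
      rw [odot_one, h.self, one_odot]
    · obtain ⟨y, q, h1, h2, h3⟩ := ih fun e' => e (Sum.inl_injective e')
      exact ⟨y, _, h1, h2.step hx, by rw [h3, odot_assoc]⟩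

theorem exists_pos_root (X : DTree S) (x : X.V ⊕ S) : ∃ p, X.Pos (Sum.inl X.root) x p := by
  induction hn : X.ndepth x using Nat.strong_induction_on generalizing x with
  | _ n ih =>
    by_cases hx : x = Sum.inl X.root
    · exact hx ▸ ⟨_, Pos.refl⟩
    · obtain ⟨p, hp⟩ := ih _ (hn ▸ X.ndepth_lt hx) _ rfl
      exact ⟨_, hp.step hx⟩

theorem pos_leaf_iff {s t : S} {p : ℂ × ℂ} : X.Pos (Sum.inr s) (Sum.inr t) p ↔ t = s ∧ p = (0, 1) := by
  constructor
  · intro h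
    by_cases e : t = s
    · subst e
      exact ⟨rfl, h.self⟩
    · obtain ⟨-, q, h1, -⟩ := h.of_ne fun e' => e (Sum.inr_injective e')
      have key : ∀ {x q}, X.Pos (Sum.inr s) x q → x = Sum.inr s ∨ ∃ t, x = Sum.inr t := by
        intro x q h
        induction h with
        | refl => exact Or.inl rfl
        | step _ _ ih => rcases ih with ih | ⟨_, ih⟩ <;> exact absurd ih Sum.inl_ne_inr
      rcases key h1 with h | ⟨_, h⟩ <;> exact absurd h Sum.inl_ne_inr
  · rintro ⟨rfl, rfl⟩
    exact Pos.refl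

/-- There is a leaf above every node. -/
theorem exists_leaf_above (X : DTree S) (x : X.V ⊕ S) : ∃ s p, X.Pos x (Sum.inr s) p := by
  rcases x with a | s
  swap
  · exact ⟨s, _, Pos.refl⟩
  have := X.finite
  obtain ⟨N, hN⟩ : ∃ N, ∀ a, X.depth a ≤ N := by
    obtain ⟨N, hN⟩ := (Set.finite_range X.depth).bddAbove
    exact ⟨N, fun a => hN ⟨a, rfl⟩⟩
  induction hn : N - X.depth a using Nat.strong_induction_on generalizing a with
  | _ n ih =>
    obtain ⟨y, hy⟩ := X.input a
    rcases y with b | s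
    · have h1 : X.ndepth _ < X.ndepth _ := X.ndepth_lt hy.1
      rw [hy.2] at h1
      have h1' : X.depth a < X.depth b := h1
      obtain ⟨s, p, h⟩ := ih (N - X.depth b) (by have := hN b; omega) b rfl
      exact ⟨s, _, (Pos.input hy).trans h⟩
    · exact ⟨s, _, Pos.input hy⟩

/-- The highest vertex below a nonempty set of leaves. -/
theorem exists_meet (X : DTree S) {A : Set S} (hA : A.Nonempty) :
    ∃ b : X.V, (∀ s ∈ A, ∃ p, X.Pos (Sum.inl b) (Sum.inr s) p) ∧
      ∀ b' : X.V, (∀ s ∈ A, ∃ p, X.Pos (Sum.inl b') (Sum.inr s) p) →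
        ∃ k, X.Pos (Sum.inl b') (Sum.inl b) k := by
  have := X.finite
  obtain ⟨b, hb, hmax⟩ := Set.exists_max_image
    {b : X.V | ∀ s ∈ A, ∃ p, X.Pos (Sum.inl b) (Sum.inr s) p} X.depth (Set.toFinite _)
    ⟨X.root, fun s _ => X.exists_pos_root _⟩
  refine ⟨b, hb, fun b' hb' => ?_⟩
  obtain ⟨s, hs⟩ := hA
  obtain ⟨p, hp⟩ := hb s hs
  obtain ⟨p', hp'⟩ := hb' s hs
  rcases hp.total hp' with ⟨k, hk⟩ | h
  · rcases hk.eq_or_lt with ⟨e, -⟩ | h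
    · rw [e]
      exact ⟨_, Pos.refl⟩
    · exact absurd (hmax b' hb') (not_le.2 h)
  · exact h

/-! ### Good trees -/

/-- The decorated trees on which the coordinates behave well: all configurations lie in the augmented
marking spaces, and the configuration at the top of an internal edge of positive radius lies in the
unit disk, so that this edge may be contracted. -/
structure Good (X : DTree S) : Prop where
  aug : ∀ a, X.conf a ∈ X.AugConf a
  inner : ∀ b, b ≠ X.root → (X.dec (Sum.inl b)).2 ≠ 0 →
    ∀ x, x ≠ Sum.inl X.root → X.succ x = b → X.dec x ∈ InDisk

theorem Valid.good (h : X.Valid) : X.Good :=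
  ⟨fun a => (h.mark a).1, fun _ hb h0 => absurd (h.internal hb) h0⟩

theorem Good.apart (h : X.Good) {x y : X.V ⊕ S} (hx : x ≠ Sum.inl X.root)
    (hy : y ≠ Sum.inl X.root) (hne : x ≠ y) (e : X.succ x = X.succ y) :
    Apart (X.dec x) (X.dec y) := (aug_iff.1 h.aug).1 x y hx hy hne e

theorem Good.leaf_ne (h : X.Good) (s : S) : (X.dec (Sum.inr s)).2 ≠ 0 := (aug_iff.1 h.aug).2.1 s

theorem Good.root_disk (h : X.Good) {x : X.V ⊕ S} (hx : x ≠ Sum.inl X.root)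
    (e : X.succ x = X.root) : X.dec x ∈ InDisk := (aug_iff.1 h.aug).2.2 x hx e

theorem Pos.dec_ne {y x : X.V ⊕ S} {p : ℂ × ℂ} (h : X.Pos y x p) (hp : p.2 ≠ 0) :
    x = y ∨ (x ≠ Sum.inl X.root ∧ (X.dec x).2 ≠ 0) := by
  cases h with
  | refl => exact Or.inl rfl
  | step hx h => exact Or.inr ⟨hx, right_ne_zero_of_mul hp⟩

theorem Good.pos_inDisk (h : X.Good) {y x : X.V ⊕ S} {p : ℂ × ℂ}
    (hy : ∀ b, y = Sum.inl b → ∀ z, z ≠ Sum.inl X.root → X.succ z = b → X.dec z ∈ InDisk)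
    (hp : X.Pos y x p) : p ∈ InDisk := by
  induction hp with
  | refl => exact one_inDisk
  | @step x p hx hp ih =>
    by_cases h0 : p.2 = 0
    · have : odot p (X.dec x) = (p.1, 0) := by simp [odot, h0]
      rw [this]
      exact fst_zero_inDisk ih
    · refine odot_mem ih ?_
      rcases hp.dec_ne h0 with e | ⟨h1, h2⟩
      · exact hy _ e.symm x hx rfl
      · exact h.inner _ (fun e => h1 (by rw [e])) h2 x hx rfl

theorem Good.abs_inDisk (h : X.Good) {x : X.V ⊕ S} {p : ℂ × ℂ}
    (hp : X.Pos (Sum.inl X.root) x p) : p ∈ InDisk :=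
  h.pos_inDisk (fun _ e _ hz hzb => h.root_disk hz (hzb.trans (Sum.inl_injective e).symm)) hp

/-- Nodes above two different incoming edges of a vertex are disjoint from each other. -/
theorem Good.apart_of_input (h : X.Good) {a : X.V} {y z x u : X.V ⊕ S} {p q : ℂ × ℂ}
    (hy : X.IsInput y a) (hz : X.IsInput z a) (hne : y ≠ z) (hp : X.Pos y x p)
    (hq : X.Pos z u q) : Apart (odot (X.dec y) p) (odot (X.dec z) q) := by
  have key : ∀ {y x : X.V ⊕ S} {p : ℂ × ℂ}, X.IsInput y a → X.Pos y x p →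
      ‖(X.dec y).2 * p.1‖ + ‖(X.dec y).2 * p.2‖ ≤ ‖(X.dec y).2‖ := by
    intro y x p hy hp
    by_cases h0 : (X.dec y).2 = 0
    · simp [h0]
    · refine odot_le (h.pos_inDisk ?_ hp)
      rintro b rfl
      exact h.inner b (fun e => hy.1 (by rw [e])) h0
  have h1 : Apart (X.dec y) (X.dec z) := h.apart hy.1 hz.1 hne (hy.2.trans hz.2.symm)
  have h2 : Apart (odot (X.dec y) p) (X.dec z) := odot_disjoint_left (key hy hp) h1
  exact (show Apart (odot (X.dec z) q) _ from odot_disjoint_left (key hz hq) h2.symm).symm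

/-- At the highest vertex below a set of at least two leaves, two of these leaves are disjoint
from each other. -/
theorem Good.split (h : X.Good) {A : Set S} (hA : A.Nontrivial) {b : X.V}
    (hb : ∀ s ∈ A, ∃ p, X.Pos (Sum.inl b) (Sum.inr s) p)
    (hmax : ∀ b' : X.V, (∀ s ∈ A, ∃ p, X.Pos (Sum.inl b') (Sum.inr s) p) →
        ∃ k, X.Pos (Sum.inl b') (Sum.inl b) k) :
    ∃ s ∈ A, ∃ t ∈ A, ∃ p q, X.Pos (Sum.inl b) (Sum.inr s) p ∧
      X.Pos (Sum.inl b) (Sum.inr t) q ∧ Apart p q := by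
  obtain ⟨s, hs, t, ht, hst⟩ := hA
  have key : ∀ s ∈ A, ∃ y q, X.IsInput y b ∧ X.Pos y (Sum.inr s) q ∧
      X.Pos (Sum.inl b) (Sum.inr s) (odot (X.dec y) q) := by
    intro s hs
    obtain ⟨p, hp⟩ := hb s hs
    obtain ⟨y, q, h1, h2, rfl⟩ := hp.first Sum.inr_ne_inl
    exact ⟨y, q, h1, h2, hp⟩
  obtain ⟨y, q, h1, h2, h3⟩ := key s hs
  by_cases hall : ∀ u ∈ A, ∃ r, X.Pos y (Sum.inr u) r
  · exfalso
    rcases y with c | c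
    · obtain ⟨k, hk⟩ := hmax c hall
      have h4 := (Pos.input h1).antisymm hk
      have := X.ndepth_lt h1.1
      rw [h1.2, h4] at this
      exact lt_irrefl _ this
    · obtain ⟨r, hr⟩ := hall t ht
      exact hst ((pos_leaf_iff.1 h2).1.trans (pos_leaf_iff.1 hr).1.symm)
  · push Not at hall
    obtain ⟨u, hu, hu'⟩ := hall
    obtain ⟨z, r, k1, k2, k3⟩ := key u hu
    exact ⟨s, hs, u, hu, _, _, h3, k3,
      h.apart_of_input h1 k1 (fun e => hu' r (e ▸ k2)) h2 k2⟩

theorem Good.exists_split (h : X.Good) {A : Set S} (hA : A.Nontrivial) :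
    ∃ b : X.V, (∀ s ∈ A, ∃ p, X.Pos (Sum.inl b) (Sum.inr s) p) ∧
      ∃ s ∈ A, ∃ t ∈ A, ∃ p q, X.Pos (Sum.inl b) (Sum.inr s) p ∧
      X.Pos (Sum.inl b) (Sum.inr t) q ∧ Apart p q := by
  obtain ⟨b, h1, h2⟩ := X.exists_meet hA.nonempty
  exact ⟨b, h1, h.split hA h1 h2⟩

theorem Good.exists_split_pair (h : X.Good) {s t : S} (hst : s ≠ t) :
    ∃ (b : X.V) (p q : ℂ × ℂ), X.Pos (Sum.inl b) (Sum.inr s) p ∧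
      X.Pos (Sum.inl b) (Sum.inr t) q ∧ Apart p q := by
  obtain ⟨b, -, u, hu, v, hv, p, q, h1, h2, h3⟩ :=
    h.exists_split (Set.nontrivial_pair hst)
  rcases hu with rfl | rfl <;> rcases hv with rfl | rfl
  · exact absurd (congrArg Prod.fst (h1.unique h2)) h3.ne
  · exact ⟨b, p, q, h1, h2, h3⟩
  · exact ⟨b, q, p, h2, h1, h3.symm⟩
  · exact absurd (congrArg Prod.fst (h1.unique h2)) h3.ne

/-- Three leaves, not all equal, lie above a vertex at which their centers are not all equal. -/
theorem Good.exists_split_triple (h : X.Good) {s t u : S} (hne : ¬ (t = s ∧ u = s)) :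
    ∃ (b : X.V) (p q r : ℂ × ℂ), X.Pos (Sum.inl b) (Sum.inr s) p ∧
      X.Pos (Sum.inl b) (Sum.inr t) q ∧ X.Pos (Sum.inl b) (Sum.inr u) r ∧
      ¬ (p.1 - q.1 = 0 ∧ p.1 - r.1 = 0) := by
  have hA : ({s, t, u} : Set S).Nontrivial := by
    by_cases e : t = s
    · exact ⟨s, by simp, u, by simp, fun e' => hne ⟨e, e'.symm⟩⟩
    · exact ⟨s, by simp, t, by simp, fun e' => e e'.symm⟩
  obtain ⟨b, hb, v, hv, w, hw, p', q', h1, h2, h3⟩ := h.exists_split hA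
  obtain ⟨p, hp⟩ := hb s (by simp)
  obtain ⟨q, hq⟩ := hb t (by simp)
  obtain ⟨r, hr⟩ := hb u (by simp)
  refine ⟨b, p, q, r, hp, hq, hr, ?_⟩
  rintro ⟨e1, e2⟩
  have key : ∀ z ∈ ({s, t, u} : Set S), ∀ p', X.Pos (Sum.inl b) (Sum.inr z) p' → p'.1 = p.1 := by
    rintro z (rfl | rfl | rfl) p' hp'
    · rw [hp.unique hp']
    · rw [← hq.unique hp', sub_eq_zero.1 e1]
    · rw [← hr.unique hp', sub_eq_zero.1 e2]
  exact h3.ne ((key v hv _ h1).trans (key w hw _ h2).symm)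

end DTree
end TrivDisks

namespace TrivDisks
open scoped ComplexConjugate

/-! ### Points of the projective line -/

/-- The point `[v : w]` of the projective line, encoded by the orthogonal projection of `ℂ²` to the
line that it spans. -/
noncomputable def bl (v w : ℂ) : ℂ × ℂ × ℂ :=
  (v * conj w / (v * conj v + w * conj w), v * conj v / (v * conj v + w * conj w),
    w * conj w / (v * conj v + w * conj w))

/-- The action of the diagonal matrix with entries `α`, `β` on the projective line. -/
noncomputable def blScale (α β : ℂ) (t : ℂ × ℂ × ℂ) : ℂ × ℂ × ℂ :=
  (α * conj β * t.1 / (α * conj α * t.2.1 + β * conj β * t.2.2),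
    α * conj α * t.2.1 / (α * conj α * t.2.1 + β * conj β * t.2.2),
    β * conj β * t.2.2 / (α * conj α * t.2.1 + β * conj β * t.2.2))

theorem bl_den_ne {v w : ℂ} (h : ¬ (v = 0 ∧ w = 0)) : v * conj v + w * conj w ≠ 0 := by
  rw [Complex.mul_conj, Complex.mul_conj, ← Complex.ofReal_add]
  intro e
  have e' : Complex.normSq v + Complex.normSq w = 0 := by exact_mod_cast e
  have h1 := Complex.normSq_nonneg v
  have h2 := Complex.normSq_nonneg w
  exact h ⟨Complex.normSq_eq_zero.1 (by linarith), Complex.normSq_eq_zero.1 (by linarith)⟩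

theorem bl_smul {k : ℂ} (hk : k ≠ 0) (v w : ℂ) : bl (k * v) (k * w) = bl v w := by
  have hk' : conj k ≠ 0 := by simpa using hk
  have e : k * v * conj (k * v) + k * w * conj (k * w) =
      (k * conj k) * (v * conj v + w * conj w) := by simp only [map_mul]; ring
  have h0 : k * conj k ≠ 0 := mul_ne_zero hk hk'
  simp only [bl, Prod.mk.injEq, e]
  simp only [map_mul]
  refine ⟨?_, ?_, ?_⟩
  · rw [show k * v * (conj k * conj w) = k * conj k * (v * conj w) by ring, mul_div_mul_left _ _ h0]
  · rw [show k * v * (conj k * conj v) = k * conj k * (v * conj v) by ring, mul_div_mul_left _ _ h0]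
  · rw [show k * w * (conj k * conj w) = k * conj k * (w * conj w) by ring, mul_div_mul_left _ _ h0]

theorem blScale_den {v w : ℂ} (α β : ℂ) :
    α * conj α * (bl v w).2.1 + β * conj β * (bl v w).2.2 =
      ((α * v) * conj (α * v) + (β * w) * conj (β * w)) / (v * conj v + w * conj w) := by
  simp only [bl, map_mul]
  ring

theorem blScale_bl {v w : ℂ} (h : ¬ (v = 0 ∧ w = 0)) (α β : ℂ) :
    blScale α β (bl v w) = bl (α * v) (β * w) := by
  have h0 := bl_den_ne h
  simp only [blScale, blScale_den]
  simp only [bl, map_mul, Prod.mk.injEq]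
  refine ⟨?_, ?_, ?_⟩ <;>
  · rw [← mul_div_assoc, div_div_div_cancel_right₀ h0]
    ring

theorem blScale_den_ne {v w : ℂ} (h : ¬ (v = 0 ∧ w = 0)) {α β : ℂ} (hα : α ≠ 0) (hβ : β ≠ 0) :
    α * conj α * (bl v w).2.1 + β * conj β * (bl v w).2.2 ≠ 0 := by
  rw [blScale_den]
  refine div_ne_zero (bl_den_ne ?_) (bl_den_ne h)
  rintro ⟨h1, h2⟩
  exact h ⟨(mul_eq_zero.1 h1).resolve_left hα, (mul_eq_zero.1 h2).resolve_left hβ⟩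

theorem bl_snd_eq_zero {v w : ℂ} (h : ¬ (v = 0 ∧ w = 0)) : (bl v w).2.2 = 0 ↔ w = 0 := by
  simp [bl, bl_den_ne h]

theorem bl_ratio {v w : ℂ} (hw : w ≠ 0) : (bl v w).1 / (bl v w).2.2 = v / w := by
  have h0 := bl_den_ne (v := v) (w := w) fun h => hw h.2
  have hw' : conj w ≠ 0 := by simpa using hw
  simp only [bl]
  rw [div_div_div_cancel_right₀ h0, mul_div_mul_right _ _ hw']

theorem continuousAt_bl {p : ℂ × ℂ} (h : ¬ (p.1 = 0 ∧ p.2 = 0)) :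
    ContinuousAt (fun p : ℂ × ℂ => bl p.1 p.2) p := by
  have h0 := bl_den_ne h
  have hc : Continuous fun z : ℂ => conj z := Complex.continuous_conj
  unfold bl
  refine ContinuousAt.prodMk ?_ (ContinuousAt.prodMk ?_ ?_) <;>
  · refine ContinuousAt.div ?_ ?_ h0 <;> fun_prop

/-! ### Coordinates of decorated trees -/

/-- The space of the coordinates: a pair `(c, r)` for every leaf, a number for two leaves, and a
point of the projective line for three leaves. -/
abbrev Coord (S : Type) : Type := (S → ℂ × ℂ) × (S → S → ℂ) × (S → S → S → ℂ × ℂ × ℂ)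

namespace DTree

variable {S S' T : Type} {X Y Z : DTree S}

/-- The position of a leaf relative to the root. -/
noncomputable def abs (X : DTree S) (s : S) : ℂ × ℂ := (X.exists_pos_root (Sum.inr s)).choose

theorem pos_abs (X : DTree S) (s : S) : X.Pos (Sum.inl X.root) (Sum.inr s) (X.abs s) :=
  (X.exists_pos_root (Sum.inr s)).choose_spec

/-- The value of `rho` at a given vertex. -/
def RhoRel (X : DTree S) (s t : S) (r : ℂ) : Prop :=
  ∃ (a : X.V) (p q : ℂ × ℂ), X.Pos (Sum.inl a) (Sum.inr s) p ∧
    X.Pos (Sum.inl a) (Sum.inr t) q ∧ p.1 ≠ q.1 ∧ r = p.2 / (p.1 - q.1)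

/-- The value of `tri` at a given vertex. -/
def TriRel (X : DTree S) (s t u : S) (v : ℂ × ℂ × ℂ) : Prop :=
  ∃ (a : X.V) (p q r : ℂ × ℂ), X.Pos (Sum.inl a) (Sum.inr s) p ∧
    X.Pos (Sum.inl a) (Sum.inr t) q ∧ X.Pos (Sum.inl a) (Sum.inr u) r ∧
    ¬ (p.1 - q.1 = 0 ∧ p.1 - r.1 = 0) ∧ v = bl (p.1 - q.1) (p.1 - r.1)

open Classical in
/-- The radius of the leaf `s` divided by the difference of the centers of `s` and `t`, in the
coordinates of any vertex at which these centers differ. -/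
noncomputable def rho (X : DTree S) (s t : S) : ℂ := if h : ∃ r, X.RhoRel s t r then h.choose else 0

open Classical in
/-- The quotient of the differences of the centers of `s` and `t` and of `s` and `u`, as a point of
the projective line, in the coordinates of any vertex at which the three centers are not all
equal. -/
noncomputable def tri (X : DTree S) (s t u : S) : ℂ × ℂ × ℂ :=
  if h : ∃ v, X.TriRel s t u v then h.choose else 0

/-- The coordinates of a decorated tree. -/
noncomputable def coord (X : DTree S) : Coord S := (X.abs, X.rho, X.tri)

theorem abs_eq {s : S} {p : ℂ × ℂ} (h : X.Pos (Sum.inl X.root) (Sum.inr s) p) : X.abs s = p :=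
  (X.pos_abs s).unique h

/-- The positions relative to two comparable vertices differ by an affine map, which rescales radii
and differences of centers by the same factor, so that their quotient is the same. -/
theorem RhoRel.unique {s t : S} {r r' : ℂ} (h : X.RhoRel s t r) (h' : X.RhoRel s t r') :
    r = r' := by
  have key : ∀ {p q p' q' k : ℂ × ℂ}, p.1 ≠ q.1 → p = odot k p' → q = odot k q' →
      p.2 / (p.1 - q.1) = p'.2 / (p'.1 - q'.1) := by
    rintro p q p' q' k hne rfl rfl
    rw [odot_fst_sub]
    have hk : k.2 ≠ 0 := by
      intro e
      exact hne (sub_eq_zero.1 (by rw [odot_fst_sub, e, zero_mul]))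
    exact mul_div_mul_left _ _ hk
  obtain ⟨a, p, q, h1, h2, h3, rfl⟩ := h
  obtain ⟨a', p', q', h1', h2', h3', rfl⟩ := h'
  obtain ⟨k, hk | hk⟩ := h1.compare h1'
  · exact key h3 (hk _ _ _ h1 h1') (hk _ _ _ h2 h2')
  · exact (key h3' (hk _ _ _ h1 h1') (hk _ _ _ h2 h2')).symm

/-- As for `rho`, the choice of the vertex does not matter. -/
theorem TriRel.unique {s t u : S} {v v' : ℂ × ℂ × ℂ} (h : X.TriRel s t u v)
    (h' : X.TriRel s t u v') : v = v' := by
  have key : ∀ {p q r p' q' r' k : ℂ × ℂ}, ¬ (p.1 - q.1 = 0 ∧ p.1 - r.1 = 0) →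
      p = odot k p' → q = odot k q' → r = odot k r' →
      bl (p.1 - q.1) (p.1 - r.1) = bl (p'.1 - q'.1) (p'.1 - r'.1) := by
    rintro p q r p' q' r' k hne rfl rfl rfl
    simp only [odot_fst_sub] at hne ⊢
    refine bl_smul ?_ _ _
    intro e
    exact hne (by simp [e])
  obtain ⟨a, p, q, r, h1, h2, h3, h4, rfl⟩ := h
  obtain ⟨a', p', q', r', h1', h2', h3', h4', rfl⟩ := h'
  obtain ⟨k, hk | hk⟩ := h1.compare h1'
  · exact key h4 (hk _ _ _ h1 h1') (hk _ _ _ h2 h2') (hk _ _ _ h3 h3')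
  · exact (key h4' (hk _ _ _ h1 h1') (hk _ _ _ h2 h2') (hk _ _ _ h3 h3')).symm

theorem rho_of_rel {s t : S} {r : ℂ} (h : X.RhoRel s t r) : X.rho s t = r := by
  have h' : ∃ r, X.RhoRel s t r := ⟨r, h⟩
  rw [rho, dif_pos h']
  exact h'.choose_spec.unique h

theorem tri_of_rel {s t u : S} {v : ℂ × ℂ × ℂ} (h : X.TriRel s t u v) : X.tri s t u = v := by
  have h' : ∃ r, X.TriRel s t u r := ⟨v, h⟩
  rw [tri, dif_pos h']
  exact h'.choose_spec.unique h

theorem rho_eq {a : X.V} {s t : S} {p q : ℂ × ℂ} (h1 : X.Pos (Sum.inl a) (Sum.inr s) p)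
    (h2 : X.Pos (Sum.inl a) (Sum.inr t) q) (h : p.1 ≠ q.1) : X.rho s t = p.2 / (p.1 - q.1) :=
  rho_of_rel ⟨a, p, q, h1, h2, h, rfl⟩

theorem tri_eq {a : X.V} {s t u : S} {p q r : ℂ × ℂ} (h1 : X.Pos (Sum.inl a) (Sum.inr s) p)
    (h2 : X.Pos (Sum.inl a) (Sum.inr t) q) (h3 : X.Pos (Sum.inl a) (Sum.inr u) r)
    (h : ¬ (p.1 - q.1 = 0 ∧ p.1 - r.1 = 0)) : X.tri s t u = bl (p.1 - q.1) (p.1 - r.1) :=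
  tri_of_rel ⟨a, p, q, r, h1, h2, h3, h, rfl⟩

theorem rho_self (X : DTree S) (s : S) : X.rho s s = 0 := by
  rw [rho, dif_neg]
  rintro ⟨r, a, p, q, h1, h2, h3, -⟩
  exact h3 (congrArg Prod.fst (h1.unique h2))

theorem tri_self (X : DTree S) (s : S) : X.tri s s s = 0 := by
  rw [tri, dif_neg]
  rintro ⟨r, a, p, q, r, h1, h2, h3, h4, -⟩
  rw [h1.unique h2, h2.unique h3] at h4
  simp at h4

theorem Good.norm_rho_lt (h : X.Good) (s t : S) : ‖X.rho s t‖ < 1 := by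
  by_cases e : s = t
  · subst e
    simp [rho_self]
  · obtain ⟨b, p, q, h1, h2, h3⟩ := h.exists_split_pair e
    rw [rho_eq h1 h2 h3.ne, norm_div, div_lt_one (norm_pos_iff.2 (sub_ne_zero.2 h3.ne))]
    have := norm_nonneg q.2
    have h3 : _ < _ := h3
    linarith

/-- The radius of `s` is a multiple of the difference of the centers of `s` and `t`, at all common
vertices. -/
theorem Good.snd_eq_rho_mul (h : X.Good) {y : X.V ⊕ S} {s t : S} {p q : ℂ × ℂ} (hst : s ≠ t)
    (h1 : X.Pos y (Sum.inr s) p) (h2 : X.Pos y (Sum.inr t) q) :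
    p.2 = X.rho s t * (p.1 - q.1) := by
  obtain ⟨b, p', q', h1', h2', h3⟩ := h.exists_split_pair hst
  have hne := sub_ne_zero.2 h3.ne
  rw [rho_eq h1' h2' h3.ne, div_mul_eq_mul_div, eq_div_iff hne]
  obtain ⟨k, hk | hk⟩ := h1.compare h1'
  · rw [hk _ _ _ h1 h1', hk _ _ _ h2 h2', odot_fst_sub]
    simp only [odot]
    ring
  · rw [hk _ _ _ h1 h1', hk _ _ _ h2 h2', odot_fst_sub]
    simp only [odot]
    ring

/-- The numbers `rho s t` and `rho s u` are proportional to the homogeneous coordinates of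
`tri s t u`, so the one of them that is not zero determines the other. -/
theorem Good.rho_tri (h : X.Good) {s t u : S} (ht : s ≠ t) (hu : s ≠ u) :
    X.rho s t * (X.tri s t u).1 = X.rho s u * (X.tri s t u).2.2 ∧
      ((X.tri s t u).2.2 = 0 → X.rho s t = 0) := by
  obtain ⟨b, p, q, r, h1, h2, h3, h4⟩ := h.exists_split_triple (s := s) (t := t) (u := u)
    fun e => ht e.1.symm
  have e1 := h.snd_eq_rho_mul ht h1 h2
  have e2 := h.snd_eq_rho_mul hu h1 h3
  rw [tri_eq h1 h2 h3 h4]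
  have e3 := e1.symm.trans e2
  constructor
  · simp only [bl]
    rw [← mul_div_assoc, ← mul_assoc, e3, ← mul_div_assoc, ← mul_assoc]
  · intro h0
    rw [bl_snd_eq_zero h4] at h0
    rw [h0, mul_zero] at e3
    exact (mul_eq_zero.1 e3).resolve_right fun e => h4 ⟨e, h0⟩

theorem Good.abs_snd (h : X.Good) {s t : S} (ht : s ≠ t) :
    (X.abs s).2 = X.rho s t * ((X.abs s).1 - (X.abs t).1) :=
  h.snd_eq_rho_mul ht (X.pos_abs s) (X.pos_abs t)

/-! ### Comparison of trees by positions -/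

/-- At the vertex `a`, two leaves have different centers. -/
def Splits (X : DTree S) (a : X.V) : Prop :=
  ∃ (s t : S) (p q : ℂ × ℂ), X.Pos (Sum.inl a) (Sum.inr s) p ∧
    X.Pos (Sum.inl a) (Sum.inr t) q ∧ p.1 ≠ q.1

/-- Every vertex of `X` that matters for the coordinates has a counterpart in `Z`, with the same
positions of the leaves up to `Aff(ℂ)`. -/
def Sim (X Z : DTree S) : Prop :=
  ∀ a, a = X.root ∨ X.Splits a → ∃ (b : Z.V) (g : ℂ × ℂ), g.2 ≠ 0 ∧
    (a = X.root → b = Z.root ∧ g = (0, 1)) ∧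
    ∀ s p, X.Pos (Sum.inl a) (Sum.inr s) p → Z.Pos (Sum.inl b) (Sum.inr s) (odot g p)

/-- The coordinates only see the positions relative to the root and to the splitting vertices, up
to `Aff(ℂ)`. -/
theorem Sim.coord_eq (h : Sim X Z) (hX : X.Good) : X.coord = Z.coord := by
  refine Prod.ext (funext fun s => ?_) (Prod.ext (funext fun s => funext fun t => ?_)
    (funext fun s => funext fun t => funext fun u => ?_))
  · obtain ⟨b, g, -, h2, h3⟩ := h _ (Or.inl rfl)
    obtain ⟨rfl, rfl⟩ := h2 rfl
    have := h3 s _ (X.pos_abs s)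
    rw [one_odot] at this
    exact (abs_eq this).symm
  · change X.rho s t = Z.rho s t
    by_cases e : s = t
    · subst e
      rw [rho_self, rho_self]
    · obtain ⟨a, p, q, h1, h2, h3⟩ := hX.exists_split_pair e
      obtain ⟨b, g, hg, -, hb⟩ := h a (Or.inr ⟨s, t, p, q, h1, h2, h3.ne⟩)
      rw [rho_eq h1 h2 h3.ne, rho_eq (hb _ _ h1) (hb _ _ h2), odot_fst_sub]
      · exact (mul_div_mul_left _ _ hg).symm
      · rw [← sub_ne_zero, odot_fst_sub]
        exact mul_ne_zero hg (sub_ne_zero.2 h3.ne)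
  · change X.tri s t u = Z.tri s t u
    by_cases e : t = s ∧ u = s
    · obtain ⟨rfl, rfl⟩ := e
      rw [tri_self, tri_self]
    · obtain ⟨a, p, q, r, h1, h2, h3, h4⟩ := hX.exists_split_triple e
      have hs : X.Splits a := by
        by_cases e' : p.1 - q.1 = 0
        · exact ⟨s, u, p, r, h1, h3, fun e'' => h4 ⟨e', sub_eq_zero.2 e''⟩⟩
        · exact ⟨s, t, p, q, h1, h2, fun e'' => e' (sub_eq_zero.2 e'')⟩
      obtain ⟨b, g, hg, -, hb⟩ := h a (Or.inr hs)
      rw [tri_eq h1 h2 h3 h4, tri_eq (hb _ _ h1) (hb _ _ h2) (hb _ _ h3)]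
      · simp only [odot_fst_sub]
        exact (bl_smul hg _ _).symm
      · simp only [odot_fst_sub, mul_eq_zero, hg, false_or]
        exact h4

end DTree
end TrivDisks

namespace TrivDisks
open scoped ComplexConjugate

namespace DTree

variable {S S' T : Type} {X : DTree S} {Y : DTree S'}

/-! ### Positions and coordinates under isomorphisms, relabellings and contractions -/

theorem odot_of_snd_eq_zero {p : ℂ × ℂ} (h : p.2 = 0) (q : ℂ × ℂ) : odot p q = p :=
  Prod.ext (by simp [odot, h]) (by simp [odot, h])

/-- Since internal edges have radius `0`, only the affine map at the vertex of departure enters. -/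
theorem IsIso.pos {X Y : DTree S} {φ : X.V ≃ Y.V} {g : X.V → ℂ × ℂ} (h : IsIso X Y φ g)
    (hX : X.Valid) {a : X.V} {s : S} {p : ℂ × ℂ} (hp : X.Pos (Sum.inl a) (Sum.inr s) p) :
    Y.Pos (Sum.inl (φ a)) (Sum.inr s) (odot (g a) p) := by
  have key : ∀ x p, X.Pos (Sum.inl a) x p → ∀ b, x = Sum.inl b →
      ∃ p', Y.Pos (Sum.inl (φ a)) (Sum.inl (φ b)) p' ∧
        ∀ u, odot p' (odot (g b) u) = odot (g a) (odot p u) := by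
    intro x p hp
    induction hp with
    | refl =>
      rintro b e
      obtain rfl := Sum.inl_injective e
      exact ⟨_, Pos.refl, fun u => by rw [one_odot, one_odot]⟩
    | @step x p hx hp ih =>
      rintro b rfl
      obtain ⟨p', h1, h2⟩ := ih _ rfl
      rw [← h.succ _ hx] at h1
      have h3 := h1.step (map_ne_root h.root hx)
      have h0 : (X.dec (Sum.inl b)).2 = 0 := hX.internal fun e => hx (by rw [e])
      refine ⟨_, h3, fun u => ?_⟩
      rw [h.dec _ hx, odot_assoc, odot_assoc, h2, odot_assoc, odot_of_snd_eq_zero h0 u,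
        odot_of_snd_eq_zero h0]
  obtain ⟨hs, q, h1, rfl⟩ := hp.of_ne Sum.inr_ne_inl
  obtain ⟨p', h2, h3⟩ := key _ _ h1 _ rfl
  rw [← h.succ _ hs] at h2
  have h4 := h2.step (map_ne_root h.root hs)
  rw [h.dec _ hs, h3] at h4
  exact h4

theorem IsIso.sim {X Y : DTree S} {φ : X.V ≃ Y.V} {g : X.V → ℂ × ℂ} (h : IsIso X Y φ g)
    (hX : X.Valid) : Sim X Y := fun a _ =>
  ⟨φ a, g a, h.g_ne a, by rintro rfl; exact ⟨h.root, h.g_root⟩, fun _ _ hp => h.pos hX hp⟩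

theorem Pos.relabel (σ : S ≃ T) {y x : X.V ⊕ S} {p : ℂ × ℂ} (h : X.Pos y x p) :
    (X.relabel σ).Pos (Sum.map id σ y) (Sum.map id σ x) p := by
  have e : ∀ x : X.V ⊕ S, Sum.map id σ.symm (Sum.map id σ x) = x := by
    rintro (a | s) <;> simp
  induction h with
  | refl => exact Pos.refl
  | @step x p hx h ih =>
    have h1 : (X.relabel σ).dec (Sum.map id σ x) = X.dec x := congrArg X.dec (e x)
    have h2 : (X.relabel σ).succ (Sum.map id σ x) = X.succ x := congrArg X.succ (e x)
    rw [← h1]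
    refine Pos.step ?_ (by rw [h2]; exact ih)
    rcases x with a | s
    · exact fun e => hx (congrArg Sum.inl (Sum.inl_injective e))
    · exact Sum.inr_ne_inl

end DTree

/-- Relabelling of coordinates. -/
def Coord.relabel {S T : Type} (σ : S ≃ T) (κ : Coord S) : Coord T :=
  (fun t => κ.1 (σ.symm t), fun s t => κ.2.1 (σ.symm s) (σ.symm t),
    fun s t u => κ.2.2 (σ.symm s) (σ.symm t) (σ.symm u))

namespace DTree

variable {S S' T : Type} {X : DTree S} {Y : DTree S'}

theorem Good.coord_relabel (hX : X.Good) (σ : S ≃ T) :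
    (X.relabel σ).coord = Coord.relabel σ X.coord := by
  have key : ∀ {a : X.V} {t : T} {p : ℂ × ℂ}, X.Pos (Sum.inl a) (Sum.inr (σ.symm t)) p →
      (X.relabel σ).Pos (Sum.inl a) (Sum.inr t) p := by
    intro a t p h
    have := h.relabel σ
    have e : (Sum.map id σ (Sum.inr (σ.symm t)) : X.V ⊕ T) = Sum.inr t := by simp
    exact cast (congrArg (fun z => (X.relabel σ).Pos (Sum.inl a) z p) e) this
  refine Prod.ext (funext fun s => ?_) (Prod.ext (funext fun s => funext fun t => ?_)
    (funext fun s => funext fun t => funext fun u => ?_))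
  · exact abs_eq (key (X.pos_abs _))
  · change (X.relabel σ).rho s t = X.rho _ _
    by_cases e : s = t
    · subst e
      rw [rho_self, rho_self]
    · obtain ⟨a, p, q, h1, h2, h3⟩ := hX.exists_split_pair (σ.symm.injective.ne e)
      rw [rho_eq h1 h2 h3.ne, rho_eq (key h1) (key h2) h3.ne]
  · change (X.relabel σ).tri s t u = X.tri _ _ _
    by_cases e : t = s ∧ u = s
    · obtain ⟨rfl, rfl⟩ := e
      rw [tri_self, tri_self]
    · obtain ⟨a, p, q, r, h1, h2, h3, h4⟩ := hX.exists_split_triple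
        (s := σ.symm s) (t := σ.symm t) (u := σ.symm u)
        fun h => e ⟨σ.symm.injective h.1, σ.symm.injective h.2⟩
      rw [tri_eq h1 h2 h3 h4, tri_eq (key h1) (key h2) (key h3) h4]

theorem Pos.contract {w : X.V} (hw : w ≠ X.root) {y x : {a : X.V // a ≠ w} ⊕ S} {p : ℂ × ℂ}
    (h : X.Pos (incl w y) (incl w x) p) : (X.contract w hw).Pos y x p := by
  have key : ∀ z p, X.Pos (incl w y) z p →
      (∀ x, z = incl w x → (X.contract w hw).Pos y x p) ∧
      (z = Sum.inl w → ∃ q, (X.contract w hw).Pos y (Sum.inl ⟨_, X.succ_ne hw⟩) q ∧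
        p = odot q (X.dec (Sum.inl w))) := by
    intro z p h
    induction h with
    | refl =>
      refine ⟨fun x e => ?_, fun e => absurd e (incl_ne y)⟩
      rw [incl_injective w e]
      exact Pos.refl
    | @step z p hz h ih =>
      constructor
      · rintro x rfl
        have hx : x ≠ Sum.inl (X.contract w hw).root := by
          rintro rfl
          exact hz rfl
        by_cases c : X.succ (incl w x) = w
        · obtain ⟨q, h1, rfl⟩ := ih.2 (congrArg Sum.inl c)
          have e1 : (X.contract w hw).succ x = ⟨_, X.succ_ne hw⟩ :=
            Subtype.ext (contractSucc_eq (hw := hw) c)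
          rw [odot_assoc, ← contractDec_eq c]
          exact Pos.step hx (e1 ▸ h1)
        · have h1 := ih.1 (Sum.inl ⟨_, c⟩) rfl
          have e1 : (X.contract w hw).succ x = ⟨_, c⟩ :=
            Subtype.ext (contractSucc_ne (hw := hw) c)
          rw [← contractDec_ne c]
          exact Pos.step hx (e1 ▸ h1)
      · rintro rfl
        exact ⟨p, ih.1 (Sum.inl ⟨_, X.succ_ne hw⟩) rfl, rfl⟩
  exact (key _ _ h).1 x rfl

/-- Contracting an internal edge is harmless if its radius is not zero, because the removed vertex
is then a change of coordinates away from the vertex below it, or if nothing splits at its top. -/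
theorem sim_contract {w : X.V} (hw : w ≠ X.root)
    (h : (X.dec (Sum.inl w)).2 ≠ 0 ∨ ¬ X.Splits w) : Sim X (X.contract w hw) := by
  intro a ha
  by_cases c : a = w
  · subst c
    have h := h.resolve_right (not_not.2 (ha.resolve_left hw))
    refine ⟨⟨_, X.succ_ne hw⟩, X.dec (Sum.inl a), h, fun e => absurd e hw, fun s p hp => ?_⟩
    have h1 := (Pos.edge (X := X) (x := Sum.inl a) fun e => hw (Sum.inl_injective e)).trans hp
    exact Pos.contract hw (y := Sum.inl ⟨_, X.succ_ne hw⟩) (x := Sum.inr s) h1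
  · refine ⟨⟨a, c⟩, (0, 1), one_ne_zero, fun e => ⟨Subtype.ext e, rfl⟩, fun s p hp => ?_⟩
    rw [one_odot]
    exact Pos.contract hw (y := Sum.inl ⟨a, c⟩) (x := Sum.inr s) hp

theorem Good.contract (hX : X.Good) {w : X.V} (hw : w ≠ X.root) (h : (X.dec (Sum.inl w)).2 ≠ 0) :
    (X.contract w hw).Good := by
  have hcw := hX.inner w hw h
  refine ⟨contract_aug hX.aug w hw (Or.inl ⟨h, hcw⟩), ?_⟩
  intro b hb h0 x hx hxb
  have hb' : b.1 ≠ X.root := fun e => hb (Subtype.ext e)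
  have h0' : (X.dec (Sum.inl b.1)).2 ≠ 0 := by
    by_cases c : X.succ (incl w (Sum.inl b)) = w
    · have h0 : (contractDec X w (Sum.inl b)).2 ≠ 0 := h0
      rw [contractDec_eq c] at h0
      exact right_ne_zero_of_mul h0
    · have h0 : (contractDec X w (Sum.inl b)).2 ≠ 0 := h0
      rwa [contractDec_ne c] at h0
  have hx' := incl_ne_root hw hx
  have hxb' : ((X.contract w hw).succ x).1 = b.1 := congrArg Subtype.val hxb
  by_cases c : X.succ (incl w x) = w
  · change contractDec X w x ∈ InDisk
    rw [contractDec_eq c]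
    refine odot_mem (hX.inner b.1 hb' h0' _ (fun e => hw (Sum.inl_injective e)) ?_) (hcw _ hx' c)
    exact (contractSucc_eq (hw := hw) c).symm.trans hxb'
  · change contractDec X w x ∈ InDisk
    rw [contractDec_ne c]
    refine hX.inner b.1 hb' h0' _ hx' ?_
    exact (contractSucc_ne (hw := hw) c).symm.trans hxb'

/-! ### Positions and coordinates of compositions -/

open Classical in
/-- The nodes of a grafted tree that come from the lower tree. -/
noncomputable def graftLower (s : S) (X : DTree S) (Y : DTree S') :
    X.V ⊕ S → (graft s X Y).V ⊕ Ins s S'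
  | Sum.inl a => Sum.inl (Sum.inl a)
  | Sum.inr t => if h : t = s then Sum.inl (Sum.inr Y.root) else Sum.inr (Sum.inl ⟨t, h⟩)

/-- The nodes of a grafted tree that come from the upper tree. -/
def graftUpper (s : S) (X : DTree S) (Y : DTree S') : Y.V ⊕ S' → (graft s X Y).V ⊕ Ins s S'
  | Sum.inl b => Sum.inl (Sum.inr b)
  | Sum.inr y => Sum.inr (Sum.inr y)

theorem graftLower_ne (s : S) {x : X.V ⊕ S} (hx : x ≠ Sum.inl X.root) :
    graftLower s X Y x ≠ Sum.inl (graft s X Y).root := by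
  rcases x with a | t
  · exact fun e => hx (congrArg Sum.inl (Sum.inl_injective (Sum.inl_injective e)))
  · by_cases h : t = s
    · simp only [graftLower, h, dite_true]
      exact fun e => Sum.inr_ne_inl (Sum.inl_injective e)
    · simp only [graftLower, h, dite_false]
      exact Sum.inr_ne_inl

theorem graft_succ_lower (s : S) (x : X.V ⊕ S) :
    (graft s X Y).succ (graftLower s X Y x) = Sum.inl (X.succ x) := by
  change graftSucc s X Y (graftLower s X Y x) = _
  rcases x with a | t
  · rfl
  · by_cases h : t = s <;> simp [graftLower, graftSucc, h]

theorem graft_dec_lower (s : S) (x : X.V ⊕ S) :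
    (graft s X Y).dec (graftLower s X Y x) = X.dec x := by
  change graftDec s X Y (graftLower s X Y x) = _
  rcases x with a | t
  · rfl
  · by_cases h : t = s <;> simp [graftLower, graftDec, h]

theorem graft_succ_upper (s : S) {x : Y.V ⊕ S'} (hx : x ≠ Sum.inl Y.root) :
    (graft s X Y).succ (graftUpper s X Y x) = Sum.inr (Y.succ x) := by
  change graftSucc s X Y (graftUpper s X Y x) = _
  rcases x with a | t
  · have : a ≠ Y.root := fun e => hx (by rw [e])
    simp [graftUpper, graftSucc, this]
  · rfl

theorem graft_dec_upper (s : S) {x : Y.V ⊕ S'} (hx : x ≠ Sum.inl Y.root) :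
    (graft s X Y).dec (graftUpper s X Y x) = Y.dec x := by
  change graftDec s X Y (graftUpper s X Y x) = _
  rcases x with a | t
  · have : a ≠ Y.root := fun e => hx (by rw [e])
    simp [graftUpper, graftDec, this]
  · rfl

theorem graft_upper_ne (s : S) (x : Y.V ⊕ S') :
    graftUpper s X Y x ≠ Sum.inl (graft s X Y).root := by
  rcases x with a | t
  · exact fun e => Sum.inr_ne_inl (Sum.inl_injective e)
  · exact Sum.inr_ne_inl

/-- Every node of a grafted tree other than the root comes from one of the two trees. -/
theorem graft_node_cases (s : S) {z : (graft s X Y).V ⊕ Ins s S'}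
    (hz : z ≠ Sum.inl (graft s X Y).root) :
    (∃ x, x ≠ Sum.inl X.root ∧ z = graftLower s X Y x) ∨
      ∃ y, y ≠ Sum.inl Y.root ∧ z = graftUpper s X Y y := by
  rcases z with (a | b) | (x | y)
  · exact Or.inl ⟨Sum.inl a, fun e => hz (by rw [Sum.inl_injective e]; rfl), rfl⟩
  · by_cases hb : b = Y.root
    · subst hb
      exact Or.inl ⟨Sum.inr s, Sum.inr_ne_inl, by simp [graftLower]⟩
    · exact Or.inr ⟨Sum.inl b, fun e => hb (Sum.inl_injective e), rfl⟩
  · exact Or.inl ⟨Sum.inr x.1, Sum.inr_ne_inl, by simp [graftLower, x.2]⟩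
  · exact Or.inr ⟨Sum.inr y, Sum.inr_ne_inl, rfl⟩

theorem Pos.graft_lower (s : S) (Y : DTree S') {y x : X.V ⊕ S} {p : ℂ × ℂ} (h : X.Pos y x p) :
    (graft s X Y).Pos (graftLower s X Y y) (graftLower s X Y x) p := by
  induction h with
  | refl => exact Pos.refl
  | @step x p hx h ih =>
    rw [← graft_dec_lower (Y := Y) s x]
    refine Pos.step (graftLower_ne s hx) ?_
    rw [graft_succ_lower]
    exact ih

theorem Pos.graft_upper (s : S) (X : DTree S) {y x : Y.V ⊕ S'} {p : ℂ × ℂ} (h : Y.Pos y x p) :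
    (graft s X Y).Pos (graftUpper s X Y y) (graftUpper s X Y x) p := by
  induction h with
  | refl => exact Pos.refl
  | @step x p hx h ih =>
    rw [← graft_dec_upper (X := X) s hx]
    refine Pos.step (graft_upper_ne s x) ?_
    rw [graft_succ_upper s hx]
    exact ih

/-- Grafting of `Y` to `X` at `s`, followed by the contraction of the new edge. -/
noncomputable def merge (s : S) (X : DTree S) (Y : DTree S') : DTree (Ins s S') :=
  (graft s X Y).contract (Sum.inr Y.root) (graft_root_ne s X Y)

/-- A vertex of the lower tree in a merged tree. -/
def mlow (s : S) (X : DTree S) (Y : DTree S') (a : X.V) : (merge s X Y).V :=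
  ⟨Sum.inl a, Sum.inl_ne_inr⟩

/-- A vertex of the upper tree in a merged tree. -/
def mup (s : S) (X : DTree S) (Y : DTree S') (b : Y.V) (hb : b ≠ Y.root) : (merge s X Y).V :=
  ⟨Sum.inr b, fun e => hb (Sum.inr_injective e)⟩

theorem Pos.merge_low {s : S} (Y : DTree S') {a : X.V} {t : S} {p : ℂ × ℂ} (ht : t ≠ s)
    (h : X.Pos (Sum.inl a) (Sum.inr t) p) :
    (merge s X Y).Pos (Sum.inl (mlow s X Y a)) (Sum.inr (Sum.inl ⟨t, ht⟩)) p := by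
  have h1 := h.graft_lower s Y
  refine Pos.contract (X := graft s X Y) _ (y := Sum.inl ⟨Sum.inl a, Sum.inl_ne_inr⟩)
    (x := Sum.inr (Sum.inl ⟨t, ht⟩)) ?_
  have e : graftLower s X Y (Sum.inr t) = Sum.inr (Sum.inl ⟨t, ht⟩) := by simp [graftLower, ht]
  rw [e] at h1
  exact h1

theorem Pos.merge_glue {s : S} {a : X.V} {y : S'} {p q : ℂ × ℂ}
    (h : X.Pos (Sum.inl a) (Sum.inr s) p) (h' : Y.Pos (Sum.inl Y.root) (Sum.inr y) q) :
    (merge s X Y).Pos (Sum.inl (mlow s X Y a)) (Sum.inr (Sum.inr y)) (odot p q) := by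
  have h1 := h.graft_lower s Y
  have e : graftLower s X Y (Sum.inr s) = Sum.inl (Sum.inr Y.root) := dif_pos rfl
  rw [e] at h1
  exact Pos.contract (X := graft s X Y) _ (y := Sum.inl ⟨Sum.inl a, Sum.inl_ne_inr⟩)
    (x := Sum.inr (Sum.inr y)) (h1.trans (h'.graft_upper s X))

theorem Pos.merge_up (s : S) (X : DTree S) {b : Y.V} (hb : b ≠ Y.root) {y : S'} {q : ℂ × ℂ}
    (h : Y.Pos (Sum.inl b) (Sum.inr y) q) :
    (merge s X Y).Pos (Sum.inl (mup s X Y b hb)) (Sum.inr (Sum.inr y)) q :=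
  Pos.contract (X := graft s X Y) _ (y := Sum.inl ⟨Sum.inr b, fun e => hb (Sum.inr_injective e)⟩)
    (x := Sum.inr (Sum.inr y)) (h.graft_upper s X)

theorem Good.merge (hX : X.Good) (hY : Y.Good) (s : S) : (merge s X Y).Good := by
  have hr : graftLower s X Y (Sum.inr s) = Sum.inl (Sum.inr Y.root) := dif_pos rfl
  have hg : (graft s X Y).Good := by
    refine ⟨graft_aug hX.aug hY.aug s, ?_⟩
    intro b hb h0 x hx hxb
    rcases graft_node_cases s hx with ⟨x, hx', rfl⟩ | ⟨y, hy', rfl⟩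
    · rw [graft_succ_lower] at hxb
      rw [graft_dec_lower]
      subst hxb
      have h0' : (X.dec (Sum.inl (X.succ x))).2 ≠ 0 := h0
      exact hX.inner _ (fun e => hb (by rw [e]; rfl)) h0' x hx' rfl
    · rw [graft_succ_upper s hy'] at hxb
      rw [graft_dec_upper s hy']
      subst hxb
      by_cases hr : Y.succ y = Y.root
      · exact hY.root_disk hy' hr
      · have e := graft_dec_upper (X := X) (Y := Y) s (x := Sum.inl (Y.succ y))
          fun e => hr (Sum.inl_injective e)
        exact hY.inner _ hr (by rw [← e]; exact h0) y hy' rfl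
  refine hg.contract _ ?_
  have h := graft_dec_lower (X := X) (Y := Y) s (Sum.inr s)
  rw [hr] at h
  exact (congrArg Prod.snd h).trans_ne (hX.leaf_ne s)

theorem merge_internal (hX : X.Valid) (hY : Y.Valid) (s : S) {b : (merge s X Y).V}
    (hb : b ≠ (merge s X Y).root) : ((merge s X Y).dec (Sum.inl b)).2 = 0 := by
  have h1 : ((graft s X Y).dec (Sum.inl b.1)).2 = 0 := by
    rcases b with ⟨a | b, h⟩
    · exact hX.internal fun e => hb (Subtype.ext (congrArg Sum.inl e))
    · have hb' : b ≠ Y.root := fun e => h (by rw [e])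
      have := graft_dec_upper (X := X) (Y := Y) s (x := Sum.inl b)
        fun e => hb' (Sum.inl_injective e)
      exact (congrArg Prod.snd this).trans (hY.internal hb')
  by_cases c : (graft s X Y).succ (incl (X := graft s X Y) (Sum.inr Y.root) (Sum.inl b)) =
      Sum.inr Y.root
  · refine (congrArg Prod.snd (contractDec_eq c)).trans ?_
    exact mul_eq_zero_of_right _ h1
  · exact (congrArg Prod.snd (contractDec_ne c)).trans h1

/-- The vertex forgotten in a composition does not matter for the coordinates. -/
theorem coord_comp_eq_merge (hX : X.Valid) (hY : Y.Valid) (s : S) :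
    (comp s X Y).coord = (merge s X Y).coord := by
  have hM := hX.good.merge hY.good s
  let v : (merge s X Y).V := mlow s X Y (X.succ (Sum.inr s))
  change (forget (merge s X Y) v).coord = _
  by_cases hu : (merge s X Y).Unstable v
  · rw [forget, dif_pos hu]
    refine (Sim.coord_eq (sim_contract hu.1 (Or.inr ?_)) hM).symm
    rintro ⟨t, u, p, q, h1, h2, h3⟩
    obtain ⟨-, b, hb⟩ := hu
    obtain ⟨y, p', hy, -, rfl⟩ := h1.first Sum.inr_ne_inl
    obtain ⟨z, q', hz, -, rfl⟩ := h2.first Sum.inr_ne_inl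
    obtain rfl := (hb y).1 hy
    obtain rfl := (hb z).1 hz
    have h0 := merge_internal hX hY s (b := b) fun e => hy.1 (by rw [e])
    rw [odot_of_snd_eq_zero h0, odot_of_snd_eq_zero h0] at h3
    exact h3 rfl
  · rw [forget, dif_neg hu]

end DTree

section

variable {S S' : Type} (s : S) (κ : Coord S) (κ' : Coord S')

/-- The factor by which the difference of two centers changes when the leaf `s` is replaced by a
configuration. -/
def compFactor : Ins s S' → Ins s S' → ℂ
  | Sum.inl x, Sum.inr b => 1 + κ.2.1 s x.1 * (κ'.1 b).1
  | Sum.inr b, Sum.inl x => 1 + κ.2.1 s x.1 * (κ'.1 b).1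
  | Sum.inl _, Sum.inl _ => 1
  | Sum.inr _, Sum.inr _ => 1

/-- The leaf of the lower tree from which a leaf of a composition comes. -/
def insProj : Ins s S' → S := Sum.elim (fun x => x.1) fun _ => s

/-- The coordinates of a composition, from the coordinates of its factors. -/
noncomputable def Coord.comp : Coord (Ins s S') :=
  (Sum.elim (fun x => κ.1 x.1) fun b => odot (κ.1 s) (κ'.1 b),
    fun e e' => match e, e' with
      | Sum.inl x, Sum.inl x' => κ.2.1 x.1 x'.1
      | Sum.inl x, Sum.inr b => κ.2.1 x.1 s / (1 + κ.2.1 s x.1 * (κ'.1 b).1)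
      | Sum.inr b, Sum.inl x =>
        κ.2.1 s x.1 * (κ'.1 b).2 / (1 + κ.2.1 s x.1 * (κ'.1 b).1)
      | Sum.inr b, Sum.inr b' => κ'.2.1 b b',
    fun e e' e'' => match e, e', e'' with
      | Sum.inr b, Sum.inr b', Sum.inr b'' => κ'.2.2 b b' b''
      | Sum.inr b, Sum.inr b', Sum.inl x =>
        bl (κ.2.1 s x.1 * ((κ'.1 b).1 - (κ'.1 b').1)) (1 + κ.2.1 s x.1 * (κ'.1 b).1)
      | Sum.inr b, Sum.inl x, Sum.inr b' =>
        bl (1 + κ.2.1 s x.1 * (κ'.1 b).1) (κ.2.1 s x.1 * ((κ'.1 b).1 - (κ'.1 b').1))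
      | e, e', e'' => blScale (compFactor s κ κ' e e') (compFactor s κ κ' e e'')
        (κ.2.2 (insProj s e) (insProj s e') (insProj s e'')))

end

namespace DTree

variable {S S' T : Type} {X : DTree S} {Y : DTree S'}

theorem one_add_ne {z w : ℂ} (hz : ‖z‖ < 1) (hw : ‖w‖ ≤ 1) : 1 + z * w ≠ 0 := by
  intro e
  have h : z * w = -1 := by linear_combination e
  have h1 : ‖z * w‖ = 1 := by rw [h]; simp
  rw [norm_mul] at h1
  have := mul_le_of_le_one_right (norm_nonneg z) hw
  linarith

theorem Good.factor_ne (hX : X.Good) (hY : Y.Good) (s t : S) (b : S') :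
    1 + X.rho s t * (Y.abs b).1 ≠ 0 := by
  refine one_add_ne (hX.norm_rho_lt _ _) ?_
  have := hY.abs_inDisk (Y.pos_abs b)
  exact (norm_fst_lt_one this).le

/-- The factors do not vanish because `|rho| < 1` and the centers lie in the unit disk. -/
theorem Good.compFactor_ne (hX : X.Good) (hY : Y.Good) (s : S) (e e' : Ins s S') :
    compFactor s X.coord Y.coord e e' ≠ 0 := by
  rcases e with x | b <;> rcases e' with x' | b'
  · exact one_ne_zero
  · exact hX.factor_ne hY _ _ _
  · exact hX.factor_ne hY _ _ _
  · exact one_ne_zero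

open Classical in
/-- The position of the leaf `s` relative to the vertex `a`, if `s` lies above `a`. -/
noncomputable def posOf (X : DTree S) (a : X.V) (s : S) : ℂ × ℂ :=
  if h : ∃ p, X.Pos (Sum.inl a) (Sum.inr s) p then h.choose else 0

theorem Pos.posOf_eq {a : X.V} {s : S} {p : ℂ × ℂ} (h : X.Pos (Sum.inl a) (Sum.inr s) p) :
    X.posOf a s = p := by
  have h' : ∃ p, X.Pos (Sum.inl a) (Sum.inr s) p := ⟨p, h⟩
  rw [posOf, dif_pos h']
  exact h'.choose_spec.unique h

/-- The leaf `s` lies above the vertex `a`. -/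
def Above (X : DTree S) (a : X.V) (s : S) : Prop := X.Pos (Sum.inl a) (Sum.inr s) (X.posOf a s)

theorem Pos.above {a : X.V} {s : S} {p : ℂ × ℂ} (h : X.Pos (Sum.inl a) (Sum.inr s) p) :
    X.Above a s := by
  rw [Above, h.posOf_eq]
  exact h

theorem Good.exists_above_pair (h : X.Good) {s t : S} (hst : s ≠ t) :
    ∃ a : X.V, X.Above a s ∧ X.Above a t ∧ (X.posOf a s).1 ≠ (X.posOf a t).1 := by
  obtain ⟨a, p, q, h1, h2, h3⟩ := h.exists_split_pair hst
  refine ⟨a, h1.above, h2.above, ?_⟩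
  rw [h1.posOf_eq, h2.posOf_eq]
  exact h3.ne

theorem Good.exists_above_triple (h : X.Good) {s t u : S} (hne : ¬ (t = s ∧ u = s)) :
    ∃ a : X.V, X.Above a s ∧ X.Above a t ∧ X.Above a u ∧
      ¬ ((X.posOf a s).1 - (X.posOf a t).1 = 0 ∧ (X.posOf a s).1 - (X.posOf a u).1 = 0) := by
  obtain ⟨a, p, q, r, h1, h2, h3, h4⟩ := h.exists_split_triple hne
  refine ⟨a, h1.above, h2.above, h3.above, ?_⟩
  rw [h1.posOf_eq, h2.posOf_eq, h3.posOf_eq]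
  exact h4

/-- The positions of the leaves of a merged tree relative to a vertex of the lower tree. -/
noncomputable def mpos (s : S) (X : DTree S) (Y : DTree S') (a : X.V) : Ins s S' → ℂ × ℂ :=
  Sum.elim (fun x => X.posOf a x.1) fun b => odot (X.posOf a s) (Y.abs b)

/-- The positions in a merged tree are given by `mpos`. -/
theorem pos_mpos {s : S} (Y : DTree S') {a : X.V} {e : Ins s S'} (h : X.Above a (insProj s e)) :
    (merge s X Y).Pos (Sum.inl (mlow s X Y a)) (Sum.inr e) (mpos s X Y a e) := by
  rcases e with x | b
  · exact Pos.merge_low Y x.2 h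
  · exact Pos.merge_glue h (Y.pos_abs b)

theorem Good.mpos_sub (hX : X.Good) {s : S} {a : X.V} {e e' : Ins s S'}
    (h : X.Above a (insProj s e)) (h' : X.Above a (insProj s e')) (hl : e.isLeft ∨ e'.isLeft) :
    (mpos s X Y a e).1 - (mpos s X Y a e').1 = compFactor s X.coord Y.coord e e' *
      ((X.posOf a (insProj s e)).1 - (X.posOf a (insProj s e')).1) := by
  rcases e with x | b <;> rcases e' with x' | b'
  · simp [mpos, compFactor, insProj]
  · have := hX.snd_eq_rho_mul (Ne.symm x.2) h' h
    simp only [mpos, compFactor, insProj, odot, Sum.elim_inl, Sum.elim_inr] at this ⊢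
    rw [this]
    change _ = (1 + X.rho s x.1 * (Y.abs b').1) * _
    ring
  · have := hX.snd_eq_rho_mul (Ne.symm x'.2) h h'
    simp only [mpos, compFactor, insProj, odot, Sum.elim_inl, Sum.elim_inr] at this ⊢
    rw [this]
    change _ = (1 + X.rho s x'.1 * (Y.abs b).1) * _
    ring
  · simp at hl

theorem Good.mpos_sub_inr (hX : X.Good) {s : S} {a : X.V} {b b' : S'} {x : {x : S // x ≠ s}}
    (h : X.Above a s) (h' : X.Above a x.1) :
    (mpos s X Y a (Sum.inr b)).1 - (mpos s X Y a (Sum.inr b')).1 =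
      X.rho s x.1 * ((Y.abs b).1 - (Y.abs b').1) * ((X.posOf a s).1 - (X.posOf a x.1).1) := by
  have := hX.snd_eq_rho_mul (Ne.symm x.2) h h'
  simp only [mpos, odot, Sum.elim_inr]
  rw [this]
  ring

theorem Good.rho_merge_of_above (hX : X.Good) (hY : Y.Good) {s : S} {e e' : Ins s S'} {a : X.V}
    (h : X.Above a (insProj s e)) (h' : X.Above a (insProj s e')) (hl : e.isLeft ∨ e'.isLeft)
    (hne : (X.posOf a (insProj s e)).1 ≠ (X.posOf a (insProj s e')).1) :
    (DTree.merge s X Y).rho e e' = (mpos s X Y a e).2 / (compFactor s X.coord Y.coord e e' *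
      ((X.posOf a (insProj s e)).1 - (X.posOf a (insProj s e')).1)) := by
  rw [← hX.mpos_sub h h' hl]
  refine rho_eq (pos_mpos Y h) (pos_mpos Y h') ?_
  rw [← sub_ne_zero, hX.mpos_sub h h' hl]
  exact mul_ne_zero (hX.compFactor_ne hY _ _ _) (sub_ne_zero.2 hne)

/-- Positions relative to a vertex of the upper tree. -/
theorem Pos.exists_merge_upper (hX : X.Good) (s : S) (b : Y.V) :
    ∃ (c : (merge s X Y).V) (g : ℂ × ℂ), g.2 ≠ 0 ∧ ∀ y q, Y.Pos (Sum.inl b) (Sum.inr y) q →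
      (merge s X Y).Pos (Sum.inl c) (Sum.inr (Sum.inr y)) (odot g q) := by
  by_cases hb : b = Y.root
  · subst hb
    exact ⟨mlow s X Y (X.succ (Sum.inr s)), X.dec (Sum.inr s), hX.leaf_ne s, fun y q h =>
      (Pos.edge Sum.inr_ne_inl).merge_glue h⟩
  · refine ⟨mup s X Y b hb, (0, 1), one_ne_zero, fun y q h => ?_⟩
    rw [one_odot]
    exact h.merge_up s X hb

/-- The point `tri` of a merged tree is read off at a vertex of the lower tree, unless the first
leaf and one of the other two come from the upper tree. -/
theorem tri_merge_of_lower (hX : X.Good) (hY : Y.Good) {s : S} {e e' e'' : Ins s S'}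
    (h' : e.isLeft ∨ e'.isLeft) (h'' : e.isLeft ∨ e''.isLeft) :
    (merge s X Y).tri e e' e'' = blScale (compFactor s X.coord Y.coord e e')
      (compFactor s X.coord Y.coord e e'') (X.tri (insProj s e) (insProj s e') (insProj s e'')) := by
  by_cases hne : insProj s e' = insProj s e ∧ insProj s e'' = insProj s e
  · have key : ∀ e e' : Ins s S', (e.isLeft ∨ e'.isLeft) → insProj s e' = insProj s e → e' = e := by
      rintro (x | b) (x' | b') hl h
      · exact congrArg Sum.inl (Subtype.ext h)
      · exact absurd h.symm x.2
      · exact absurd h x'.2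
      · simp at hl
    rw [hne.1, hne.2, key e e' h' hne.1, key e e'' h'' hne.2, tri_self, tri_self]
    simp [blScale]
    rfl
  · obtain ⟨a, h1, h2, h3, h4⟩ := hX.exists_above_triple hne
    rw [tri_eq h1 h2 h3 h4, blScale_bl h4, ← hX.mpos_sub h1 h2 h', ← hX.mpos_sub h1 h3 h'']
    refine tri_eq (pos_mpos Y h1) (pos_mpos Y h2) (pos_mpos Y h3) ?_
    rw [hX.mpos_sub h1 h2 h', hX.mpos_sub h1 h3 h'', mul_eq_zero, mul_eq_zero]
    simp only [hX.compFactor_ne hY, false_or]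
    exact h4

/-- The coordinates of a merged tree are determined by the coordinates of its two parts. -/
theorem coord_merge (hX : X.Good) (hY : Y.Good) (s : S) :
    (merge s X Y).coord = Coord.comp s X.coord Y.coord := by
  refine Prod.ext (funext fun e => ?_) (Prod.ext (funext fun e => funext fun e' => ?_)
    (funext fun e => funext fun e' => funext fun e'' => ?_))
  · rcases e with x | b
    · exact abs_eq ((X.pos_abs x.1).merge_low Y x.2)
    · exact abs_eq ((X.pos_abs s).merge_glue (Y.pos_abs b))
  -- `rho`: two leaves of the upper tree are compared there, all others at a vertex of the lower tree
  · change (merge s X Y).rho e e' = _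
    rcases e with x | b <;> rcases e' with x' | b'
    · by_cases hxx : x = x'
      · subst hxx
        rw [rho_self]
        exact (X.rho_self _).symm
      · obtain ⟨a, h1, h2, h3⟩ := hX.exists_above_pair fun e => hxx (Subtype.ext e)
        rw [hX.rho_merge_of_above hY (e := Sum.inl x) (e' := Sum.inl x') h1 h2 (by simp) h3]
        refine Eq.trans ?_ (rho_eq h1 h2 h3).symm
        simp [compFactor, mpos, insProj]
    · obtain ⟨a, h1, h2, h3⟩ := hX.exists_above_pair x.2
      rw [hX.rho_merge_of_above hY (e := Sum.inl x) (e' := Sum.inr b') h1 h2 (by simp) h3,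
        mul_comm, ← div_div]
      change _ = X.rho x.1 s / _
      rw [rho_eq h1 h2 h3]
      rfl
    · obtain ⟨a, h1, h2, h3⟩ := hX.exists_above_pair x'.2.symm
      rw [hX.rho_merge_of_above hY (e := Sum.inr b) (e' := Sum.inl x') h1 h2 (by simp) h3,
        mul_comm, ← div_div]
      change _ = X.rho s x'.1 * _ / _
      rw [rho_eq h1 h2 h3, div_mul_eq_mul_div]
      rfl
    · change _ = Y.rho b b'
      by_cases hbb : b = b'
      · subst hbb
        rw [rho_self, rho_self]
      · obtain ⟨c, p, q, h1, h2, h3⟩ := hY.exists_split_pair hbb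
        obtain ⟨d, g, hg, hd⟩ := Pos.exists_merge_upper (Y := Y) hX s c
        rw [rho_eq h1 h2 h3.ne, rho_eq (hd _ _ h1) (hd _ _ h2), odot_fst_sub]
        · exact mul_div_mul_left _ _ hg
        · rw [← sub_ne_zero, odot_fst_sub]
          exact mul_ne_zero hg (sub_ne_zero.2 h3.ne)
  · change (merge s X Y).tri e e' e'' = _
    have low := fun h h' => tri_merge_of_lower hX hY (s := s) (e := e) (e' := e') (e'' := e'') h h'
    -- two leaves of the upper and one of the lower tree: compare at a vertex that splits `s` from the
    -- leaf of the lower tree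
    have hmix : ∀ (b b' : S') (x : {x : S // x ≠ s}), ∃ k : ℂ, k ≠ 0 ∧ ∃ (d : (merge s X Y).V)
        (p q r : ℂ × ℂ), (merge s X Y).Pos (Sum.inl d) (Sum.inr (Sum.inr b)) p ∧
        (merge s X Y).Pos (Sum.inl d) (Sum.inr (Sum.inr b')) q ∧
        (merge s X Y).Pos (Sum.inl d) (Sum.inr (Sum.inl x)) r ∧
        p.1 - q.1 = k * (X.rho s x.1 * ((Y.abs b).1 - (Y.abs b').1)) ∧
        p.1 - r.1 = k * (1 + X.rho s x.1 * (Y.abs b).1) := by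
      intro b b' x
      obtain ⟨a, h1, h2, h3⟩ := hX.exists_above_pair x.2.symm
      refine ⟨_, sub_ne_zero.2 h3, _, _, _, _, pos_mpos Y (e := Sum.inr b) h1,
        pos_mpos Y (e := Sum.inr b') h1, pos_mpos Y (e := Sum.inl x) h2, ?_, ?_⟩
      · rw [hX.mpos_sub_inr h1 h2, mul_comm]
      · rw [hX.mpos_sub (e := Sum.inr b) (e' := Sum.inl x) h1 h2 (by simp), mul_comm]
        rfl
    rcases e with x | b
    · rcases e' with x' | b' <;> rcases e'' with x'' | b'' <;> exact low (by simp) (by simp)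
    · rcases e' with x' | b' <;> rcases e'' with x'' | b''
      · exact low (by simp) (by simp)
      · obtain ⟨k, hk, d, p, q, r, h1, h2, h3, e1, e2⟩ := hmix b b'' x'
        rw [tri_eq h1 h3 h2, e1, e2]
        · exact bl_smul hk _ _
        · rw [e2]
          exact fun e => mul_ne_zero hk (hX.factor_ne hY _ _ _) e.1
      · obtain ⟨k, hk, d, p, q, r, h1, h2, h3, e1, e2⟩ := hmix b b' x''
        rw [tri_eq h1 h2 h3, e1, e2]
        · exact bl_smul hk _ _
        · rw [e2]
          exact fun e => mul_ne_zero hk (hX.factor_ne hY _ _ _) e.2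
      · change _ = Y.tri b b' b''
        by_cases hbb : b' = b ∧ b'' = b
        · obtain ⟨rfl, rfl⟩ := hbb
          rw [tri_self, tri_self]
        · obtain ⟨c, p, q, r, h1, h2, h3, h4⟩ := hY.exists_split_triple hbb
          obtain ⟨d, g, hg, hd⟩ := Pos.exists_merge_upper (Y := Y) hX s c
          rw [tri_eq h1 h2 h3 h4, tri_eq (hd _ _ h1) (hd _ _ h2) (hd _ _ h3)]
          · simp only [odot_fst_sub]
            exact bl_smul hg _ _
          · simp only [odot_fst_sub, mul_eq_zero, hg, false_or]
            exact h4

end DTree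
end TrivDisks

namespace TrivDisks
open scoped ComplexConjugate
open DTree

/-! ### Coordinates on the operad and the induced topology -/

section

variable {S S' T : Type}

/-- The coordinates of an element of `𝕄̄(S)`. -/
noncomputable def crd (x : MbarObj S) : Coord S :=
  Quotient.lift (s := mbarSetoid S) (fun X => X.1.coord)
    (fun X _ ⟨_, _, h⟩ => (h.sim X.2).coord_eq X.2.good) x

theorem crd_toMbar {X : DTree S} (h : X.Valid) : crd (toMbar X h) = X.coord := rfl

theorem exists_toMbar (x : MbarObj S) : ∃ (X : DTree S) (h : X.Valid), x = toMbar X h := by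
  induction x using Quotient.inductionOn with
  | _ X => exact ⟨X.1, X.2, rfl⟩

theorem toMbar_eq_of_equivalent {X Y : DTree S} (hX : X.Valid) (hY : Y.Valid)
    (h : Equivalent X Y) : toMbar X hX = toMbar Y hY :=
  Quotient.sound (s := mbarSetoid S) (a := ⟨X, hX⟩) (b := ⟨Y, hY⟩) h

/-- Relabelling of elements of `𝕄̄(S)`. -/
noncomputable abbrev mrelabel [Finite S] [Finite T] (σ : S ≃ T) (x : MbarObj S) : MbarObj T :=
  Mbar.relabel σ x

/-- Partial composition of elements of `𝕄̄(S)` and `𝕄̄(S')`. -/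
noncomputable abbrev mcomp [Finite S] [Finite S'] (s : S) (x : MbarObj S) (y : MbarObj S') :
    MbarObj (Ins s S') :=
  Mbar.comp s x y

theorem crd_relabel [Finite S] [Finite T] (σ : S ≃ T) (x : MbarObj S) :
    crd (mrelabel σ x) = Coord.relabel σ (crd x) := by
  obtain ⟨X, h, rfl⟩ := exists_toMbar x
  exact h.good.coord_relabel σ

theorem crd_comp [Finite S] [Finite S'] (s : S) (x : MbarObj S) (y : MbarObj S') :
    crd (mcomp s x y) = Coord.comp s (crd x) (crd y) := by
  obtain ⟨X, h, rfl⟩ := exists_toMbar x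
  obtain ⟨Y, h', rfl⟩ := exists_toMbar y
  exact (coord_comp_eq_merge h h' s).trans (coord_merge h.good h'.good s)

theorem crd_rho_self (x : MbarObj S) (s : S) : (crd x).2.1 s s = 0 := by
  obtain ⟨X, h, rfl⟩ := exists_toMbar x
  exact X.rho_self s

theorem crd_tri_self (x : MbarObj S) (s : S) : (crd x).2.2 s s s = 0 := by
  obtain ⟨X, h, rfl⟩ := exists_toMbar x
  exact X.tri_self s

theorem crd_tri_eq_bl (x : MbarObj S) {s t u : S} (hne : ¬ (t = s ∧ u = s)) :
    ∃ v w, ¬ (v = 0 ∧ w = 0) ∧ (crd x).2.2 s t u = bl v w := by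
  obtain ⟨X, h, rfl⟩ := exists_toMbar x
  obtain ⟨a, p, q, r, h1, h2, h3, h4⟩ := h.good.exists_split_triple hne
  exact ⟨_, _, h4, tri_eq h1 h2 h3 h4⟩

theorem crd_factor_ne (x : MbarObj S) (y : MbarObj S') (s t : S) (b : S') :
    1 + (crd x).2.1 s t * ((crd y).1 b).1 ≠ 0 := by
  obtain ⟨X, h, rfl⟩ := exists_toMbar x
  obtain ⟨Y, h', rfl⟩ := exists_toMbar y
  exact h.good.factor_ne h'.good s t b

/-- A shortcut instance. -/
noncomputable instance : TopologicalSpace (S → S → S → ℂ × ℂ × ℂ) :=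
  @Pi.topologicalSpace _ _ fun _ => @Pi.topologicalSpace _ _ fun _ => Pi.topologicalSpace

/-- A shortcut instance. -/
noncomputable instance : TopologicalSpace (S → S → ℂ × ℂ × ℂ) :=
  @Pi.topologicalSpace _ _ fun _ => Pi.topologicalSpace

/-- The topology of `𝕄̄(S)`, induced by the coordinates. -/
noncomputable instance : TopologicalSpace (MbarObj S) := TopologicalSpace.induced crd inferInstance

theorem continuous_crd : Continuous (crd : MbarObj S → Coord S) := continuous_induced_dom

theorem continuous_mbar_iff {α : Type*} [TopologicalSpace α] {f : α → MbarObj S} :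
    Continuous f ↔ (∀ s, Continuous fun a => (crd (f a)).1 s) ∧
      (∀ s t, Continuous fun a => (crd (f a)).2.1 s t) ∧
      ∀ s t u, Continuous fun a => (crd (f a)).2.2 s t u := by
  rw [continuous_induced_rng]
  constructor
  · intro h
    exact ⟨fun s => (continuous_apply s).comp (continuous_fst.comp h),
      fun s t => (continuous_apply t).comp ((continuous_apply s).comp
        (continuous_fst.comp (continuous_snd.comp h))),
      fun s t u => (continuous_apply u).comp ((continuous_apply t).comp ((continuous_apply s).comp
        (continuous_snd.comp (continuous_snd.comp h))))⟩
  · rintro ⟨h1, h2, h3⟩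
    exact Continuous.prodMk (continuous_pi h1) (Continuous.prodMk
      (continuous_pi fun s => continuous_pi (h2 s))
      (continuous_pi fun s => continuous_pi fun t => continuous_pi (h3 s t)))

theorem continuous_mbar_relabel [Finite S] [Finite T] (σ : S ≃ T) :
    Continuous fun x : MbarObj S => mrelabel σ x := by
  refine continuous_induced_rng.2 ?_
  have : (crd ∘ fun x : MbarObj S => mrelabel σ x) =
      fun x => Coord.relabel σ (crd x) := funext fun x => crd_relabel σ x
  rw [this]
  have h := continuous_crd (S := S)
  unfold Coord.relabel
  fun_prop

theorem continuous_blScale {α : Type*} [TopologicalSpace α] {f g : α → ℂ} {t : α → ℂ × ℂ × ℂ}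
    (hf : Continuous f) (hg : Continuous g) (ht : Continuous t)
    (h0 : ∀ a, f a * conj (f a) * (t a).2.1 + g a * conj (g a) * (t a).2.2 ≠ 0) :
    Continuous fun a => blScale (f a) (g a) (t a) := by
  have hf' : Continuous fun a => conj (f a) := Complex.continuous_conj.comp hf
  have hg' : Continuous fun a => conj (g a) := Complex.continuous_conj.comp hg
  unfold blScale
  refine Continuous.prodMk ?_ (Continuous.prodMk ?_ ?_) <;>
  · refine Continuous.div ?_ ?_ h0 <;> fun_prop

theorem continuous_bl {α : Type*} [TopologicalSpace α] {f g : α → ℂ}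
    (hf : Continuous f) (hg : Continuous g) (h0 : ∀ a, ¬ (f a = 0 ∧ g a = 0)) :
    Continuous fun a => bl (f a) (g a) :=
  continuous_iff_continuousAt.2 fun a =>
    ContinuousAt.comp (f := fun a => (f a, g a)) (x := a)
      (continuousAt_bl (p := (f a, g a)) (h0 a)) (hf.prodMk hg).continuousAt

/-- The coordinates of a composition are continuous functions of the coordinates of its factors:
the denominators that occur do not vanish on `𝕄̄`. -/
theorem continuous_mbar_comp [Finite S] [Finite S'] (s : S) :
    Continuous fun p : MbarObj S × MbarObj S' => mcomp s p.1 p.2 := by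
  refine continuous_induced_rng.2 ?_
  have : (crd ∘ fun p : MbarObj S × MbarObj S' => (mcomp s p.1 p.2)) =
      fun p => Coord.comp s (crd p.1) (crd p.2) := funext fun p => crd_comp s p.1 p.2
  rw [this]
  have h1 : Continuous fun p : MbarObj S × MbarObj S' => crd p.1 := continuous_crd.comp continuous_fst
  have h2 : Continuous fun p : MbarObj S × MbarObj S' => crd p.2 := continuous_crd.comp continuous_snd
  have hfac : ∀ e e' : Ins s S', Continuous fun p : MbarObj S × MbarObj S' =>
      compFactor s (crd p.1) (crd p.2) e e' := by
    rintro (x | b) (x' | b') <;> simp only [compFactor] <;> fun_prop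
  have hfac0 : ∀ (e e' : Ins s S') (p : MbarObj S × MbarObj S'),
      compFactor s (crd p.1) (crd p.2) e e' ≠ 0 := by
    rintro (x | b) (x' | b') p
    · exact one_ne_zero
    · exact crd_factor_ne _ _ _ _ _
    · exact crd_factor_ne _ _ _ _ _
    · exact one_ne_zero
  refine Continuous.prodMk (continuous_pi fun e => ?_) (Continuous.prodMk
    (continuous_pi fun e => continuous_pi fun e' => ?_)
    (continuous_pi fun e => continuous_pi fun e' => continuous_pi fun e'' => ?_))
  · rcases e with x | b
    · simp only [Sum.elim_inl]
      fun_prop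
    · simp only [Sum.elim_inr, odot]
      fun_prop
  · rcases e with x | b <;> rcases e' with x' | b'
    · simp only
      fun_prop
    · refine Continuous.div (by fun_prop) (by fun_prop) fun p => crd_factor_ne _ _ _ _ _
    · refine Continuous.div (by fun_prop) (by fun_prop) fun p => crd_factor_ne _ _ _ _ _
    · simp only
      fun_prop
  · have low : Continuous fun p : MbarObj S × MbarObj S' =>
        blScale (compFactor s (crd p.1) (crd p.2) e e') (compFactor s (crd p.1) (crd p.2) e e'')
        ((crd p.1).2.2 (insProj s e) (insProj s e') (insProj s e'')) := by
      by_cases hne : insProj s e' = insProj s e ∧ insProj s e'' = insProj s e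
      · have : (fun p : MbarObj S × MbarObj S' =>
          blScale (compFactor s (crd p.1) (crd p.2) e e') (compFactor s (crd p.1) (crd p.2) e e'')
            ((crd p.1).2.2 (insProj s e) (insProj s e') (insProj s e''))) = fun _ => 0 := by
          funext p
          rw [hne.1, hne.2, crd_tri_self]
          simp [blScale]
        rw [this]
        exact continuous_const
      · refine continuous_blScale (hfac _ _) (hfac _ _) (by fun_prop) fun p => ?_
        obtain ⟨v, w, h, e⟩ := crd_tri_eq_bl p.1 hne
        rw [e]
        exact blScale_den_ne h (hfac0 _ _ _) (hfac0 _ _ _)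
    rcases e with x | b
    · rcases e' with x' | b' <;> rcases e'' with x'' | b'' <;> exact low
    · rcases e' with x' | b' <;> rcases e'' with x'' | b''
      · exact low
      · exact continuous_bl (by fun_prop) (by fun_prop) fun p e => crd_factor_ne _ _ _ _ _ e.1
      · exact continuous_bl (by fun_prop) (by fun_prop) fun p e => crd_factor_ne _ _ _ _ _ e.2
      · simp only
        fun_prop

end

end TrivDisks

namespace TrivDisks
open scoped ComplexConjugate
open Topology Filter

namespace DTree

variable {S : Type} {X : DTree S}

/-! ### Pruning of a terminal vertex -/

/-- `w` is a vertex other than the root, and its incoming edges are the leaves in `A`. -/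
def Terminal (X : DTree S) (w : X.V) (A : Set S) : Prop :=
  w ≠ X.root ∧ ∀ x, X.IsInput x w ↔ ∃ s ∈ A, x = Sum.inr s

/-- The leaves that remain when the leaves in `A` are replaced by a single one. -/
abbrev Collapse {S : Type} (A : Set S) : Type := {s : S // s ∉ A} ⊕ Unit

section

variable {w : X.V} {A : Set S}

/-- The node of `X` that corresponds to a node of the pruned tree; the new leaf corresponds to the
removed vertex `w`. -/
def pnode (w : X.V) (A : Set S) : {a : X.V // a ≠ w} ⊕ Collapse A → X.V ⊕ S
  | Sum.inl a => Sum.inl a.1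
  | Sum.inr (Sum.inl s) => Sum.inr s.1
  | Sum.inr (Sum.inr _) => Sum.inl w

theorem pnode_injective (w : X.V) (A : Set S) : Function.Injective (pnode w A) := by
  rintro (a | s | u) (b | t | v) h
  · exact congrArg Sum.inl (Subtype.ext (Sum.inl_injective h))
  · exact absurd h Sum.inl_ne_inr
  · exact absurd (Sum.inl_injective h) a.2
  · exact absurd h Sum.inr_ne_inl
  · exact congrArg (Sum.inr ∘ Sum.inl) (Subtype.ext (Sum.inr_injective h))
  · exact absurd h Sum.inr_ne_inl
  · exact absurd (Sum.inl_injective h).symm b.2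
  · exact absurd h Sum.inl_ne_inr
  · rfl

theorem Terminal.succ_leaf (hw : X.Terminal w A) {s : S} (hs : s ∈ A) : X.succ (Sum.inr s) = w :=
  ((hw.2 _).2 ⟨s, hs, rfl⟩).2

theorem Terminal.pnode_ne_root (hw : X.Terminal w A) {x : {a : X.V // a ≠ w} ⊕ Collapse A}
    (hx : x ≠ Sum.inl ⟨X.root, hw.1.symm⟩) : pnode w A x ≠ Sum.inl X.root := by
  rcases x with a | s | u
  · exact fun e => hx (congrArg Sum.inl (Subtype.ext (Sum.inl_injective e)))
  · exact Sum.inr_ne_inl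
  · exact fun e => hw.1 (Sum.inl_injective e)

theorem Terminal.succ_pnode_ne (hw : X.Terminal w A) {x : {a : X.V // a ≠ w} ⊕ Collapse A}
    (hx : x ≠ Sum.inl ⟨X.root, hw.1.symm⟩) : X.succ (pnode w A x) ≠ w := by
  intro e
  obtain ⟨s, hs, h⟩ := (hw.2 _).1 ⟨hw.pnode_ne_root hx, e⟩
  rcases x with a | t | u
  · exact absurd h Sum.inl_ne_inr
  · exact t.2 (Sum.inr_injective h ▸ hs)
  · exact absurd h Sum.inl_ne_inr

theorem Terminal.exists_pnode (hw : X.Terminal w A) {a : X.V} (ha : a ≠ w) {x : X.V ⊕ S}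
    (hx : X.IsInput x a) : ∃ z, z ≠ Sum.inl ⟨X.root, hw.1.symm⟩ ∧ pnode w A z = x := by
  rcases x with b | s
  · by_cases hb : b = w
    · exact ⟨Sum.inr (Sum.inr ()), Sum.inr_ne_inl, by rw [hb]; rfl⟩
    · exact ⟨Sum.inl ⟨b, hb⟩,
        fun e => hx.1 (congrArg Sum.inl (congrArg Subtype.val (Sum.inl_injective e))), rfl⟩
  · have hs : s ∉ A := fun hs => ha (hx.2.symm.trans (hw.succ_leaf hs))
    exact ⟨Sum.inr (Sum.inl ⟨s, hs⟩), Sum.inr_ne_inl, rfl⟩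

open Classical in
/-- The successor map of the pruned tree. -/
noncomputable def pruneSucc (hw : X.Terminal w A) (x : {a : X.V // a ≠ w} ⊕ Collapse A) :
    {a : X.V // a ≠ w} :=
  if h : X.succ (pnode w A x) = w then ⟨X.root, hw.1.symm⟩ else ⟨X.succ (pnode w A x), h⟩

theorem pruneSucc_val (hw : X.Terminal w A) {x : {a : X.V // a ≠ w} ⊕ Collapse A}
    (hx : x ≠ Sum.inl ⟨X.root, hw.1.symm⟩) :
    (pruneSucc hw x).1 = X.succ (pnode w A x) := by
  rw [pruneSucc, dif_neg (hw.succ_pnode_ne hx)]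

/-- The decorations of the pruned tree. -/
def pruneDec (w : X.V) (A : Set S) (p : ℂ × ℂ) : {a : X.V // a ≠ w} ⊕ Collapse A → ℂ × ℂ
  | Sum.inl a => X.dec (Sum.inl a.1)
  | Sum.inr (Sum.inl s) => X.dec (Sum.inr s.1)
  | Sum.inr (Sum.inr _) => p

/-- The tree in which a terminal vertex is replaced by a leaf with decoration `p`. -/
noncomputable def prune (hw : X.Terminal w A) (p : ℂ × ℂ) : DTree (Collapse A) where
  V := {a : X.V // a ≠ w}
  finite := have := X.finite; inferInstance
  root := ⟨X.root, hw.1.symm⟩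
  succ := pruneSucc hw
  acyclic := by
    obtain ⟨d, hd⟩ := X.acyclic
    refine ⟨fun a => d a.1, fun a ha => ?_⟩
    have h1 : (Sum.inl a : {a : X.V // a ≠ w} ⊕ Collapse A) ≠ Sum.inl ⟨X.root, hw.1.symm⟩ :=
      fun e => ha (Sum.inl_injective e)
    change d (pruneSucc hw (Sum.inl a)).1 < _
    rw [pruneSucc_val hw h1]
    exact hd a.1 fun e => ha (Subtype.ext e)
  input := by
    rintro ⟨a, ha⟩
    obtain ⟨x, hx⟩ := X.input a
    obtain ⟨z, hz, rfl⟩ := hw.exists_pnode ha hx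
    exact ⟨z, hz, Subtype.ext ((pruneSucc_val hw hz).trans hx.2)⟩
  dec := pruneDec w A p

/-- The new leaf of a pruned tree. -/
abbrev tip (A : Set S) : Collapse A := Sum.inr ()

theorem prune_isInput (hw : X.Terminal w A) (p : ℂ × ℂ) (z : {a : X.V // a ≠ w} ⊕ Collapse A)
    (a : {a : X.V // a ≠ w}) :
    (X.prune hw p).IsInput z a ↔ z ≠ Sum.inl ⟨X.root, hw.1.symm⟩ ∧ X.IsInput (pnode w A z) a.1 := by
  constructor
  · rintro ⟨h1, h2⟩
    exact ⟨h1, hw.pnode_ne_root h1, (pruneSucc_val hw h1).symm.trans (congrArg Subtype.val h2)⟩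
  · rintro ⟨h1, h2⟩
    exact ⟨h1, Subtype.ext ((pruneSucc_val hw h1).trans h2.2)⟩

theorem prune_dec (hw : X.Terminal w A) (p : ℂ × ℂ) {z : {a : X.V // a ≠ w} ⊕ Collapse A}
    (hz : z ≠ Sum.inr (tip A)) : (X.prune hw p).dec z = X.dec (pnode w A z) := by
  rcases z with a | s | u
  · rfl
  · rfl
  · exact absurd rfl hz

theorem Pos.prune (hw : X.Terminal w A) (p : ℂ × ℂ) {y x : {a : X.V // a ≠ w} ⊕ Collapse A}
    {q : ℂ × ℂ} (h : X.Pos (pnode w A y) (pnode w A x) q) (hx : x ≠ Sum.inr (tip A)) :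
    (X.prune hw p).Pos y x q := by
  have key : ∀ z q, X.Pos (pnode w A y) z q → ∀ x, z = pnode w A x → x ≠ Sum.inr (tip A) →
      (X.prune hw p).Pos y x q := by
    intro z q h
    induction h with
    | refl =>
      intro x e _
      rw [pnode_injective w A e]
      exact Pos.refl
    | @step z q hz h ih =>
      rintro x rfl hx
      have hx' : x ≠ Sum.inl ⟨X.root, hw.1.symm⟩ := by
        rintro rfl
        exact hz rfl
      have h1 := ih (Sum.inl ⟨_, hw.succ_pnode_ne hx'⟩) rfl Sum.inl_ne_inr
      have e : (X.prune hw p).succ x = ⟨_, hw.succ_pnode_ne hx'⟩ :=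
        Subtype.ext (pruneSucc_val hw hx')
      rw [← prune_dec hw p hx]
      exact Pos.step hx' (e ▸ h1)
  exact key _ _ h x rfl hx

theorem Pos.prune_tip (hw : X.Terminal w A) (p : ℂ × ℂ) {a : X.V} (ha : a ≠ w) {q : ℂ × ℂ}
    (h : X.Pos (Sum.inl a) (Sum.inl (X.succ (Sum.inl w))) q) :
    (X.prune hw p).Pos (Sum.inl ⟨a, ha⟩) (Sum.inr (tip A)) (odot q p) := by
  have h1 := Pos.prune hw p (y := Sum.inl ⟨a, ha⟩) (x := Sum.inl ⟨_, X.succ_ne hw.1⟩) h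
    Sum.inl_ne_inr
  have h2 : (Sum.inr (tip A) : {a : X.V // a ≠ w} ⊕ Collapse A) ≠
    Sum.inl ⟨X.root, hw.1.symm⟩ := Sum.inr_ne_inl
  have e : (X.prune hw p).succ (Sum.inr (tip A)) = ⟨_, X.succ_ne hw.1⟩ :=
    Subtype.ext (pruneSucc_val hw h2)
  exact Pos.step h2 (e ▸ h1)

/-- The conditions on the decoration of the new leaf of a pruned tree. -/
structure PruneOK (X : DTree S) (w : X.V) (p : ℂ × ℂ) : Prop where
  ne : p.2 ≠ 0
  apart : ∀ y, X.IsInput y (X.succ (Sum.inl w)) → y ≠ Sum.inl w → Apart p (X.dec y)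
  disk : X.dec (Sum.inl w) ∈ InDisk → p ∈ InDisk

/-- The new leaf satisfies the conditions on configurations by `PruneOK`; the other conditions are
inherited. -/
theorem Good.prune (hX : X.Good) (hw : X.Terminal w A) {p : ℂ × ℂ} (hp : X.PruneOK w p) :
    (X.prune hw p).Good := by
  have hwr : (Sum.inl w : X.V ⊕ S) ≠ Sum.inl X.root := fun e => hw.1 (Sum.inl_injective e)
  have hs : ∀ {x y : {a : X.V // a ≠ w} ⊕ Collapse A}, x ≠ Sum.inl ⟨X.root, hw.1.symm⟩ →
      y ≠ Sum.inl ⟨X.root, hw.1.symm⟩ → (X.prune hw p).succ x = (X.prune hw p).succ y →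
      X.succ (pnode w A x) = X.succ (pnode w A y) := by
    intro x y hx hy e
    rw [← pruneSucc_val hw hx, ← pruneSucc_val hw hy]
    exact congrArg Subtype.val e
  refine ⟨aug_iff.2 ⟨?_, ?_, ?_⟩, ?_⟩
  · intro x y hx hy hxy e
    have e' := hs hx hy e
    by_cases cx : x = Sum.inr (tip A)
    · subst cx
      have hy' := hxy.symm
      rw [prune_dec hw p hy']
      exact hp.apart _ ⟨hw.pnode_ne_root hy, e'.symm⟩ fun e =>
        hy' (pnode_injective w A (a₂ := Sum.inr (tip A)) e)
    · by_cases cy : y = Sum.inr (tip A)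
      · subst cy
        rw [prune_dec hw p cx]
        exact (hp.apart _ ⟨hw.pnode_ne_root hx, e'⟩ fun e =>
          cx (pnode_injective w A (a₂ := Sum.inr (tip A)) e)).symm
      · rw [prune_dec hw p cx, prune_dec hw p cy]
        exact hX.apart (hw.pnode_ne_root hx) (hw.pnode_ne_root hy)
          (fun e => hxy (pnode_injective w A e)) e'
  · rintro (s | u)
    · exact hX.leaf_ne s.1
    · exact hp.ne
  · intro x hx e
    have e' : X.succ (pnode w A x) = X.root :=
      (pruneSucc_val hw hx).symm.trans (congrArg Subtype.val e)
    by_cases cx : x = Sum.inr (tip A)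
    · subst cx
      exact hp.disk (hX.root_disk hwr e')
    · rw [prune_dec hw p cx]
      exact hX.root_disk (hw.pnode_ne_root hx) e'
  · rintro b hb h0 x hx rfl
    have h0' : (X.dec (Sum.inl (X.succ (pnode w A x)))).2 ≠ 0 := by
      rw [← pruneSucc_val hw hx]
      exact h0
    have hb' : X.succ (pnode w A x) ≠ X.root := by
      rw [← pruneSucc_val hw hx]
      exact fun e => hb (Subtype.ext e)
    by_cases cx : x = Sum.inr (tip A)
    · subst cx
      exact hp.disk (hX.inner _ hb' h0' _ hwr rfl)
    · rw [prune_dec hw p cx]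
      exact hX.inner _ hb' h0' _ (hw.pnode_ne_root hx) rfl

theorem nearlyStable_prune (hX : X.NearlyStable) (hw : X.Terminal w A) (p : ℂ × ℂ) :
    (X.prune hw p).NearlyStable := by
  intro a ha
  obtain ⟨z, hz, hu⟩ := ha
  obtain ⟨hz1, hz2⟩ := (prune_isInput hw p z a).1 hz
  by_cases hzt : z = Sum.inr (tip A)
  · exact Or.inr ⟨tip A, by rw [← hzt]; exact hz.2⟩
  have hb : X.Bivalent a.1 := by
    refine ⟨pnode w A z, hz2, fun y hy => ?_⟩
    obtain ⟨z', h1, rfl⟩ := hw.exists_pnode a.2 hy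
    rw [hu z' ((prune_isInput hw p z' a).2 ⟨h1, hy⟩)]
  rcases hX a.1 hb with h | ⟨s, hs⟩
  · exact Or.inl (Subtype.ext h)
  · obtain ⟨z', h1, h2⟩ := hw.exists_pnode (x := Sum.inr s) a.2 ⟨Sum.inr_ne_inl, hs⟩
    rcases z' with b | t
    · exact absurd h2 Sum.inl_ne_inr
    · refine Or.inr ⟨t, ((prune_isInput hw p (Sum.inr t) a).2 ⟨h1, ?_⟩).2⟩
      rw [h2]
      exact ⟨Sum.inr_ne_inl, hs⟩

theorem Valid.prune (hX : X.Valid) (hw : X.Terminal w A) {p : ℂ × ℂ} (hp : X.PruneOK w p) :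
    (X.prune hw p).Valid :=
  valid_iff.2 ⟨nearlyStable_prune hX.nearlyStable hw p, (hX.good.prune hw hp).aug,
    fun _ hb => hX.internal fun e => hb (Subtype.ext e)⟩

/-- A small enough disk can be put in place of the point at the top of which a terminal vertex
lies. -/
theorem eventually_pruneOK [Finite S] (hX : X.Good) (hw : X.Terminal w A)
    (h0 : (X.dec (Sum.inl w)).2 = 0) :
    ∀ᶠ r in 𝓝[≠] (0 : ℂ), X.PruneOK w ((X.dec (Sum.inl w)).1, r) := by
  have := X.finite
  set c := (X.dec (Sum.inl w)).1
  have h1 : ∀ᶠ r in 𝓝 (0 : ℂ), ∀ y, X.IsInput y (X.succ (Sum.inl w)) → y ≠ Sum.inl w →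
      Apart (c, r) (X.dec y) := by
    refine eventually_all.2 fun y => ?_
    by_cases hy : X.IsInput y (X.succ (Sum.inl w)) ∧ y ≠ Sum.inl w
    · have h := hX.apart (fun e => hw.1 (Sum.inl_injective e)) hy.1.1 hy.2.symm hy.1.2.symm
      have hlt : ‖(0 : ℂ)‖ + ‖(X.dec y).2‖ < ‖c - (X.dec y).1‖ := by
        unfold Apart at h
        rwa [h0] at h
      have hc : ContinuousAt (fun r : ℂ => ‖r‖ + ‖(X.dec y).2‖) 0 := by fun_prop
      filter_upwards [hc.eventually_lt continuousAt_const hlt] with r hr _ _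
      exact hr
    · exact Eventually.of_forall fun r h h' => absurd ⟨h, h'⟩ hy
  have h2 : ∀ᶠ r in 𝓝 (0 : ℂ), X.dec (Sum.inl w) ∈ InDisk → (c, r) ∈ InDisk := by
    by_cases hd : X.dec (Sum.inl w) ∈ InDisk
    · have hlt : ‖c‖ + ‖(0 : ℂ)‖ < 1 := by simpa using norm_fst_lt_one hd
      have hc : ContinuousAt (fun r : ℂ => ‖c‖ + ‖r‖) 0 := by fun_prop
      filter_upwards [hc.eventually_lt continuousAt_const hlt] with r hr _
      exact ⟨hr.le, fun _ => hr⟩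
    · exact Eventually.of_forall fun r h => absurd h hd
  filter_upwards [self_mem_nhdsWithin, nhdsWithin_le_nhds h1, nhdsWithin_le_nhds h2]
    with r h h' h'' using ⟨h, h', h''⟩

end

/-! ### Terminal vertices in coordinates -/

/-- Internal edges of a valid tree have radius `0`, so a leaf has positive radius relative to a
vertex exactly if it is adjacent to it. -/
theorem Valid.snd_pos (hX : X.Valid) {a : X.V} {s : S} {p : ℂ × ℂ}
    (h : X.Pos (Sum.inl a) (Sum.inr s) p) : p.2 ≠ 0 ↔ X.succ (Sum.inr s) = a := by
  obtain ⟨hs, q, h1, rfl⟩ := h.of_ne Sum.inr_ne_inl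
  constructor
  · intro h0
    have h2 : q.2 ≠ 0 := left_ne_zero_of_mul h0
    rcases h1.dec_ne h2 with e | ⟨h3, h4⟩
    · exact Sum.inl_injective e
    · exact absurd (hX.internal fun e => h3 (by rw [e])) h4
  · rintro rfl
    rw [h1.self, one_odot]
    exact hX.good.leaf_ne s

end DTree

/-- In terms of coordinates: `A` is the set of incoming edges of a terminal vertex. -/
def TC {S : Type} (κ : Coord S) (A : Set S) : Prop :=
  A.Nonempty ∧ ∀ s ∈ A, (κ.1 s).2 = 0 ∧ (∀ u, u ∉ A → κ.2.1 s u = 0) ∧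
    ∀ t ∈ A, t ≠ s → κ.2.1 s t ≠ 0

/-- In terms of coordinates: the vertex that carries the leaf `s` is not a bivalent vertex different
from the root. Otherwise `s` is called degenerate. -/
def NZ {S : Type} (κ : Coord S) (s : S) : Prop := (κ.1 s).2 ≠ 0 ∨ ∃ t, κ.2.1 s t ≠ 0

namespace DTree

variable {S : Type} {X : DTree S}

/-- A nonzero value of `rho s t` is only possible at the vertex that carries `s`. -/
theorem Valid.rho_ne (hX : X.Valid) {s t : S} (h : X.rho s t ≠ 0) :
    ∃ q, X.Pos (Sum.inl (X.succ (Sum.inr s))) (Sum.inr t) q := by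
  have hst : s ≠ t := by
    rintro rfl
    exact h (X.rho_self s)
  obtain ⟨b, p, q, h1, h2, h3⟩ := hX.good.exists_split_pair hst
  rw [rho_eq h1 h2 h3.ne] at h
  rw [(hX.snd_pos h1).1 fun e => h (by rw [e, zero_div])]
  exact ⟨q, h2⟩

theorem Valid.rho_ne_of_pos (hX : X.Valid) {s t : S} (hst : s ≠ t) {q : ℂ × ℂ}
    (h : X.Pos (Sum.inl (X.succ (Sum.inr s))) (Sum.inr t) q) : X.rho s t ≠ 0 := by
  have h1 := Pos.edge (X := X) (x := Sum.inr s) Sum.inr_ne_inl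
  obtain ⟨y, q, hy, h2, rfl⟩ := h.first Sum.inr_ne_inl
  have hne : Sum.inr s ≠ y := by
    rintro rfl
    exact hst (pos_leaf_iff.1 h2).1.symm
  have h3 := hX.good.apart_of_input ⟨Sum.inr_ne_inl, rfl⟩ hy hne Pos.refl h2
  rw [odot_one] at h3
  rw [rho_eq h1 h h3.ne]
  exact div_ne_zero (hX.good.leaf_ne s) (sub_ne_zero.2 h3.ne)

theorem Valid.abs_snd_ne (hX : X.Valid) {s : S} :
    (X.abs s).2 ≠ 0 ↔ X.succ (Sum.inr s) = X.root := hX.snd_pos (X.pos_abs s)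

theorem Terminal.mem_of_pos {w : X.V} {A : Set S} (hw : X.Terminal w A) {t : S} {q : ℂ × ℂ}
    (h : X.Pos (Sum.inl w) (Sum.inr t) q) : t ∈ A := by
  obtain ⟨y, q, hy, h2, rfl⟩ := h.first Sum.inr_ne_inl
  obtain ⟨s, hs, rfl⟩ := (hw.2 y).1 hy
  rwa [(pos_leaf_iff.1 h2).1]

theorem Terminal.nonempty {w : X.V} {A : Set S} (hw : X.Terminal w A) : A.Nonempty := by
  obtain ⟨y, hy⟩ := X.input w
  obtain ⟨s, hs, -⟩ := (hw.2 y).1 hy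
  exact ⟨s, hs⟩

theorem Valid.tc_of_terminal (hX : X.Valid) {w : X.V} {A : Set S} (hw : X.Terminal w A) :
    TC X.coord A := by
  refine ⟨hw.nonempty, fun s hs => ⟨?_, fun u hu => ?_, fun t ht hts => ?_⟩⟩
  · by_contra h
    exact hw.1 ((hw.succ_leaf hs).symm.trans (hX.abs_snd_ne.1 h))
  · by_contra h
    obtain ⟨q, hq⟩ := hX.rho_ne h
    rw [hw.succ_leaf hs] at hq
    exact hu (hw.mem_of_pos hq)
  · refine hX.rho_ne_of_pos hts.symm (q := X.dec (Sum.inr t)) ?_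
    rw [hw.succ_leaf hs]
    exact Pos.input ((hw.2 _).2 ⟨t, ht, rfl⟩)

/-- The condition `TC` forces the leaves in `A` to be carried by the same vertex, and no other
leaf to lie above it. -/
theorem Valid.terminal_of_tc (hX : X.Valid) {A : Set S} (hA : TC X.coord A) :
    ∃ w, X.Terminal w A := by
  obtain ⟨⟨a, ha⟩, h⟩ := hA
  have hwr : X.succ (Sum.inr a) ≠ X.root := fun e => hX.abs_snd_ne.2 e (h a ha).1
  have hsub : ∀ {t q}, X.Pos (Sum.inl (X.succ (Sum.inr a))) (Sum.inr t) q → t ∈ A := by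
    intro t q hq
    by_contra ht
    exact hX.rho_ne_of_pos (fun e : a = t => ht (e ▸ ha)) hq ((h a ha).2.1 t ht)
  have hsucc : ∀ t ∈ A, X.succ (Sum.inr t) = X.succ (Sum.inr a) := by
    intro t ht
    by_cases e : a = t
    · rw [e]
    · have h1 : X.rho a t ≠ 0 := (h a ha).2.2 t ht (Ne.symm e)
      have h2 : X.rho t a ≠ 0 := (h t ht).2.2 a ha e
      obtain ⟨q1, k1⟩ := hX.rho_ne h1
      obtain ⟨q2, k2⟩ := hX.rho_ne h2
      obtain ⟨-, r1, l1, -⟩ := k1.of_ne Sum.inr_ne_inl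
      obtain ⟨-, r2, l2, -⟩ := k2.of_ne Sum.inr_ne_inl
      exact Sum.inl_injective (l1.antisymm l2)
  refine ⟨_, hwr, fun x => ⟨fun hx => ?_, ?_⟩⟩
  · rcases x with c | s
    · exfalso
      obtain ⟨s, p, hs⟩ := X.exists_leaf_above (Sum.inl c)
      have h1 := hsucc s (hsub ((Pos.input hx).trans hs))
      obtain ⟨-, r, l, -⟩ := hs.of_ne Sum.inr_ne_inl
      rw [h1] at l
      have h2 := X.ndepth_lt hx.1
      rw [hx.2] at h2
      exact absurd l.le (not_le.2 h2)
    · exact ⟨s, hsub (Pos.input hx), rfl⟩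
  · rintro ⟨s, hs, rfl⟩
    exact ⟨Sum.inr_ne_inl, hsucc s hs⟩

/-- A tree with more than one vertex has a terminal vertex. -/
theorem exists_terminal (X : DTree S) {a : X.V} (ha : a ≠ X.root) : ∃ w A, X.Terminal w A := by
  have := X.finite
  obtain ⟨w, hw, hmax⟩ := Set.exists_max_image {a | a ≠ X.root} X.depth (Set.toFinite _) ⟨a, ha⟩
  refine ⟨w, {s | X.succ (Sum.inr s) = w}, hw, fun x => ⟨fun hx => ?_, ?_⟩⟩
  · rcases x with b | s
    · have h1 := X.ndepth_lt hx.1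
      rw [hx.2] at h1
      exact absurd (hmax b fun e => hx.1 (congrArg Sum.inl e)) (not_le.2 h1)
    · exact ⟨s, hx.2, rfl⟩
  · rintro ⟨s, hs, rfl⟩
    exact ⟨Sum.inr_ne_inl, hs⟩

end DTree
end TrivDisks

namespace TrivDisks
open scoped ComplexConjugate
open Topology Filter

/-! ### The coordinates determine a decorated tree -/

/-- A configuration is determined up to `Aff(ℂ)` by the quotients `r_s / (c_s - c_t)`. -/
theorem odot_eq_of_ratio {p q p' q' : ℂ × ℂ} (hp : p.2 ≠ 0) (hp' : p'.2 ≠ 0)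
    (h : p.1 ≠ q.1) (h' : p'.1 ≠ q'.1) (e : p.2 / (p.1 - q.1) = p'.2 / (p'.1 - q'.1))
    (e' : q.2 / (q.1 - p.1) = q'.2 / (q'.1 - p'.1)) :
    q' = odot (odot p' (oinv p)) q := by
  have h1 := sub_ne_zero.2 h
  have h2 := sub_ne_zero.2 h'
  have h3 := sub_ne_zero.2 h.symm
  have h4 := sub_ne_zero.2 h'.symm
  rw [div_eq_div_iff h1 h2] at e
  rw [div_eq_div_iff h3 h4] at e'
  have k : q'.1 = p'.1 - p'.2 / p.2 * (p.1 - q.1) := by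
    field_simp
    linear_combination -e
  refine Prod.ext ?_ ?_
  · simp only [odot, oinv]
    rw [k]
    field_simp
    ring
  · simp only [odot, oinv]
    have k' : q'.1 - p'.1 = p'.2 / p.2 * (q.1 - p.1) := by rw [k]; ring
    rw [k', mul_left_comm] at e'
    have : q'.2 * (q.1 - p.1) = (p'.2 * p.2⁻¹ * q.2) * (q.1 - p.1) := by
      rw [← e']
      field_simp
    exact mul_right_cancel₀ h3 this

namespace DTree

variable {S : Type} {X Y : DTree S}

/-- A leaf at the root or with a sibling satisfies `NZ`. -/
theorem Valid.nz (hX : X.Valid) {t : S} (h : X.succ (Sum.inr t) = X.root ∨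
    ∃ y, y ≠ Sum.inr t ∧ X.IsInput y (X.succ (Sum.inr t))) : NZ X.coord t := by
  rcases h with h | ⟨y, hy, hyt⟩
  · exact Or.inl (hX.abs_snd_ne.2 h)
  · obtain ⟨s, p, hs⟩ := X.exists_leaf_above y
    refine Or.inr ⟨s, hX.rho_ne_of_pos ?_ ((Pos.input hyt).trans hs)⟩
    rintro rfl
    obtain ⟨-, q, hq, -⟩ := hs.of_ne hy.symm
    have h1 := X.ndepth_lt hyt.1
    rw [hyt.2] at h1
    exact absurd hq.le (not_le.2 h1)

/-- The radius of a leaf `t`, absolute and relative to the other leaves, is determined up to a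
common factor by the remaining coordinates. -/
theorem exists_scale (hX : X.Good) (hY : Y.Good) (h1 : ∀ s, (X.abs s).1 = (Y.abs s).1)
    (h2 : X.tri = Y.tri) {t : S} (hXt : NZ X.coord t) (hYt : NZ Y.coord t) :
    ∃ k : ℂ, k ≠ 0 ∧ (Y.abs t).2 = k * (X.abs t).2 ∧ ∀ s, Y.rho t s = k * X.rho t s := by
  have hne : ∀ {Z : DTree S} {s}, Z.rho t s ≠ 0 → t ≠ s := by
    rintro Z s h rfl
    exact h (Z.rho_self t)
  -- all values `rho t s` are proportional to one nonzero value; if there is none, `t` is the only leaf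
  by_cases hu : ∃ u, X.rho t u ≠ 0
  · obtain ⟨u, hu⟩ := hu
    have htu := hne hu
    have hT : ∀ s, t ≠ s → (X.tri t u s).2.2 ≠ 0 := fun s hs h =>
      hu ((hX.rho_tri htu hs).2 h)
    have hu' : Y.rho t u ≠ 0 := by
      intro h0
      rcases hYt with h | ⟨s, h⟩
      · exact h ((hY.abs_snd htu).trans (by rw [h0, zero_mul]))
      · have hs := hne h
        have e := (hY.rho_tri htu hs).1
        rw [h0, zero_mul, ← h2] at e
        exact mul_ne_zero h (hT s hs) e.symm
    refine ⟨Y.rho t u / X.rho t u, div_ne_zero hu' hu, ?_, fun s => ?_⟩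
    · rw [hX.abs_snd htu, hY.abs_snd htu, h1, h1]
      field_simp
    · by_cases hs : t = s
      · subst hs
        rw [rho_self, rho_self, mul_zero]
      · have e1 := (hX.rho_tri htu hs).1
        have e2 := (hY.rho_tri htu hs).1
        rw [← h2] at e2
        refine mul_right_cancel₀ (hT s hs) ?_
        rw [← e2, mul_assoc, ← e1]
        field_simp
  · push Not at hu
    have hR : (X.abs t).2 ≠ 0 := by
      rcases hXt with h | ⟨s, h⟩
      · exact h
      · exact absurd (hu s) h
    have hs : ∀ s, t = s := by
      intro s
      by_contra h
      exact hR ((hX.abs_snd h).trans (by rw [hu, zero_mul]))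
    have hR' : (Y.abs t).2 ≠ 0 := by
      rcases hYt with h | ⟨s, h⟩
      · exact h
      · exact absurd (hs s) (hne h)
    refine ⟨(Y.abs t).2 / (X.abs t).2, div_ne_zero hR' hR, by field_simp, fun s => ?_⟩
    rw [← hs s, rho_self, rho_self, mul_zero]

section

variable {w : X.V} {A : Set S}

/-- A section of the map that collapses `A`. -/
def lift (A : Set S) (a : S) : Collapse A → S := Sum.elim Subtype.val fun _ => a

theorem lift_injective {a : S} (ha : a ∈ A) : Function.Injective (lift A a) := by
  rintro (s | u) (t | v) h
  · exact congrArg Sum.inl (Subtype.ext h)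
  · exact absurd (show s.1 ∈ A from (show s.1 = a from h) ▸ ha) s.2
  · exact absurd (show t.1 ∈ A from (show a = t.1 from h) ▸ ha) t.2
  · rfl

theorem lift_mem {a : S} {e : Collapse A} (h : lift A a e ∈ A) : e = tip A := by
  rcases e with s | u
  · exact absurd h s.2
  · rfl

variable (hw : X.Terminal w A) (h0 : (X.dec (Sum.inl w)).2 = 0)
include hw

theorem Terminal.pos_succ {b : X.V} {a : S} (ha : a ∈ A) (hb : b ≠ w) {v : ℂ × ℂ}
    (h : X.Pos (Sum.inl b) (Sum.inr a) v) :
    ∃ q, X.Pos (Sum.inl b) (Sum.inl (X.succ (Sum.inl w))) q ∧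
      v = odot (odot q (X.dec (Sum.inl w))) (X.dec (Sum.inr a)) := by
  obtain ⟨-, q, h1, rfl⟩ := h.of_ne Sum.inr_ne_inl
  rw [hw.succ_leaf ha] at h1
  obtain ⟨-, q', h2, rfl⟩ := h1.of_ne fun e => hb (Sum.inl_injective e).symm
  exact ⟨q', h2, rfl⟩

theorem Terminal.ne_of_pos {b : X.V} {a : S} {e e' : Collapse A} (hne : e ≠ e') {v v' : ℂ × ℂ}
    (h : X.Pos (Sum.inl b) (Sum.inr (lift A a e)) v)
    (h' : X.Pos (Sum.inl b) (Sum.inr (lift A a e')) v') : b ≠ w := by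
  rintro rfl
  exact hne ((lift_mem (hw.mem_of_pos h)).trans (lift_mem (hw.mem_of_pos h')).symm)

include h0

/-- The leaf `e` of the pruned tree has the center of the leaf `lift A a e` of the original tree,
relative to all vertices other than `w`, and apart from the new leaf also its radius. -/
theorem pos_prune_lift {b : X.V} (hb : b ≠ w) {a : S} (ha : a ∈ A) (r : ℂ) {e : Collapse A}
    {v : ℂ × ℂ} (h : X.Pos (Sum.inl b) (Sum.inr (lift A a e)) v) :
    ∃ u, (X.prune hw ((X.dec (Sum.inl w)).1, r)).Pos (Sum.inl ⟨b, hb⟩) (Sum.inr e) u ∧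
      u.1 = v.1 ∧ (e ≠ tip A → u = v) := by
  rcases e with s | u
  · exact ⟨v, Pos.prune hw _ (y := Sum.inl ⟨b, hb⟩) (x := Sum.inr (Sum.inl s)) h
      (fun e => Sum.inl_ne_inr (Sum.inr_injective e)), rfl, fun _ => rfl⟩
  · obtain ⟨q, h1, rfl⟩ := hw.pos_succ ha hb h
    refine ⟨_, Pos.prune_tip hw _ hb h1, ?_, fun e => absurd rfl e⟩
    simp [odot, h0]

theorem prune_abs_fst {a : S} (ha : a ∈ A) (r : ℂ) (e : Collapse A) :
    ((X.prune hw ((X.dec (Sum.inl w)).1, r)).abs e).1 = (X.abs (lift A a e)).1 := by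
  obtain ⟨u, h1, h2, -⟩ := pos_prune_lift hw h0 hw.1.symm ha r (X.pos_abs (lift A a e))
  rw [abs_eq h1, h2]

theorem prune_abs {a : S} (ha : a ∈ A) (r : ℂ) {e : Collapse A} (he : e ≠ tip A) :
    (X.prune hw ((X.dec (Sum.inl w)).1, r)).abs e = X.abs (lift A a e) := by
  obtain ⟨u, h1, -, h2⟩ := pos_prune_lift hw h0 hw.1.symm ha r (X.pos_abs (lift A a e))
  rw [abs_eq h1, h2 he]

theorem prune_rho (hX : X.Good) {a : S} (ha : a ∈ A) (r : ℂ) {e : Collapse A} (he : e ≠ tip A)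
    (e' : Collapse A) : (X.prune hw ((X.dec (Sum.inl w)).1, r)).rho e e' =
      X.rho (lift A a e) (lift A a e') := by
  by_cases hee : e = e'
  · rw [hee, rho_self, rho_self]
  · obtain ⟨b, p, q, h1, h2, h3⟩ := hX.exists_split_pair fun h => hee (lift_injective ha h)
    have hb := hw.ne_of_pos hee h1 h2
    obtain ⟨u, k1, l1, m1⟩ := pos_prune_lift hw h0 hb ha r h1
    obtain ⟨v, k2, l2, -⟩ := pos_prune_lift hw h0 hb ha r h2
    rw [rho_eq h1 h2 h3.ne, rho_eq k1 k2 (by rw [l1, l2]; exact h3.ne), m1 he, l2]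

theorem prune_tri (hX : X.Good) {a : S} (ha : a ∈ A) (r : ℂ) (e e' e'' : Collapse A) :
    (X.prune hw ((X.dec (Sum.inl w)).1, r)).tri e e' e'' =
      X.tri (lift A a e) (lift A a e') (lift A a e'') := by
  by_cases hee : e' = e ∧ e'' = e
  · rw [hee.1, hee.2, tri_self, tri_self]
  · obtain ⟨b, p, q, v, h1, h2, h3, h4⟩ := hX.exists_split_triple
      (s := lift A a e) (t := lift A a e') (u := lift A a e'')
      fun h => hee ⟨lift_injective ha h.1, lift_injective ha h.2⟩
    have hb : b ≠ w := by
      by_cases c : e' = e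
      · exact hw.ne_of_pos (fun h => hee ⟨c, h⟩) h3 h1
      · exact hw.ne_of_pos c h2 h1
    obtain ⟨u, k1, l1, -⟩ := pos_prune_lift hw h0 hb ha r h1
    obtain ⟨v, k2, l2, -⟩ := pos_prune_lift hw h0 hb ha r h2
    obtain ⟨v, k3, l3, -⟩ := pos_prune_lift hw h0 hb ha r h3
    rw [tri_eq h1 h2 h3 h4, tri_eq k1 k2 k3 (by rw [l1, l2, l3]; exact h4), l1, l2, l3]

omit h0 in
theorem prune_abs_tip (r k : ℂ) :
    ((X.prune hw ((X.dec (Sum.inl w)).1, k * r)).abs (tip A)).2 =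
      k * ((X.prune hw ((X.dec (Sum.inl w)).1, r)).abs (tip A)).2 := by
  obtain ⟨a, ha⟩ := hw.nonempty
  obtain ⟨q, h1, -⟩ := hw.pos_succ ha hw.1.symm (X.pos_abs a)
  rw [abs_eq (Pos.prune_tip hw _ hw.1.symm h1), abs_eq (Pos.prune_tip hw _ hw.1.symm h1)]
  simp only [odot]
  ring

theorem prune_rho_tip (hX : X.Good) (r k : ℂ) (e : Collapse A) :
    (X.prune hw ((X.dec (Sum.inl w)).1, k * r)).rho (tip A) e =
      k * (X.prune hw ((X.dec (Sum.inl w)).1, r)).rho (tip A) e := by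
  obtain ⟨a, ha⟩ := hw.nonempty
  by_cases hee : tip A = e
  · rw [← hee, rho_self, rho_self, mul_zero]
  · obtain ⟨b, p, q, h1, h2, h3⟩ := hX.exists_split_pair
      (s := lift A a (tip A)) (t := lift A a e) fun h => hee (lift_injective ha h)
    have hb := hw.ne_of_pos hee h1 h2
    obtain ⟨q', h5, rfl⟩ := hw.pos_succ ha hb h1
    have key : ∀ r, (X.prune hw ((X.dec (Sum.inl w)).1, r)).rho (tip A) e =
        q'.2 * r / ((odot q' (X.dec (Sum.inl w))).1 - q.1) := by
      intro r
      obtain ⟨v, k2, l2, -⟩ := pos_prune_lift hw h0 hb ha r h2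
      have hne : (odot q' ((X.dec (Sum.inl w)).1, r)).1 ≠ v.1 := by
        rw [l2]
        intro e
        refine h3.ne (Eq.trans ?_ e)
        simp [odot, h0]
      rw [rho_eq (Pos.prune_tip hw _ hb h5) k2 hne, l2]
      rfl
    rw [key, key]
    ring

omit h0 in
/-- Near stability is what excludes that the new leaf is alone at a vertex other than the root. -/
theorem Valid.nz_tip (hX : X.Valid) {p : ℂ × ℂ} (hp : X.PruneOK w p) :
    NZ (X.prune hw p).coord (tip A) := by
  have hP := hX.prune hw hp
  have hs : ((X.prune hw p).succ (Sum.inr (tip A))).1 = X.succ (Sum.inl w) :=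
    pruneSucc_val hw (x := Sum.inr (tip A)) Sum.inr_ne_inl
  refine hP.nz ?_
  by_cases hr : X.succ (Sum.inl w) = X.root
  · exact Or.inl (Subtype.ext (hs.trans hr))
  · right
    have hwr : (Sum.inl w : X.V ⊕ S) ≠ Sum.inl X.root := fun e => hw.1 (Sum.inl_injective e)
    have : ∃ y, y ≠ Sum.inl w ∧ X.IsInput y (X.succ (Sum.inl w)) := by
      by_contra h
      push Not at h
      have hb : X.Bivalent (X.succ (Sum.inl w)) :=
        ⟨Sum.inl w, ⟨hwr, rfl⟩, fun y hy => by
          by_contra hne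
          exact h y hne hy⟩
      rcases hX.nearlyStable _ hb with e | ⟨s, hs⟩
      · exact hr e
      · exact h (Sum.inr s) Sum.inr_ne_inl ⟨Sum.inr_ne_inl, hs⟩
    obtain ⟨y, hy, hy'⟩ := this
    obtain ⟨z, h1, rfl⟩ := hw.exists_pnode (X.succ_ne hw.1) hy'
    refine ⟨z, ?_, (prune_isInput hw p z _).2 ⟨h1, ?_⟩⟩
    · rintro rfl
      exact hy rfl
    · rw [hs]
      exact hy'

end

theorem PruneOK.scale {w : X.V} {c r : ℂ} (h : X.PruneOK w (c, r)) {k : ℂ} (hk : k ≠ 0)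
    (hk1 : ‖k‖ ≤ 1) : X.PruneOK w (c, k * r) := by
  have hle : ‖k * r‖ ≤ ‖r‖ := by
    rw [norm_mul]
    exact mul_le_of_le_one_left (norm_nonneg _) hk1
  refine ⟨mul_ne_zero hk h.ne, fun y h1 h2 => ?_, fun hd => ?_⟩
  · have : _ < _ := h.apart y h1 h2
    change ‖k * r‖ + _ < _
    simp only at this
    linarith
  · obtain ⟨h1, h2⟩ := h.disk hd
    simp only at h1 h2
    refine ⟨?_, fun hc => ?_⟩
    · simp only
      linarith
    · have := h2 hc
      simp only
      linarith

theorem exists_equiv_extend {α β : Type*} {w : α} {w' : β}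
    (φ : {a : α // a ≠ w} ≃ {b : β // b ≠ w'}) :
    ∃ ψ : α ≃ β, ψ w = w' ∧ ∀ b (hb : b ≠ w), ψ b = (φ ⟨b, hb⟩).1 := by
  classical
  refine ⟨(Equiv.optionSubtypeNe w).symm.trans
    ((Equiv.optionCongr φ).trans (Equiv.optionSubtypeNe w')), by simp, fun b hb => ?_⟩
  simp [Equiv.optionSubtypeNe_symm_of_ne hb]

/-- An isomorphism of pruned trees extends to the original trees. -/
theorem equivalent_of_prune (hX : X.Valid) (hY : Y.Valid) {A : Set S} {w : X.V} {w' : Y.V}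
    (hw : X.Terminal w A) (hw' : Y.Terminal w' A) (hrho : X.rho = Y.rho) {r r' : ℂ}
    (h : Equivalent (X.prune hw ((X.dec (Sum.inl w)).1, r))
      (Y.prune hw' ((Y.dec (Sum.inl w')).1, r'))) : Equivalent X Y := by
  classical
  obtain ⟨φ, g, hφ⟩ := h
  obtain ⟨a, ha⟩ := hw.nonempty
  obtain ⟨ψ, hψw, hψ⟩ : ∃ ψ : X.V ≃ Y.V, ψ w = w' ∧ ∀ b (hb : b ≠ w), ψ b = (φ ⟨b, hb⟩).1 :=
    exists_equiv_extend φ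
  let k : X.V → ℂ × ℂ := fun b => if hb : b = w then
    odot (Y.dec (Sum.inr a)) (oinv (X.dec (Sum.inr a))) else g ⟨b, hb⟩
  have hkw : k w = odot (Y.dec (Sum.inr a)) (oinv (X.dec (Sum.inr a))) := dif_pos rfl
  have hk : ∀ b (hb : b ≠ w), k b = g ⟨b, hb⟩ := fun b hb => dif_neg hb
  -- the nodes of `X`
  have cases : ∀ x : X.V ⊕ S, x ≠ Sum.inl X.root → (∃ s ∈ A, x = Sum.inr s) ∨
      ∃ z, z ≠ Sum.inl ⟨X.root, hw.1.symm⟩ ∧ pnode w A z = x := by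
    intro x hx
    by_cases hxw : X.succ x = w
    · exact Or.inl ((hw.2 x).1 ⟨hx, hxw⟩)
    · obtain ⟨z, h1, h2⟩ := hw.exists_pnode hxw ⟨hx, rfl⟩
      exact Or.inr ⟨z, h1, h2⟩
  have hmap : ∀ z : {b : X.V // b ≠ w} ⊕ Collapse A,
      Sum.map ψ id (pnode w A z) = pnode w' A (Sum.map φ id z) := by
    rintro (b | s | u)
    · exact congrArg Sum.inl (hψ b.1 b.2)
    · rfl
    · exact congrArg Sum.inl hψw
  -- at `w`, the affine map that matches the leaf `a` also matches the other leaves in `A`, because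
  -- the values of `rho` agree
  refine ⟨ψ, k, ?_, ?_, ?_, ?_, ?_⟩
  · rw [hψ _ hw.1.symm]
    exact congrArg Subtype.val hφ.root
  · rw [hk _ hw.1.symm]
    exact hφ.g_root
  · intro b
    by_cases hb : b = w
    · rw [hb, hkw]
      exact mul_ne_zero (hY.good.leaf_ne a) (oinv_snd_ne (hX.good.leaf_ne a))
    · rw [hk b hb]
      exact hφ.g_ne _
  · intro x hx
    rcases cases x hx with ⟨s, hs, rfl⟩ | ⟨z, hz, rfl⟩
    · rw [hw.succ_leaf hs, hψw]
      exact hw'.succ_leaf hs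
    · have hz' := map_ne_root hφ.root hz
      rw [hmap, hψ _ (hw.succ_pnode_ne hz)]
      refine (pruneSucc_val hw' hz').symm.trans ((congrArg Subtype.val (hφ.succ z hz)).trans (congrArg (fun b => (φ b).1) ?_))
      exact Subtype.ext (pruneSucc_val hw hz)
  · intro x hx
    rcases cases x hx with ⟨s, hs, rfl⟩ | ⟨z, hz, rfl⟩
    · rw [hw.succ_leaf hs, hkw]
      change Y.dec (Sum.inr s) = _
      by_cases hsa : s = a
      · subst hsa
        rw [odot_assoc, oinv_odot (hX.good.leaf_ne s), odot_one]
      · have hpos : ∀ {t}, t ∈ A → X.Pos (Sum.inl w) (Sum.inr t) (X.dec (Sum.inr t)) :=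
          fun ht => Pos.input ((hw.2 _).2 ⟨_, ht, rfl⟩)
        have hpos' : ∀ {t}, t ∈ A → Y.Pos (Sum.inl w') (Sum.inr t) (Y.dec (Sum.inr t)) :=
          fun ht => Pos.input ((hw'.2 _).2 ⟨_, ht, rfl⟩)
        have hap := hX.good.apart (x := Sum.inr a) (y := Sum.inr s) Sum.inr_ne_inl Sum.inr_ne_inl
          (fun e => hsa (Sum.inr_injective e).symm)
          ((hw.succ_leaf ha).trans (hw.succ_leaf hs).symm)
        have hap' := hY.good.apart (x := Sum.inr a) (y := Sum.inr s) Sum.inr_ne_inl Sum.inr_ne_inl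
          (fun e => hsa (Sum.inr_injective e).symm)
          ((hw'.succ_leaf ha).trans (hw'.succ_leaf hs).symm)
        refine odot_eq_of_ratio (hX.good.leaf_ne a) (hY.good.leaf_ne a) hap.ne hap'.ne ?_ ?_
        · rw [← rho_eq (hpos ha) (hpos hs) hap.ne, ← rho_eq (hpos' ha) (hpos' hs) hap'.ne, hrho]
        · rw [← rho_eq (hpos hs) (hpos ha) hap.symm.ne,
            ← rho_eq (hpos' hs) (hpos' ha) hap'.symm.ne, hrho]
    · have hd := hφ.dec z hz
      have hsz : (X.prune hw ((X.dec (Sum.inl w)).1, r)).succ z =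
          ⟨X.succ (pnode w A z), hw.succ_pnode_ne hz⟩ := Subtype.ext (pruneSucc_val hw hz)
      rw [hmap, hk _ (hw.succ_pnode_ne hz), ← hsz]
      by_cases hzt : z = Sum.inr (tip A)
      · subst hzt
        have h1 : (X.dec (Sum.inl w)).2 = 0 := hX.internal hw.1
        have h2 : (Y.dec (Sum.inl w')).2 = 0 := hY.internal hw'.1
        refine Prod.ext ((congrArg Prod.fst hd).trans rfl : (Y.dec (Sum.inl w')).1 = _) ?_
        exact h2.trans (by simp [odot, pnode, h1])
      · rw [prune_dec _ _ hzt] at hd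
        refine (prune_dec hw' ((Y.dec (Sum.inl w')).1, r') ?_).symm.trans hd
        · rcases z with b | s | u
          · exact Sum.inl_ne_inr
          · exact fun e => Sum.inl_ne_inr (Sum.inr_injective e)
          · exact absurd rfl hzt

/-- Valid trees with the same coordinates are isomorphic, by induction on the number of vertices:
a terminal vertex is visible in the coordinates, and the radii of the leaves that replace it can be
chosen such that the two pruned trees have the same coordinates, too. -/
theorem equivalent_of_coord_eq (n : ℕ) : ∀ {S : Type} [Finite S] {X Y : DTree S}, X.Valid →
    Y.Valid → X.coord = Y.coord → Nat.card X.V = n → Equivalent X Y := by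
  induction n with
  | zero =>
    intro S _ X Y _ _ _ hn
    have := X.finite
    have : Nonempty X.V := ⟨X.root⟩
    exact absurd hn Nat.card_pos.ne'
  | succ n ih =>
    intro S _ X Y hX hY he hn
    have := X.finite
    by_cases h1 : ∃ a, a ≠ X.root
    · obtain ⟨a, ha⟩ := h1
      obtain ⟨w, A, hw⟩ := X.exists_terminal ha
      obtain ⟨w', hw'⟩ := hY.terminal_of_tc (he ▸ hX.tc_of_terminal hw)
      have h0 := hX.internal hw.1
      have h0' := hY.internal hw'.1
      obtain ⟨r, hr⟩ := (eventually_pruneOK hX.good hw h0).exists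
      obtain ⟨r', hr'⟩ := (eventually_pruneOK hY.good hw' h0').exists
      obtain ⟨a, ha⟩ := hw.nonempty
      have habs : X.abs = Y.abs := congrArg Prod.fst he
      have hrho : X.rho = Y.rho := congrArg (fun k => k.2.1) he
      have htri : X.tri = Y.tri := congrArg (fun k => k.2.2) he
      have htri' : ∀ r r', (X.prune hw ((X.dec (Sum.inl w)).1, r)).tri =
          (Y.prune hw' ((Y.dec (Sum.inl w')).1, r')).tri := by
        intro r r'
        funext e e' e''
        rw [prune_tri hw h0 hX.good ha, prune_tri hw' h0' hY.good ha, htri]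
      obtain ⟨k, hk0, hk1, hk2⟩ := exists_scale (hX.prune hw hr).good (hY.prune hw' hr').good
        (fun e => by rw [prune_abs_fst hw h0 ha, prune_abs_fst hw' h0' ha, habs])
        (htri' r r') (hX.nz_tip hw hr) (hY.nz_tip hw' hr')
      -- rescale the two radii by numbers of norm at most `1` whose quotient is the factor `k`
      obtain ⟨m, m', hm, hm', l, l', hmm⟩ : ∃ m m' : ℂ, m ≠ 0 ∧ m' ≠ 0 ∧ ‖m‖ ≤ 1 ∧ ‖m'‖ ≤ 1 ∧
          m' * k = m := by
        by_cases hk : ‖k‖ ≤ 1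
        · exact ⟨k, 1, hk0, one_ne_zero, hk, by simp, one_mul k⟩
        · refine ⟨1, k⁻¹, one_ne_zero, inv_ne_zero hk0, by simp, ?_, inv_mul_cancel₀ hk0⟩
          rw [norm_inv]
          exact inv_le_one_of_one_le₀ (not_le.1 hk).le
      refine equivalent_of_prune hX hY hw hw' hrho (r := m * r) (r' := m' * r')
        (ih (hX.prune hw (hr.scale hm l)) (hY.prune hw' (hr'.scale hm' l')) ?_ ?_)
      · refine Prod.ext (funext fun e => ?_) (Prod.ext (funext fun e => funext fun e' => ?_)
          (htri' _ _))
        · by_cases het : e = tip A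
          · subst het
            refine Prod.ext ?_ ?_
            · exact (prune_abs_fst hw h0 ha _ _).trans
                ((congrArg Prod.fst (congrFun habs _)).trans (prune_abs_fst hw' h0' ha _ _).symm)
            · refine (prune_abs_tip hw _ _).trans (Eq.trans ?_ (prune_abs_tip hw' _ _).symm)
              rw [hk1, ← hmm]
              ring
          · exact (prune_abs hw h0 ha _ het).trans
              ((congrFun habs _).trans (prune_abs hw' h0' ha _ het).symm)
        · by_cases het : e = tip A
          · subst het
            refine (prune_rho_tip hw h0 hX.good _ _ _).trans
              (Eq.trans ?_ (prune_rho_tip hw' h0' hY.good _ _ _).symm)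
            rw [hk2, ← hmm]
            ring
          · exact (prune_rho hw h0 hX.good ha _ het _).trans
              ((congrFun (congrFun hrho _) _).trans (prune_rho hw' h0' hY.good ha _ het _).symm)
      · change Nat.card {a : X.V // a ≠ w} = n
        classical
        have h2 := Nat.card_congr (Equiv.optionSubtypeNe w)
        rw [Finite.card_option] at h2
        omega
    -- two corollas
    · have h1' : ¬ ∃ b, b ≠ Y.root := by
        rintro ⟨b, hb⟩
        obtain ⟨w, A, hw⟩ := Y.exists_terminal hb
        obtain ⟨w', hw'⟩ := hX.terminal_of_tc (he ▸ hY.tc_of_terminal hw)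
        exact h1 ⟨w', hw'.1⟩
      push Not at h1 h1'
      have u1 : Unique X.V := ⟨⟨X.root⟩, h1⟩
      have u2 : Unique Y.V := ⟨⟨Y.root⟩, h1'⟩
      refine ⟨Equiv.ofUnique _ _, fun _ => (0, 1), Subsingleton.elim _ _, rfl,
        fun _ => one_ne_zero, fun x hx => Subsingleton.elim _ _, ?_⟩
      rintro (a | s) hx
      · exact absurd (congrArg Sum.inl (h1 a)) hx
      · have key : ∀ Z : DTree S, (∀ a, a = Z.root) → Z.abs s = Z.dec (Sum.inr s) := fun Z hZ =>
          abs_eq (Pos.input ⟨Sum.inr_ne_inl, hZ _⟩)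
        rw [one_odot, ← key X h1]
        exact (key Y h1').symm.trans (congrArg (fun k => k.1 s) he.symm)

end DTree

/-- An element of `𝕄̄(S)` is determined by its coordinates. -/
theorem crd_injective {S : Type} [Finite S] : Function.Injective (crd : MbarObj S → Coord S) := by
  intro x y h
  obtain ⟨X, hX, rfl⟩ := exists_toMbar x
  obtain ⟨Y, hY, rfl⟩ := exists_toMbar y
  exact toMbar_eq_of_equivalent hX hY (DTree.equivalent_of_coord_eq _ hX hY h rfl)

end TrivDisks

namespace TrivDisks
open scoped ComplexConjugate
open Topology Filter DTree

/-! ### The operads of framed little disks and of trivialized annuli -/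

section

variable {S S' S'' T T' : Type}

theorem symm_comp_eq {α : Type*} (σ : S ≃ T) {x : S → α} {y : T → α} (h : ∀ s, y (σ s) = x s) :
    (fun t => x (σ.symm t)) = y := by
  funext t
  rw [← h, Equiv.apply_symm_apply]

theorem insConf_congr (σ : S ≃ T) (τ : S' ≃ T') (s : S) (x : S → ℂ × ℂ) (y : S' → ℂ × ℂ) :
    insConf (σ s) (fun t => x (σ.symm t)) (fun t => y (τ.symm t)) =
      fun e => insConf s x y ((Ins.congr σ τ s).symm e) := by
  refine (symm_comp_eq _ ?_).symm
  rintro (a | b) <;> simp [insConf, Ins.congr]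

theorem insConf_left (x : S → ℂ × ℂ) (a : Unit → ℂ × ℂ) :
    (fun t => insConf () a x ((Ins.left S).symm t)) = fun s => odot (a ()) (x s) := by
  refine symm_comp_eq _ ?_
  rintro (⟨a, h⟩ | b)
  · exact absurd rfl h
  · rfl

theorem insConf_right (s : S) (x : S → ℂ × ℂ) :
    (fun t => insConf s x (fun _ => (0, 1)) ((Ins.right s).symm t)) = x := by
  refine symm_comp_eq _ ?_
  rintro (⟨a, h⟩ | b)
  · rfl
  · exact (odot_one _).symm

theorem insConf_seq (s : S) (t : S') (x : S → ℂ × ℂ) (y : S' → ℂ × ℂ) (r : S'' → ℂ × ℂ) :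
    (fun e => insConf (Sum.inr t : Ins s S') (insConf s x y) r ((Ins.seq S'' s t).symm e)) =
      insConf s x (insConf t y r) := by
  refine symm_comp_eq _ ?_
  rintro (⟨x | y, h⟩ | r)
  · rfl
  · rfl
  · exact (odot_assoc _ _ _).symm

theorem insConf_par (s t : S) (h : t ≠ s) (x : S → ℂ × ℂ) (y : S' → ℂ × ℂ) (r : S'' → ℂ × ℂ) :
    (fun e => insConf (Sum.inl ⟨t, h⟩ : Ins s S') (insConf s x y) r
      ((Ins.par S' S'' s t h).symm e)) =
      insConf (Sum.inl ⟨s, h.symm⟩ : Ins t S'') (insConf t x r) y := by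
  refine symm_comp_eq _ ?_
  rintro (⟨x | y, h⟩ | r) <;> rfl

theorem isOperad_FLD : IsOperad FLD where
  relabel_refl _ := rfl
  relabel_trans _ _ _ := rfl
  equivariant σ τ s x y := Subtype.ext (insConf_congr σ τ s x.1 y.1)
  one_comp x := Subtype.ext ((insConf_left x.1 _).trans (funext fun _ => one_odot _))
  comp_one s x := Subtype.ext (insConf_right s x.1)
  assoc_seq s t x y r := Subtype.ext (insConf_seq s t x.1 y.1 r.1)
  assoc_par s t h x y r := Subtype.ext (insConf_par s t h x.1 y.1 r.1)

theorem isOperad_FLD1 : IsOperad FLD1 where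
  relabel_refl _ := rfl
  relabel_trans _ _ _ := rfl
  equivariant σ τ s x y := Subtype.ext (isOperad_FLD.equivariant σ τ s x.1 y.1)
  one_comp x := Subtype.ext (isOperad_FLD.one_comp x.1)
  comp_one s x := Subtype.ext (isOperad_FLD.comp_one s x.1)
  assoc_seq s t x y r := Subtype.ext (isOperad_FLD.assoc_seq s t x.1 y.1 r.1)
  assoc_par s t h x y r := Subtype.ext (isOperad_FLD.assoc_par s t h x.1 y.1 r.1)

theorem isOperad_AnTriv : IsOperad AnTriv where
  relabel_refl _ := rfl
  relabel_trans _ _ _ := rfl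
  equivariant σ τ s x y := Subtype.ext (insConf_congr σ τ s x.1 y.1)
  one_comp x := Subtype.ext ((insConf_left x.1 _).trans (funext fun _ => one_odot _))
  comp_one s x := Subtype.ext (insConf_right s x.1)
  assoc_seq s t x y r := Subtype.ext (insConf_seq s t x.1 y.1 r.1)
  assoc_par s t h x y r := Subtype.ext (insConf_par s t h x.1 y.1 r.1)

theorem continuous_insConf (s : S) : Continuous fun p : (S → ℂ × ℂ) × (S' → ℂ × ℂ) =>
    insConf s p.1 p.2 := by
  refine continuous_pi ?_
  rintro (a | b)
  · simp only [insConf, Sum.elim_inl]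
    fun_prop
  · simp only [insConf, Sum.elim_inr, odot]
    fun_prop

theorem continuous_FLD_val [Finite S] :
    @Continuous (FLD.obj S) (S → ℂ × ℂ) (FLD.top S) _ fun x => x.1 := continuous_induced_dom

theorem continuous_FLD_iff [Finite S] {α : Type*} [TopologicalSpace α] {f : α → FLD.obj S} :
    @Continuous α (FLD.obj S) _ (FLD.top S) f ↔ Continuous fun a => (f a).1 :=
  continuous_induced_rng

theorem isTopOperad_FLD : IsTopOperad FLD FLD.top where
  isOperad := isOperad_FLD
  continuous_relabel {S T} _ _ σ := by
    let _ := FLD.top S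
    exact continuous_FLD_iff.2 (continuous_pi fun t =>
      (continuous_apply (σ.symm t)).comp continuous_FLD_val)
  continuous_comp {S S'} _ _ s := by
    let _ := FLD.top S
    let _ := FLD.top S'
    exact continuous_FLD_iff.2 ((continuous_insConf s).comp
      ((continuous_FLD_val.comp continuous_fst).prodMk (continuous_FLD_val.comp continuous_snd)))

theorem continuous_AnTriv_val [Finite S] :
    @Continuous (AnTriv.obj S) (S → ℂ × ℂ) (AnTriv.top S) _ fun x => x.1 := continuous_induced_dom

theorem continuous_AnTriv_iff [Finite S] {α : Type*} [TopologicalSpace α] {f : α → AnTriv.obj S} :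
    @Continuous α (AnTriv.obj S) _ (AnTriv.top S) f ↔ Continuous fun a => (f a).1 :=
  continuous_induced_rng

theorem isTopOperad_AnTriv : IsTopOperad AnTriv AnTriv.top where
  isOperad := isOperad_AnTriv
  continuous_relabel {S T} _ _ σ := by
    let _ := AnTriv.top S
    exact continuous_AnTriv_iff.2 (continuous_pi fun t =>
      (continuous_apply (σ.symm t)).comp continuous_AnTriv_val)
  continuous_comp {S S'} _ _ s := by
    let _ := AnTriv.top S
    let _ := AnTriv.top S'
    exact continuous_AnTriv_iff.2 ((continuous_insConf s).comp
      ((continuous_AnTriv_val.comp continuous_fst).prodMk (continuous_AnTriv_val.comp continuous_snd)))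

theorem continuous_FLD1_val [Finite S] :
    @Continuous (FLD1.obj S) (FLD.obj S) (FLD1.top S) (FLD.top S) fun x => x.1 := by
  let _ := FLD.top S
  exact continuous_induced_dom

theorem isTopOperad_FLD1 : IsTopOperad FLD1 FLD1.top where
  isOperad := isOperad_FLD1
  continuous_relabel {S T} _ _ σ := by
    let _ := FLD.top S
    let _ := FLD.top T
    let _ := FLD1.top S
    exact continuous_induced_rng.2 ((isTopOperad_FLD.continuous_relabel σ).comp
      continuous_FLD1_val)
  continuous_comp {S S'} _ _ s := by
    let _ := FLD.top S
    let _ := FLD.top S'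
    let _ := FLD.top (Ins s S')
    let _ := FLD1.top S
    let _ := FLD1.top S'
    exact continuous_induced_rng.2 ((isTopOperad_FLD.continuous_comp s).comp
      ((continuous_FLD1_val.comp continuous_fst).prodMk
        (continuous_FLD1_val.comp continuous_snd)))

theorem isTopOperadHom_fld1ToFLD : IsTopOperadHom FLD1.top FLD.top fld1ToFLD where
  isOperadHom := ⟨fun _ _ => rfl, rfl, fun _ _ _ => rfl⟩
  continuous S _ := by
    let _ := FLD.top S
    exact continuous_induced_dom

theorem isTopOperadHom_fld1ToAnTriv : IsTopOperadHom FLD1.top AnTriv.top fld1ToAnTriv where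
  isOperadHom := ⟨fun _ _ => rfl, rfl, fun _ _ _ => rfl⟩
  continuous S _ := by
    let _ := FLD.top S
    let _ := FLD1.top S
    exact continuous_AnTriv_iff.2 (continuous_FLD_val.comp continuous_FLD1_val)

/-! ### The maps to the trivialized little disks operad -/

theorem corolla_abs [Nonempty S] (x : S → ℂ × ℂ) : (corolla x).abs = x :=
  funext fun _ => abs_eq (Pos.input ⟨Sum.inr_ne_inl, rfl⟩)

theorem corolla_pos [Nonempty S] (x : S → ℂ × ℂ) (s : S) :
    (corolla x).Pos (Sum.inl ()) (Sum.inr s) (x s) := Pos.input ⟨Sum.inr_ne_inl, rfl⟩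

/-- A decorated tree in which the leaves have the positions `x` relative to the root has the
coordinates of the corolla `x`. -/
theorem coord_eq_corolla [Nonempty S] {x : S → ℂ × ℂ} (hx : (corolla x).Good) {Z : DTree S}
    (h : Z.abs = x) : Z.coord = (corolla x).coord := by
  refine (Sim.coord_eq (fun _ _ => ⟨Z.root, (0, 1), one_ne_zero, fun _ => ⟨rfl, rfl⟩,
    fun s p hp => ?_⟩) hx).symm
  rw [one_odot, hp.unique (corolla_pos x s), ← h]
  exact Z.pos_abs s

variable [Finite S] [Finite S'] [Finite T]

/-- The map `fldToMbar`, with values in `MbarObj S`. -/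
abbrev kmap (x : FLD.obj S) : MbarObj S := fldToMbarObj S x

/-- The map `antrivToMbar`, with values in `MbarObj S`. -/
noncomputable abbrev lmap (x : AnTriv.obj S) : MbarObj S := antrivToMbar S x

theorem crd_kmap_abs (x : FLD.obj S) : (crd (kmap x)).1 = x.1 :=
  have := x.2.1
  corolla_abs x.1

theorem eq_kmap {z : MbarObj S} {x : FLD.obj S} (h : (crd z).1 = x.1) : z = kmap x := by
  have := x.2.1
  obtain ⟨Z, hZ, rfl⟩ := exists_toMbar z
  exact crd_injective (coord_eq_corolla
    (corolla_valid x.2.2.1 x.2.2.2.1 x.2.2.2.2).good h)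

theorem mbar_ext_of_subsingleton [Subsingleton S] {z z' : MbarObj S}
    (h : (crd z).1 = (crd z').1) : z = z' := by
  refine crd_injective (Prod.ext h (Prod.ext ?_ ?_))
  · funext s t
    rw [Subsingleton.elim t s, crd_rho_self, crd_rho_self]
  · funext s t u
    rw [Subsingleton.elim t s, Subsingleton.elim u s, crd_tri_self, crd_tri_self]

omit [Finite S] in
theorem annulus0_pos [Nonempty S] (p : ℂ × ℂ) (s : S) :
    (annulus0 p).Pos (Sum.inl (annulus0 (S := S) p).root) (Sum.inr s) p := by
  have h1 : (annulus0 (S := S) p).Pos (Sum.inl false) (Sum.inl true) p :=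
    Pos.input ⟨by simp [annulus0], rfl⟩
  have h2 : (annulus0 (S := S) p).Pos (Sum.inl true) (Sum.inr s) (0, 1) :=
    Pos.input ⟨Sum.inr_ne_inl, rfl⟩
  have h := h1.trans h2
  rw [odot_one] at h
  exact h

theorem crd_lmap_abs (x : AnTriv.obj S) : (crd (lmap x)).1 = x.1 := by
  have hS : Subsingleton S := (Nat.card_eq_one_iff_unique.1 x.2.1).1
  have hS' : Nonempty S := (Nat.card_eq_one_iff_unique.1 x.2.1).2
  by_cases h : (x.1 (Classical.arbitrary S)).2 = 0
  · have e : lmap x = toMbar (annulus0 (x.1 (Classical.arbitrary S)))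
        (annulus0_valid x.2.1 (x.2.2.2 _) h) := dif_pos h
    rw [e]
    funext s
    refine (abs_eq (annulus0_pos _ s)).trans ?_
    rw [Subsingleton.elim s]
  · have e : lmap x = toMbar (corolla x.1) (corolla_valid x.2.2.1
      (fun s => by rwa [Subsingleton.elim s (Classical.arbitrary S)]) x.2.2.2) := dif_neg h
    rw [e]
    exact corolla_abs x.1

theorem isOperadHom_fldToMbar : IsOperadHom fldToMbar where
  map_relabel σ x := by
    refine (eq_kmap ?_).symm
    rw [show crd (Mbar.relabel σ (fldToMbar _ x)) = _ from crd_relabel σ (kmap x)]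
    funext t
    exact congrFun (crd_kmap_abs x) _
  map_one := rfl
  map_comp s x y := by
    refine (eq_kmap ?_).symm
    rw [show crd (Mbar.comp s (fldToMbar _ x) (fldToMbar _ y)) = _ from
      crd_comp s (kmap x) (kmap y)]
    simp only [Coord.comp, crd_kmap_abs]
    rfl

theorem isOperadHom_antrivToMbar : IsOperadHom antrivToMbar where
  map_relabel {S T} _ _ σ x := by
    have : Subsingleton T := (Nat.card_eq_one_iff_unique.1 (AnTriv.relabel σ x).2.1).1
    refine mbar_ext_of_subsingleton (z := lmap (AnTriv.relabel σ x)) (z' := mrelabel σ (lmap x)) ?_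
    rw [crd_relabel]
    funext t
    simp only [Coord.relabel, crd_lmap_abs]
    rfl
  map_one := by
    refine mbar_ext_of_subsingleton (z := lmap AnTriv.one) (z' := kmap FLD.one) ?_
    rw [crd_lmap_abs, crd_kmap_abs]
    rfl
  map_comp {S S'} _ _ s x y := by
    have : Subsingleton (Ins s S') := (Nat.card_eq_one_iff_unique.1 (AnTriv.comp s x y).2.1).1
    refine mbar_ext_of_subsingleton (z := lmap (AnTriv.comp s x y))
      (z' := mcomp s (lmap x) (lmap y)) ?_
    rw [crd_comp]
    simp only [Coord.comp, crd_lmap_abs]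
    rfl

theorem fld1_comm (a : FLD1.obj S) : fldToMbar S (fld1ToFLD S a) = antrivToMbar S (fld1ToAnTriv S a) := by
  have : Subsingleton S := (Nat.card_eq_one_iff_unique.1 a.2).1
  refine mbar_ext_of_subsingleton (z := kmap (fld1ToFLD S a)) (z' := lmap (fld1ToAnTriv S a)) ?_
  rw [crd_kmap_abs, crd_lmap_abs]
  rfl

theorem fldToMbar_injective : Function.Injective (fldToMbar S) := fun x y h =>
  Subtype.ext ((crd_kmap_abs x).symm.trans ((congrArg (fun z => (crd z).1) h).trans
    (crd_kmap_abs y)))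

theorem antrivToMbar_injective : Function.Injective (antrivToMbar S) := fun x y h =>
  Subtype.ext ((crd_lmap_abs x).symm.trans ((congrArg (fun z => (crd z).1) h).trans
    (crd_lmap_abs y)))

theorem crd_kmap_rho (x : FLD.obj S) {s t : S} (h : s ≠ t) :
    (crd (kmap x)).2.1 s t = (x.1 s).2 / ((x.1 s).1 - (x.1 t).1) :=
  have := x.2.1
  rho_eq (corolla_pos x.1 s) (corolla_pos x.1 t) (Apart.ne (x.2.2.1 s t h))

theorem crd_kmap_tri (x : FLD.obj S) {s t u : S} (h : ¬ (t = s ∧ u = s)) :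
    ¬ ((x.1 s).1 - (x.1 t).1 = 0 ∧ (x.1 s).1 - (x.1 u).1 = 0) ∧ (crd (kmap x)).2.2 s t u =
      bl ((x.1 s).1 - (x.1 t).1) ((x.1 s).1 - (x.1 u).1) := by
  have := x.2.1
  have h' : ¬ ((x.1 s).1 - (x.1 t).1 = 0 ∧ (x.1 s).1 - (x.1 u).1 = 0) := by
    rintro ⟨h1, h2⟩
    refine h ⟨?_, ?_⟩
    · by_contra e
      exact (Apart.ne (x.2.2.1 s t (Ne.symm e))) (sub_eq_zero.1 h1)
    · by_contra e
      exact (Apart.ne (x.2.2.1 s u (Ne.symm e))) (sub_eq_zero.1 h2)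
  exact ⟨h', tri_eq (corolla_pos x.1 s) (corolla_pos x.1 t) (corolla_pos x.1 u) h'⟩

theorem continuous_kmap : @Continuous _ _ (FLD.top S) _ (kmap (S := S)) := by
  let _ := FLD.top S
  have hx : ∀ s, Continuous fun x : FLD.obj S => x.1 s := fun s =>
    (continuous_apply s).comp continuous_FLD_val
  refine continuous_mbar_iff.2 ⟨fun s => ?_, fun s t => ?_, fun s t u => ?_⟩
  · simp only [crd_kmap_abs]
    exact hx s
  · by_cases h : s = t
    · subst h
      simp only [crd_rho_self]
      exact continuous_const
    · simp only [crd_kmap_rho _ h]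
      exact Continuous.div (continuous_snd.comp (hx s))
        ((continuous_fst.comp (hx s)).sub (continuous_fst.comp (hx t)))
        fun x => sub_ne_zero.2 (Apart.ne (x.2.2.1 s t h))
  · by_cases h : t = s ∧ u = s
    · rw [h.1, h.2]
      simp only [crd_tri_self]
      exact continuous_const
    · simp only [fun x : FLD.obj S => (crd_kmap_tri x h).2]
      exact continuous_bl ((continuous_fst.comp (hx s)).sub (continuous_fst.comp (hx t)))
        ((continuous_fst.comp (hx s)).sub (continuous_fst.comp (hx u)))
        fun x => (crd_kmap_tri x h).1

theorem continuous_lmap : @Continuous _ _ (AnTriv.top S) _ (lmap (S := S)) := by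
  let _ := AnTriv.top S
  have hx : ∀ s, Continuous fun x : AnTriv.obj S => x.1 s := fun s =>
    (continuous_apply s).comp continuous_AnTriv_val
  refine continuous_iff_continuousAt.2 fun x => ?_
  have hS : Subsingleton S := (Nat.card_eq_one_iff_unique.1 x.2.1).1
  refine Continuous.continuousAt (continuous_mbar_iff.2
    ⟨fun s => ?_, fun s t => ?_, fun s t u => ?_⟩)
  · simp only [crd_lmap_abs]
    exact hx s
  · simp only [Subsingleton.elim t s, crd_rho_self]
    exact continuous_const
  · simp only [Subsingleton.elim t s, Subsingleton.elim u s, crd_tri_self]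
    exact continuous_const

/-- The topology of the trivialized little disks operad. -/
@[reducible] noncomputable def Mbar.top : OperadTop Mbar := fun S _ => inferInstanceAs (TopologicalSpace (MbarObj S))

theorem isTopOperadHom_fldToMbar : IsTopOperadHom FLD.top Mbar.top fldToMbar :=
  ⟨isOperadHom_fldToMbar, fun _ _ => continuous_kmap⟩

theorem isTopOperadHom_antrivToMbar : IsTopOperadHom AnTriv.top Mbar.top antrivToMbar :=
  ⟨isOperadHom_antrivToMbar, fun _ _ => continuous_lmap⟩

instance : T2Space (MbarObj S) :=
  T2Space.of_injective_continuous crd_injective continuous_crd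

/-- Elements in which all leaves have positive radius are configurations of disks. -/
theorem exists_kmap {z : MbarObj S} (h : ∀ s, ((crd z).1 s).2 ≠ 0) : ∃ x, z = kmap x := by
  obtain ⟨Z, hZ, rfl⟩ := exists_toMbar z
  have hne : Nonempty S := by
    obtain ⟨s, -⟩ := Z.exists_leaf_above (Sum.inl Z.root)
    exact ⟨s⟩
  have hs : ∀ s, Z.succ (Sum.inr s) = Z.root := fun s => hZ.abs_snd_ne.1 (h s)
  have ha : ∀ s, Z.abs s = Z.dec (Sum.inr s) := fun s =>
    abs_eq (Pos.input ⟨Sum.inr_ne_inl, hs s⟩)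
  refine ⟨⟨Z.abs, hne, fun s t hst => ?_, h, fun s => hZ.good.abs_inDisk (Z.pos_abs s)⟩,
    eq_kmap rfl⟩
  rw [ha, ha]
  exact hZ.good.apart Sum.inr_ne_inl Sum.inr_ne_inl (fun e => hst (Sum.inr_injective e))
    ((hs s).trans (hs t).symm)

end

end TrivDisks

namespace TrivDisks
open scoped ComplexConjugate
open Topology Filter

namespace DTree

variable {S : Type} {X : DTree S}

/-! ### Contraction of the internal edges of positive radius -/

theorem nearlyStable_contract (hX : X.NearlyStable) {w : X.V} (hw : w ≠ X.root) :
    (X.contract w hw).NearlyStable := by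
  have h1 : ∀ {x : {a : X.V // a ≠ w} ⊕ S}, X.succ (incl w x) = w →
      ((X.contract w hw).succ x).1 = X.succ (Sum.inl w) := fun h => contractSucc_eq (hw := hw) h
  have h2 : ∀ {x : {a : X.V // a ≠ w} ⊕ S}, X.succ (incl w x) ≠ w →
      ((X.contract w hw).succ x).1 = X.succ (incl w x) := fun h => contractSucc_ne (hw := hw) h
  have hin : ∀ {z : {a : X.V // a ≠ w} ⊕ S} {b : {a : X.V // a ≠ w}} {c : X.V},
      z ≠ Sum.inl ⟨X.root, hw.symm⟩ → ((X.contract w hw).succ z).1 = c → c = b.1 →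
      (X.contract w hw).IsInput z b := fun h1 h2 h3 => ⟨h1, Subtype.ext (h2.trans h3)⟩
  -- the inputs of `w` are inputs of its successor in the contracted tree
  have hup : ∀ y, X.IsInput y w → ∃ z, z ≠ Sum.inl ⟨X.root, hw.symm⟩ ∧ incl w z = y :=
    fun y hy => exists_incl hw (fun e => X.succ_ne hw (by rw [← e]; exact hy.2)) hy.1
  rintro b ⟨z, hz, hu⟩
  have hz2 : ((X.contract w hw).succ z).1 = b.1 := congrArg Subtype.val hz.2
  by_cases hzw : X.succ (incl w z) = w
  · -- `b` is the successor of `w`, and `z` is the only input of `w`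
    have hbw := (h1 hzw).symm.trans hz2
    have hb : X.Bivalent w := by
      refine ⟨incl w z, ⟨incl_ne_root hw hz.1, hzw⟩, fun y hy => ?_⟩
      obtain ⟨z', k, rfl⟩ := hup y hy
      rw [hu z' (hin k (h1 hy.2) hbw)]
    rcases hX w hb with e | ⟨s, hs⟩
    · exact absurd e hw
    · exact Or.inr ⟨s, Subtype.ext ((h1 (x := Sum.inr s) hs).trans hbw)⟩
  · have hzb := (h2 hzw).symm.trans hz2
    by_cases hbw : b.1 = X.succ (Sum.inl w)
    · -- an input of `w` would be another input of `b`
      obtain ⟨y, hy⟩ := X.input w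
      obtain ⟨z', k, rfl⟩ := hup y hy
      have := hu z' (hin k (h1 hy.2) hbw.symm)
      rw [this] at hy
      exact absurd hy.2 hzw
    · have hb : X.Bivalent b.1 := by
        refine ⟨incl w z, ⟨incl_ne_root hw hz.1, hzb⟩, fun y hy => ?_⟩
        obtain ⟨z', k, rfl⟩ := exists_incl hw (y := y)
          (fun e => hbw (by rw [← e]; exact hy.2.symm)) hy.1
        rw [hu z' (hin k (h2 (hy.2.trans_ne b.2)) hy.2)]
      rcases hX b.1 hb with e | ⟨s, hs⟩
      · exact Or.inl (Subtype.ext e)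
      · exact Or.inr ⟨s, Subtype.ext ((h2 (x := Sum.inr s) (hs.trans_ne b.2)).trans hs)⟩

theorem exists_contracts (n : ℕ) : ∀ {X : DTree S}, Nat.card X.V = n → X.Good → X.NearlyStable →
    ∃ Y : DTree S, Y.Valid ∧ Relation.ReflTransGen Contracts X Y ∧ Y.coord = X.coord := by
  induction n with
  | zero =>
    intro X hn _ _
    have := X.finite
    have : Nonempty X.V := ⟨X.root⟩
    exact absurd hn Nat.card_pos.ne'
  | succ n ih =>
    intro X hn hX hs
    have := X.finite
    by_cases h : ∃ w, w ≠ X.root ∧ (X.dec (Sum.inl w)).2 ≠ 0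
    · obtain ⟨w, hw, h0⟩ := h
      have hc : Nat.card (X.contract w hw).V = n := by
        change Nat.card {a : X.V // a ≠ w} = n
        classical
        have h2 := Nat.card_congr (Equiv.optionSubtypeNe w)
        rw [Finite.card_option] at h2
        omega
      obtain ⟨Y, h1, h2, h3⟩ := ih hc (hX.contract hw h0) (nearlyStable_contract hs hw)
      exact ⟨Y, h1, Relation.ReflTransGen.head ⟨w, hw, h0, rfl⟩ h2,
        h3.trans ((sim_contract hw (Or.inl h0)).coord_eq hX).symm⟩
    · push Not at h
      exact ⟨X, valid_iff.2 ⟨hs, hX.aug, h⟩, Relation.ReflTransGen.refl, rfl⟩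

theorem Contracts.coord_eq {X Y : DTree S} (h : Relation.ReflTransGen Contracts X Y) (hX : X.Good) :
    Y.coord = X.coord := by
  suffices Y.Good ∧ Y.coord = X.coord from this.2
  induction h with
  | refl => exact ⟨hX, rfl⟩
  | tail _ h ih =>
    obtain ⟨w, hw, h0, rfl⟩ := h
    exact ⟨ih.1.contract hw h0, ((sim_contract hw (Or.inl h0)).coord_eq ih.1).symm.trans ih.2⟩

theorem Good.exists_mbar (hX : X.Good) (hs : X.NearlyStable) : ∃ x : MbarObj S, crd x = X.coord := by
  obtain ⟨Y, h1, -, h3⟩ := exists_contracts _ rfl hX hs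
  exact ⟨toMbar Y h1, h3⟩

/-! ### Continuity of the coordinates in the decorations -/

/-- The tree `X` with other decorations. -/
abbrev withDec (X : DTree S) (d : X.V ⊕ S → ℂ × ℂ) : DTree S := { X with dec := d }

theorem Pos.exists_continuous {y x : X.V ⊕ S} {p : ℂ × ℂ} (h : X.Pos y x p) :
    ∃ F : (X.V ⊕ S → ℂ × ℂ) → ℂ × ℂ, Continuous F ∧ ∀ d, (X.withDec d).Pos y x (F d) := by
  induction h with
  | refl => exact ⟨fun _ => (0, 1), continuous_const, fun _ => Pos.refl⟩
  | @step x p hx h ih =>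
    obtain ⟨F, h1, h2⟩ := ih
    refine ⟨fun d => odot (F d) (d x), ?_, fun d => Pos.step (X := X.withDec d) hx (h2 d)⟩
    simp only [odot]
    fun_prop

/-- Near a good tree, each coordinate can be computed at the vertex at which it is computed for
that tree. -/
theorem continuousAt_coord [Finite S] (hX : X.Good) :
    ContinuousAt (fun d => (X.withDec d).coord) X.dec := by
  refine ContinuousAt.prodMk ?_ (ContinuousAt.prodMk ?_ ?_)
  · refine Continuous.continuousAt (continuous_pi fun s => ?_)
    obtain ⟨F, h1, h2⟩ := (X.pos_abs s).exists_continuous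
    rw [show (fun d => (X.withDec d).abs s) = F from funext fun d => abs_eq (h2 d)]
    exact h1
  · refine continuousAt_pi.2 fun s => continuousAt_pi.2 fun t => ?_
    by_cases e : s = t
    · subst e
      simp only [rho_self]
      exact continuousAt_const
    · obtain ⟨a, p, q, h1, h2, h3⟩ := hX.exists_split_pair e
      obtain ⟨F, f1, f2⟩ := h1.exists_continuous
      obtain ⟨G, g1, g2⟩ := h2.exists_continuous
      have hne : (F X.dec).1 - (G X.dec).1 ≠ 0 := by
        rw [(f2 X.dec).unique h1, (g2 X.dec).unique h2]
        exact sub_ne_zero.2 h3.ne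
      have hc : ContinuousAt (fun d => (F d).1 - (G d).1) X.dec := by fun_prop
      have h : ContinuousAt (fun d => (F d).2 / ((F d).1 - (G d).1)) X.dec :=
        ContinuousAt.div (by fun_prop) hc hne
      refine h.congr ?_
      filter_upwards [hc.eventually_ne hne] with d hd
      exact (rho_eq (f2 d) (g2 d) (sub_ne_zero.1 hd)).symm
  · refine continuousAt_pi.2 fun s => continuousAt_pi.2 fun t => continuousAt_pi.2 fun u => ?_
    by_cases e : t = s ∧ u = s
    · obtain ⟨rfl, rfl⟩ := e
      simp only [tri_self]
      exact continuousAt_const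
    · obtain ⟨a, p, q, r, h1, h2, h3, h4⟩ := hX.exists_split_triple e
      obtain ⟨F, f1, f2⟩ := h1.exists_continuous
      obtain ⟨G, g1, g2⟩ := h2.exists_continuous
      obtain ⟨H, k1, k2⟩ := h3.exists_continuous
      have hne : ¬ ((F X.dec).1 - (G X.dec).1 = 0 ∧ (F X.dec).1 - (H X.dec).1 = 0) := by
        rwa [(f2 X.dec).unique h1, (g2 X.dec).unique h2, (k2 X.dec).unique h3]
      have hc : ContinuousAt (fun d => (F d).1 - (G d).1) X.dec := by fun_prop
      have hc' : ContinuousAt (fun d => (F d).1 - (H d).1) X.dec := by fun_prop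
      have h : ContinuousAt (fun d => bl ((F d).1 - (G d).1) ((F d).1 - (H d).1)) X.dec :=
        ContinuousAt.comp (f := fun d => ((F d).1 - (G d).1, (F d).1 - (H d).1))
          (continuousAt_bl (p := (_, _)) hne) (hc.prodMk hc')
      refine h.congr ?_
      have hev : ∀ᶠ d in 𝓝 X.dec, ¬ ((F d).1 - (G d).1 = 0 ∧ (F d).1 - (H d).1 = 0) := by
        by_cases h0 : (F X.dec).1 - (G X.dec).1 = 0
        · filter_upwards [hc'.eventually_ne fun h => hne ⟨h0, h⟩] with d hd h using hd h.2
        · filter_upwards [hc.eventually_ne h0] with d hd h using hd h.1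
      filter_upwards [hev] with d hd
      exact (tri_eq (f2 d) (g2 d) (k2 d) hd).symm

/-! ### Reassembling a pruned tree -/

/-- The tree with two vertices in which the root is decorated by `(0, q)` and the other vertex,
which carries all leaves, by `u`. -/
def thick [hS : Nonempty S] (q : ℂ) (u : S → ℂ × ℂ) : DTree S where
  V := Bool
  finite := inferInstance
  root := false
  succ := Sum.elim (fun _ => false) (fun _ => true)
  acyclic := ⟨fun b => if b then 1 else 0, fun b h => by cases b <;> simp_all⟩
  input
    | false => ⟨Sum.inl true, by simp, rfl⟩
    | true => hS.elim fun s => ⟨Sum.inr s, Sum.inr_ne_inl, rfl⟩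
  dec := Sum.elim (fun _ => (0, q)) u

theorem thick_pos [Nonempty S] (q : ℂ) (u : S → ℂ × ℂ) (s : S) :
    (thick q u).Pos (Sum.inl true) (Sum.inr s) (u s) := Pos.input ⟨Sum.inr_ne_inl, rfl⟩

theorem thick_pos_root [Nonempty S] (q : ℂ) (u : S → ℂ × ℂ) (s : S) :
    (thick q u).Pos (Sum.inl (thick q u).root) (Sum.inr s) (odot (0, q) (u s)) := by
  have h1 : (thick q u).Pos (Sum.inl false) (Sum.inl true) (0, q) :=
    Pos.input ⟨by simp [thick], rfl⟩
  exact h1.trans (thick_pos q u s)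

theorem thick_good [Nonempty S] {q : ℂ} (hq : ‖q‖ ≤ 1) {u : S → ℂ × ℂ} (h1 : u ∈ Conf0 S)
    (h2 : ∀ s, (u s).2 ≠ 0) (h3 : ∀ s, u s ∈ InDisk) : (thick q u).Good := by
  refine ⟨aug_iff.2 ⟨?_, h2, ?_⟩, ?_⟩
  · rintro (a | s) (b | t) hx hy hxy e
    · cases a
      · exact absurd rfl hx
      · cases b
        · exact absurd rfl hy
        · exact absurd rfl hxy
    · exact absurd e Bool.false_ne_true
    · exact absurd e.symm Bool.false_ne_true
    · exact h1 s t fun e => hxy (congrArg Sum.inr e)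
  · rintro (a | s) hx e
    · have : ‖(0 : ℂ)‖ + ‖q‖ ≤ 1 := by simpa using hq
      exact ⟨this, fun h => absurd rfl h⟩
    · exact absurd e.symm Bool.false_ne_true
  · rintro b hb - (a | s) hx e
    · cases b
      · exact absurd rfl hb
      · exact absurd e Bool.false_ne_true
    · exact h3 s

end DTree

open DTree

section

variable {S : Type} {P : OperadData.{u}}

/-- The action of `P(1)` on `P(S)` by composition on the left. -/
def OperadData.act [Finite S] (P : OperadData.{u}) (a : P.obj Unit) (x : P.obj S) : P.obj S :=
  P.relabel (Ins.left S) (P.comp () a x)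

/-- The leaf of the original tree that a leaf of the reassembled tree stands for. -/
def collapseFun (A : Set S) : Ins (tip A) A → S
  | Sum.inl ⟨Sum.inl s, _⟩ => s.1
  | Sum.inl ⟨Sum.inr _, h⟩ => (h rfl).elim
  | Sum.inr a => a.1

/-- Inserting the elements of `A` for the leaf to which they were collapsed gives back `S`. -/
noncomputable def collapseEquiv (A : Set S) : Ins (tip A) A ≃ S :=
  Equiv.ofBijective (collapseFun A) (by
    constructor
    · rintro (⟨s | u, h⟩ | a) (⟨t | v, h'⟩ | b) e
      · have : s = t := Subtype.ext e
        subst this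
        rfl
      · exact absurd rfl h'
      · exact absurd (show s.1 ∈ A from (show s.1 = b.1 from e) ▸ b.2) s.2
      · exact absurd rfl h
      · exact absurd rfl h
      · exact absurd rfl h
      · exact absurd (show t.1 ∈ A from (show a.1 = t.1 from e) ▸ a.2) t.2
      · exact absurd rfl h'
      · exact congrArg Sum.inr (Subtype.ext e)
    · intro s
      by_cases hs : s ∈ A
      · exact ⟨Sum.inr ⟨s, hs⟩, rfl⟩
      · exact ⟨Sum.inl ⟨Sum.inl ⟨s, hs⟩, Sum.inl_ne_inr⟩, rfl⟩)

/-- Inserting `y` for the leaf to which the elements of `A` were collapsed. -/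
noncomputable def OperadData.glue [Finite S] (P : OperadData.{u}) (A : Set S)
    (x : P.obj (Collapse A)) (y : P.obj A) : P.obj S :=
  P.relabel (collapseEquiv A) (P.comp (tip A) x y)

end

section

variable {S : Type}

namespace DTree

variable {X : DTree S}

/-- A tree with a terminal vertex is reassembled from the pruned tree and the terminal vertex. -/
theorem coord_eq_reassemble (hX : X.Good) {w : X.V} {A : Set S} (hw : X.Terminal w A)
    [Nonempty A] {c r q : ℂ} (hd : X.dec (Sum.inl w) = (c, r * q)) (hp : X.PruneOK w (c, r))
    (hq : ‖q‖ ≤ 1) (hu : ∀ a ∈ A, X.dec (Sum.inr a) ∈ InDisk) :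
    X.coord = Coord.relabel (collapseEquiv A) (Coord.comp (tip A) (X.prune hw (c, r)).coord
      (thick q fun a : A => X.dec (Sum.inr a.1)).coord) := by
  set u : A → ℂ × ℂ := fun a => X.dec (Sum.inr a.1)
  have hT : (thick q u).Good := by
    refine thick_good hq (fun a b hab => ?_) (fun a => hX.leaf_ne a.1) fun a => hu a.1 a.2
    exact hX.apart Sum.inr_ne_inl Sum.inr_ne_inl
      (fun e => hab (Subtype.ext (Sum.inr_injective e)))
      ((hw.succ_leaf a.2).trans (hw.succ_leaf b.2).symm)
  have hP := hX.prune hw hp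
  rw [← coord_merge hP hT, ← (hP.merge hT (tip A)).coord_relabel]
  refine Sim.coord_eq (fun a _ => ?_) hX
  by_cases ha : a = w
  · subst ha
    refine ⟨mup (tip A) (X.prune hw (c, r)) (thick q u) true (by simp [thick]), (0, 1),
      one_ne_zero, fun e => absurd e hw.1, fun s p hp => ?_⟩
    have hs := hw.mem_of_pos hp
    rw [one_odot, hp.unique (Pos.input ((hw.2 _).2 ⟨s, hs, rfl⟩))]
    exact ((thick_pos q u ⟨s, hs⟩).merge_up (tip A) (X.prune hw (c, r)) _).relabel
      (collapseEquiv A)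
  · refine ⟨mlow (tip A) (X.prune hw (c, r)) (thick q u) ⟨a, ha⟩, (0, 1), one_ne_zero,
      fun e => ⟨by subst e; rfl, rfl⟩, fun s p hp => ?_⟩
    rw [one_odot]
    by_cases hs : s ∈ A
    · obtain ⟨q', h1, rfl⟩ := hw.pos_succ hs ha hp
      have h2 := ((Pos.prune_tip hw (c, r) ha h1).merge_glue
        (thick_pos_root q u ⟨s, hs⟩)).relabel (collapseEquiv A)
      have e : odot (odot q' (X.dec (Sum.inl w))) (X.dec (Sum.inr s)) =
          odot (odot q' (c, r)) (odot (0, q) (u ⟨s, hs⟩)) := by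
        rw [← odot_assoc, odot_assoc q' (c, r), hd]
        simp [odot, u]
      rw [e]
      exact h2
    · have h1 : (X.prune hw (c, r)).Pos (Sum.inl ⟨a, ha⟩)
          (Sum.inr (Sum.inl ⟨s, hs⟩ : Collapse A)) p :=
        Pos.prune hw (c, r) (y := Sum.inl ⟨a, ha⟩) (x := Sum.inr (Sum.inl ⟨s, hs⟩)) hp
          (fun e => Sum.inl_ne_inr (Sum.inr_injective e))
      exact (h1.merge_low (thick q u) Sum.inl_ne_inr).relabel (collapseEquiv A)

theorem thick_coord [Nonempty S] {q : ℂ} {u : S → ℂ × ℂ} (hu : (corolla u).Good) :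
    (thick q u).coord = (fun s => odot (0, q) (u s), (corolla u).rho, (corolla u).tri) := by
  refine Prod.ext (funext fun s => abs_eq (thick_pos_root q u s)) (Prod.ext ?_ ?_)
  · funext s t
    by_cases e : s = t
    · subst e
      exact (rho_self _ s).trans (rho_self _ s).symm
    · obtain ⟨⟨⟩, p, p', h1, h2, h3⟩ := hu.exists_split_pair e
      rw [h1.unique (corolla_pos u s), h2.unique (corolla_pos u t)] at h3
      exact (rho_eq (thick_pos q u s) (thick_pos q u t) h3.ne).trans
        (rho_eq (corolla_pos u s) (corolla_pos u t) h3.ne).symm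
  · funext s t v
    by_cases e : t = s ∧ v = s
    · obtain ⟨rfl, rfl⟩ := e
      exact (tri_self _ _).trans (tri_self _ _).symm
    · obtain ⟨⟨⟩, p, p', p'', h1, h2, h3, h4⟩ := hu.exists_split_triple e
      rw [h1.unique (corolla_pos u s), h2.unique (corolla_pos u t),
        h3.unique (corolla_pos u v)] at h4
      exact (tri_eq (thick_pos q u s) (thick_pos q u t) (thick_pos q u v) h4).trans
        (tri_eq (corolla_pos u s) (corolla_pos u t) (corolla_pos u v) h4).symm

end DTree

variable [Finite S]

/-- The action of annuli on `𝕄̄(S)`, with values in `MbarObj S`. -/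
noncomputable abbrev mact (a : MbarObj Unit) (x : MbarObj S) : MbarObj S := Mbar.act a x

/-- The operation `glue` of `𝕄̄`, with values in `MbarObj S`. -/
noncomputable abbrev mglue (A : Set S) (x : MbarObj (Collapse A)) (y : MbarObj A) : MbarObj S :=
  Mbar.glue A x y

theorem crd_act (a : MbarObj Unit) (x : MbarObj S) : crd (mact a x) =
    (fun s => odot ((crd a).1 ()) ((crd x).1 s), (crd x).2.1, (crd x).2.2) := by
  refine (crd_relabel (Ins.left S) (mcomp () a x)).trans ?_
  rw [crd_comp]
  rfl

theorem crd_glue (A : Set S) (x : MbarObj (Collapse A)) (y : MbarObj A) : crd (mglue A x y) =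
    Coord.relabel (collapseEquiv A) (Coord.comp (tip A) (crd x) (crd y)) :=
  (crd_relabel _ (mcomp (tip A) x y)).trans (congrArg _ (crd_comp _ _ _))

/-- The annulus with center `0` and radius `q`. -/
def annulus (q : ℂ) (hq : ‖q‖ ≤ 1) : AnTriv.obj Unit :=
  ⟨fun _ => (0, q), Nat.card_unique, fun i j h => absurd (Subsingleton.elim i j) h,
    fun _ => ⟨by simpa using hq, fun h => absurd rfl h⟩⟩

theorem crd_act_annulus {q : ℂ} (hq : ‖q‖ ≤ 1) (u : FLD.obj S) :
    have := u.2.1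
    crd (mact (lmap (annulus q hq)) (kmap u)) = (thick q u.1).coord := by
  have := u.2.1
  rw [crd_act, crd_lmap_abs, crd_kmap_abs]
  exact (thick_coord (corolla_valid u.2.2.1 u.2.2.2.1 u.2.2.2.2).good).symm

/-- The configuration at a terminal vertex. -/
def DTree.Good.top {X : DTree S} (hX : X.Good) {w : X.V} {A : Set S} (hw : X.Terminal w A)
    (hu : ∀ a ∈ A, X.dec (Sum.inr a) ∈ InDisk) : FLD.obj A :=
  ⟨fun a => X.dec (Sum.inr a.1), hw.nonempty.to_subtype, fun a b hab =>
    hX.apart Sum.inr_ne_inl Sum.inr_ne_inl (fun e => hab (Subtype.ext (Sum.inr_injective e)))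
      ((hw.succ_leaf a.2).trans (hw.succ_leaf b.2).symm),
    fun a => hX.leaf_ne a.1, fun a => hu a.1 a.2⟩

/-- An element with the coordinates of a tree with a terminal vertex is obtained by gluing a thick
or thin annulus with a configuration of disks into an element with the coordinates of the pruned
tree. -/
theorem eq_glue {X : DTree S} (hX : X.Good) {w : X.V} {A : Set S} (hw : X.Terminal w A)
    {c r q : ℂ} (hd : X.dec (Sum.inl w) = (c, r * q)) (hp : X.PruneOK w (c, r))
    (hq : ‖q‖ ≤ 1) (hu : ∀ a ∈ A, X.dec (Sum.inr a) ∈ InDisk) {x : MbarObj S}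
    (hx : crd x = X.coord) {x0 : MbarObj (Collapse A)} (hx0 : crd x0 = (X.prune hw (c, r)).coord) :
    x = mglue A x0 (mact (lmap (annulus q hq)) (kmap (hX.top hw hu))) := by
  refine crd_injective ?_
  have := hw.nonempty.to_subtype
  rw [hx, crd_glue, hx0, crd_act_annulus]
  exact coord_eq_reassemble hX hw hd hp hq hu

end

end TrivDisks

namespace TrivDisks
open scoped ComplexConjugate
open Topology Filter

/-! ### The diameter of a union of disks -/

section

variable {ι : Type*} [Finite ι]

/-- The diameter of the union of a finite family of disks, as a maximum over pairs of disks. -/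
noncomputable def unionDiam (m : ι → ℂ × ℂ) : ℝ :=
  ⨆ p : ι × ι, (‖(m p.1).1 - (m p.2).1‖ + ‖(m p.1).2‖ + ‖(m p.2).2‖)

theorem le_unionDiam (m : ι → ℂ × ℂ) (i j : ι) :
    ‖(m i).1 - (m j).1‖ + ‖(m i).2‖ + ‖(m j).2‖ ≤ unionDiam m :=
  le_ciSup (f := fun p : ι × ι => ‖(m p.1).1 - (m p.2).1‖ + ‖(m p.1).2‖ + ‖(m p.2).2‖)
    (Finite.bddAbove_range _) (i, j)

omit [Finite ι] in
/-- Affine maps rescale the diameter. -/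
theorem unionDiam_odot (g : ℂ × ℂ) (m : ι → ℂ × ℂ) :
    unionDiam (fun i => odot g (m i)) = ‖g.2‖ * unionDiam m := by
  rw [unionDiam, unionDiam, Real.mul_iSup_of_nonneg (norm_nonneg _)]
  congr 1
  funext p
  rw [odot_fst_sub]
  simp only [odot, norm_mul]
  ring

theorem continuous_unionDiam [Nonempty ι] : Continuous (unionDiam (ι := ι)) := by
  have := Fintype.ofFinite ι
  have e : (unionDiam (ι := ι)) = fun m => Finset.univ.sup' Finset.univ_nonempty
      fun p : ι × ι => (‖(m p.1).1 - (m p.2).1‖ + ‖(m p.1).2‖ + ‖(m p.2).2‖) :=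
    funext fun m => (Finset.sup'_univ_eq_ciSup _).symm
  rw [e]
  exact Continuous.finset_sup'_apply _ fun p _ => by fun_prop

theorem exists_norm_eq_one_mul (z : ℂ) : ∃ w : ℂ, ‖w‖ = 1 ∧ z = ‖z‖ * w := by
  by_cases h : z = 0
  · exact ⟨1, by simp, by simp [h]⟩
  · have h' : (‖z‖ : ℂ) ≠ 0 := by simpa using h
    exact ⟨z / ‖z‖, by simp [h], by field_simp⟩

/-- The maximum is attained at the points of the two disks that are opposite to each other on the
line through the centers. -/
theorem diam_eq_unionDiam [Nonempty ι] (m : ι → ℂ × ℂ) :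
    Metric.diam (⋃ e, Metric.closedBall (m e).1 ‖(m e).2‖) = unionDiam m := by
  have hb : Bornology.IsBounded (⋃ e, Metric.closedBall (m e).1 ‖(m e).2‖) :=
    Bornology.isBounded_iUnion.2 fun _ => Metric.isBounded_closedBall
  refine le_antisymm (Metric.diam_le_of_forall_dist_le ?_ ?_) (ciSup_le ?_)
  · obtain ⟨i⟩ := ‹Nonempty ι›
    exact le_trans (by positivity) (le_unionDiam m i i)
  · intro x hx y hy
    obtain ⟨i, hi⟩ := Set.mem_iUnion.1 hx
    obtain ⟨j, hj⟩ := Set.mem_iUnion.1 hy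
    have h1 := dist_triangle4 x (m i).1 (m j).1 y
    rw [Metric.mem_closedBall] at hi hj
    rw [dist_comm (m j).1 y, dist_eq_norm (m i).1] at h1
    have := le_unionDiam m i j
    linarith
  · rintro ⟨i, j⟩
    obtain ⟨w, hw, hz⟩ := exists_norm_eq_one_mul ((m i).1 - (m j).1)
    have hx : (m i).1 + ‖(m i).2‖ * w ∈ ⋃ e, Metric.closedBall (m e).1 ‖(m e).2‖ :=
      Set.mem_iUnion.2 ⟨i, by simp [hw]⟩
    have hy : (m j).1 - ‖(m j).2‖ * w ∈ ⋃ e, Metric.closedBall (m e).1 ‖(m e).2‖ :=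
      Set.mem_iUnion.2 ⟨j, by simp [hw]⟩
    refine le_of_eq_of_le ?_ (Metric.dist_le_diam_of_mem hb hx hy)
    have e : (m i).1 + ‖(m i).2‖ * w - ((m j).1 - ‖(m j).2‖ * w) =
        ((‖(m i).1 - (m j).1‖ + ‖(m i).2‖ + ‖(m j).2‖ : ℝ) : ℂ) * w := by
      push_cast
      linear_combination hz
    rw [dist_eq_norm, e, norm_mul, hw, mul_one, Complex.norm_real, Real.norm_of_nonneg]
    positivity

end

namespace DTree

variable {S : Type} {X : DTree S}

/-! ### Normalized representatives -/

theorem leafAbove_iff {s : S} {x : X.V ⊕ S} : X.LeafAbove s x ↔ ∃ p, X.Pos x (Sum.inr s) p := by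
  have key : ∀ y, Relation.ReflTransGen
      (fun y y' => y ≠ Sum.inl X.root ∧ y' = Sum.inl (X.succ y)) y x → ∃ p, X.Pos x y p := by
    intro y h
    induction h using Relation.ReflTransGen.head_induction_on with
    | refl => exact ⟨_, Pos.refl⟩
    | head h' _ ih =>
      obtain ⟨p, hp⟩ := ih
      obtain ⟨h1, rfl⟩ := h'
      exact ⟨_, hp.step h1⟩
  refine ⟨key _, ?_⟩
  rintro ⟨p, hp⟩
  unfold RTree.LeafAbove
  generalize Sum.inr s = y at hp
  induction hp with
  | refl => exact Relation.ReflTransGen.refl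
  | step hx _ ih => exact Relation.ReflTransGen.head ⟨hx, rfl⟩ ih

/-- The least leaf above a node. -/
theorem exists_least [Finite S] (X : DTree S) (ord : LinearOrder S) (x : X.V ⊕ S) :
    ∃ s, X.LeafAbove s x ∧ ∀ t, X.LeafAbove t x → ord.le s t := by
  obtain ⟨s, p, hs⟩ := X.exists_leaf_above x
  exact @Set.exists_min_image S S ord {s | X.LeafAbove s x} id (Set.toFinite _)
    ⟨s, leafAbove_iff.2 ⟨p, hs⟩⟩

variable [Finite S] (ord : LinearOrder S)

/-- The least leaf above a node. -/
noncomputable def least (X : DTree S) (x : X.V ⊕ S) : S := (X.exists_least ord x).choose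

theorem leafAbove_least (x : X.V ⊕ S) : X.LeafAbove (X.least ord x) x :=
  (X.exists_least ord x).choose_spec.1

theorem exists_pos_least (x : X.V ⊕ S) : ∃ p, X.Pos x (Sum.inr (X.least ord x)) p :=
  leafAbove_iff.1 (leafAbove_least ord x)

theorem least_leaf (s : S) : X.least ord (Sum.inr s) = s := by
  obtain ⟨p, hp⟩ := X.exists_pos_least ord (Sum.inr s)
  exact (pos_leaf_iff.1 hp).1

theorem before_iff {x y : X.V ⊕ S} :
    X.Before ord x y ↔ ord.lt (X.least ord x) (X.least ord y) := by
  constructor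
  · rintro ⟨s, h1, h2⟩
    exact @lt_of_le_of_lt _ ord.toPreorder _ _ _ ((X.exists_least ord x).choose_spec.2 s h1)
      (h2 _ (leafAbove_least ord y))
  · intro h
    exact ⟨_, leafAbove_least ord x, fun t ht =>
      @lt_of_lt_of_le _ ord.toPreorder _ _ _ h ((X.exists_least ord y).choose_spec.2 t ht)⟩

instance (a : X.V) : Finite (X.E a) :=
  haveI := X.finite
  inferInstanceAs (Finite {x : X.V ⊕ S // X.IsInput x a})

instance (a : X.V) : Nonempty (X.E a) := by
  obtain ⟨x, hx⟩ := X.input a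
  exact ⟨⟨x, hx⟩⟩

omit [Finite S] in
/-- Different incoming edges of a vertex have no node above them in common. -/
theorem eq_of_pos_of_input {a : X.V} {x y : X.V ⊕ S} (hx : X.IsInput x a) (hy : X.IsInput y a)
    {z : X.V ⊕ S} {p q : ℂ × ℂ} (h : X.Pos x z p) (h' : X.Pos y z q) : x = y := by
  have key : ∀ {x y : X.V ⊕ S}, X.IsInput x a → X.IsInput y a → ∀ {k}, X.Pos x y k → x = y := by
    intro x y hx hy k hk
    by_contra hne
    obtain ⟨-, q, h1, -⟩ := hk.of_ne (Ne.symm hne)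
    have h2 := X.ndepth_lt hx.1
    rw [hx.2] at h2
    rw [hy.2] at h1
    exact absurd h1.le (not_le.2 h2)
  rcases h.total h' with ⟨k, hk⟩ | ⟨k, hk⟩
  · exact key hx hy hk
  · exact (key hy hx hk).symm

theorem least_injective {a : X.V} : Function.Injective fun e : X.E a => X.least ord e.1 := by
  intro e e' h
  obtain ⟨p, hp⟩ := X.exists_pos_least ord e.1
  obtain ⟨q, hq⟩ := X.exists_pos_least ord e'.1
  have h : X.least ord e.1 = X.least ord e'.1 := h
  rw [h] at hp
  exact Subtype.ext (eq_of_pos_of_input e.2 e'.2 hp hq)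

/-- The first two incoming edges of a vertex. -/
structure FirstTwo (X : DTree S) (a : X.V) (e₁ e₂ : X.E a) : Prop where
  ne : e₁ ≠ e₂
  first : ∀ e, e ≠ e₁ → X.Before ord e₁.1 e.1
  second : ∀ e, e ≠ e₁ → e ≠ e₂ → X.Before ord e₂.1 e.1

theorem FirstTwo.unique {a : X.V} {e₁ e₂ e₁' e₂' : X.E a} (h : FirstTwo ord X a e₁ e₂)
    (h' : FirstTwo ord X a e₁' e₂') : e₁ = e₁' ∧ e₂ = e₂' := by
  have asymm : ∀ {x y : X.V ⊕ S}, X.Before ord x y → X.Before ord y x → False := by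
    intro x y h1 h2
    rw [before_iff] at h1 h2
    exact @lt_asymm _ ord.toPreorder _ _ h1 h2
  have e1 : e₁ = e₁' := by
    by_contra hne
    exact asymm (h.first _ (Ne.symm hne)) (h'.first _ hne)
  subst e1
  refine ⟨rfl, ?_⟩
  by_contra hne
  exact asymm (h.second _ h'.ne.symm (Ne.symm hne)) (h'.second _ h.ne.symm hne)

theorem exists_edges (X : DTree S) (a : X.V) :
    ∃ e : X.E a × X.E a, ¬ X.Bivalent a → FirstTwo ord X a e.1 e.2 := by
  by_cases hb : X.Bivalent a
  · obtain ⟨e⟩ := (inferInstance : Nonempty (X.E a))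
    exact ⟨(e, e), fun h => absurd hb h⟩
  · have key : ∀ A : Set (X.E a), A.Nonempty → ∃ e ∈ A, ∀ e' ∈ A, e' ≠ e → X.Before ord e.1 e'.1 := by
      intro A hA
      obtain ⟨e, he, hm⟩ := @Set.exists_min_image (X.E a) S ord A (fun e => X.least ord e.1)
        (Set.toFinite _) hA
      refine ⟨e, he, fun e' he' hne => (before_iff ord).2 ?_⟩
      exact @lt_of_le_of_ne _ ord.toPartialOrder _ _ (hm e' he')
        fun h => hne (least_injective ord h).symm
    obtain ⟨e₁, -, h1⟩ := key Set.univ Set.univ_nonempty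
    have hne : {e : X.E a | e ≠ e₁}.Nonempty := by
      by_contra h
      refine hb ⟨e₁.1, e₁.2, fun y hy => ?_⟩
      by_contra hy'
      exact h ⟨⟨y, hy⟩, fun e => hy' (congrArg Subtype.val e)⟩
    obtain ⟨e₂, h2, h3⟩ := key _ hne
    exact ⟨(e₁, e₂), fun _ => ⟨fun h => h2 h.symm, fun e => h1 e trivial,
      fun e he he' => h3 e he he'⟩⟩

/-- The first incoming edge of a vertex (any edge, if there is only one). -/
noncomputable def edge₁ (X : DTree S) (a : X.V) : X.E a := (exists_edges ord X a).choose.1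

/-- The second incoming edge of a vertex (any edge, if there is only one). -/
noncomputable def edge₂ (X : DTree S) (a : X.V) : X.E a := (exists_edges ord X a).choose.2

theorem firstTwo {a : X.V} (h : ¬ X.Bivalent a) :
    FirstTwo ord X a (X.edge₁ ord a) (X.edge₂ ord a) := (exists_edges ord X a).choose_spec h

theorem normalized_iff {a : X.V} {m : X.E a → ℂ × ℂ} : X.Normalized ord a m ↔
    (X.Bivalent a → ∀ e, m e = (0, 1)) ∧ (¬ X.Bivalent a → (m (X.edge₁ ord a)).1 = 0 ∧
      (m (X.edge₂ ord a)).1.im = 0 ∧ 0 < (m (X.edge₂ ord a)).1.re ∧ unionDiam m = 1 / 2) := by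
  unfold RTree.Normalized
  rw [diam_eq_unionDiam]
  refine and_congr_right fun _ => ⟨fun h hb => ?_, fun h e₁ e₂ h1 h2 h3 => ?_⟩
  · have := firstTwo ord hb
    exact h _ _ this.ne this.first this.second
  · have hb : ¬ X.Bivalent a := by
      rintro ⟨x, _, hx⟩
      exact h1 (Subtype.ext ((hx _ e₁.2).trans (hx _ e₂.2).symm))
    obtain ⟨rfl, rfl⟩ := FirstTwo.unique ord ⟨h1, h2, h3⟩ (firstTwo ord hb)
    exact h hb

theorem eq_edge₁ {a : X.V} (h : X.Bivalent a) (e : X.E a) : e = X.edge₁ ord a := by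
  obtain ⟨x, _, hx⟩ := h
  exact Subtype.ext ((hx _ e.2).trans (hx _ (X.edge₁ ord a).2).symm)

theorem normalized_inDisk {a : X.V} {m : X.E a → ℂ × ℂ} (h : X.Normalized ord a m) (e : X.E a) :
    m e ∈ InDisk := by
  obtain ⟨h1, h2⟩ := (normalized_iff ord).1 h
  by_cases hb : X.Bivalent a
  · rw [h1 hb]
    exact one_inDisk
  · obtain ⟨h3, -, -, h4⟩ := h2 hb
    have h5 := le_unionDiam m e (X.edge₁ ord a)
    rw [h3, h4, sub_zero] at h5
    have h6 := norm_nonneg (m (X.edge₁ ord a)).2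
    exact ⟨by linarith, fun _ => by linarith⟩

/-- The linear part of the affine map that normalizes a configuration whose first two centers
differ by `c` and whose disks have a union of diameter `D`. -/
noncomputable def normScale (c : ℂ) (D : ℝ) : ℂ := (‖c‖ : ℂ) / c / (2 * D : ℝ)

open Classical in
/-- The affine map that normalizes a configuration. -/
noncomputable def normAff (X : DTree S) (a : X.V) (m : X.E a → ℂ × ℂ) : ℂ × ℂ :=
  if a = X.root then (0, 1) else if X.Bivalent a then oinv (m (X.edge₁ ord a)) else
    (-(normScale ((m (X.edge₂ ord a)).1 - (m (X.edge₁ ord a)).1) (unionDiam m) *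
      (m (X.edge₁ ord a)).1),
      normScale ((m (X.edge₂ ord a)).1 - (m (X.edge₁ ord a)).1) (unionDiam m))

/-- The normalized representative of a configuration. -/
noncomputable def normConf (X : DTree S) (a : X.V) (m : X.E a → ℂ × ℂ) : X.E a → ℂ × ℂ :=
  fun e => odot (X.normAff ord a m) (m e)

theorem normAff_root (m : X.E X.root → ℂ × ℂ) : X.normAff ord X.root m = (0, 1) := if_pos rfl

theorem normAff_bivalent {a : X.V} (ha : a ≠ X.root) (hb : X.Bivalent a) (m : X.E a → ℂ × ℂ) :
    X.normAff ord a m = oinv (m (X.edge₁ ord a)) := by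
  rw [normAff, if_neg ha, if_pos hb]

theorem normAff_eq {a : X.V} (ha : a ≠ X.root) (hb : ¬ X.Bivalent a) (m : X.E a → ℂ × ℂ) :
    X.normAff ord a m =
    (-(normScale ((m (X.edge₂ ord a)).1 - (m (X.edge₁ ord a)).1) (unionDiam m) *
      (m (X.edge₁ ord a)).1),
      normScale ((m (X.edge₂ ord a)).1 - (m (X.edge₁ ord a)).1) (unionDiam m)) := by
  rw [normAff, if_neg ha, if_neg hb]

theorem edge_ne {a : X.V} (hb : ¬ X.Bivalent a) {m : X.E a → ℂ × ℂ} (hm : m ∈ Conf0 (X.E a)) :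
    (m (X.edge₂ ord a)).1 - (m (X.edge₁ ord a)).1 ≠ 0 :=
  sub_ne_zero.2 (Apart.ne (hm _ _ (firstTwo ord hb).ne.symm))

theorem unionDiam_pos (ord : LinearOrder S) {a : X.V} (hb : ¬ X.Bivalent a) {m : X.E a → ℂ × ℂ}
    (hm : m ∈ Conf0 (X.E a)) : 0 < unionDiam m := by
  have h1 := le_unionDiam m (X.edge₂ ord a) (X.edge₁ ord a)
  have h2 := norm_pos_iff.2 (edge_ne ord hb hm)
  have := norm_nonneg (m (X.edge₂ ord a)).2
  have := norm_nonneg (m (X.edge₁ ord a)).2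
  linarith

/-- At a bivalent vertex other than the root, the single incoming edge is external by near
stability, so its radius is not zero. -/
theorem edge₁_snd_ne (hX : X.NearlyStable) {a : X.V} (ha : a ≠ X.root) (hb : X.Bivalent a)
    {m : X.E a → ℂ × ℂ} (hm : m ∈ X.AugConf a) : (m (X.edge₁ ord a)).2 ≠ 0 := by
  obtain ⟨s, hs⟩ := (hX a hb).resolve_left ha
  exact hm.2.1 _ s (congrArg Subtype.val (eq_edge₁ ord hb ⟨Sum.inr s, Sum.inr_ne_inl, hs⟩)).symm

theorem normScale_ne {c : ℂ} {D : ℝ} (hc : c ≠ 0) (hD : 0 < D) : normScale c D ≠ 0 := by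
  unfold normScale
  refine div_ne_zero (div_ne_zero (by simpa using hc) hc) ?_
  exact_mod_cast (by positivity : 2 * D ≠ 0)

theorem norm_normScale {c : ℂ} {D : ℝ} (hc : c ≠ 0) (hD : 0 < D) : ‖normScale c D‖ = 1 / (2 * D) := by
  have h : ‖c‖ ≠ 0 := norm_ne_zero_iff.2 hc
  rw [normScale, norm_div, norm_div, Complex.norm_real, Complex.norm_real, norm_norm, div_self h,
    Real.norm_of_nonneg (by positivity)]

theorem normScale_mul {c : ℂ} {D : ℝ} (hc : c ≠ 0) :
    normScale c D * c = ((‖c‖ / (2 * D) : ℝ) : ℂ) := by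
  unfold normScale
  push_cast
  field_simp

theorem normAff_snd_ne (hX : X.NearlyStable) (a : X.V) {m : X.E a → ℂ × ℂ}
    (hm : m ∈ X.AugConf a) : (X.normAff ord a m).2 ≠ 0 := by
  by_cases ha : a = X.root
  · subst ha
    rw [normAff_root]
    exact one_ne_zero
  · by_cases hb : X.Bivalent a
    · rw [normAff_bivalent ord ha hb]
      exact oinv_snd_ne (edge₁_snd_ne ord hX ha hb hm)
    · rw [normAff_eq ord ha hb]
      exact normScale_ne (edge_ne ord hb hm.1) (unionDiam_pos ord hb hm.1)

theorem normConf_root (m : X.E X.root → ℂ × ℂ) : X.normConf ord X.root m = m := by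
  funext e
  rw [normConf, normAff_root, one_odot]

theorem normConf_normalized (hX : X.NearlyStable) {a : X.V} (ha : a ≠ X.root)
    {m : X.E a → ℂ × ℂ} (hm : m ∈ X.AugConf a) : X.Normalized ord a (X.normConf ord a m) := by
  refine (normalized_iff ord).2 ⟨fun hb e => ?_, fun hb => ?_⟩
  · rw [normConf, normAff_bivalent ord ha hb, eq_edge₁ ord hb e,
      oinv_odot (edge₁_snd_ne ord hX ha hb hm)]
  · have hc := edge_ne ord hb hm.1
    have hD := unionDiam_pos ord hb hm.1
    have e1 : (X.normConf ord a m (X.edge₁ ord a)).1 = 0 := by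
      simp only [normConf, normAff_eq ord ha hb, odot]
      ring
    have e2 : (X.normConf ord a m (X.edge₂ ord a)).1 =
        ((‖(m (X.edge₂ ord a)).1 - (m (X.edge₁ ord a)).1‖ / (2 * unionDiam m) : ℝ) : ℂ) := by
      rw [← normScale_mul hc]
      simp only [normConf, normAff_eq ord ha hb, odot]
      ring
    refine ⟨e1, ?_, ?_, ?_⟩
    · rw [e2, Complex.ofReal_im]
    · rw [e2, Complex.ofReal_re]
      have := norm_pos_iff.2 hc
      positivity
    · unfold normConf
      rw [unionDiam_odot, normAff_eq ord ha hb, norm_normScale hc hD]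
      field_simp

theorem normConf_of_normalized {a : X.V} (ha : a ≠ X.root) {m : X.E a → ℂ × ℂ}
    (h : X.Normalized ord a m) : X.normConf ord a m = m := by
  obtain ⟨h1, h2⟩ := (normalized_iff ord).1 h
  by_cases hb : X.Bivalent a
  · funext e
    rw [normConf, normAff_bivalent ord ha hb, h1 hb, h1 hb, oinv_odot one_ne_zero]
  · obtain ⟨h3, h4, h5, h6⟩ := h2 hb
    have e : normScale ((m (X.edge₂ ord a)).1 - (m (X.edge₁ ord a)).1) (unionDiam m) = 1 := by
      rw [h3, sub_zero, h6]
      have e2 : (m (X.edge₂ ord a)).1 = ((m (X.edge₂ ord a)).1.re : ℂ) :=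
        Complex.ext rfl (by simp [h4])
      have h7 : ((m (X.edge₂ ord a)).1.re : ℂ) ≠ 0 := by exact_mod_cast h5.ne'
      rw [normScale, e2, Complex.norm_real, Real.norm_of_nonneg h5.le, div_self h7]
      norm_num
    funext e'
    rw [normConf, normAff_eq ord ha hb, e, h3]
    simp [odot]

/-- The normalized representative only depends on the class of a configuration modulo `Aff(ℂ)`. -/
theorem normConf_odot (hX : X.NearlyStable) {a : X.V} {g : ℂ × ℂ} (hg : g.2 ≠ 0)
    (hr : a = X.root → g = (0, 1)) {m : X.E a → ℂ × ℂ} (hm : m ∈ X.AugConf a) :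
    X.normConf ord a (fun e => odot g (m e)) = X.normConf ord a m := by
  by_cases ha : a = X.root
  · rw [hr ha]
    simp only [one_odot]
  · by_cases hb : X.Bivalent a
    · funext e
      have h0 := edge₁_snd_ne ord hX ha hb hm
      rw [normConf, normConf, normAff_bivalent ord ha hb, normAff_bivalent ord ha hb,
        eq_edge₁ ord hb e, oinv_odot h0, oinv_odot]
      exact mul_ne_zero hg h0
    · funext e
      have hc := edge_ne ord hb hm.1
      have key : normScale ((odot g (m (X.edge₂ ord a))).1 - (odot g (m (X.edge₁ ord a))).1)
          (unionDiam fun e => odot g (m e)) * g.2 =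
          normScale ((m (X.edge₂ ord a)).1 - (m (X.edge₁ ord a)).1) (unionDiam m) := by
        rw [unionDiam_odot, odot_fst_sub]
        have h1 : (‖g.2‖ : ℂ) ≠ 0 := by simpa using hg
        have h2 : (unionDiam m : ℂ) ≠ 0 := by exact_mod_cast (unionDiam_pos ord hb hm.1).ne'
        unfold normScale
        rw [norm_mul]
        push_cast
        field_simp
      rw [normConf, normConf, normAff_eq ord ha hb, normAff_eq ord ha hb, ← key]
      simp only [odot]
      refine Prod.ext ?_ ?_
      · simp only
        ring
      · simp only
        ring

theorem continuous_normConf (hX : X.NearlyStable) (a : X.V) (e : X.E a) :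
    Continuous fun m : X.AugConf a => X.normConf ord a m.1 e := by
  have hm : ∀ e, Continuous fun m : X.AugConf a => m.1 e := fun e =>
    (continuous_apply e).comp continuous_subtype_val
  by_cases ha : a = X.root
  · subst ha
    simp only [normConf_root]
    exact hm e
  · by_cases hb : X.Bivalent a
    · simp only [normConf, normAff_bivalent ord ha hb, oinv, odot]
      have h0 : ∀ m : X.AugConf a, (m.1 (X.edge₁ ord a)).2 ≠ 0 := fun m =>
        edge₁_snd_ne ord hX ha hb m.2
      have h1 := hm (X.edge₁ ord a)
      have h2 := hm e
      have h3 : Continuous fun m : X.AugConf a => ((m.1 (X.edge₁ ord a)).2)⁻¹ :=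
        (continuous_snd.comp h1).inv₀ h0
      have h4 : Continuous fun m : X.AugConf a =>
          -((m.1 (X.edge₁ ord a)).1 / (m.1 (X.edge₁ ord a)).2) :=
        ((continuous_fst.comp h1).div (continuous_snd.comp h1) h0).neg
      exact (h4.add (h3.mul (continuous_fst.comp h2))).prodMk (h3.mul (continuous_snd.comp h2))
    · simp only [normConf, normAff_eq ord ha hb, odot]
      have h1 := hm (X.edge₁ ord a)
      have h2 := hm e
      have hd : Continuous fun m : X.AugConf a =>
          (m.1 (X.edge₂ ord a)).1 - (m.1 (X.edge₁ ord a)).1 :=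
        (continuous_fst.comp (hm _)).sub (continuous_fst.comp (hm _))
      have hs : Continuous fun m : X.AugConf a =>
          normScale ((m.1 (X.edge₂ ord a)).1 - (m.1 (X.edge₁ ord a)).1) (unionDiam m.1) := by
        unfold normScale
        refine ((Complex.continuous_ofReal.comp hd.norm).div hd fun m => edge_ne ord hb m.2.1).div
          (Complex.continuous_ofReal.comp
            (continuous_const.mul (continuous_unionDiam.comp continuous_subtype_val))) fun m => ?_
        have := unionDiam_pos ord hb m.2.1
        exact_mod_cast (by positivity : 2 * unionDiam m.1 ≠ 0)
      exact ((hs.mul (continuous_fst.comp h1)).neg.add (hs.mul (continuous_fst.comp h2))).prodMk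
        (hs.mul (continuous_snd.comp h2))

end DTree
end TrivDisks

namespace TrivDisks
open scoped ComplexConjugate
open Topology Filter

namespace DTree

variable {S : Type} {X : DTree S}

/-! ### The basic neighborhoods are small -/

theorem withDec_pos {d d' : X.V ⊕ S → ℂ × ℂ} (h : ∀ x, x ≠ Sum.inl X.root → d x = d' x)
    {y : X.V ⊕ S} : ∀ {x : X.V ⊕ S} {p : ℂ × ℂ}, DTree.Pos (X.withDec d) y x p →
      DTree.Pos (X.withDec d') y x p := by
  intro x p hp
  refine @Pos.rec S (X.withDec d) y (fun x p _ => DTree.Pos (X.withDec d') y x p)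
    (Pos.refl (X := X.withDec d')) (fun {x p} hx _ ih => ?_) x p hp
  have e : (X.withDec d).dec x = (X.withDec d').dec x := h x hx
  rw [e]
  exact Pos.step (X := X.withDec d') hx ih

theorem Good.withDec_coord {d d' : X.V ⊕ S → ℂ × ℂ} (hd : (X.withDec d).Good)
    (h : ∀ x, x ≠ Sum.inl X.root → d x = d' x) : (X.withDec d).coord = (X.withDec d').coord :=
  Sim.coord_eq (fun a _ => ⟨a, (0, 1), one_ne_zero, fun e => ⟨e, rfl⟩, fun s p hp => by
    rw [one_odot]
    exact withDec_pos h hp⟩) hd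

theorem odot_mem_augConf {a : X.V} {m : X.E a → ℂ × ℂ} (hm : m ∈ X.AugConf a) {g : ℂ × ℂ}
    (hg : g.2 ≠ 0) (hr : a = X.root → g = (0, 1)) : (fun e => odot g (m e)) ∈ X.AugConf a := by
  refine ⟨fun i j hij => odot_disjoint_both hg (hm.1 i j hij),
    fun e s hs => mul_ne_zero hg (hm.2.1 e s hs), fun ha e => ?_⟩
  change odot g (m e) ∈ InDisk
  rw [hr ha, one_odot]
  exact hm.2.2 ha e

variable [Finite S] (ord : LinearOrder S)

theorem good_withDec {d : X.V ⊕ S → ℂ × ℂ} (h : ∀ a, (X.withDec d).conf a ∈ X.AugConf a)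
    (hn : ∀ a, a ≠ X.root → X.Normalized ord a ((X.withDec d).conf a)) : (X.withDec d).Good :=
  ⟨h, fun b hb _ x hx hxb => normalized_inDisk ord (hn b hb) ⟨x, hx, hxb⟩⟩

/-- The decorations by normalized representatives. -/
noncomputable def normDec (X : DTree S) (x : X.V ⊕ S) : ℂ × ℂ :=
  odot (X.normAff ord (X.succ x) (X.conf (X.succ x))) (X.dec x)

theorem conf_normDec (a : X.V) :
    (X.withDec (X.normDec ord)).conf a = X.normConf ord a (X.conf a) := by
  funext ⟨x, h, hx⟩
  subst hx
  rfl

theorem normAff_of_root {a : X.V} (ha : a = X.root) (m : X.E a → ℂ × ℂ) :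
    X.normAff ord a m = (0, 1) := if_pos ha

theorem Valid.normDec_internal (hX : X.Valid) {b : X.V} (hb : b ≠ X.root) :
    (X.normDec ord (Sum.inl b)).2 = 0 := by
  simp only [normDec, odot]
  rw [hX.internal hb, mul_zero]

theorem normConf_mem (hX : X.NearlyStable) {a : X.V} {m : X.E a → ℂ × ℂ}
    (hm : m ∈ X.AugConf a) : X.normConf ord a m ∈ X.AugConf a :=
  odot_mem_augConf (g := X.normAff ord a m) hm (normAff_snd_ne ord hX a hm)
    fun h => normAff_of_root ord h m

theorem Valid.normDec_valid (hX : X.Valid) : (X.withDec (X.normDec ord)).Valid := by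
  refine valid_iff.2 ⟨hX.nearlyStable, fun a => ?_, fun b hb => ?_⟩
  · have e := conf_normDec (X := X) ord a
    change (X.withDec (X.normDec ord)).conf a ∈ X.AugConf a
    rw [e]
    exact normConf_mem ord hX.nearlyStable (hX.good.aug a)
  · exact hX.normDec_internal ord hb

theorem Valid.toMbar_normDec (hX : X.Valid) :
    toMbar X hX = toMbar (X.withDec (X.normDec ord)) (hX.normDec_valid ord) := by
  refine toMbar_eq_of_equivalent _ _ ⟨Equiv.refl _, fun a => X.normAff ord a (X.conf a), rfl,
    normAff_root ord _, fun a => normAff_snd_ne ord hX.nearlyStable a (hX.good.aug a), ?_, ?_⟩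
  · rintro (a | s) _ <;> rfl
  · rintro (a | s) _ <;> rfl

theorem Valid.normDec_inDisk (hX : X.Valid) {x : X.V ⊕ S} (hx : x ≠ Sum.inl X.root) :
    X.normDec ord x ∈ InDisk := by
  by_cases h : X.succ x = X.root
  · rw [normDec, normAff_of_root ord h, one_odot]
    exact hX.good.root_disk hx h
  · have h1 := normConf_normalized ord hX.nearlyStable h (hX.good.aug (X.succ x))
    exact normalized_inDisk ord h1 ⟨x, hx, rfl⟩

/-- The elements of small basic neighborhoods have the coordinates of the tree `X` with
decorations close to the normalized ones, because contractions of edges of positive radius do not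
change the coordinates. -/
theorem exists_nbhd_dec (hX : X.Valid) {T : Set (X.V ⊕ S → ℂ × ℂ)} (hT : T ∈ 𝓝 (X.normDec ord)) :
    ∃ U : ∀ a : X.V, Set (X.AugMark a),
      (∀ a, IsOpen (U a) ∧ X.toAugMark a (X.conf a) (hX.mark a).1 ∈ U a) ∧
      ∀ p ∈ basicNbhd ord X U, ∃ d ∈ T, (X.withDec d).Good ∧
        (∀ x, x ≠ Sum.inl X.root → d x ∈ InDisk) ∧ crd p = (X.withDec d).coord := by
  have := X.finite
  rw [nhds_pi, Filter.mem_pi] at hT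
  obtain ⟨I, -, W, hW, hIW⟩ := hT
  have hns := hX.nearlyStable
  -- configurations whose normalized representatives are in the given boxes; invariant under `Aff(ℂ)`
  let V : ∀ a : X.V, Set (X.AugConf a) := fun a =>
    {m | ∀ e : X.E a, X.normConf ord a m.1 e ∈ interior (W e.1)}
  have hV : ∀ a, IsOpen (V a) := fun a => by
    rw [show V a = ⋂ e : X.E a, {m | X.normConf ord a m.1 e ∈ interior (W e.1)} from by
      ext m
      simp [V]]
    exact isOpen_iInter_of_finite fun e =>
      isOpen_interior.preimage (continuous_normConf ord hns a e)
  have hVinv : ∀ {a} {m m' : X.AugConf a},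
      X.toAugMark a m.1 m.2 = X.toAugMark a m'.1 m'.2 → m ∈ V a → m' ∈ V a := by
    intro a m m' h hm
    obtain ⟨g, h1, h2, h3⟩ := Quotient.exact (s := X.affSetoid a) h
    have e : m'.1 = fun e => odot g (m.1 e) := funext h3
    intro e'
    rw [e, normConf_odot ord hns h1 h2 m.2]
    exact hm e'
  let U : ∀ a : X.V, Set (X.AugMark a) := fun a => {μ | ∃ m ∈ V a, X.toAugMark a m.1 m.2 = μ}
  refine ⟨U, fun a => ⟨?_, ⟨X.conf a, (hX.mark a).1⟩, fun e => ?_, rfl⟩, ?_⟩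
  · refine isOpen_coinduced.2 ?_
    convert hV a using 1
    ext m
    constructor
    · rintro ⟨m', h1, h2⟩
      exact hVinv h2 h1
    · intro h
      exact ⟨m, h, rfl⟩
  · have := congrFun (conf_normDec ord (X := X) a) e
    refine this ▸ ?_
    exact mem_interior_iff_mem_nhds.2 (hW e.1)
  · rintro p ⟨d, h, hU, hn, Y, hY, hc, rfl⟩
    have hd : (X.withDec d).Good := good_withDec ord h hn
    have hmem : ∀ x, x ≠ Sum.inl X.root → d x ∈ W x := by
      intro x hx
      obtain ⟨m, h1, h2⟩ := hU (X.succ x)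
      have h3 := hVinv (m' := ⟨_, h (X.succ x)⟩) h2 h1 ⟨x, hx, rfl⟩
      have e : X.normConf ord (X.succ x) ((X.withDec d).conf (X.succ x)) =
          (X.withDec d).conf (X.succ x) := by
        by_cases hr : X.succ x = X.root
        · funext e
          rw [normConf, normAff_of_root ord hr, one_odot]
        · exact normConf_of_normalized ord hr (hn _ hr)
      have h4 : d x ∈ interior (W x) := by
        have := h3
        simp only [] at this
        rw [e] at this
        exact this
      exact interior_subset h4
    classical
    -- the decoration of the root vertex is arbitrary in `d`, so it is reset to that of `normDec`
    have hoff : ∀ x, x ≠ Sum.inl X.root →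
        d x = Function.update d (Sum.inl X.root) (X.normDec ord (Sum.inl X.root)) x :=
      fun x hx => (Function.update_of_ne hx _ _).symm
    have hd' : (X.withDec (Function.update d (Sum.inl X.root)
        (X.normDec ord (Sum.inl X.root)))).Good := by
      have hconf : ∀ a, (X.withDec (Function.update d (Sum.inl X.root)
          (X.normDec ord (Sum.inl X.root)))).conf a = (X.withDec d).conf a :=
        fun a => funext fun e => (hoff e.1 e.2.1).symm
      refine good_withDec ord (fun a => ?_) fun a ha => ?_
      · rw [hconf]
        exact h a
      · rw [hconf]
        exact hn a ha
    refine ⟨_, hIW fun x _ => ?_, hd', fun x hx => ?_, ?_⟩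
    · by_cases hx : x = Sum.inl X.root
      · rw [hx, Function.update_self]
        exact mem_of_mem_nhds (hW _)
      · rw [← hoff x hx]
        exact hmem x hx
    · rw [← hoff x hx]
      by_cases hr : X.succ x = X.root
      · exact hd.root_disk hx hr
      · exact normalized_inDisk ord (hn _ hr) ⟨x, hx, rfl⟩
    · rw [← hd.withDec_coord hoff]
      exact Contracts.coord_eq hc hd

theorem exists_basicNbhd_subset (hX : X.Valid) {t : Set (MbarObj S)} (ht : t ∈ 𝓝 (toMbar X hX)) :
    ∃ U : ∀ a : X.V, Set (X.AugMark a),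
      (∀ a, IsOpen (U a) ∧ X.toAugMark a (X.conf a) (hX.mark a).1 ∈ U a) ∧
      basicNbhd ord X U ⊆ t := by
  rw [hX.toMbar_normDec ord, nhds_induced, Filter.mem_comap] at ht
  obtain ⟨V, hV, hVt⟩ := ht
  have hc := continuousAt_coord (hX.normDec_valid ord).good
  obtain ⟨U, h1, h2⟩ := exists_nbhd_dec ord hX (hc hV)
  refine ⟨U, h1, fun p hp => ?_⟩
  obtain ⟨d, hd, -, -, he⟩ := h2 p hp
  refine hVt ?_
  change crd p ∈ V
  rw [he]
  exact hd

end DTree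
end TrivDisks

namespace TrivDisks
open scoped ComplexConjugate
open Topology Filter

namespace DTree

variable {S : Type} {X Y : DTree S}

/-! ### The basic neighborhoods are neighborhoods -/

section

variable [Finite S] (ord : LinearOrder S)

/-- The first incoming edge is the one below the least leaf above the vertex. -/
theorem least_edge₁ (a : X.V) : X.least ord (X.edge₁ ord a).1 = X.least ord (Sum.inl a) := by
  obtain ⟨p, hp⟩ := X.exists_pos_least ord (Sum.inl a)
  obtain ⟨y, q, hy, hq, -⟩ := hp.first Sum.inr_ne_inl
  obtain ⟨p1, hp1⟩ := X.exists_pos_least ord (X.edge₁ ord a).1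
  have hle : ord.le (X.least ord (Sum.inl a)) (X.least ord (X.edge₁ ord a).1) :=
    (X.exists_least ord (Sum.inl a)).choose_spec.2 _
      (leafAbove_iff.2 ⟨_, (Pos.input (X.edge₁ ord a).2).trans hp1⟩)
  refine ord.le_antisymm _ _ ?_ hle
  by_cases hye : (⟨y, hy⟩ : X.E a) = X.edge₁ ord a
  · rw [← hye]
    exact (X.exists_least ord y).choose_spec.2 _ (leafAbove_iff.2 ⟨_, hq⟩)
  · have hb : ¬ X.Bivalent a := fun hb => hye (eq_edge₁ ord hb _)
    obtain ⟨s, h1, h2⟩ := (firstTwo ord hb).first _ hye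
    have h3 := h2 _ (leafAbove_iff.2 ⟨_, hq⟩)
    refine ord.le_trans _ _ _ ((X.exists_least ord _).choose_spec.2 _ h1) ?_
    exact (@le_of_lt _ (ord.toPartialOrder.toPreorder) _ _ h3)

/-- The least leaf above the second incoming edge of a vertex. -/
noncomputable def second (X : DTree S) (a : X.V) : S := X.least ord (X.edge₂ ord a).1

theorem exists_pos_second (a : X.V) : ∃ p, X.Pos (Sum.inl a) (Sum.inr (X.second ord a)) p := by
  obtain ⟨p, hp⟩ := X.exists_pos_least ord (X.edge₂ ord a).1
  exact ⟨_, (Pos.input (X.edge₂ ord a).2).trans hp⟩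

omit [Finite S] in
theorem eq_of_bivalent (hX : X.NearlyStable) {a : X.V} (ha : a ≠ X.root) (hb : X.Bivalent a) :
    ∃ s : S, X.succ (Sum.inr s) = a ∧ (∀ e : X.E a, e.1 = Sum.inr s) ∧
      ∀ t p, X.Pos (Sum.inl a) (Sum.inr t) p → t = s := by
  obtain ⟨s, hs⟩ := (hX a hb).resolve_left ha
  have h1 : ∀ e : X.E a, e.1 = Sum.inr s := fun e =>
    hb.unique e.2 ⟨Sum.inr_ne_inl, hs⟩
  refine ⟨s, hs, h1, fun t p hp => ?_⟩
  obtain ⟨y, q, hy, hq, -⟩ := hp.first Sum.inr_ne_inl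
  rw [show y = Sum.inr s from h1 ⟨y, hy⟩] at hq
  exact (pos_leaf_iff.1 hq).1

/-- A map from the vertices of `X` to the vertices of a tree `Y` with the same leaves that
respects the positions of vertices and leaves, and such that the configurations of leaves
seen from `β a` still determine a frame at `a`. -/
structure Shadow (X Y : DTree S) (β : X.V → Y.V) : Prop where
  root : β X.root = Y.root
  pos : ∀ x, x ≠ Sum.inl X.root → ∃ k, Y.Pos (Sum.inl (β (X.succ x))) (Sum.map β id x) k
  apart : ∀ a, a ≠ X.root → ¬ X.Bivalent a →
    (Y.posOf (β a) (X.least ord (Sum.inl a))).1 ≠ (Y.posOf (β a) (X.second ord a)).1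
  ne : ∀ a, a ≠ X.root → X.Bivalent a → (Y.posOf (β a) (X.least ord (Sum.inl a))).2 ≠ 0

variable {ord}

theorem Shadow.pos_map {β : X.V → Y.V} (h : Shadow ord X Y β) {a : X.V} {x : X.V ⊕ S}
    {p : ℂ × ℂ} (hp : X.Pos (Sum.inl a) x p) :
    ∃ k, Y.Pos (Sum.inl (β a)) (Sum.map β id x) k := by
  induction hp with
  | refl => exact ⟨_, Pos.refl⟩
  | step hx _ ih =>
    obtain ⟨k, hk⟩ := ih
    obtain ⟨k', hk'⟩ := h.pos _ hx
    exact ⟨_, hk.trans hk'⟩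

theorem Shadow.pos_leaf {β : X.V → Y.V} (h : Shadow ord X Y β) {a : X.V} {s : S}
    {p : ℂ × ℂ} (hp : X.Pos (Sum.inl a) (Sum.inr s) p) :
    Y.Pos (Sum.inl (β a)) (Sum.inr s) (Y.posOf (β a) s) := by
  obtain ⟨k, hk⟩ := h.pos_map hp
  have hk : Y.Pos (Sum.inl (β a)) (Sum.inr s) k := hk
  rw [hk.posOf_eq]
  exact hk

variable (ord)

open Classical in
/-- The coordinate system at `β x` in which the two first leaves above a vertex `x` have centers
`0` and `1`; if `x` is bivalent, the one in which the leaf above it is the unit disk. -/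
noncomputable def shadowFrame (X Y : DTree S) (β : X.V → Y.V) : X.V ⊕ S → ℂ × ℂ
  | Sum.inr _ => (0, 1)
  | Sum.inl a => if a = X.root then (0, 1) else
      if X.Bivalent a then Y.posOf (β a) (X.least ord (Sum.inl a)) else
        ((Y.posOf (β a) (X.least ord (Sum.inl a))).1,
          (Y.posOf (β a) (X.second ord a)).1 - (Y.posOf (β a) (X.least ord (Sum.inl a))).1)

variable {ord}

theorem Shadow.frame_ne {β : X.V → Y.V} (h : Shadow ord X Y β) (x : X.V ⊕ S) :
    (shadowFrame ord X Y β x).2 ≠ 0 := by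
  rcases x with a | s
  · unfold shadowFrame
    by_cases h1 : a = X.root
    · simp [h1]
    · by_cases h2 : X.Bivalent a
      · simp only [h1, h2, if_true, if_false]
        exact h.ne a h1 h2
      · simp only [h1, h2, if_false]
        exact sub_ne_zero.2 (h.apart a h1 h2).symm
  · exact one_ne_zero

variable (ord)

open Classical in
/-- The position of the leaf `s` in the frame at the vertex `a`, in terms of coordinates. -/
noncomputable def frame (X : DTree S) (κ : Coord S) (a : X.V) (s : S) : ℂ × ℂ :=
  if a = X.root then κ.1 s else if X.Bivalent a then (0, 1) else
    ((κ.2.2 (X.least ord (Sum.inl a)) s (X.second ord a)).1 /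
      (κ.2.2 (X.least ord (Sum.inl a)) s (X.second ord a)).2.2,
    if s = X.least ord (Sum.inl a) then -κ.2.1 s (X.second ord a) else
      κ.2.1 s (X.least ord (Sum.inl a)) *
        ((κ.2.2 (X.least ord (Sum.inl a)) s (X.second ord a)).1 /
      (κ.2.2 (X.least ord (Sum.inl a)) s (X.second ord a)).2.2))

variable {ord}

theorem least_ne_second {a : X.V} (hb : ¬ X.Bivalent a) :
    X.least ord (Sum.inl a) ≠ X.second ord a := by
  rw [← least_edge₁, second]
  exact fun e => (firstTwo ord hb).ne (least_injective ord e)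

/-- The quotients of differences of centers that occur are values of `tri`, and the radii are
obtained from `rho`. -/
theorem Shadow.frame_eq {β : X.V → Y.V} (h : Shadow ord X Y β) (hX : X.NearlyStable)
    (hY : Y.Good) {a : X.V} {s : S} {p : ℂ × ℂ} (hp : X.Pos (Sum.inl a) (Sum.inr s) p) :
    X.frame ord Y.coord a s =
      odot (oinv (shadowFrame ord X Y β (Sum.inl a))) (Y.posOf (β a) s) := by
  have hs := h.pos_leaf hp
  by_cases h1 : a = X.root
  · subst h1
    rw [h.root] at hs
    simp only [frame, shadowFrame, if_true]
    rw [h.root]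
    change Y.abs s = _
    rw [abs_eq hs]
    simp [oinv, odot]
  · by_cases h2 : X.Bivalent a
    · obtain ⟨t, -, -, ht⟩ := eq_of_bivalent hX h1 h2
      obtain ⟨q, hq⟩ := X.exists_pos_least ord (Sum.inl a)
      have e : s = X.least ord (Sum.inl a) := (ht s p hp).trans (ht _ q hq).symm
      simp only [frame, shadowFrame, h1, h2, if_true, if_false]
      rw [e, oinv_odot (h.ne a h1 h2)]
    · obtain ⟨q, hq⟩ := X.exists_pos_least ord (Sum.inl a)
      obtain ⟨r, hr⟩ := X.exists_pos_second ord a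
      have hq' := h.pos_leaf hq
      have hr' := h.pos_leaf hr
      have hne := h.apart a h1 h2
      have hne' := sub_ne_zero.2 hne
      have hne'' := sub_ne_zero.2 hne.symm
      simp only [frame, shadowFrame, h1, h2, if_false]
      set s1 := X.least ord (Sum.inl a)
      set s2 := X.second ord a
      have ht : Y.coord.2.2 s1 s s2 = bl ((Y.posOf (β a) s1).1 - (Y.posOf (β a) s).1)
          ((Y.posOf (β a) s1).1 - (Y.posOf (β a) s2).1) :=
        tri_eq hq' hs hr' fun e => hne' e.2
      have hrat : (Y.coord.2.2 s1 s s2).1 / (Y.coord.2.2 s1 s s2).2.2 =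
          ((Y.posOf (β a) s).1 - (Y.posOf (β a) s1).1) /
            ((Y.posOf (β a) s2).1 - (Y.posOf (β a) s1).1) := by
        rw [ht, bl_ratio hne']
        rw [← neg_sub, ← neg_sub (Y.posOf (β a) s2).1, neg_div_neg_eq]
      rw [hrat]
      refine Prod.ext ?_ ?_
      · simp only [odot, oinv]
        field_simp
        ring
      · simp only [odot, oinv]
        split_ifs with h3
        · subst h3
          have : Y.coord.2.1 s1 s2 = _ := rho_eq hq' hr' hne
          rw [this, ← div_neg, neg_sub]
          field_simp
        · have : (Y.posOf (β a) s).2 = Y.coord.2.1 s s1 * _ := hY.snd_eq_rho_mul h3 hs hq'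
          rw [this]
          field_simp

variable (ord)

open Classical in
/-- The decorations of a tree of shape `X`, in frames where the two first leaves above a vertex
have centers `0` and `1`, as functions of the coordinates. -/
noncomputable def rough (X : DTree S) (κ : Coord S) (x : X.V ⊕ S) : ℂ × ℂ :=
  ((X.frame ord κ (X.succ x) (X.least ord x)).1,
    match x with
    | Sum.inr s => (X.frame ord κ (X.succ (Sum.inr s)) s).2
    | Sum.inl b => if X.Bivalent b then (X.frame ord κ (X.succ (Sum.inl b))
        (X.least ord (Sum.inl b))).2 else
      (X.frame ord κ (X.succ (Sum.inl b)) (X.second ord b)).1 -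
        (X.frame ord κ (X.succ (Sum.inl b)) (X.least ord (Sum.inl b))).1)

variable {ord}

/-- The decoration of an edge of `X` is the change of frames between the images of its endpoints
in `Y`. -/
theorem Shadow.rough_eq {β : X.V → Y.V} (h : Shadow ord X Y β) (hX : X.NearlyStable)
    (hY : Y.Good) {x : X.V ⊕ S} (hx : x ≠ Sum.inl X.root) {k : ℂ × ℂ}
    (hk : Y.Pos (Sum.inl (β (X.succ x))) (Sum.map β id x) k) :
    X.rough ord Y.coord x = odot (odot (oinv (shadowFrame ord X Y β (Sum.inl (X.succ x)))) k)
      (shadowFrame ord X Y β x) := by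
  have hf : ∀ s p, X.Pos x (Sum.inr s) p → X.frame ord Y.coord (X.succ x) s =
      odot (oinv (shadowFrame ord X Y β (Sum.inl (X.succ x)))) (Y.posOf (β (X.succ x)) s) :=
    fun s p hp => h.frame_eq hX hY ((Pos.edge hx).trans hp)
  rcases x with b | s
  · have hk : Y.Pos (Sum.inl (β (X.succ (Sum.inl b)))) (Sum.inl (β b)) k := hk
    have hb : b ≠ X.root := fun e => hx (by rw [e])
    have hf : ∀ s p, X.Pos (Sum.inl b) (Sum.inr s) p →
        X.frame ord Y.coord (X.succ (Sum.inl b)) s =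
        odot (odot (oinv (shadowFrame ord X Y β (Sum.inl (X.succ (Sum.inl b))))) k)
          (Y.posOf (β b) s) := by
      intro s p hp
      rw [hf s p hp, odot_assoc, (hk.trans (h.pos_leaf hp)).posOf_eq]
    obtain ⟨q, hq⟩ := X.exists_pos_least ord (Sum.inl b)
    obtain ⟨r, hr⟩ := X.exists_pos_second ord b
    by_cases h2 : X.Bivalent b
    · simp only [rough, h2, if_true, shadowFrame, hb, if_false]
      exact hf _ _ hq
    · simp only [rough, h2, if_false]
      rw [hf _ _ hq, hf _ _ hr]
      simp only [shadowFrame, hb, h2, if_false]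
      refine Prod.ext rfl ?_
      exact odot_fst_sub _ _ _
  · have hk : Y.Pos (Sum.inl (β (X.succ (Sum.inr s)))) (Sum.inr s) k := hk
    rw [shadowFrame, odot_one]
    simp only [rough, least_leaf]
    rw [hf s _ Pos.refl, hk.posOf_eq]

end

section

variable [Finite S]

/-- The scaling factors that turn frames in which the first two centers are `0` and `1` into
normalized ones. -/
theorem exists_scales (X : DTree S) :
    ∃ D : (X.V ⊕ S → ℂ × ℂ) → X.V ⊕ S → ℝ, (∀ x, Continuous fun d => D d x) ∧
      (∀ d s, D d (Sum.inr s) = 1) ∧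
      (∀ d a, a = X.root ∨ X.Bivalent a → D d (Sum.inl a) = 1) ∧
      ∀ d a, a ≠ X.root → ¬ X.Bivalent a →
        D d (Sum.inl a) = 2 * unionDiam fun e : X.E a => ((d e.1).1, (d e.1).2 * (D d e.1 : ℂ)) := by
  classical
  have := X.finite
  -- iterate the defining equation, starting with the constant function `1`
  let step : ((X.V ⊕ S → ℂ × ℂ) → X.V ⊕ S → ℝ) → (X.V ⊕ S → ℂ × ℂ) → X.V ⊕ S → ℝ :=
    fun D d => Sum.elim (fun a => if a = X.root ∨ X.Bivalent a then 1 else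
      2 * unionDiam fun e : X.E a => ((d e.1).1, (d e.1).2 * (D d e.1 : ℂ))) fun _ => 1
  let D : ℕ → (X.V ⊕ S → ℂ × ℂ) → X.V ⊕ S → ℝ := fun n => Nat.rec (fun _ _ => 1)
    (fun _ => step) n
  have h1 : ∀ n d s, D n d (Sum.inr s) = 1 := by
    intro n d s
    cases n <;> rfl
  have h2 : ∀ n d a, a = X.root ∨ X.Bivalent a → D n d (Sum.inl a) = 1 := by
    intro n d a ha
    cases n
    · rfl
    · exact if_pos ha
  have h3 : ∀ (n : ℕ) (d : X.V ⊕ S → ℂ × ℂ) (a : X.V), a ≠ X.root → ¬ X.Bivalent a →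
      D (n + 1) d (Sum.inl a) =
        2 * unionDiam fun e : X.E a => ((d e.1).1, (d e.1).2 * Complex.ofReal (D n d e.1)) := by
    intro n d a h h'
    exact if_neg (not_or.2 ⟨h, h'⟩)
  have hc : ∀ n x, Continuous fun d => D n d x := by
    intro n
    induction n with
    | zero => exact fun x => continuous_const
    | succ n ih =>
      rintro (a | s)
      · by_cases ha : a = X.root ∨ X.Bivalent a
        · simp only [h2 _ _ a ha]
          exact continuous_const
        · simp only [h3 n _ a (not_or.1 ha).1 (not_or.1 ha).2]
          refine continuous_const.mul (continuous_unionDiam.comp (continuous_pi fun e => ?_))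
          exact (continuous_fst.comp (continuous_apply _)).prodMk
            ((continuous_snd.comp (continuous_apply _)).mul
              (Complex.continuous_ofReal.comp (ih _)))
      · simp only [h1]
        exact continuous_const
  obtain ⟨N, hN⟩ := (Set.finite_range X.ndepth).bddAbove
  have hN : ∀ x, X.ndepth x ≤ N := fun x => hN ⟨x, rfl⟩
  -- the iteration is stationary, from the uppermost vertices downwards
  have hstab : ∀ n x d, N < X.ndepth x + n → D (n + 1) d x = D n d x := by
    intro n
    induction n with
    | zero => exact fun x d h => absurd (hN x) (by omega)
    | succ n ih =>
      rintro (a | s) d h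
      · by_cases ha : a = X.root ∨ X.Bivalent a
        · exact (h2 (n + 1 + 1) d a ha).trans (h2 (n + 1) d a ha).symm
        · have ha' := not_or.1 ha
          refine (h3 (n + 1) _ _ ha'.1 ha'.2).trans (Eq.trans ?_ (h3 n _ _ ha'.1 ha'.2).symm)
          have : ∀ e : X.E a, D (n + 1) d e.1 = D n d e.1 := fun e => by
            have := X.ndepth_lt e.2.1
            rw [e.2.2] at this
            exact ih e.1 d (by omega)
          simp only [this]
      · exact (h1 (n + 1 + 1) d s).trans (h1 (n + 1) d s).symm
  refine ⟨D (N + 1), hc (N + 1), h1 (N + 1), h2 (N + 1), fun d a h h' => ?_⟩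
  refine (h3 _ _ _ h h').trans ?_
  have : ∀ e : X.E a, D (N + 1) d e.1 = D N d e.1 := fun e => by
    have := X.ndepth_lt e.2.1
    exact hstab N e.1 d (by omega)
  simp only [this]

open Classical in
/-- The factors of `exists_scales`; the decoration of the root is irrelevant. -/
noncomputable def scale (X : DTree S) (d : X.V ⊕ S → ℂ × ℂ) (x : X.V ⊕ S) : ℝ :=
  X.exists_scales.choose (Function.update d (Sum.inl X.root) 0) x

theorem continuousAt_scale {α : Type*} [TopologicalSpace α] {f : α → X.V ⊕ S → ℂ × ℂ} {k : α}
    (hf : ∀ x, x ≠ Sum.inl X.root → ContinuousAt (fun t => f t x) k) (x : X.V ⊕ S) :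
    ContinuousAt (fun t => X.scale (f t) x) k := by
  classical
  refine (X.exists_scales.choose_spec.1 x).continuousAt.comp (continuousAt_pi.2 fun y => ?_)
  by_cases hy : y = Sum.inl X.root
  · subst hy
    simp only [Function.update_self]
    exact continuousAt_const
  · simp only [Function.update_of_ne hy]
    exact hf y hy

theorem scale_leaf (d : X.V ⊕ S → ℂ × ℂ) (s : S) : X.scale d (Sum.inr s) = 1 :=
  X.exists_scales.choose_spec.2.1 _ s

theorem scale_one (d : X.V ⊕ S → ℂ × ℂ) {a : X.V} (h : a = X.root ∨ X.Bivalent a) :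
    X.scale d (Sum.inl a) = 1 :=
  X.exists_scales.choose_spec.2.2.1 _ a h

theorem scale_eq (d : X.V ⊕ S → ℂ × ℂ) {a : X.V} (h : a ≠ X.root) (h' : ¬ X.Bivalent a) :
    X.scale d (Sum.inl a) =
      2 * unionDiam fun e : X.E a => ((d e.1).1, (d e.1).2 * (X.scale d e.1 : ℂ)) := by
  classical
  have h1 := X.exists_scales.choose_spec.2.2.2 (Function.update d (Sum.inl X.root) 0) a h h'
  have h2 : ∀ e : X.E a, Function.update d (Sum.inl X.root) 0 e.1 = d e.1 :=
    fun e => Function.update_of_ne e.2.1 _ _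
  simp only [h2] at h1
  unfold scale
  convert h1

end

section

variable [Finite S] {ord : LinearOrder S}

/-- The decorations in normalized frames, given the ones in frames in which the first two centers
are `0` and `1`. -/
noncomputable def fine (X : DTree S) (d : X.V ⊕ S → ℂ × ℂ) (x : X.V ⊕ S) : ℂ × ℂ :=
  odot (0, ((X.scale d (Sum.inl (X.succ x)))⁻¹ : ℝ)) ((d x).1, (d x).2 * (X.scale d x : ℂ))

variable (ord) in
/-- At the vertices other than the root, the first two centers are `0` and `1`, or there is a
single incoming edge with the unit disk. -/
def Framed (X : DTree S) (d : X.V ⊕ S → ℂ × ℂ) : Prop :=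
  ∀ a, a ≠ X.root → (X.Bivalent a → ∀ e : X.E a, d e.1 = (0, 1)) ∧
    (¬ X.Bivalent a → (d (X.edge₁ ord a).1).1 = 0 ∧ (d (X.edge₂ ord a).1).1 = 1)

theorem Framed.scale_pos {d : X.V ⊕ S → ℂ × ℂ} (h : X.Framed ord d) (x : X.V ⊕ S) :
    0 < X.scale d x := by
  rcases x with a | s
  · by_cases ha : a = X.root ∨ X.Bivalent a
    · rw [scale_one d ha]
      exact one_pos
    · obtain ⟨h1, h2⟩ := not_or.1 ha
      obtain ⟨e1, e2⟩ := (h a h1).2 h2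
      rw [scale_eq d h1 h2]
      have := le_unionDiam (fun e : X.E a => ((d e.1).1, (d e.1).2 * (X.scale d e.1 : ℂ)))
        (X.edge₂ ord a) (X.edge₁ ord a)
      simp only [e1, e2, sub_zero, norm_one] at this
      have k1 := norm_nonneg ((d (X.edge₂ ord a).1).2 * (X.scale d (X.edge₂ ord a).1 : ℂ))
      have k2 := norm_nonneg ((d (X.edge₁ ord a).1).2 * (X.scale d (X.edge₁ ord a).1 : ℂ))
      linarith
  · rw [scale_leaf]
    exact one_pos

/-- After rescaling by `1 / (2 D)`, where `D` is the diameter, the diameter is `1 / 2`. -/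
theorem Framed.normalized {d : X.V ⊕ S → ℂ × ℂ} (h : X.Framed ord d) (hX : X.NearlyStable)
    {a : X.V} (ha : a ≠ X.root) : X.Normalized ord a fun e : X.E a => X.fine d e.1 := by
  refine normalized_iff ord |>.2 ⟨fun hb e => ?_, fun hb => ?_⟩
  · obtain ⟨s, hs, he, -⟩ := eq_of_bivalent hX ha hb
    have h1 := (h a ha).1 hb e
    rw [he e] at h1 ⊢
    rw [fine, h1, hs, scale_leaf, scale_one d (Or.inr hb)]
    simp [odot]
  · obtain ⟨e1, e2⟩ := (h a ha).2 hb
    have hD := h.scale_pos (Sum.inl a)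
    have hs : ∀ e : X.E a, X.succ e.1 = a := fun e => e.2.2
    refine ⟨?_, ?_, ?_, ?_⟩
    · simp [fine, odot, e1]
    · simp [fine, odot, e2]
    · simp only [fine, odot, e2, hs]
      simpa using hD
    · have : (fun e : X.E a => X.fine d e.1) = fun e : X.E a =>
          odot (0, ((X.scale d (Sum.inl a))⁻¹ : ℝ))
            ((d e.1).1, (d e.1).2 * (X.scale d e.1 : ℂ)) := by
        funext e
        rw [fine, hs]
      rw [this, unionDiam_odot]
      have h2 := scale_eq d ha hb
      rw [Complex.norm_real, Real.norm_of_nonneg (inv_nonneg.2 hD.le)]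
      rw [inv_mul_eq_div, div_eq_div_iff hD.ne' two_ne_zero, one_mul, mul_comm]
      exact h2.symm

/-- In the frames at the images of the vertices in `Y`, the first two centers are `0` and `1`. -/
theorem Shadow.framed {β : X.V → Y.V} (h : Shadow ord X Y β) (hX : X.NearlyStable)
    (hY : Y.Good) : X.Framed ord (X.rough ord Y.coord) := by
  intro a ha
  refine ⟨fun hb e => ?_, fun hb => ?_⟩
  · obtain ⟨s, hs, he, -⟩ := eq_of_bivalent hX ha hb
    rw [he e]
    simp only [rough, least_leaf, hs, frame, ha, hb, if_false, if_true]
  · obtain ⟨q, hq⟩ := X.exists_pos_least ord (Sum.inl a)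
    obtain ⟨r, hr⟩ := X.exists_pos_second ord a
    have hne := sub_ne_zero.2 (h.apart a ha hb).symm
    have e1 : (X.rough ord Y.coord (X.edge₁ ord a).1).1 =
        (X.frame ord Y.coord a (X.least ord (Sum.inl a))).1 := by
      rw [← least_edge₁]
      simp only [rough, (X.edge₁ ord a).2.2]
    have e2 : (X.rough ord Y.coord (X.edge₂ ord a).1).1 =
        (X.frame ord Y.coord a (X.second ord a)).1 := by
      simp only [rough, (X.edge₂ ord a).2.2, second]
    rw [e1, e2, h.frame_eq hX hY hq, h.frame_eq hX hY hr]
    simp only [shadowFrame, ha, hb, if_false, odot, oinv]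
    constructor <;> field_simp <;> ring

variable (ord) in
/-- The frame at `a` that leads to normalized decorations. -/
noncomputable def fineFrame (X Y : DTree S) (β : X.V → Y.V) (x : X.V ⊕ S) : ℂ × ℂ :=
  odot (0, ((X.scale (X.rough ord Y.coord) x)⁻¹ : ℝ)) (oinv (shadowFrame ord X Y β x))

theorem Shadow.fineFrame_ne {β : X.V → Y.V} (h : Shadow ord X Y β) (hX : X.NearlyStable)
    (hY : Y.Good) (x : X.V ⊕ S) : (fineFrame ord X Y β x).2 ≠ 0 :=
  mul_ne_zero (Complex.ofReal_ne_zero.2 (inv_ne_zero ((h.framed hX hY).scale_pos x).ne'))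
    (oinv_snd_ne (h.frame_ne x))

theorem Shadow.fineFrame_leaf (β : X.V → Y.V) (s : S) :
    fineFrame ord X Y β (Sum.inr s) = (0, 1) := by
  simp [fineFrame, scale_leaf, shadowFrame, oinv, odot]

theorem Shadow.fineFrame_root (β : X.V → Y.V) :
    fineFrame ord X Y β (Sum.inl X.root) = (0, 1) := by
  simp [fineFrame, scale_one, shadowFrame, oinv, odot]

/-- The rescaled decorations are the changes between the rescaled frames. -/
theorem Shadow.fine_eq {β : X.V → Y.V} (h : Shadow ord X Y β) (hX : X.NearlyStable)
    (hY : Y.Good) {x : X.V ⊕ S} (hx : x ≠ Sum.inl X.root) {k : ℂ × ℂ}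
    (hk : Y.Pos (Sum.inl (β (X.succ x))) (Sum.map β id x) k) :
    odot (X.fine (X.rough ord Y.coord) x) (fineFrame ord X Y β x) =
      odot (fineFrame ord X Y β (Sum.inl (X.succ x))) k := by
  have hD := (h.framed hX hY).scale_pos x
  have h1 : X.fine (X.rough ord Y.coord) x =
      odot (odot (0, ((X.scale (X.rough ord Y.coord) (Sum.inl (X.succ x)))⁻¹ : ℝ))
        (X.rough ord Y.coord x)) (0, (X.scale (X.rough ord Y.coord) x : ℝ)) := by
    simp [fine, odot, mul_assoc]
  have h2 : odot (0, (X.scale (X.rough ord Y.coord) x : ℂ))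
      (0, ((X.scale (X.rough ord Y.coord) x)⁻¹ : ℝ)) = (0, 1) := by
    have : (X.scale (X.rough ord Y.coord) x : ℂ) ≠ 0 := Complex.ofReal_ne_zero.2 hD.ne'
    simp [odot, this]
  rw [h1, h.rough_eq hX hY hx hk, fineFrame, fineFrame]
  simp only [odot_assoc]
  rw [← odot_assoc _ _ (oinv _), h2, one_odot, odot_oinv (h.frame_ne x), odot_one]

/-- With the decorations computed from the coordinates of `Y`, the tree `X` has the same positions
of leaves as `Y`. -/
theorem Shadow.sim {β : X.V → Y.V} (h : Shadow ord X Y β) (hX : X.NearlyStable)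
    (hY : Y.Good) : Sim (X.withDec (X.fine (X.rough ord Y.coord))) Y := by
  have key : ∀ (a : X.V) (x : X.V ⊕ S) (p : ℂ × ℂ),
      DTree.Pos (X.withDec (X.fine (X.rough ord Y.coord))) (Sum.inl a) x p →
      ∃ k, Y.Pos (Sum.inl (β a)) (Sum.map β id x) k ∧
        odot p (fineFrame ord X Y β x) = odot (fineFrame ord X Y β (Sum.inl a)) k := by
    intro a x p hp
    refine @Pos.rec S (X.withDec (X.fine (X.rough ord Y.coord))) (Sum.inl a) (fun x p _ =>
      ∃ k, Y.Pos (Sum.inl (β a)) (Sum.map β id x) k ∧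
        odot p (fineFrame ord X Y β x) = odot (fineFrame ord X Y β (Sum.inl a)) k)
      ⟨_, Pos.refl, by rw [one_odot, odot_one]⟩ (fun {x p} hx _ ih => ?_) x p hp
    obtain ⟨k, hk, e⟩ := ih
    obtain ⟨k', hk'⟩ := h.pos x hx
    refine ⟨_, hk.trans hk', ?_⟩
    have := h.fine_eq hX hY hx hk'
    rw [odot_assoc]
    refine (congrArg (odot p) this).trans ?_
    rw [← odot_assoc]
    exact (congrArg (fun z => odot z k') e).trans (odot_assoc _ _ _)
  intro a _
  have hg := h.fineFrame_ne hX hY (Sum.inl a)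
  refine ⟨β a, oinv (fineFrame ord X Y β (Sum.inl a)), oinv_snd_ne hg, fun e => ?_,
    fun s p hp => ?_⟩
  · have e : a = X.root := e
    rw [e, Shadow.fineFrame_root]
    exact ⟨h.root, by simp [oinv]⟩
  · obtain ⟨k, hk, e⟩ := key a _ _ hp
    rw [Shadow.fineFrame_leaf, odot_one] at e
    rw [e, oinv_odot_cancel hg]
    exact hk

end

end DTree
end TrivDisks

namespace TrivDisks
open scoped ComplexConjugate
open Topology Filter

namespace DTree

variable {S : Type} {X Y : DTree S}

theorem Valid.dec_eq_zero (hX : X.Valid) {x : X.V ⊕ S} (hx : x ≠ Sum.inl X.root) :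
    (X.dec x).2 = 0 ∨ ∃ s, x = Sum.inr s := by
  rcases x with b | s
  · exact Or.inl (hX.internal fun e => hx (by rw [e]))
  · exact Or.inr ⟨s, rfl⟩

variable [Finite S] (ord : LinearOrder S)

theorem Valid.shadow_self (hX : X.Valid) : Shadow ord X X id := by
  refine ⟨rfl, fun x hx => ⟨X.dec x, ?_⟩, fun a ha hb => ?_, fun a ha hb => ?_⟩
  · rw [Sum.map_id_id]
    exact Pos.edge hx
  · obtain ⟨p, hp⟩ := X.exists_pos_least ord (X.edge₁ ord a).1
    obtain ⟨q, hq⟩ := X.exists_pos_least ord (X.edge₂ ord a).1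
    have h := (hX.good.apart_of_input (X.edge₁ ord a).2 (X.edge₂ ord a).2
      (fun e => (firstTwo ord hb).ne (Subtype.ext e)) hp hq).ne
    have h1 := (Pos.input (X.edge₁ ord a).2).trans hp
    have h2 := (Pos.input (X.edge₂ ord a).2).trans hq
    rw [least_edge₁] at h1
    rw [← h1.posOf_eq, ← h2.posOf_eq] at h
    exact h
  · obtain ⟨s, hs, -, h⟩ := eq_of_bivalent hX.nearlyStable ha hb
    obtain ⟨q, hq⟩ := X.exists_pos_least ord (Sum.inl a)
    have e := h _ q hq
    have h1 : X.Pos (Sum.inl a) (Sum.inr s) (X.dec (Sum.inr s)) :=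
      Pos.input ⟨Sum.inr_ne_inl, hs⟩
    change (X.posOf a (X.least ord (Sum.inl a))).2 ≠ 0
    rw [e, h1.posOf_eq]
    exact hX.good.leaf_ne s

/-- For `Y = X`, the construction returns the normalized decorations of `X`. -/
theorem Valid.fine_self (hX : X.Valid) {x : X.V ⊕ S} (hx : x ≠ Sum.inl X.root) :
    X.fine (X.rough ord X.coord) x = X.normDec ord x := by
  have hS := hX.shadow_self ord
  have hns := hX.nearlyStable
  have h1 : ∀ x, x ≠ Sum.inl X.root → X.fine (X.rough ord X.coord) x =
      odot (fineFrame ord X X id (Sum.inl (X.succ x))) (X.dec x) := by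
    intro x hx
    have h := hS.fine_eq hns hX.good hx (k := X.dec x) (by
      rw [Sum.map_id_id]
      exact Pos.edge hx)
    rcases hX.dec_eq_zero hx with h0 | ⟨s, rfl⟩
    · have h2 : (X.fine (X.rough ord X.coord) x).2 = 0 := by
        have := congrArg Prod.snd h
        simp only [odot, h0, mul_zero] at this
        exact (mul_eq_zero.1 this).resolve_right (hS.fineFrame_ne hns hX.good x)
      rw [odot_of_snd_eq_zero h2] at h
      exact h
    · rw [Shadow.fineFrame_leaf, odot_one] at h
      exact h
  by_cases hr : X.succ x = X.root
  · rw [h1 x hx, hr, Shadow.fineFrame_root, normDec, normAff_of_root ord hr]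
  · have hn := (hS.framed hns hX.good).normalized hns hr
    have e : (fun e : X.E (X.succ x) => X.fine (X.rough ord X.coord) e.1) = fun e =>
        odot (fineFrame ord X X id (Sum.inl (X.succ x))) (X.conf (X.succ x) e) := by
      funext e
      rw [h1 e.1 e.2.1, e.2.2]
      rfl
    have h2 := normConf_of_normalized ord hr hn
    rw [e, normConf_odot ord hns (hS.fineFrame_ne hns hX.good _) (fun h => absurd h hr)
      (hX.good.aug _)] at h2
    rw [h1 x hx]
    exact (congrFun h2 ⟨x, hx, rfl⟩).symm

/-- Near the coordinates of `X`, the denominators in `frame` do not vanish. -/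
theorem continuousAt_frame (hX : X.Valid) {a : X.V} {s : S} {p : ℂ × ℂ}
    (hp : X.Pos (Sum.inl a) (Sum.inr s) p) :
    ContinuousAt (fun κ : Coord S => X.frame ord κ a s) X.coord := by
  by_cases h1 : a = X.root
  · simp only [frame, h1, if_true]
    fun_prop
  · by_cases h2 : X.Bivalent a
    · simp only [frame, h1, h2, if_true, if_false]
      exact continuousAt_const
    · have hS := hX.shadow_self ord
      obtain ⟨q, hq⟩ := X.exists_pos_least ord (Sum.inl a)
      obtain ⟨r, hr⟩ := X.exists_pos_second ord a
      have hne := sub_ne_zero.2 (hS.apart a h1 h2)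
      have ht : X.coord.2.2 (X.least ord (Sum.inl a)) s (X.second ord a) = _ :=
        tri_eq (hS.pos_leaf hq) (hS.pos_leaf hp) (hS.pos_leaf hr) fun e => hne e.2
      have h0 : (X.coord.2.2 (X.least ord (Sum.inl a)) s (X.second ord a)).2.2 ≠ 0 := by
        rw [ht]
        exact fun e => hne ((bl_snd_eq_zero fun e => hne e.2).1 e)
      have c3 : ContinuousAt (fun κ : Coord S =>
          κ.2.2 (X.least ord (Sum.inl a)) s (X.second ord a)) X.coord := by
        fun_prop
      have c1 : ContinuousAt (fun κ : Coord S =>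
          (κ.2.2 (X.least ord (Sum.inl a)) s (X.second ord a)).1 /
            (κ.2.2 (X.least ord (Sum.inl a)) s (X.second ord a)).2.2) X.coord :=
        (continuous_fst.continuousAt.comp c3).div
          ((continuous_snd.comp continuous_snd).continuousAt.comp c3) h0
      simp only [frame, h1, h2, if_false]
      refine c1.prodMk ?_
      by_cases h3 : s = X.least ord (Sum.inl a)
      · simp only [h3, if_true]
        fun_prop
      · simp only [h3, if_false]
        refine ContinuousAt.mul ?_ c1
        fun_prop

theorem continuousAt_rough (hX : X.Valid) {x : X.V ⊕ S} (hx : x ≠ Sum.inl X.root) :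
    ContinuousAt (fun κ : Coord S => X.rough ord κ x) X.coord := by
  have h : ∀ {s p}, X.Pos x (Sum.inr s) p →
      ContinuousAt (fun κ : Coord S => X.frame ord κ (X.succ x) s) X.coord :=
    fun hp => continuousAt_frame ord hX ((Pos.edge hx).trans hp)
  obtain ⟨q, hq⟩ := X.exists_pos_least ord x
  refine (continuous_fst.continuousAt.comp (h hq)).prodMk ?_
  rcases x with b | s
  · obtain ⟨r, hr⟩ := X.exists_pos_second ord b
    by_cases h2 : X.Bivalent b
    · simp only [h2, if_true]
      exact continuous_snd.continuousAt.comp (h hq)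
    · simp only [h2, if_false]
      exact (continuous_fst.continuousAt.comp (h hr)).sub
        (continuous_fst.continuousAt.comp (h hq))
  · exact continuous_snd.continuousAt.comp (h Pos.refl)

theorem continuousAt_fine (hX : X.Valid) {x : X.V ⊕ S} (hx : x ≠ Sum.inl X.root) :
    ContinuousAt (fun κ : Coord S => X.fine (X.rough ord κ) x) X.coord := by
  have h1 := fun y => continuousAt_scale (fun x hx => continuousAt_rough ord hX hx) y
  have h2 := continuousAt_rough ord hX hx
  have h3 := ((hX.shadow_self ord).framed hX.nearlyStable hX.good).scale_pos
    (Sum.inl (X.succ x))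
  have h4 := (Complex.continuous_ofReal.continuousAt.comp
    ((h1 (Sum.inl (X.succ x))).inv₀ h3.ne'))
  have h5 := Complex.continuous_ofReal.continuousAt.comp (h1 x)
  have h6 := continuous_fst.continuousAt.comp h2
  have h7 := continuous_snd.continuousAt.comp h2
  exact (continuousAt_const.add (h4.mul h6)).prodMk (h4.mul (h7.mul h5))

/-- The augmented configurations form a neighborhood of a configuration whose radii at internal
edges vanish, apart from the condition that external edges at the root lie in the disk. -/
theorem eventually_augConf {a : X.V} {m₀ : X.E a → ℂ × ℂ} (h : m₀ ∈ X.MarkConf a) :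
    ∀ᶠ m in 𝓝 m₀, (a = X.root → ∀ (e : X.E a) s, e.1 = Sum.inr s → m e ∈ InDisk) →
      m ∈ X.AugConf a := by
  have h1 : ∀ e : X.E a, ContinuousAt (fun m : X.E a → ℂ × ℂ => m e) m₀ := fun e =>
    (continuous_apply e).continuousAt
  have hc : ∀ᶠ m in 𝓝 m₀, ∀ i j : X.E a, i ≠ j →
      ‖(m i).2‖ + ‖(m j).2‖ < ‖(m i).1 - (m j).1‖ := by
    refine eventually_all.2 fun i => eventually_all.2 fun j => ?_
    by_cases hij : i = j
    · exact Eventually.of_forall fun m h => absurd hij h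
    · have : ∀ᶠ m : X.E a → ℂ × ℂ in 𝓝 m₀, ‖(m i).2‖ + ‖(m j).2‖ < ‖(m i).1 - (m j).1‖ :=
        ((((h1 i).snd.norm).add (h1 j).snd.norm)).eventually_lt
          (((h1 i).fst.sub (h1 j).fst).norm) (h.1.1 i j hij)
      exact this.mono fun m h _ => h
  have hl : ∀ᶠ m in 𝓝 m₀, ∀ (e : X.E a) (s : S), e.1 = Sum.inr s → (m e).2 ≠ 0 := by
    refine eventually_all.2 fun e => eventually_all.2 fun s => ?_
    by_cases hs : e.1 = Sum.inr s
    · have : ∀ᶠ m : X.E a → ℂ × ℂ in 𝓝 m₀, (m e).2 ≠ 0 :=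
        ((continuous_snd.comp (continuous_apply e)).continuousAt).eventually_ne (h.1.2.1 e s hs)
      exact this.mono fun m h _ => h
    · exact Eventually.of_forall fun m h => absurd h hs
  have hi : ∀ᶠ m in 𝓝 m₀, ∀ (e : X.E a) (b : X.V), a = X.root → e.1 = Sum.inl b →
      m e ∈ InDisk := by
    have := X.finite
    refine eventually_all.2 fun e => eventually_all.2 fun b => ?_
    by_cases hb : a = X.root ∧ e.1 = Sum.inl b
    · have h0 := h.2 e b hb.2
      have h2 := norm_fst_lt_one (h.1.2.2 hb.1 e)
      have : ∀ᶠ m : X.E a → ℂ × ℂ in 𝓝 m₀, ‖(m e).1‖ + ‖(m e).2‖ < 1 :=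
        ((h1 e).fst.norm.add (h1 e).snd.norm).eventually_lt continuousAt_const
          (by simpa [h0] using h2)
      exact this.mono fun m h _ _ => ⟨h.le, fun _ => h⟩
    · exact Eventually.of_forall fun m h h' => absurd ⟨h, h'⟩ hb
  filter_upwards [hc, hl, hi] with m h1 h2 h3 h4
  refine ⟨h1, h2, fun ha e => ?_⟩
  rcases he : e.1 with b | s
  · exact h3 e b ha he
  · exact h4 ha e s he

/-- The vertices of a tree `Y` near `X` that correspond to those of `X` are the uppermost ones below
all leaves above the latter. -/
theorem exists_shadow (hX : X.Valid) (hY : Y.Valid)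
    (h : ∀ a, a ≠ X.root → ¬ X.Bivalent a → ∀ s p, X.Pos (Sum.inl a) (Sum.inr s) p →
      (Y.tri (X.least ord (Sum.inl a)) s (X.second ord a)).2.2 ≠ 0) :
    ∃ β : X.V → Y.V, Shadow ord X Y β := by
  classical
  have hA : ∀ a : X.V, {s : S | ∃ p, X.Pos (Sum.inl a) (Sum.inr s) p}.Nonempty :=
    fun a => X.exists_leaf_above (Sum.inl a)
  choose μ hμ hmax using fun a => Y.exists_meet (hA a)
  let β : X.V → Y.V := fun a => if a = X.root then Y.root else μ a
  have hβr : β X.root = Y.root := if_pos rfl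
  have hβ : ∀ a, a ≠ X.root → β a = μ a := fun a ha => if_neg ha
  have hab : ∀ a s p, X.Pos (Sum.inl a) (Sum.inr s) p →
      ∃ q, Y.Pos (Sum.inl (β a)) (Sum.inr s) q := by
    intro a s p hp
    by_cases ha : a = X.root
    · rw [ha, hβr]
      exact Y.exists_pos_root _
    · rw [hβ a ha]
      exact hμ a s ⟨p, hp⟩
  -- if the centers of the first two leaves coincided at `μ a`, then `tri` would be degenerate there
  refine ⟨β, hβr, ?_, fun a ha hb hne => ?_, fun a ha hb => ?_⟩
  · rintro (b | s) hx
    · have hb : b ≠ X.root := fun e => hx (by rw [e])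
      change ∃ k, Y.Pos (Sum.inl (β (X.succ (Sum.inl b)))) (Sum.inl (β b)) k
      rw [hβ b hb]
      refine hmax b _ fun s ⟨p, hp⟩ => ?_
      exact hab _ s _ ((Pos.edge hx).trans hp)
    · exact hab _ s _ (Pos.edge hx)
  · rw [hβ a ha] at hne
    obtain ⟨q, hq⟩ := X.exists_pos_least ord (Sum.inl a)
    obtain ⟨r, hr⟩ := X.exists_pos_second ord a
    obtain ⟨q', hq'⟩ := hμ a _ ⟨q, hq⟩
    obtain ⟨r', hr'⟩ := hμ a _ ⟨r, hr⟩
    have hnt : {s : S | ∃ p, X.Pos (Sum.inl a) (Sum.inr s) p}.Nontrivial :=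
      ⟨_, ⟨q, hq⟩, _, ⟨r, hr⟩, least_ne_second hb⟩
    obtain ⟨s, hs, t, ht, k, l, hk, hl, hkl⟩ := hY.good.split hnt (hμ a) (hmax a)
    rw [hq'.posOf_eq, hr'.posOf_eq] at hne
    -- one of the leaves above `a` has a center different from those of the first two
    obtain ⟨u, ⟨v, hv⟩, w, hw, hne'⟩ : ∃ u ∈ {s : S | ∃ p, X.Pos (Sum.inl a) (Sum.inr s) p},
        ∃ w, Y.Pos (Sum.inl (μ a)) (Sum.inr u) w ∧ q'.1 - w.1 ≠ 0 := by
      by_cases e : q'.1 - k.1 = 0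
      · refine ⟨t, ht, l, hl, fun e' => hkl.ne ?_⟩
        rw [← sub_eq_zero.1 e, ← sub_eq_zero.1 e']
      · exact ⟨s, hs, k, hk, e⟩
    have h0 : ¬ (q'.1 - w.1 = 0 ∧ q'.1 - r'.1 = 0) := fun e => hne' e.1
    refine h a ha hb u v hv ?_
    rw [tri_eq hq' hw hr' h0]
    exact (bl_snd_eq_zero h0).2 (sub_eq_zero.2 hne)
  · obtain ⟨s, hs, -, hu⟩ := eq_of_bivalent hX.nearlyStable ha hb
    obtain ⟨q, hq⟩ := X.exists_pos_least ord (Sum.inl a)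
    rw [hu _ q hq, hβ a ha]
    have h1 : Y.Pos (Sum.inl (Y.succ (Sum.inr s))) (Sum.inr s) (Y.dec (Sum.inr s)) :=
      Pos.edge Sum.inr_ne_inl
    obtain ⟨k, hk⟩ := hmax a (Y.succ (Sum.inr s)) fun t ⟨p, hp⟩ => by
      rw [hu t p hp]
      exact ⟨_, h1⟩
    obtain ⟨p, hp⟩ := hμ a s ⟨q, by rw [← hu _ q hq]; exact hq⟩
    obtain ⟨-, p', hp', -⟩ := hp.of_ne Sum.inr_ne_inl
    have e := hk.antisymm hp'
    rw [Sum.inl_injective e, h1.posOf_eq]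
    exact hY.good.leaf_ne s

/-- For `Y` near `X`, the decorations `fine X (rough X Y.coord)` depend continuously on the
coordinates of `Y`, so they are close to the normalized decorations of `X`; and with these
decorations `X` contracts to `Y`. -/
theorem basicNbhd_mem_nhds (hX : X.Valid) {U : ∀ a : X.V, Set (X.AugMark a)}
    (hU : ∀ a, IsOpen (U a) ∧ X.toAugMark a (X.conf a) (hX.mark a).1 ∈ U a) :
    basicNbhd ord X U ∈ 𝓝 (toMbar X hX) := by
  have hfin := X.finite
  have hns := hX.nearlyStable
  -- near the normalized decorations, all configurations are in the given open sets
  have h1 : ∀ a : X.V, ∀ᶠ m in 𝓝 (X.normConf ord a (X.conf a)),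
      ∀ hm : m ∈ X.AugConf a, X.toAugMark a m hm ∈ U a := by
    intro a
    have hm0 := normConf_mem ord hns (hX.good.aug a)
    have hmem : X.toAugMark a _ hm0 ∈ U a := by
      have e : X.toAugMark a (X.conf a) (hX.mark a).1 = X.toAugMark a _ hm0 :=
        Quotient.sound ⟨X.normAff ord a (X.conf a), normAff_snd_ne ord hns a (hX.good.aug a),
          fun h => normAff_of_root ord h _, fun e => rfl⟩
      rw [← e]
      exact (hU a).2
    have ho : IsOpen {m : X.AugConf a | X.toAugMark a m.1 m.2 ∈ U a} :=
      isOpen_coinduced.1 (hU a).1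
    obtain ⟨O, hO, hOe⟩ := isOpen_induced_iff.1 ho
    have h0 : (⟨_, hm0⟩ : X.AugConf a) ∈ {m : X.AugConf a | X.toAugMark a m.1 m.2 ∈ U a} := hmem
    rw [← hOe] at h0
    filter_upwards [hO.mem_nhds h0] with m hm hm'
    have : (⟨m, hm'⟩ : X.AugConf a) ∈ Subtype.val ⁻¹' O := hm
    rw [hOe] at this
    exact this
  have h2 : ∀ a : X.V, ∀ᶠ m in 𝓝 (X.normConf ord a (X.conf a)),
      (a = X.root → ∀ (e : X.E a) s, e.1 = Sum.inr s → m e ∈ InDisk) → m ∈ X.AugConf a := by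
    intro a
    rw [← conf_normDec]
    exact eventually_augConf (X := X) ((hX.normDec_valid ord).mark a)
  have h3 : ∀ a : X.V, Tendsto (fun (κ : Coord S) (e : X.E a) => X.fine (X.rough ord κ) e.1)
      (𝓝 X.coord) (𝓝 (X.normConf ord a (X.conf a))) := by
    intro a
    refine tendsto_pi_nhds.2 fun e => ?_
    have h := continuousAt_fine ord hX e.2.1
    rw [ContinuousAt, hX.fine_self ord e.2.1] at h
    rw [← conf_normDec]
    exact h
  -- the condition for the existence of a shadow is open
  have h4 : ∀ᶠ κ : Coord S in 𝓝 X.coord, ∀ (a : X.V) (s : S), a ≠ X.root → ¬ X.Bivalent a →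
      (∃ p, X.Pos (Sum.inl a) (Sum.inr s) p) →
      (κ.2.2 (X.least ord (Sum.inl a)) s (X.second ord a)).2.2 ≠ 0 := by
    refine eventually_all.2 fun a => eventually_all.2 fun s => ?_
    by_cases h : a ≠ X.root ∧ ¬ X.Bivalent a ∧ ∃ p, X.Pos (Sum.inl a) (Sum.inr s) p
    · obtain ⟨ha, hb, p, hp⟩ := h
      have hS := hX.shadow_self ord
      obtain ⟨q, hq⟩ := X.exists_pos_least ord (Sum.inl a)
      obtain ⟨r, hr⟩ := X.exists_pos_second ord a
      have hne := sub_ne_zero.2 (hS.apart a ha hb)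
      have ht : X.coord.2.2 (X.least ord (Sum.inl a)) s (X.second ord a) = _ :=
        tri_eq (hS.pos_leaf hq) (hS.pos_leaf hp) (hS.pos_leaf hr) fun e => hne e.2
      have h0 : (X.coord.2.2 (X.least ord (Sum.inl a)) s (X.second ord a)).2.2 ≠ 0 := by
        rw [ht]
        exact fun e => hne ((bl_snd_eq_zero fun e => hne e.2).1 e)
      have : ∀ᶠ κ : Coord S in 𝓝 X.coord,
          (κ.2.2 (X.least ord (Sum.inl a)) s (X.second ord a)).2.2 ≠ 0 :=
        ContinuousAt.eventually_ne (by fun_prop) h0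
      exact this.mono fun κ h _ _ _ => h
    · exact Eventually.of_forall fun κ h1 h2 h3 => absurd ⟨h1, h2, h3⟩ h
  have h5 := (eventually_all.2 fun a => (h3 a).eventually (h1 a)).and
    ((eventually_all.2 fun a => (h3 a).eventually (h2 a)).and h4)
  have h6 : ∀ᶠ p in 𝓝 (toMbar X hX), _ :=
    (continuous_crd.tendsto (toMbar X hX)).eventually h5
  refine mem_of_superset h6 fun p hp => ?_
  obtain ⟨Y, hY, rfl⟩ := exists_toMbar p
  obtain ⟨k1, k2, k3⟩ := hp
  simp only [crd_toMbar] at k1 k2 k3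
  obtain ⟨β, hβ⟩ := exists_shadow ord hX hY fun a ha hb s p hp => k3 a s ha hb ⟨p, hp⟩
  have hsim := hβ.sim hns hY.good
  have haug : ∀ a, (fun e : X.E a => X.fine (X.rough ord Y.coord) e.1) ∈ X.AugConf a := by
    refine fun a => k2 a fun ha e s hs => ?_
    have hr : X.succ (Sum.inr s) = X.root := by
      rw [← hs, e.2.2, ha]
    obtain ⟨k, hk⟩ := hβ.pos (Sum.inr s) Sum.inr_ne_inl
    have := hβ.fine_eq hns hY.good Sum.inr_ne_inl hk
    rw [Shadow.fineFrame_leaf, odot_one, hr, Shadow.fineFrame_root, one_odot] at this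
    rw [hs, this]
    rw [hr, hβ.root] at hk
    exact hY.good.abs_inDisk hk
  have hnorm : ∀ a, a ≠ X.root →
      X.Normalized ord a fun e : X.E a => X.fine (X.rough ord Y.coord) e.1 :=
    fun a ha => (hβ.framed hns hY.good).normalized hns ha
  have hgood : (X.withDec (X.fine (X.rough ord Y.coord))).Good := good_withDec ord haug hnorm
  obtain ⟨Z, hZ, hc, he⟩ := exists_contracts _ rfl hgood hns
  refine ⟨_, haug, fun a => k1 a (haug a), hnorm, Z, hZ, hc, crd_injective ?_⟩
  rw [crd_toMbar, crd_toMbar, he, hsim.coord_eq hgood]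

end DTree

/-- The topology induced by the coordinates has the prescribed neighborhood bases. -/
theorem hasBasicNbhds_top : HasBasicNbhds Mbar.top := by
  intro S _ ord X hX
  refine ⟨fun t => ⟨fun ht => ?_, fun ⟨U, hU, hUt⟩ => ?_⟩⟩
  · exact DTree.exists_basicNbhd_subset ord hX ht
  · exact mem_of_superset (DTree.basicNbhd_mem_nhds ord hX hU) hUt

end TrivDisks

namespace TrivDisks
open scoped ComplexConjugate
open Topology Filter

/-! ### Density of the framed little disks, and the operad axioms -/

namespace DTree

variable {S : Type} {X : DTree S}

theorem Pos.snd_ne {y x : X.V ⊕ S} {p : ℂ × ℂ} (h : X.Pos y x p)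
    (h0 : ∀ x, x ≠ Sum.inl X.root → (X.dec x).2 ≠ 0) : p.2 ≠ 0 := by
  induction h with
  | refl => exact one_ne_zero
  | step hx _ ih => exact mul_ne_zero ih (h0 _ hx)

/-- An element is a limit of framed little disks: let the radii of the internal edges tend to zero. -/
theorem Valid.mem_closure [Finite S] (hX : X.Valid)
    (hd : ∀ x, x ≠ Sum.inl X.root → X.dec x ∈ InDisk) :
    toMbar X hX ∈ closure (Set.range (kmap (S := S))) := by
  classical
  have hfin := X.finite
  -- the internal edges get the radius `ε`
  let δ : X.V ⊕ S → ℂ := fun x => if ∃ b, b ≠ X.root ∧ x = Sum.inl b then 1 else 0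
  let d : ℂ → X.V ⊕ S → ℂ × ℂ := fun ε x => ((X.dec x).1, (X.dec x).2 + ε * δ x)
  have hδ : ∀ b, b ≠ X.root → δ (Sum.inl b) = 1 := fun b hb => if_pos ⟨b, hb, rfl⟩
  have hδ' : ∀ s, δ (Sum.inr s) = 0 := fun s => if_neg fun ⟨b, _, e⟩ => Sum.inr_ne_inl e
  have hd0 : d 0 = X.dec := by
    funext x
    simp [d]
  have hc : Continuous d := by
    refine continuous_pi fun x => ?_
    fun_prop
  have hdl : ∀ ε s, d ε (Sum.inr s) = X.dec (Sum.inr s) := fun ε s => by simp [d, hδ']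
  have h1 : ∀ᶠ ε in 𝓝 (0 : ℂ), ∀ a, (fun e : X.E a => d ε e.1) ∈ X.AugConf a := by
    refine eventually_all.2 fun a => ?_
    have hcont : Tendsto (fun (ε : ℂ) (e : X.E a) => d ε e.1) (𝓝 0) (𝓝 (X.conf a)) := by
      have : Continuous fun (ε : ℂ) (e : X.E a) => d ε e.1 :=
        continuous_pi fun e => (continuous_apply e.1).comp hc
      have h := this.tendsto 0
      rw [hd0] at h
      exact h
    filter_upwards [hcont.eventually (eventually_augConf (hX.mark a))] with ε h
    refine h fun ha e s hs => ?_
    rw [hs, hdl]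
    exact hd _ Sum.inr_ne_inl
  have h2 : ∀ᶠ ε in 𝓝 (0 : ℂ), ∀ x, x ≠ Sum.inl X.root → d ε x ∈ InDisk := by
    refine eventually_all.2 fun x => ?_
    rcases x with b | s
    · by_cases hb : b = X.root
      · exact Eventually.of_forall fun ε h => absurd (congrArg Sum.inl hb) h
      · have hb' : (Sum.inl b : X.V ⊕ S) ≠ Sum.inl X.root := fun e => hb (Sum.inl_injective e)
        have hcx : Continuous fun ε => d ε (Sum.inl b) := (continuous_apply _).comp hc
        have : ∀ᶠ ε in 𝓝 (0 : ℂ), ‖(d ε (Sum.inl b)).1‖ + ‖(d ε (Sum.inl b)).2‖ < 1 := by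
          refine (hcx.fst.norm.add hcx.snd.norm).continuousAt.eventually_lt continuousAt_const ?_
          change ‖(d 0 (Sum.inl b)).1‖ + ‖(d 0 (Sum.inl b)).2‖ < 1
          rw [hd0, hX.internal hb, norm_zero, add_zero]
          exact norm_fst_lt_one (hd _ hb')
        exact this.mono fun ε h _ => ⟨h.le, fun _ => h⟩
    · refine Eventually.of_forall fun ε h => ?_
      rw [hdl]
      exact hd _ h
  have h3 : Tendsto (fun ε => (X.withDec (d ε)).coord) (𝓝[≠] 0) (𝓝 X.coord) := by
    have h := (continuousAt_coord hX.good).tendsto.comp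
      (show Tendsto d (𝓝 0) (𝓝 X.dec) from hd0 ▸ hc.tendsto 0)
    exact h.mono_left nhdsWithin_le_nhds
  rw [mem_closure_iff_nhds]
  intro t ht
  rw [nhds_induced, Filter.mem_comap] at ht
  obtain ⟨V, hV, hVt⟩ := ht
  rw [crd_toMbar] at hV
  obtain ⟨ε, hε, e1, e2, e3⟩ := ((eventually_mem_nhdsWithin (s := {(0 : ℂ)}ᶜ) (a := 0)).and
    ((h1.filter_mono nhdsWithin_le_nhds).and ((h2.filter_mono nhdsWithin_le_nhds).and
      (h3.eventually_mem hV)))).exists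
  have hε : ε ≠ 0 := hε
  have hg : (X.withDec (d ε)).Good := ⟨e1, fun b hb _ x hx _ => e2 x hx⟩
  obtain ⟨z, hz⟩ := hg.exists_mbar hX.nearlyStable
  obtain ⟨x, rfl⟩ := exists_kmap (z := z) fun s => by
    have h := (X.withDec (d ε)).pos_abs s
    rw [hz]
    refine h.snd_ne ?_
    rintro (b | s) hx
    · have hb : b ≠ X.root := fun e => hx (by rw [e])
      change (X.dec (Sum.inl b)).2 + ε * δ (Sum.inl b) ≠ 0
      rw [hX.internal hb, hδ b hb, zero_add, mul_one]
      exact hε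
    · change (d ε (Sum.inr s)).2 ≠ 0
      rw [hdl]
      exact hX.good.leaf_ne s
  refine ⟨_, hVt ?_, x, rfl⟩
  change crd (kmap x) ∈ V
  rw [hz]
  exact e3

end DTree

open DTree

variable {S S' S'' T T' : Type} [Finite S] [Finite S'] [Finite S''] [Finite T] [Finite T']

theorem denseRange_kmap : DenseRange (kmap (S := S)) := by
  classical
  intro z
  obtain ⟨X, hX, rfl⟩ := exists_toMbar z
  obtain ⟨e⟩ := finite_iff_nonempty_fintype S |>.1 inferInstance
  let ord : LinearOrder S := LinearOrder.lift' (Fintype.equivFin S) (Fintype.equivFin S).injective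
  rw [hX.toMbar_normDec ord]
  exact (hX.normDec_valid ord).mem_closure fun x hx => hX.normDec_inDisk ord hx

/-- All axioms are equations between continuous maps to a Hausdorff space or follow from the
formulas for the coordinates; the former hold on the dense subset of framed little disks. -/
theorem isOperad_Mbar : IsOperad Mbar where
  relabel_refl x := crd_injective (crd_relabel (Equiv.refl _) x)
  relabel_trans σ τ x := crd_injective ((crd_relabel (σ.trans τ) x).trans ((crd_relabel τ
    (mrelabel σ x)).trans (congrArg (Coord.relabel τ) (crd_relabel σ x))).symm)
  equivariant {S T S' T'} _ _ _ _ σ τ s x y := by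
    have hk := isOperadHom_fldToMbar
    have h := (denseRange_kmap (S := S).prodMap (denseRange_kmap (S := S'))).equalizer
      (g := fun p => mcomp (σ s) (mrelabel σ p.1) (mrelabel τ p.2))
      (h := fun p => mrelabel (Ins.congr σ τ s) (mcomp s p.1 p.2))
      ((continuous_mbar_comp (σ s)).comp (((continuous_mbar_relabel σ).comp continuous_fst).prodMk
        ((continuous_mbar_relabel τ).comp continuous_snd)))
      ((continuous_mbar_relabel _).comp (continuous_mbar_comp s))
      (funext fun p => by
        have e := congrArg kmap (isOperad_FLD.equivariant σ τ s p.1 p.2)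
        have e1 := hk.map_comp (σ s) (FLD.relabel σ p.1) (FLD.relabel τ p.2)
        have e2 := hk.map_relabel (Ins.congr σ τ s) (FLD.comp s p.1 p.2)
        have e3 := hk.map_comp s p.1 p.2
        have e4 := hk.map_relabel σ p.1
        have e5 := hk.map_relabel τ p.2
        rw [e4, e5] at e1
        rw [e3] at e2
        exact e1.symm.trans (e.trans e2))
    exact congrFun h (x, y)
  one_comp {S} _ x := by
    have hk := isOperadHom_fldToMbar
    have h := (denseRange_kmap (S := S)).equalizer
      (g := fun p => mrelabel (Ins.left S) (mcomp () Mbar.one p)) (h := fun p => p)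
      ((continuous_mbar_relabel _).comp ((continuous_mbar_comp ()).comp
        (continuous_const.prodMk continuous_id))) continuous_id
      (funext fun p => by
        have e := congrArg kmap (isOperad_FLD.one_comp p)
        have e2 := hk.map_relabel (Ins.left S) (FLD.comp () FLD.one p)
        have e3 := hk.map_comp () FLD.one p
        rw [e3, hk.map_one] at e2
        exact e2.symm.trans e)
    exact congrFun h x
  comp_one {S} _ s x := by
    have hk := isOperadHom_fldToMbar
    have h := (denseRange_kmap (S := S)).equalizer
      (g := fun p => mrelabel (Ins.right s) (mcomp s p Mbar.one)) (h := fun p => p)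
      ((continuous_mbar_relabel _).comp ((continuous_mbar_comp s).comp
        (continuous_id.prodMk continuous_const))) continuous_id
      (funext fun p => by
        have e := congrArg kmap (isOperad_FLD.comp_one s p)
        have e2 := hk.map_relabel (Ins.right s) (FLD.comp s p FLD.one)
        have e3 := hk.map_comp s p FLD.one
        rw [e3, hk.map_one] at e2
        exact e2.symm.trans e)
    exact congrFun h x
  assoc_seq {S S' S''} _ _ _ s t x y r := by
    have hk := isOperadHom_fldToMbar
    have h := (denseRange_kmap (S := S).prodMap ((denseRange_kmap (S := S')).prodMap
        (denseRange_kmap (S := S'')))).equalizer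
      (g := fun p => mrelabel (Ins.seq S'' s t)
        (mcomp (Sum.inr t : Ins s S') (mcomp s p.1 p.2.1) p.2.2))
      (h := fun p => mcomp s p.1 (mcomp t p.2.1 p.2.2))
      ((continuous_mbar_relabel _).comp ((continuous_mbar_comp _).comp
        (((continuous_mbar_comp s).comp (continuous_fst.prodMk continuous_snd.fst)).prodMk
          continuous_snd.snd)))
      ((continuous_mbar_comp s).comp (continuous_fst.prodMk
        ((continuous_mbar_comp t).comp continuous_snd)))
      (funext fun p => by
        have e := congrArg kmap (isOperad_FLD.assoc_seq s t p.1 p.2.1 p.2.2)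
        have e1 := hk.map_relabel (Ins.seq S'' s t)
          (FLD.comp (Sum.inr t : Ins s S') (FLD.comp s p.1 p.2.1) p.2.2)
        rw [hk.map_comp, hk.map_comp] at e1
        have e2 := hk.map_comp s p.1 (FLD.comp t p.2.1 p.2.2)
        rw [hk.map_comp t] at e2
        exact e1.symm.trans (e.trans e2))
    exact congrFun h (x, y, r)
  assoc_par {S S' S''} _ _ _ s t hts x y r := by
    have hk := isOperadHom_fldToMbar
    have h := (denseRange_kmap (S := S).prodMap ((denseRange_kmap (S := S')).prodMap
        (denseRange_kmap (S := S'')))).equalizer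
      (g := fun p => mrelabel (Ins.par S' S'' s t hts)
        (mcomp (Sum.inl ⟨t, hts⟩ : Ins s S') (mcomp s p.1 p.2.1) p.2.2))
      (h := fun p => mcomp (Sum.inl ⟨s, hts.symm⟩ : Ins t S'') (mcomp t p.1 p.2.2) p.2.1)
      ((continuous_mbar_relabel _).comp ((continuous_mbar_comp _).comp
        (((continuous_mbar_comp s).comp (continuous_fst.prodMk continuous_snd.fst)).prodMk
          continuous_snd.snd)))
      ((continuous_mbar_comp _).comp
        (((continuous_mbar_comp t).comp (continuous_fst.prodMk continuous_snd.snd)).prodMk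
          continuous_snd.fst))
      (funext fun p => by
        have e := congrArg kmap (isOperad_FLD.assoc_par s t hts p.1 p.2.1 p.2.2)
        have e1 := hk.map_relabel (Ins.par S' S'' s t hts)
          (FLD.comp (Sum.inl ⟨t, hts⟩ : Ins s S') (FLD.comp s p.1 p.2.1) p.2.2)
        rw [hk.map_comp, hk.map_comp] at e1
        have e2 := hk.map_comp (Sum.inl ⟨s, hts.symm⟩ : Ins t S'') (FLD.comp t p.1 p.2.2) p.2.1
        rw [hk.map_comp t] at e2
        exact e1.symm.trans (e.trans e2))
    exact congrFun h (x, y, r)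

theorem isTopOperad_Mbar : IsTopOperad Mbar Mbar.top where
  isOperad := isOperad_Mbar
  continuous_relabel σ := continuous_mbar_relabel σ
  continuous_comp s := continuous_mbar_comp s

end TrivDisks

namespace TrivDisks
open Topology Filter DTree

/-! ### Operads: relabelings, and the actions of the elements of arity one -/

section

variable {S S' S'' T T' : Type}

/-- A version of `Ins.congr` in which the target of the distinguished element is arbitrary. -/
def Ins.map (σ : S ≃ T) (τ : S' ≃ T') {s : S} {t : T} (h : σ s = t) : Ins s S' ≃ Ins t T' :=
  Equiv.sumCongr (σ.subtypeEquiv fun x => by rw [← h]; simp) τ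

variable {P : OperadData.{u}} (hP : IsOperad P)
variable [Finite S] [Finite S'] [Finite S''] [Finite T] [Finite T']

include hP

/-- Equivariance, with the two relabelings and the image of the leaf `s` as separate data. -/
theorem IsOperad.comp_relabel (σ : S ≃ T) (τ : S' ≃ T') {s : S} {t : T} (h : σ s = t)
    (x : P.obj S) (y : P.obj S') : P.comp t (P.relabel σ x) (P.relabel τ y) =
      P.relabel (Ins.map σ τ h) (P.comp s x y) := by
  subst h
  exact hP.equivariant σ τ s x y

theorem IsOperad.comp_relabel_left (σ : S ≃ T) {s : S} {t : T} (h : σ s = t)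
    (x : P.obj S) (y : P.obj S') : P.comp t (P.relabel σ x) y =
      P.relabel (Ins.map σ (Equiv.refl _) h) (P.comp s x y) := by
  rw [← hP.comp_relabel, hP.relabel_refl]

theorem IsOperad.comp_relabel_right (τ : S' ≃ T') (s : S)
    (x : P.obj S) (y : P.obj S') : P.comp s x (P.relabel τ y) =
      P.relabel (Ins.map (Equiv.refl _) τ (Equiv.refl_apply s)) (P.comp s x y) := by
  have := hP.comp_relabel (Equiv.refl S) τ (Equiv.refl_apply s) x y
  rwa [hP.relabel_refl] at this

theorem IsOperad.eq_relabel_symm {σ : S ≃ T} {x : P.obj S} {y : P.obj T}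
    (h : P.relabel σ x = y) : x = P.relabel σ.symm y := by
  rw [← h, ← hP.relabel_trans, Equiv.self_trans_symm, hP.relabel_refl]

theorem IsOperad.assoc_seq' (s : S) (t : S') (x : P.obj S) (y : P.obj S') (r : P.obj S'') :
    P.comp (Sum.inr t : Ins s S') (P.comp s x y) r =
      P.relabel (Ins.seq S'' s t).symm (P.comp s x (P.comp t y r)) :=
  hP.eq_relabel_symm (hP.assoc_seq s t x y r)

theorem IsOperad.assoc_par' (s t : S) (h : t ≠ s) (x : P.obj S) (y : P.obj S') (r : P.obj S'') :
    P.comp (Sum.inl ⟨t, h⟩ : Ins s S') (P.comp s x y) r =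
      P.relabel (Ins.par S' S'' s t h).symm
        (P.comp (Sum.inl ⟨s, h.symm⟩ : Ins t S'') (P.comp t x r) y) :=
  hP.eq_relabel_symm (hP.assoc_par s t h x y r)

theorem IsOperad.act_relabel (σ : S ≃ T) (a : P.obj Unit) (x : P.obj S) :
    P.act a (P.relabel σ x) = P.relabel σ (P.act a x) := by
  rw [OperadData.act, OperadData.act, hP.comp_relabel_right, ← hP.relabel_trans,
    ← hP.relabel_trans]
  refine congrArg (fun e => P.relabel e _) (Equiv.ext ?_)
  rintro (⟨x, h⟩ | b)
  · exact absurd rfl h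
  · rfl

theorem IsOperad.act_comp (a : P.obj Unit) (s : S) (x : P.obj S) (y : P.obj S') :
    P.comp s (P.act a x) y = P.act a (P.comp s x y) := by
  rw [OperadData.act, OperadData.act,
    hP.comp_relabel_left (Ins.left S) (s := Sum.inr s) (t := s) rfl, hP.assoc_seq',
    ← hP.relabel_trans]
  refine congrArg (fun e => P.relabel e _) (Equiv.ext ?_)
  rintro (⟨x, h⟩ | (⟨b, h⟩ | c))
  · exact absurd rfl h
  · rfl
  · rfl

theorem IsOperad.act_act (a b : P.obj Unit) (x : P.obj S) :
    P.act (P.act a b) x = P.act a (P.act b x) := by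
  have e : P.act b x = P.relabel (Ins.left S) (P.comp () b x) := rfl
  rw [e, hP.act_relabel, ← hP.act_comp]
  rfl

omit hP in
/-- The action of `P(1)` on `P(S)` by composition on the right, at an element of `S`. -/
noncomputable def OperadData.ract (P : OperadData.{u}) (s : S) (x : P.obj S)
    (a : P.obj Unit) : P.obj S :=
  P.relabel (Ins.right s) (P.comp s x a)

theorem IsOperad.ract_comp (s : S) (x : P.obj S) (a : P.obj Unit) (y : P.obj S') :
    P.comp s (P.ract s x a) y = P.comp s x (P.act a y) := by
  rw [OperadData.act, OperadData.ract,
    hP.comp_relabel_left (Ins.right s) (s := Sum.inr ()) (t := s) rfl, hP.assoc_seq',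
    ← hP.relabel_trans, hP.comp_relabel_right]
  refine congrArg (fun e => P.relabel e _) (Equiv.ext ?_)
  rintro (⟨x, h⟩ | (⟨b, h⟩ | c))
  · rfl
  · exact absurd rfl h
  · rfl

omit hP

theorem IsOperadHom.map_act {Q : OperadData.{v}} {f : Family P Q} (hf : IsOperadHom f)
    (a : P.obj Unit) (x : P.obj S) : f S (P.act a x) = Q.act (f Unit a) (f S x) := by
  rw [OperadData.act, OperadData.act, hf.map_relabel, hf.map_comp]

theorem IsOperadHom.map_ract {Q : OperadData.{v}} {f : Family P Q} (hf : IsOperadHom f)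
    (s : S) (x : P.obj S) (a : P.obj Unit) :
    f S (P.ract s x a) = Q.ract s (f S x) (f Unit a) := by
  rw [OperadData.ract, OperadData.ract, hf.map_relabel, hf.map_comp]

theorem IsOperadHom.map_glue {Q : OperadData.{v}} {f : Family P Q} (hf : IsOperadHom f)
    (A : Set S) (x : P.obj (Collapse A)) (y : P.obj A) :
    f S (P.glue A x y) = Q.glue A (f _ x) (f _ y) := by
  rw [OperadData.glue, OperadData.glue, hf.map_relabel, hf.map_comp]

end

/-- The product of two operads. -/
def OperadData.prod (P : OperadData.{u}) (Q : OperadData.{v}) : OperadData.{max u v} where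
  obj S _ := P.obj S × Q.obj S
  relabel σ x := (P.relabel σ x.1, Q.relabel σ x.2)
  one := (P.one, Q.one)
  comp s x y := (P.comp s x.1 y.1, Q.comp s x.2 y.2)

theorem IsOperad.prod {P : OperadData.{u}} {Q : OperadData.{v}} (hP : IsOperad P)
    (hQ : IsOperad Q) : IsOperad (P.prod Q) where
  relabel_refl _ := Prod.ext (hP.relabel_refl _) (hQ.relabel_refl _)
  relabel_trans σ τ _ := Prod.ext (hP.relabel_trans σ τ _) (hQ.relabel_trans σ τ _)
  equivariant σ τ s _ _ := Prod.ext (hP.equivariant σ τ s _ _) (hQ.equivariant σ τ s _ _)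
  one_comp _ := Prod.ext (hP.one_comp _) (hQ.one_comp _)
  comp_one s _ := Prod.ext (hP.comp_one s _) (hQ.comp_one s _)
  assoc_seq s t _ _ _ := Prod.ext (hP.assoc_seq s t _ _ _) (hQ.assoc_seq s t _ _ _)
  assoc_par s t h _ _ _ := Prod.ext (hP.assoc_par s t h _ _ _) (hQ.assoc_par s t h _ _ _)

/-! ### The suboperad generated by framed little disks and annuli -/

section

variable {Q : OperadData.{u}}

/-- An operad `Q` under `FLD` and `An^triv`, compatibly on `FLD₁`, with a morphism of such operads
to `𝕄̄`. -/
structure OverMbar (B : Family FLD Q) (C : Family AnTriv Q) (π : Family Q Mbar) : Prop where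
  isOperad : IsOperad Q
  homB : IsOperadHom B
  homC : IsOperadHom C
  homπ : IsOperadHom π
  comm : ∀ (S : Type) [Finite S] (a : FLD1.obj S), B S (fld1ToFLD S a) = C S (fld1ToAnTriv S a)
  πB : ∀ (S : Type) [Finite S] (x : FLD.obj S), π S (B S x) = fldToMbar S x
  πC : ∀ (S : Type) [Finite S] (x : AnTriv.obj S), π S (C S x) = antrivToMbar S x

/-- The framed little disk with values `x`, as an element of arity one. -/
def disk1 (p : ℂ × ℂ) (h : p ∈ InDisk) (h0 : p.2 ≠ 0) : FLD.obj Unit :=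
  ⟨fun _ => p, ⟨()⟩, fun i j e => absurd (Subsingleton.elim i j) e, fun _ => h0, fun _ => h⟩

/-- The annulus `p`, as an element of arity one. -/
def annulus1 (p : ℂ × ℂ) (h : p ∈ InDisk) : AnTriv.obj Unit :=
  ⟨fun _ => p, Nat.card_unique, fun i j e => absurd (Subsingleton.elim i j) e, fun _ => h⟩

/-- The composition of the annulus of radius zero with the framed little disks `u`. -/
def cap (B : Family FLD Q) (C : Family AnTriv Q) {S : Type} [Finite S] (u : FLD.obj S) :
    Q.obj S :=
  Q.act (C Unit (annulus 0 (by simp))) (B S u)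

variable {B : Family FLD Q} {C : Family AnTriv Q} {π : Family Q Mbar} (H : OverMbar B C π)
variable {S S' T : Type} [Finite S] [Finite S'] [Finite T]

include H

/-- In arity one, framed little disks and annuli of nonzero radius are identified in `Q`. -/
theorem OverMbar.disk_eq (p : ℂ × ℂ) (h : p ∈ InDisk) (h0 : p.2 ≠ 0) :
    B Unit (disk1 p h h0) = C Unit (annulus1 p h) :=
  H.comm Unit ⟨disk1 p h h0, Nat.card_unique⟩

omit H in
theorem FLD_act_val (a : FLD.obj Unit) (x : FLD.obj S) :
    (FLD.act a x).1 = fun s => odot (a.1 ()) (x.1 s) := insConf_left x.1 a.1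

omit H in
theorem AnTriv_act_val (a : AnTriv.obj Unit) (x : AnTriv.obj S) :
    (AnTriv.act a x).1 = fun s => odot (a.1 ()) (x.1 s) := insConf_left x.1 a.1

/-- An annulus of radius zero centered at the origin absorbs annuli. -/
theorem OverMbar.zero_act (p : ℂ × ℂ) (h : p ∈ InDisk) :
    Q.act (C Unit (annulus 0 (by simp))) (C Unit (annulus1 p h)) =
      C Unit (annulus 0 (by simp)) := by
  rw [← H.homC.map_act]
  refine congrArg (C Unit) (Subtype.ext ?_)
  rw [AnTriv_act_val]
  funext s
  simp [annulus, annulus1, odot]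

theorem OverMbar.act_zero {q : ℂ} (hq : ‖q‖ ≤ 1) :
    Q.act (C Unit (annulus q hq)) (C Unit (annulus 0 (by simp))) =
      C Unit (annulus 0 (by simp)) := by
  rw [← H.homC.map_act]
  refine congrArg (C Unit) (Subtype.ext ?_)
  rw [AnTriv_act_val]
  funext s
  simp [annulus, odot]

theorem OverMbar.relabel_cap (σ : S ≃ T) (u : FLD.obj S) :
    Q.relabel σ (cap B C u) = cap B C (FLD.relabel σ u) := by
  rw [cap, cap, H.homB.map_relabel, H.isOperad.act_relabel]

theorem OverMbar.cap_comp (s : S) (u : FLD.obj S) (v : FLD.obj S') :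
    Q.comp s (cap B C u) (B S' v) = cap B C (FLD.comp s u v) := by
  rw [cap, cap, H.homB.map_comp, H.isOperad.act_comp]

/-- A cap absorbs the concentric annuli that it is inserted in. -/
theorem OverMbar.act_cap {q : ℂ} (hq : ‖q‖ ≤ 1) (u : FLD.obj S) :
    Q.act (C Unit (annulus q hq)) (cap B C u) = cap B C u := by
  rw [cap, ← H.isOperad.act_act, H.act_zero]

/-- Caps only depend on framed little disks up to the action of `Aff(ℂ)`. -/
theorem OverMbar.cap_eq {u u' : FLD.obj S} {g : ℂ × ℂ} (hg : g.2 ≠ 0)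
    (h : ∀ s, u'.1 s = odot g (u.1 s)) : cap B C u' = cap B C u := by
  have hpos : 0 < 1 + ‖g.1‖ + ‖g.2‖ := by positivity
  -- after a contraction, `g` becomes a disk
  let ε : ℝ := (1 + ‖g.1‖ + ‖g.2‖)⁻¹
  have hε : 0 < ε := inv_pos.2 hpos
  have hε1 : ε ≤ 1 := inv_le_one_of_one_le₀ (by
    have := norm_nonneg g.1
    have := norm_nonneg g.2
    linarith)
  have hn : ‖(ε : ℂ)‖ = ε := by rw [Complex.norm_real, Real.norm_of_nonneg hε.le]
  have h1 : ((0, (ε : ℂ)) : ℂ × ℂ) ∈ InDisk := ⟨by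
    change ‖(0 : ℂ)‖ + ‖(ε : ℂ)‖ ≤ 1
    rwa [norm_zero, zero_add, hn], fun h => absurd rfl h⟩
  have h2 : odot (0, (ε : ℂ)) g ∈ InDisk := by
    have : ‖(odot (0, (ε : ℂ)) g).1‖ + ‖(odot (0, (ε : ℂ)) g).2‖ < 1 := by
      simp only [odot, zero_add, norm_mul, hn]
      rw [← mul_add, inv_mul_lt_one₀ hpos]
      linarith
    exact ⟨this.le, fun _ => this⟩
  have h1' : ((0, (ε : ℂ)) : ℂ × ℂ).2 ≠ 0 := Complex.ofReal_ne_zero.2 hε.ne'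
  have h2' : (odot (0, (ε : ℂ)) g).2 ≠ 0 := mul_ne_zero h1' hg
  have key : ∀ (p : ℂ × ℂ) (hp : p ∈ InDisk) (hp0 : p.2 ≠ 0) (u : FLD.obj S),
      cap B C u = cap B C (FLD.act (disk1 p hp hp0) u) := by
    intro p hp hp0 u
    rw [cap, cap, H.homB.map_act, ← H.isOperad.act_act, H.disk_eq, H.zero_act]
  rw [key _ h1 h1' u', key _ h2 h2' u]
  congr 1
  refine Subtype.ext ?_
  rw [FLD_act_val, FLD_act_val]
  funext s
  simp only [disk1]
  rw [h, odot_assoc]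

/-- Inserting a cap in a cap with a single disk gives a cap. -/
theorem OverMbar.cap_comp_cap {s : S} (hs : ∀ t, t = s) (v : FLD.obj S) (u : FLD.obj S') :
    ∃ e : S' ≃ Ins s S', (∀ b, e b = Sum.inr b) ∧
      Q.comp s (cap B C v) (cap B C u) = Q.relabel e (cap B C u) := by
  have : IsEmpty {x : S // x ≠ s} := ⟨fun x => x.2 (hs x.1)⟩
  let τ : Unit ≃ S := ⟨fun _ => s, fun _ => (), fun _ => rfl, fun t => (hs t).symm⟩
  have hv : v = FLD.relabel τ (FLD.relabel τ.symm v) := by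
    rw [← isOperad_FLD.relabel_trans, Equiv.symm_trans_self, isOperad_FLD.relabel_refl]
  set v' := FLD.relabel τ.symm v
  have hv' : v' = disk1 (v'.1 ()) (v'.2.2.2.2 ()) (v'.2.2.2.1 ()) := rfl
  refine ⟨(Ins.left S').symm.trans (Ins.map τ (Equiv.refl S') (s := ()) (t := s) rfl), fun b => rfl, ?_⟩
  have h2 : Q.act (cap B C v') (cap B C u) = cap B C u := by
    rw [cap, cap, H.isOperad.act_act, ← H.isOperad.act_act (B Unit v'),
      ← H.isOperad.act_act (C Unit (annulus 0 _)), ← H.isOperad.act_act (C Unit (annulus 0 _)),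
      hv', H.disk_eq, H.zero_act]
    -- `annulus 0 _` and `annulus1 (0, 0) _` agree by definition
    exact congrArg (fun a => Q.act a (B S' u)) (H.zero_act (0, 0) (by simp [InDisk]))
  conv_lhs => rw [hv, ← H.relabel_cap, H.isOperad.comp_relabel_left τ (s := ()) (t := s) rfl]
  conv_rhs => rw [← h2, OperadData.act, ← H.isOperad.relabel_trans]
  refine congrArg (fun e => Q.relabel e _) (Equiv.ext ?_)
  rintro (⟨x, h⟩ | b)
  · exact absurd rfl h
  · rfl

end

end TrivDisks

namespace TrivDisks
open Topology Filter DTree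

section

variable {S S' T : Type}

/-! ### Degenerate leaves of compositions with caps -/

/-- The characterization of terminal vertices by coordinates is compatible with relabelings. -/
theorem tc_relabel (σ : S ≃ T) {κ : Coord S} {A : Set T} (h : TC (Coord.relabel σ κ) A) :
    TC κ (σ ⁻¹' A) := by
  obtain ⟨⟨a, ha⟩, h⟩ := h
  refine ⟨⟨σ.symm a, by simpa using ha⟩, fun s hs => ?_⟩
  have := h (σ s) hs
  simp only [Coord.relabel, Equiv.symm_apply_apply] at this
  refine ⟨this.1, fun u hu => ?_, fun t ht hts => ?_⟩
  · have := this.2.1 (σ u) hu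
    rwa [Equiv.symm_apply_apply] at this
  · have := this.2.2 (σ t) ht fun e => hts (σ.injective e)
    rwa [Equiv.symm_apply_apply] at this

theorem nz_relabel (σ : S ≃ T) {κ : Coord S} {s : S} : NZ (Coord.relabel σ κ) (σ s) ↔ NZ κ s := by
  simp only [NZ, Coord.relabel, Equiv.symm_apply_apply]
  exact or_congr Iff.rfl ⟨fun ⟨t, h⟩ => ⟨_, h⟩, fun ⟨t, h⟩ => ⟨σ t, by simpa using h⟩⟩

variable {t : S} {κ : Coord S} {κ' : Coord S'}

/-- When a cap is inserted at `t`, the other leaves are degenerate in the composition if and only if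
they were before. -/
theorem nz_comp_inl [Nonempty S'] (h0 : ∀ b, (κ'.1 b).1 = 0) {x : {x : S // x ≠ t}} :
    NZ (Coord.comp t κ κ') (Sum.inl x) ↔ NZ κ x.1 := by
  have hb := Classical.arbitrary S'
  refine or_congr Iff.rfl ⟨?_, ?_⟩
  · rintro ⟨y | b, h⟩
    · exact ⟨_, h⟩
    · refine ⟨t, fun e => h ?_⟩
      simp [Coord.comp, e]
  · rintro ⟨y, h⟩
    by_cases hy : y = t
    · subst hy
      refine ⟨Sum.inr hb, ?_⟩
      simpa [Coord.comp, h0] using h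
    · exact ⟨Sum.inl ⟨y, hy⟩, h⟩

/-- When a cap is inserted, its leaves become the incoming edges of a terminal vertex. -/
theorem tc_comp_inr [Nonempty S'] (h0 : ∀ b, κ'.1 b = (0, 0))
    (h1 : ∀ b b', b ≠ b' → κ'.2.1 b b' ≠ 0) :
    TC (Coord.comp t κ κ') (Set.range Sum.inr) := by
  refine ⟨⟨_, Classical.arbitrary S', rfl⟩, ?_⟩
  rintro _ ⟨b, rfl⟩
  refine ⟨by simp [Coord.comp, odot, h0], ?_, ?_⟩
  · rintro (x | b') hb
    · simp [Coord.comp, h0]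
    · exact absurd ⟨b', rfl⟩ hb
  · rintro _ ⟨b', rfl⟩ hne
    exact h1 b b' fun e => hne (by rw [e])

/-- When a cap is inserted at `t`, the incoming edges of a terminal vertex are either the leaves of
the cap or those of a terminal vertex that was there before and is not adjacent to `t`. -/
theorem tc_comp_cases [Nonempty S'] (h0 : ∀ b, κ'.1 b = (0, 0))
    (h1 : ∀ b b', b ≠ b' → κ'.2.1 b b' ≠ 0) {A : Set (Ins t S')}
    (h : TC (Coord.comp t κ κ') A) :
    A = Set.range Sum.inr ∨ ∃ A₀ : Set S, t ∉ A₀ ∧ TC κ A₀ ∧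
      A = {e | ∃ x : {x : S // x ≠ t}, x.1 ∈ A₀ ∧ e = Sum.inl x} := by
  by_cases hb : ∃ b, Sum.inr b ∈ A
  · obtain ⟨b, hb⟩ := hb
    refine Or.inl (Set.ext ?_)
    rintro (x | b')
    · refine ⟨fun hx => ?_, fun ⟨b, e⟩ => absurd e Sum.inr_ne_inl⟩
      refine absurd ?_ ((h.2 _ hb).2.2 _ hx Sum.inl_ne_inr)
      simp [Coord.comp, h0]
    · refine ⟨fun _ => ⟨b', rfl⟩, fun _ => ?_⟩
      by_contra hb'
      have hne : b ≠ b' := fun e => hb' (e ▸ hb)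
      exact h1 b b' hne ((h.2 _ hb).2.1 _ hb')
  · push Not at hb
    refine Or.inr ⟨{x | ∃ h : x ≠ t, Sum.inl ⟨x, h⟩ ∈ A}, fun ⟨h, _⟩ => h rfl, ⟨?_, ?_⟩, ?_⟩
    · obtain ⟨x | b, hx⟩ := h.1
      · exact ⟨x.1, x.2, hx⟩
      · exact absurd hx (hb b)
    · rintro x ⟨hxt, hx⟩
      obtain ⟨e1, e2, e3⟩ := h.2 _ hx
      refine ⟨e1, fun u hu => ?_, ?_⟩
      · by_cases hut : u = t
        · subst hut
          have := e2 _ (hb (Classical.arbitrary S'))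
          simpa [Coord.comp, h0] using this
        · exact e2 (Sum.inl ⟨u, hut⟩) fun h => hu ⟨hut, h⟩
      · rintro y ⟨hyt, hy⟩ hyx
        exact e3 _ hy fun e => hyx (congrArg Subtype.val (Sum.inl_injective e))
    · ext e
      rcases e with x | b
      · refine ⟨fun hx => ⟨x, ⟨x.2, hx⟩, rfl⟩, ?_⟩
        rintro ⟨y, ⟨_, hy⟩, e⟩
        rw [e]
        exact hy
      · exact ⟨fun h => absurd h (hb b), fun ⟨x, _, e⟩ => absurd e Sum.inr_ne_inl⟩

end

/-! ### Generated elements and their presentations -/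

section

variable {Q : OperadData.{u}}

/-- The suboperad generated by framed little disks and annuli: its elements are obtained from
framed little disks by inserting caps. -/
inductive Gen (B : Family FLD Q) (C : Family AnTriv Q) : ∀ {S : Type} [Finite S], Q.obj S → Prop
  | base {S : Type} [Finite S] (x : FLD.obj S) : Gen B C (B S x)
  | cap {S S' T : Type} [Finite S] [Finite S'] [Finite T] (t : S) (σ : Ins t S' ≃ T)
      {x : Q.obj S} (u : FLD.obj S') (h : Gen B C x) :
      Gen B C (Q.relabel σ (Q.comp t x (cap B C u)))

variable {B : Family FLD Q} {C : Family AnTriv Q} {π : Family Q Mbar} (H : OverMbar B C π)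
variable {S S' T : Type} [Finite S] [Finite S'] [Finite T]

include H

theorem OverMbar.gen_relabel (σ : S ≃ T) {x : Q.obj S} (h : Gen B C x) :
    Gen B C (Q.relabel σ x) := by
  cases h with
  | base x =>
    rw [← H.homB.map_relabel]
    exact Gen.base _
  | cap t τ u h =>
    rw [← H.isOperad.relabel_trans]
    exact Gen.cap t _ u h

theorem OverMbar.gen_comp_cap (s : S) {x : Q.obj S} (h : Gen B C x) (u : FLD.obj S') :
    Gen B C (Q.comp s x (cap B C u)) := by
  have := Gen.cap s (Equiv.refl _) u h
  rwa [H.isOperad.relabel_refl] at this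

/-- The disks inserted at a leaf are absorbed by the cap or by the framed little disks that carry
this leaf. -/
theorem OverMbar.gen_comp_base {x : Q.obj S} (h : Gen B C x) (v : FLD.obj S') :
    ∀ s, Gen B C (Q.comp s x (B S' v)) := by
  induction h with
  | base x =>
    intro s
    rw [← H.homB.map_comp]
    exact Gen.base _
  | cap t σ u h ih =>
    intro s
    obtain ⟨e, rfl⟩ := σ.surjective s
    rw [H.isOperad.comp_relabel_left σ rfl]
    refine H.gen_relabel _ ?_
    rcases e with ⟨x, hx⟩ | b
    · rw [H.isOperad.assoc_par']
      exact H.gen_relabel _ (H.gen_comp_cap _ (ih x) u)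
    · rw [H.isOperad.assoc_seq', H.cap_comp]
      exact H.gen_relabel _ (H.gen_comp_cap _ h _)

/-- The generated elements are closed under composition: the lower element `y` is inserted in `x` one
factor after the other. -/
theorem OverMbar.gen_comp {x : Q.obj S} {y : Q.obj S'} (hx : Gen B C x) (hy : Gen B C y) (s : S) :
    Gen B C (Q.comp s x y) := by
  induction hy with
  | base v => exact H.gen_comp_base hx v s
  | cap t σ u h ih =>
    rw [H.isOperad.comp_relabel_right, ← H.isOperad.assoc_seq]
    exact H.gen_relabel _ (H.gen_relabel _ (H.gen_comp_cap _ ih u))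

theorem OverMbar.gen_one : Gen B C Q.one := by
  rw [← H.homB.map_one]
  exact Gen.base _

omit H in
/-- An annulus is a relabeled annulus with label set `Unit`. -/
theorem AnTriv_eq_relabel (a : AnTriv.obj S) :
    ∃ (τ : Unit ≃ S) (p : ℂ × ℂ) (hp : p ∈ InDisk), a = AnTriv.relabel τ (annulus1 p hp) := by
  obtain ⟨hs, ⟨s⟩⟩ := Nat.card_eq_one_iff_unique.1 a.2.1
  let τ : Unit ≃ S := ⟨fun _ => s, fun _ => (), fun _ => rfl, fun t => Subsingleton.elim _ _⟩
  refine ⟨τ, a.1 s, a.2.2.2 s, Subtype.ext (funext fun t => ?_)⟩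
  rw [Subsingleton.elim t s]
  rfl

/-- Annuli are generated: those of nonzero radius are framed little disks, and an annulus of radius
zero is a cap with a single disk, inserted in a disk. -/
theorem OverMbar.gen_annulus (a : AnTriv.obj S) : Gen B C (C S a) := by
  obtain ⟨τ, p, hp, rfl⟩ := AnTriv_eq_relabel a
  rw [H.homC.map_relabel]
  refine H.gen_relabel _ ?_
  by_cases h0 : p.2 = 0
  · -- the annulus `(c, 0)` is the composition of a disk, the annulus `(0, 0)` and the unit
    have hc := norm_fst_lt_one hp
    let r : ℝ := (1 - ‖p.1‖) / 2
    have hr : 0 < r := by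
      simp only [r]
      linarith
    have hn : ‖(r : ℂ)‖ = r := by rw [Complex.norm_real, Real.norm_of_nonneg hr.le]
    have hlt : ‖p.1‖ + ‖(r : ℂ)‖ < 1 := by
      rw [hn]
      simp only [r]
      linarith
    have h1 : (p.1, (r : ℂ)) ∈ InDisk := ⟨hlt.le, fun _ => hlt⟩
    have h2 : ((p.1, (r : ℂ)) : ℂ × ℂ).2 ≠ 0 := Complex.ofReal_ne_zero.2 hr.ne'
    have e : C Unit (annulus1 p hp) =
        Q.act (B Unit (disk1 _ h1 h2)) (cap B C (disk1 (0, 1) one_inDisk one_ne_zero)) := by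
      rw [cap, H.disk_eq, H.disk_eq, ← H.homC.map_act, ← H.homC.map_act]
      refine congrArg (C Unit) (Subtype.ext ?_)
      rw [AnTriv_act_val, AnTriv_act_val]
      funext s
      exact Prod.ext (by simp [annulus1, annulus, odot]) (by simp [annulus1, annulus, odot, h0])
    rw [e]
    exact H.gen_relabel _ (H.gen_comp_cap _ (Gen.base _) _)
  · rw [← H.disk_eq p hp h0]
    exact Gen.base _

theorem OverMbar.gen_ract (s : S) {x : Q.obj S} (h : Gen B C x) {q : ℂ} (hq : ‖q‖ ≤ 1) :
    Gen B C (Q.ract s x (C Unit (annulus q hq))) :=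
  H.gen_relabel _ (H.gen_comp h (H.gen_annulus _) s)

/-- The cap in `𝕄̄`. -/
theorem OverMbar.map_cap (u : FLD.obj S) :
    π S (cap B C u) = mact (lmap (annulus 0 (by simp))) (kmap u) := by
  rw [cap, H.homπ.map_act, H.πB, H.πC]
  rfl

theorem OverMbar.crd_cap (u : FLD.obj S) :
    crd (π S (cap B C u)) = (fun _ => (0, 0), (crd (kmap u)).2) := by
  rw [H.map_cap, crd_act, crd_lmap_abs]
  refine Prod.ext (funext fun s => ?_) rfl
  simp [annulus, odot]

omit H in
theorem rho_kmap_ne (u : FLD.obj S) {s t : S} (h : s ≠ t) : (crd (kmap u)).2.1 s t ≠ 0 := by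
  rw [crd_kmap_rho u h]
  exact div_ne_zero (u.2.2.2.1 s) (sub_ne_zero.2 (Apart.ne (u.2.2.1 s t h)))

theorem OverMbar.crd_relabel_comp {t : S} (σ : Ins t S' ≃ T) (x : Q.obj S) (y : Q.obj S') :
    crd (π T (Q.relabel σ (Q.comp t x y))) =
      Coord.relabel σ (Coord.comp t (crd (π S x)) (crd (π S' y))) := by
  rw [H.homπ.map_relabel, H.homπ.map_comp]
  exact (crd_relabel σ (mcomp t (π S x) (π S' y))).trans (congrArg _ (crd_comp _ _ _))

omit H in
/-- A presentation of `x` as a composition with a cap with set of leaves `A`, in which the leaf at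
which the cap is inserted is not degenerate. -/
def Presentation (B : Family FLD Q) (C : Family AnTriv Q) (π : Family Q Mbar) (x : Q.obj S)
    (A : Set S) : Prop :=
  ∃ (y : Q.obj (Collapse A)) (u : FLD.obj A), Gen B C y ∧
    NZ (crd (S := Collapse A) (π (Collapse A) y)) (tip A) ∧ x = Q.glue A y (cap B C u)

/-- If a cap is inserted at a leaf that is not degenerate, the result has a presentation. -/
theorem OverMbar.presentation {t : S} (σ : Ins t S' ≃ T) {x : Q.obj S} (u : FLD.obj S')
    (hx : Gen B C x) (ht : NZ (crd (S := S) (π S x)) t) {A : Set T}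
    (hA : ∀ s, s ∈ A ↔ ∃ b, σ (Sum.inr b) = s) :
    Presentation B C π (Q.relabel σ (Q.comp t x (cap B C u))) A := by
  classical
  have hl : ∀ y, σ (Sum.inl y) ∉ A := fun y h => by
    obtain ⟨b, e⟩ := (hA _).1 h
    exact Sum.inr_ne_inl (σ.injective e)
  let τ' : S' ≃ A := Equiv.ofBijective (fun b => ⟨σ (Sum.inr b), (hA _).2 ⟨b, rfl⟩⟩) (by
    refine ⟨fun b b' e => Sum.inr_injective (σ.injective (congrArg Subtype.val e)), ?_⟩
    rintro ⟨a, ha⟩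
    obtain ⟨b, rfl⟩ := (hA a).1 ha
    exact ⟨b, rfl⟩)
  let φ : S → Collapse A := fun x =>
    if h : x = t then tip A else Sum.inl ⟨σ (Sum.inl ⟨x, h⟩), hl _⟩
  have hφt : φ t = tip A := dif_pos rfl
  have hφ : ∀ x (h : x ≠ t), φ x = Sum.inl ⟨σ (Sum.inl ⟨x, h⟩), hl _⟩ := fun x h => dif_neg h
  let τ : S ≃ Collapse A := Equiv.ofBijective φ (by
    constructor
    · intro x y e
      by_cases hx : x = t
      · by_cases hy : y = t
        · rw [hx, hy]
        · rw [hx, hφt, hφ y hy] at e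
          exact absurd e Sum.inr_ne_inl
      · by_cases hy : y = t
        · rw [hy, hφt, hφ x hx] at e
          exact absurd e Sum.inl_ne_inr
        · rw [hφ x hx, hφ y hy] at e
          exact congrArg Subtype.val (Sum.inl_injective (σ.injective
            (congrArg Subtype.val (Sum.inl_injective e))))
    · rintro (⟨a, ha⟩ | ⟨⟩)
      · obtain ⟨x | b, rfl⟩ := σ.surjective a
        · exact ⟨x.1, hφ x.1 x.2⟩
        · exact absurd ((hA _).2 ⟨b, rfl⟩) ha
      · exact ⟨t, hφt⟩)
  have hτ : τ t = tip A := hφt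
  refine ⟨Q.relabel τ x, FLD.relabel τ' u, H.gen_relabel τ hx, ?_, ?_⟩
  · rw [H.homπ.map_relabel]
    have e : crd (S := Collapse A) (Mbar.relabel τ (π S x)) = Coord.relabel τ (crd (π S x)) :=
      crd_relabel τ (π S x)
    rw [e, ← hτ]
    exact (nz_relabel τ).2 ht
  · rw [OperadData.glue, ← H.relabel_cap, H.isOperad.comp_relabel τ τ' hτ,
      ← H.isOperad.relabel_trans]
    refine congrArg (fun e => Q.relabel e _) (Equiv.ext ?_)
    rintro (⟨x, hx⟩ | b)
    · have e : τ x = Sum.inl ⟨σ (Sum.inl ⟨x, hx⟩), hl _⟩ := hφ x hx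
      have h2 : ∀ (z : Collapse A) (hz : z ≠ tip A), z = Sum.inl ⟨σ (Sum.inl ⟨x, hx⟩), hl _⟩ →
          σ (Sum.inl ⟨x, hx⟩) = collapseEquiv A (Sum.inl ⟨z, hz⟩) := by
        rintro _ hz rfl
        rfl
      exact h2 _ _ e
    · rfl

/-- Each set of leaves that is the set of incoming edges of a terminal vertex underlies a
presentation. -/
theorem OverMbar.exists_presentation {x : Q.obj S} (hx : Gen B C x) :
    ∀ A : Set S, TC (crd (S := S) (π S x)) A → Presentation B C π x A := by
  induction hx with
  | base x =>
    intro A hA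
    obtain ⟨s, hs⟩ := hA.1
    have h := (hA.2 s hs).1
    rw [H.πB] at h
    have e : (crd (kmap x)).1 s = x.1 s := congrFun (crd_kmap_abs x) s
    exact absurd ((congrArg Prod.snd e).symm.trans h) (x.2.2.2.1 s)
  | @cap S S' T _ _ _ t σ x u hx ih =>
    intro A hA
    have := u.2.1
    have hop := H.isOperad
    rw [H.crd_relabel_comp, H.crd_cap] at hA
    rcases tc_comp_cases (κ' := (fun _ => (0, 0), (crd (kmap u)).2)) (fun _ => rfl)
      (fun b b' h => rho_kmap_ne u h) (tc_relabel σ hA) with h | ⟨A₀, htA, hA₀, h⟩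
    · have hA' : ∀ s, s ∈ A ↔ ∃ b, σ (Sum.inr b) = s := by
        intro s
        have : s ∈ A ↔ σ.symm s ∈ σ ⁻¹' A := by simp
        rw [this, h]
        exact exists_congr fun b => by rw [Equiv.eq_symm_apply]
      by_cases ht : NZ (crd (S := S) (π S x)) t
      · exact H.presentation σ u hx ht hA'
      · -- the cap is inserted in a cap with a single disk
        have htc : TC (crd (S := S) (π S x)) {t} := by
          rw [NZ, not_or, not_not, not_exists] at ht
          refine ⟨⟨t, rfl⟩, ?_⟩
          rintro s rfl
          exact ⟨ht.1, fun u _ => not_not.1 (ht.2 u), fun t' h h' => absurd h h'⟩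
        obtain ⟨y, v, hy, hyt, e⟩ := ih _ htc
        have hct : collapseEquiv ({t} : Set S) (Sum.inr ⟨t, Set.mem_singleton t⟩) = t := rfl
        obtain ⟨ρ, hρ, e2⟩ := H.cap_comp_cap (s := (⟨t, Set.mem_singleton t⟩ : ({t} : Set S)))
          (fun z => Subtype.ext z.2) v u
        have e3 : Q.relabel σ (Q.comp t x (cap B C u)) = Q.relabel
            ((Ins.map (Equiv.refl _) ρ (Equiv.refl_apply _)).trans ((Ins.seq S' (tip ({t} : Set S))
              (⟨t, Set.mem_singleton t⟩ : ({t} : Set S))).symm.trans ((Ins.map (collapseEquiv {t})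
                (Equiv.refl S') (s := Sum.inr ⟨t, Set.mem_singleton t⟩) (t := t) hct).trans σ)))
            (Q.comp (tip {t}) y (cap B C u)) := by
          rw [e, OperadData.glue, hop.comp_relabel_left (collapseEquiv {t})
            (s := Sum.inr ⟨t, Set.mem_singleton t⟩) (t := t) hct, hop.assoc_seq', e2, hop.comp_relabel_right]
          rw [hop.relabel_trans, hop.relabel_trans, hop.relabel_trans]
        rw [e3]
        refine H.presentation _ u hy hyt fun s => ?_
        rw [hA']
        refine exists_congr fun b => ?_
        have : σ (Sum.inr b) = (((Ins.map (Equiv.refl _) ρ (Equiv.refl_apply _)).trans ((Ins.seq S'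
            (tip ({t} : Set S)) (⟨t, Set.mem_singleton t⟩ : ({t} : Set S))).symm.trans
              ((Ins.map (collapseEquiv {t}) (Equiv.refl S') (s := Sum.inr ⟨t, Set.mem_singleton t⟩)
                (t := t) hct).trans σ))) (Sum.inr b)) := by
          change _ = σ ((Ins.map (collapseEquiv {t}) (Equiv.refl S') (s := Sum.inr ⟨t, Set.mem_singleton t⟩)
            (t := t) hct) ((Ins.seq S' (tip ({t} : Set S)) (⟨t, Set.mem_singleton t⟩ : ({t} : Set S))).symm
              (Sum.inr (ρ b))))
          rw [hρ]
          rfl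
        rw [this]
    · -- the two caps are inserted at different leaves
      obtain ⟨y, v, hy, hyt, e⟩ := ih A₀ hA₀
      let t₀ : Collapse A₀ := Sum.inl ⟨t, htA⟩
      have ht₀ : t₀ ≠ tip A₀ := Sum.inl_ne_inr
      have e3 : Q.relabel σ (Q.comp t x (cap B C u)) = Q.relabel
          ((Ins.par A₀ S' (tip A₀) t₀ ht₀).symm.trans ((Ins.map (collapseEquiv A₀)
            (Equiv.refl S') (s := Sum.inl ⟨t₀, ht₀⟩) (t := t) rfl).trans σ))
          (Q.comp (Sum.inl ⟨tip A₀, ht₀.symm⟩ : Ins t₀ S') (Q.comp t₀ y (cap B C u))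
            (cap B C v)) := by
        rw [e, OperadData.glue, hop.comp_relabel_left (collapseEquiv A₀)
          (s := Sum.inl ⟨t₀, ht₀⟩) (t := t) rfl, hop.assoc_par']
        simp only [hop.relabel_trans]
      rw [e3]
      refine H.presentation _ v (H.gen_comp_cap _ hy u) ?_ fun s => ?_
      · rw [H.homπ.map_comp]
        have e4 : crd (S := Ins t₀ S') (Mbar.comp t₀ (π _ y) (π S' (cap B C u))) =
          Coord.comp t₀ (crd (π _ y)) (crd (π S' (cap B C u))) := crd_comp _ _ _
        rw [e4]
        refine (nz_comp_inl (x := ⟨tip A₀, ht₀.symm⟩) fun b => ?_).2 hyt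
        rw [H.crd_cap]
      · have : s ∈ A ↔ σ.symm s ∈ σ ⁻¹' A := by simp
        rw [this, h]
        constructor
        · rintro ⟨z, hz, e⟩
          refine ⟨⟨z.1, hz⟩, ?_⟩
          rw [Equiv.symm_apply_eq] at e
          rw [e]
          rfl
        · rintro ⟨b, rfl⟩
          refine ⟨⟨b.1, fun e => htA (e ▸ b.2)⟩, b.2, ?_⟩
          rw [Equiv.symm_apply_eq]
          rfl

end

end TrivDisks

namespace TrivDisks
open Topology Filter DTree

/-! ### Generated elements are determined by their image in `𝕄̄` -/

section

variable {S S' T : Type}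

theorem Coord.relabel_injective (σ : S ≃ T) : Function.Injective (Coord.relabel σ) := by
  intro κ κ' h
  refine Prod.ext (funext fun s => ?_) (Prod.ext (funext fun s => funext fun t => ?_)
    (funext fun s => funext fun t => funext fun u => ?_))
  · have := congrFun (congrArg Prod.fst h) (σ s)
    simpa [Coord.relabel] using this
  · have := congrFun (congrFun (congrArg (fun κ => κ.2.1) h) (σ s)) (σ t)
    simpa [Coord.relabel] using this
  · have := congrFun (congrFun (congrFun (congrArg (fun κ => κ.2.2) h) (σ s)) (σ t)) (σ u)
    simpa [Coord.relabel] using this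

theorem tc_relabel_symm (σ : S ≃ T) {κ : Coord S} {A : Set S} (h : TC κ A) :
    TC (Coord.relabel σ κ) (σ.symm ⁻¹' A) := by
  refine tc_relabel σ.symm ?_
  have : Coord.relabel σ.symm (Coord.relabel σ κ) = κ := by
    simp [Coord.relabel]
  rwa [this]

/-- A triple with two equal entries and a different one has a fixed value of `tri`. -/
theorem crd_tri_left (z : MbarObj S) {s u : S} (h : u ≠ s) :
    (crd z).2.2 s s u = bl 0 1 ∧ (crd z).2.2 s u s = bl 1 0 := by
  obtain ⟨X, hX, rfl⟩ := exists_toMbar z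
  obtain ⟨b, p, q, r, hp, hq, hr, hne⟩ := hX.good.exists_split_triple (s := s) (t := s) (u := u)
    fun e => h e.2
  rw [crd_toMbar]
  obtain rfl := hp.unique hq
  have hw : p.1 - r.1 ≠ 0 := fun e => hne ⟨sub_self _, e⟩
  constructor
  · refine (tri_eq hp hp hr hne).trans ?_
    have := bl_smul hw 0 1
    rw [mul_zero, mul_one] at this
    rw [sub_self, this]
  · refine (tri_eq hp hr hp fun e => hne ⟨e.2, e.1⟩).trans ?_
    have := bl_smul hw 1 0
    rw [mul_zero, mul_one] at this
    rw [sub_self, this]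

theorem compFactor_eq_one {t : S} {κ : Coord S} {κ' : Coord S'} (h0 : ∀ b, (κ'.1 b).1 = 0)
    (e e' : Ins t S') : compFactor t κ κ' e e' = 1 := by
  rcases e with x | b <;> rcases e' with y | b' <;> simp [compFactor, h0]

theorem blScale_one_tri (z : MbarObj S) (s t u : S) :
    blScale 1 1 ((crd z).2.2 s t u) = (crd z).2.2 s t u := by
  by_cases h : t = s ∧ u = s
  · obtain ⟨rfl, rfl⟩ := h
    rw [crd_tri_self]
    simp [blScale]
  · obtain ⟨v, w, h1, h2⟩ := crd_tri_eq_bl z h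
    rw [h2, blScale_bl h1, one_mul, one_mul]

open Classical in
/-- The leaves of the lower tree as leaves of a composition, given a leaf of the upper tree. -/
noncomputable def Ins.up (t : S) (b : S') (x : S) : Ins t S' :=
  if h : x = t then Sum.inr b else Sum.inl ⟨x, h⟩

theorem Ins.up_self (t : S) (b : S') : Ins.up t b t = Sum.inr b := dif_pos rfl

theorem Ins.up_ne {t : S} (b : S') {x : S} (h : x ≠ t) : Ins.up t b x = Sum.inl ⟨x, h⟩ :=
  dif_neg h

variable {t : S} {κ' : Coord S'}

/-- The centers, and the radii at the other leaves, are recovered after a cap is inserted at `t`. -/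
theorem comp_up_abs {κ : Coord S} (h0 : ∀ b, κ'.1 b = (0, 0)) (b : S') (x : S) :
    ((Coord.comp t κ κ').1 (Ins.up t b x)).1 = (κ.1 x).1 ∧
      (x ≠ t → (Coord.comp t κ κ').1 (Ins.up t b x) = κ.1 x) := by
  by_cases hx : x = t
  · subst hx
    rw [Ins.up_self]
    exact ⟨by simp [Coord.comp, odot, h0], fun h => absurd rfl h⟩
  · rw [Ins.up_ne b hx]
    exact ⟨rfl, fun _ => rfl⟩

/-- The values `rho x y` with `x ≠ t` are recovered after a cap is inserted at `t`. -/
theorem comp_up_rho {κ : Coord S} (h0 : ∀ b, κ'.1 b = (0, 0)) (b : S') {x : S} (hx : x ≠ t)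
    (y : S) : (Coord.comp t κ κ').2.1 (Ins.up t b x) (Ins.up t b y) = κ.2.1 x y := by
  by_cases hy : y = t
  · subst hy
    rw [Ins.up_self, Ins.up_ne b hx]
    simp [Coord.comp, h0]
  · rw [Ins.up_ne b hy, Ins.up_ne b hx]
    rfl

/-- The values of `tri` are recovered after a cap is inserted at `t`. -/
theorem comp_up_tri (z : MbarObj S) (h0 : ∀ b, κ'.1 b = (0, 0)) (b : S')
    (hb : κ'.2.2 b b b = 0) (x y w : S) :
    (Coord.comp t (crd z) κ').2.2 (Ins.up t b x) (Ins.up t b y) (Ins.up t b w) =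
      (crd z).2.2 x y w := by
  have h1 : ∀ e e' : Ins t S', compFactor t (crd z) κ' e e' = 1 :=
    compFactor_eq_one fun b => by rw [h0]
  by_cases hx : x = t
  · subst hx
    by_cases hy : y = x
    · subst hy
      by_cases hw : w = y
      · subst hw
        rw [crd_tri_self, Ins.up_self]
        exact hb
      · rw [(crd_tri_left z hw).1, Ins.up_self, Ins.up_ne b hw]
        simp [Coord.comp, h0]
    · by_cases hw : w = x
      · subst hw
        rw [(crd_tri_left z hy).2, Ins.up_self, Ins.up_ne b hy]
        simp [Coord.comp, h0]
      · rw [Ins.up_self, Ins.up_ne b hw, Ins.up_ne b hy]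
        refine Eq.trans ?_ (blScale_one_tri z _ _ _)
        simp only [Coord.comp, h1]
        rfl
  · have key : ∀ e e', (Coord.comp t (crd z) κ').2.2 (Sum.inl ⟨x, hx⟩) e e' =
        (crd z).2.2 x (insProj t e) (insProj t e') := by
      intro e e'
      refine Eq.trans ?_ (blScale_one_tri z _ _ _)
      rcases e with e | e <;> rcases e' with e' | e' <;> simp only [Coord.comp, h1] <;> rfl
    have h2 : ∀ y, insProj t (Ins.up t b y) = y := by
      intro y
      by_cases hy : y = t
      · rw [hy, Ins.up_self]
        rfl
      · rw [Ins.up_ne b hy]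
        rfl
    rw [Ins.up_ne b hx, key, h2, h2]

variable [Finite S] [Finite S']

omit [Finite S] in
/-- If two elements have the same centers and the same values of `tri`, and the leaf `t` is not
degenerate in either of them, then the coordinates that involve the radius at `t` are proportional. -/
theorem exists_scale_crd {z z' : MbarObj S} (h1 : ∀ s, ((crd z).1 s).1 = ((crd z').1 s).1)
    (h2 : (crd z).2.2 = (crd z').2.2) {t : S} (hz : NZ (crd z) t) (hz' : NZ (crd z') t) :
    ∃ k : ℂ, k ≠ 0 ∧ ((crd z').1 t).2 = k * ((crd z).1 t).2 ∧
      ∀ s, (crd z').2.1 t s = k * (crd z).2.1 t s := by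
  obtain ⟨X, hX, rfl⟩ := exists_toMbar z
  obtain ⟨Y, hY, rfl⟩ := exists_toMbar z'
  simp only [crd_toMbar] at *
  exact exists_scale hX.good hY.good h1 h2 hz hz'

theorem crd_annulus {q : ℂ} (hq : ‖q‖ ≤ 1) (b : Unit) : (crd (lmap (annulus q hq))).1 b = (0, q) := by
  rw [crd_lmap_abs]
  rfl

/-- Two elements that agree up to the radius at the leaf `t` agree after insertion of suitable
annuli. -/
theorem comp_annulus_eq {z z' : MbarObj S} {t : S} {k : ℂ}
    (h1 : ∀ s, ((crd z).1 s).1 = ((crd z').1 s).1) (h2 : (crd z).2.2 = (crd z').2.2)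
    (h3 : ∀ s, s ≠ t → (crd z).1 s = (crd z').1 s)
    (h4 : ∀ s, s ≠ t → ∀ s', (crd z).2.1 s s' = (crd z').2.1 s s')
    (hk1 : ((crd z').1 t).2 = k * ((crd z).1 t).2)
    (hk2 : ∀ s, (crd z').2.1 t s = k * (crd z).2.1 t s) {q q' : ℂ} (hq : ‖q‖ ≤ 1) (hq' : ‖q'‖ ≤ 1)
    (hqk : q = k * q') :
    mcomp t z (lmap (annulus q hq)) = mcomp t z' (lmap (annulus q' hq')) := by
  refine crd_injective ?_
  rw [crd_comp, crd_comp]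
  have e1 := crd_annulus hq
  have e2 := crd_annulus hq'
  have f1 : ∀ e e' : Ins t Unit, compFactor t (crd z) (crd (lmap (annulus q hq))) e e' = 1 :=
    compFactor_eq_one fun b => by rw [e1]
  have f2 : ∀ e e' : Ins t Unit, compFactor t (crd z') (crd (lmap (annulus q' hq'))) e e' = 1 :=
    compFactor_eq_one fun b => by rw [e2]
  refine Prod.ext (funext ?_) (Prod.ext (funext₂ ?_) (funext₃ ?_))
  · rintro (x | b)
    · exact h3 x.1 x.2
    · simp only [Coord.comp, Sum.elim_inr, e1, e2, odot, mul_zero, add_zero]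
      rw [h1, hk1, hqk]
      refine Prod.ext rfl ?_
      ring
  · rintro (x | b) (y | b')
    · exact h4 x.1 x.2 _
    · simp only [Coord.comp, e1, e2, mul_zero, add_zero, div_one]
      exact h4 x.1 x.2 _
    · simp only [Coord.comp, e1, e2, mul_zero, add_zero, div_one]
      rw [hk2, hqk]
      ring
    · exact (crd_rho_self _ _).trans (crd_rho_self _ _).symm
  · rintro (x | b) (y | b') (w | b'')
    all_goals simp only [Coord.comp, e1, e2, f1, f2, h2, mul_zero, add_zero, sub_self]
    exact (crd_tri_self _ _).trans (crd_tri_self _ _).symm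

/-- The insertion of an annulus of nonzero radius creates no degenerate leaves. -/
theorem nz_ract (z : MbarObj S) (t : S) {q : ℂ} (hq : ‖q‖ ≤ 1) (hq0 : q ≠ 0) {s : S}
    (h : NZ (crd z) s) : NZ (crd (mrelabel (Ins.right t) (mcomp t z (lmap (annulus q hq))))) s := by
  have e1 := crd_annulus hq
  rw [crd_relabel, crd_comp]
  by_cases hs : s = t
  · subst hs
    have e : s = Ins.right s (Sum.inr ()) := rfl
    conv => rw [e]
    refine (nz_relabel _).2 ?_
    rcases h with h | ⟨u, h⟩
    · refine Or.inl ?_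
      simp only [Coord.comp, e1, odot]
      exact mul_ne_zero h hq0
    · by_cases hu : u = s
      · rw [hu, crd_rho_self] at h
        exact absurd rfl h
      · refine Or.inr ⟨Sum.inl ⟨u, hu⟩, ?_⟩
        simp only [Coord.comp, e1, mul_zero, add_zero, div_one]
        exact mul_ne_zero h hq0
  · have e : s = Ins.right t (Sum.inl ⟨s, hs⟩) := rfl
    rw [e]
    refine (nz_relabel _).2 ((nz_comp_inl (x := ⟨s, hs⟩) fun b => ?_).2 h)
    rw [e1]

/-- The number of leaves plus the number of degenerate leaves. -/
noncomputable def weight {S : Type} (κ : Coord S) : ℕ := Nat.card (S ⊕ {s // ¬ NZ κ s})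

theorem card_lt_card_of_notMem_range {α β : Type} [Finite α] [Finite β] {f : α → β}
    (hf : Function.Injective f) {b : β} (hb : b ∉ Set.range f) : Nat.card α < Nat.card β := by
  have := Fintype.ofFinite α
  have := Fintype.ofFinite β
  rw [Nat.card_eq_fintype_card, Nat.card_eq_fintype_card]
  exact Fintype.card_lt_of_injective_of_notMem f hf hb

omit [Finite S'] in
/-- If a terminal vertex is replaced by a single leaf that is not degenerate, then the weight
drops: either the number of leaves does, or a degenerate leaf is replaced by another one. -/
theorem weight_lt {x : MbarObj S} {A : Set S} (hA : TC (crd x) A) {z : MbarObj (Collapse A)}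
    (hz : NZ (crd z) (tip A))
    (h : ∀ s : {s // s ∉ A}, NZ (crd x) s.1 → NZ (crd z) (Sum.inl s)) :
    weight (crd z) < weight (crd x) := by
  classical
  obtain ⟨⟨a, ha⟩, hTC⟩ := hA
  have hl : ∀ e : Collapse A, ¬ NZ (crd z) e → ¬ NZ (crd x) (lift A a e) := by
    rintro (s | ⟨⟩) he hs
    · exact he (h s hs)
    · exact he hz
  let f : Collapse A ⊕ {e // ¬ NZ (crd z) e} → S ⊕ {s // ¬ NZ (crd x) s} :=
    Sum.map (lift A a) fun e => ⟨lift A a e.1, hl e.1 e.2⟩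
  have hf : Function.Injective f := (lift_injective ha).sumMap fun e e' h =>
    Subtype.ext (lift_injective ha (congrArg Subtype.val h))
  by_cases h1 : ∃ a' ∈ A, a' ≠ a
  · obtain ⟨a', ha', hne⟩ := h1
    refine card_lt_card_of_notMem_range hf (b := Sum.inl a') ?_
    rintro ⟨e | e, he⟩
    · have he : lift A a e = a' := Sum.inl_injective he
      have := lift_mem (he ▸ ha' : lift A a e ∈ A)
      subst this
      exact hne he.symm
    · exact absurd he Sum.inr_ne_inl
  · push Not at h1
    have hna : ¬ NZ (crd x) a := by
      rintro (h | ⟨u, h⟩)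
      · exact h (hTC a ha).1
      · by_cases hu : u ∈ A
        · rw [h1 u hu, crd_rho_self] at h
          exact h rfl
        · exact h ((hTC a ha).2.1 u hu)
    refine card_lt_card_of_notMem_range hf (b := Sum.inr ⟨a, hna⟩) ?_
    rintro ⟨e | e, he⟩
    · exact absurd he Sum.inl_ne_inr
    · have he : lift A a e.1 = a := congrArg Subtype.val (Sum.inr_injective he)
      have := lift_mem (show lift A a e.1 ∈ A by rw [he]; exact ha)
      exact e.2 (this ▸ hz)

end

section

variable {Q : OperadData.{u}} {B : Family FLD Q} {C : Family AnTriv Q} {π : Family Q Mbar}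
variable (H : OverMbar B C π)

include H

/-- A generated element is a framed little disk, or its image in `𝕄̄` has a terminal vertex other than
the root. -/
theorem OverMbar.base_or_tc {S : Type} [Finite S] {x : Q.obj S} (hx : Gen B C x) :
    (∃ u, x = B S u) ∨ ∃ A, TC (crd (S := S) (π S x)) A := by
  cases hx with
  | base u => exact Or.inl ⟨u, rfl⟩
  | cap t σ u h =>
    have := u.2.1
    refine Or.inr ⟨σ.symm ⁻¹' Set.range Sum.inr, ?_⟩
    rw [H.crd_relabel_comp, H.crd_cap]
    exact tc_relabel_symm σ (tc_comp_inr (fun _ => rfl) fun b b' h => rho_kmap_ne u h)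

theorem OverMbar.crd_glue {S : Type} [Finite S] {A : Set S} (y : Q.obj (Collapse A))
    (u : FLD.obj A) : crd (S := S) (π S (Q.glue A y (cap B C u))) = Coord.relabel (collapseEquiv A)
      (Coord.comp (tip A) (crd (S := Collapse A) (π _ y)) (fun _ => (0, 0), (crd (kmap u)).2)) := by
  rw [OperadData.glue, H.crd_relabel_comp, H.crd_cap]

/-- A cap absorbs the concentric annuli that it is inserted in. -/
theorem OverMbar.glue_ract {S : Type} [Finite S] {A : Set S} (y : Q.obj (Collapse A))
    (u : FLD.obj A) {q : ℂ} (hq : ‖q‖ ≤ 1) :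
    Q.glue A (Q.ract (tip A) y (C Unit (annulus q hq))) (cap B C u) = Q.glue A y (cap B C u) := by
  rw [OperadData.glue, OperadData.glue, H.isOperad.ract_comp, H.act_cap]

omit H in
/-- Framed little disks with the same ratios of radii and distances differ by an affine map. -/
theorem exists_affine {S : Type} [Finite S] {u u' : FLD.obj S}
    (h : (crd (kmap u)).2.1 = (crd (kmap u')).2.1) :
    ∃ g : ℂ × ℂ, g.2 ≠ 0 ∧ ∀ s, u'.1 s = odot g (u.1 s) := by
  obtain ⟨a⟩ := u.2.1
  have h1 : (u.1 a).2 ≠ 0 := u.2.2.2.1 a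
  have h2 : (u'.1 a).2 ≠ 0 := u'.2.2.2.1 a
  refine ⟨odot (u'.1 a) (oinv (u.1 a)), mul_ne_zero h2 (oinv_snd_ne h1), fun b => ?_⟩
  by_cases hb : b = a
  · rw [hb, odot_assoc, oinv_odot h1, odot_one]
  · have k1 : (u.1 a).1 ≠ (u.1 b).1 := Apart.ne (u.2.2.1 a b (Ne.symm hb))
    have k2 : (u'.1 a).1 ≠ (u'.1 b).1 := Apart.ne (u'.2.2.1 a b (Ne.symm hb))
    refine odot_eq_of_ratio h1 h2 k1 k2 ?_ ?_
    · rw [← crd_kmap_rho u (Ne.symm hb), ← crd_kmap_rho u' (Ne.symm hb), h]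
    · rw [← crd_kmap_rho u hb, ← crd_kmap_rho u' hb, h]

/-- By induction on the weight. Given a terminal vertex of the common image in `𝕄̄`, both elements
are obtained by inserting a cap at a leaf. The two caps agree. The elements that the caps are inserted
in have images in `𝕄̄` that may differ by the radius at this leaf; they become equal after the
insertion of suitable annuli, and these annuli are absorbed by the caps. -/
theorem OverMbar.gen_unique (n : ℕ) : ∀ {S : Type} [Finite S] {x x' : Q.obj S}, Gen B C x →
    Gen B C x' → π S x = π S x' → weight (crd (S := S) (π S x)) = n → x = x' := by
  induction n using Nat.strong_induction_on with
  | _ n ih =>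
  intro S _ x x' hx hx' hπ hn
  by_cases hTC : ∃ A, TC (crd (S := S) (π S x)) A
  · obtain ⟨A, hA⟩ := hTC
    obtain ⟨y, u, hy, hyt, rfl⟩ := H.exists_presentation hx A hA
    obtain ⟨y', u', hy', hyt', rfl⟩ := H.exists_presentation hx' A (hπ ▸ hA)
    obtain ⟨a⟩ := u.2.1
    have E := congrArg (crd (S := S)) hπ
    rw [H.crd_glue, H.crd_glue] at E
    have E := Coord.relabel_injective _ E
    -- the two caps agree
    have hu : cap B C u' = cap B C u := by
      have hrho : (crd (kmap u)).2.1 = (crd (kmap u')).2.1 := funext₂ fun b b' =>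
        congrFun (congrFun (congrArg (fun κ => κ.2.1) E) (Sum.inr b)) (Sum.inr b')
      obtain ⟨g, hg, h⟩ := exists_affine hrho
      exact H.cap_eq hg h
    -- the remaining factors agree up to the radius at the new leaf
    set w : MbarObj (Collapse A) := π _ y with hw
    set w' : MbarObj (Collapse A) := π _ y' with hw'
    have h0 : ∀ (u : FLD.obj A) (b : A), (((fun _ => (0, 0), (crd (kmap u)).2) : Coord A).1 b) =
        (0, 0) := fun _ _ => rfl
    have h1 : ∀ s, ((crd w).1 s).1 = ((crd w').1 s).1 := fun s => by
      rw [← (comp_up_abs (t := tip A) (h0 u) a s).1, ← (comp_up_abs (t := tip A) (h0 u') a s).1, E]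
    have h2 : (crd w).2.2 = (crd w').2.2 := funext₃ fun s t v => by
      rw [← comp_up_tri (t := tip A) w (h0 u) a (crd_tri_self _ _) s t v,
        ← comp_up_tri (t := tip A) w' (h0 u') a (crd_tri_self _ _) s t v, E]
    have h3 : ∀ s, s ≠ tip A → (crd w).1 s = (crd w').1 s := fun s hs => by
      rw [← (comp_up_abs (t := tip A) (h0 u) a s).2 hs,
        ← (comp_up_abs (t := tip A) (h0 u') a s).2 hs, E]
    have h4 : ∀ s, s ≠ tip A → ∀ s', (crd w).2.1 s s' = (crd w').2.1 s s' := fun s hs s' => by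
      rw [← comp_up_rho (t := tip A) (h0 u) a hs s', ← comp_up_rho (t := tip A) (h0 u') a hs s', E]
    obtain ⟨k, hk, hk1, hk2⟩ := exists_scale_crd h1 h2 hyt hyt'
    -- the annuli have to have norm at most one and ratio `k`
    obtain ⟨q, q', hq, hq', hq0, hqk⟩ : ∃ q q' : ℂ, ‖q‖ ≤ 1 ∧ ‖q'‖ ≤ 1 ∧ q ≠ 0 ∧ q = k * q' := by
      rcases le_total ‖k‖ 1 with h | h
      · exact ⟨k, 1, h, by simp, hk, by simp⟩
      · exact ⟨1, k⁻¹, by simp, by rw [norm_inv]; exact inv_le_one_of_one_le₀ h, one_ne_zero,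
          (mul_inv_cancel₀ hk).symm⟩
    have hc := comp_annulus_eq h1 h2 h3 h4 hk1 hk2 hq hq' hqk
    have hz : π _ (Q.ract (tip A) y (C Unit (annulus q hq))) =
        mrelabel (Ins.right (tip A)) (mcomp (tip A) w (lmap (annulus q hq))) := by
      rw [H.homπ.map_ract, H.πC]
      rfl
    have hz' : π _ (Q.ract (tip A) y' (C Unit (annulus q' hq'))) =
        mrelabel (Ins.right (tip A)) (mcomp (tip A) w' (lmap (annulus q' hq'))) := by
      rw [H.homπ.map_ract, H.πC]
      rfl
    have key := ih (weight (crd (S := Collapse A) (π _ (Q.ract (tip A) y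
      (C Unit (annulus q hq)))))) (by
        rw [← hn, hz]
        refine weight_lt hA (nz_ract _ _ hq hq0 hyt) fun s hs => nz_ract _ _ hq hq0 ?_
        rw [H.crd_glue] at hs
        have : Nonempty A := ⟨a⟩
        have e : s.1 = collapseEquiv A (Sum.inl ⟨Sum.inl s, Sum.inl_ne_inr⟩) := rfl
        rw [e] at hs
        exact (nz_comp_inl (x := ⟨Sum.inl s, Sum.inl_ne_inr⟩) fun _ => rfl).1
          ((nz_relabel _).1 hs))
      (H.gen_ract (tip A) hy hq) (H.gen_ract (tip A) hy' hq') (by rw [hz, hz', hc]) rfl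
    rw [← H.glue_ract y u hq, ← H.glue_ract y' u' hq', key, hu]
  · obtain ⟨u, rfl⟩ := (H.base_or_tc hx).resolve_right hTC
    obtain ⟨u', rfl⟩ := (H.base_or_tc hx').resolve_right (hπ ▸ hTC)
    rw [H.πB, H.πB] at hπ
    rw [fldToMbar_injective hπ]

/-- Each element of `𝕄̄` lifts to a generated element: insert the terminal vertices one after the
other. -/
theorem OverMbar.exists_gen (n : ℕ) : ∀ {S : Type} [Finite S] (X : DTree S) (hX : X.Valid),
    Nat.card X.V = n → ∃ x : Q.obj S, Gen B C x ∧ π S x = toMbar X hX := by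
  induction n with
  | zero =>
    intro S _ X hX hn
    have := X.finite
    have : IsEmpty X.V := Finite.card_eq_zero_iff.1 hn
    exact isEmptyElim X.root
  | succ n ih =>
    intro S _ X hX hn
    by_cases hr : ∀ a : X.V, a = X.root
    · obtain ⟨u, hu⟩ := exists_kmap (z := toMbar X hX) fun s => by
        rw [crd_toMbar]
        exact hX.abs_snd_ne.2 (hr _)
      exact ⟨B S u, Gen.base u, (H.πB S u).trans hu.symm⟩
    · push Not at hr
      obtain ⟨a, ha⟩ := hr
      classical
      obtain ⟨e⟩ := finite_iff_nonempty_fintype S |>.1 inferInstance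
      let ord : LinearOrder S :=
        LinearOrder.lift' (Fintype.equivFin S) (Fintype.equivFin S).injective
      rw [hX.toMbar_normDec ord]
      have hN := hX.normDec_valid ord
      obtain ⟨w, A, hw⟩ := exists_terminal (X.withDec (X.normDec ord)) ha
      have hw0 := hN.internal hw.1
      obtain ⟨r, hr⟩ := (eventually_pruneOK hN.good hw hw0).exists
      have hcard : Nat.card ((X.withDec (X.normDec ord)).prune hw
          (((X.withDec (X.normDec ord)).dec (Sum.inl w)).1, r)).V = n := by
        have := X.finite
        change Nat.card {a : X.V // a ≠ w} = n
        rw [show Nat.card {a : X.V // a ≠ w} = Nat.card X.V - 1 from by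
          have := Fintype.ofFinite X.V
          rw [Nat.card_eq_fintype_card, Nat.card_eq_fintype_card]
          exact Set.card_ne_eq w, hn, Nat.add_sub_cancel]
      obtain ⟨y, hy, hyπ⟩ := ih _ (hN.prune hw hr) hcard
      have hd : (X.withDec (X.normDec ord)).dec (Sum.inl w) =
          (((X.withDec (X.normDec ord)).dec (Sum.inl w)).1, r * 0) :=
        Prod.ext rfl (hw0.trans (mul_zero r).symm)
      have hu : ∀ b ∈ A, (X.withDec (X.normDec ord)).dec (Sum.inr b) ∈ InDisk :=
        fun b _ => hX.normDec_inDisk ord Sum.inr_ne_inl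
      have h1 := eq_glue hN.good hw hd hr (by simp) hu (crd_toMbar hN)
        (crd_toMbar (hN.prune hw hr))
      refine ⟨Q.glue A y (cap B C (hN.good.top hw hu)), H.gen_relabel _
        (H.gen_comp_cap _ hy _), ?_⟩
      rw [h1, H.homπ.map_glue, hyπ, H.map_cap]

theorem OverMbar.exists_gen_mbar {S : Type} [Finite S] (z : MbarObj S) :
    ∃ x : Q.obj S, Gen B C x ∧ π S x = z := by
  obtain ⟨X, hX, rfl⟩ := exists_toMbar z
  exact H.exists_gen _ X hX rfl

end

end TrivDisks

namespace TrivDisks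
open Topology Filter DTree

/-! ### The universal property -/

section

variable {P : OperadData.{u}} {f : Family FLD P} {g : Family AnTriv P}

/-- The map from `FLD` to the product of `𝕄̄` and `P`. -/
def graphB (f : Family FLD P) : Family FLD (Mbar.prod P) := fun S _ x => (fldToMbar S x, f S x)

/-- The map from `An^triv` to the product of `𝕄̄` and `P`. -/
noncomputable def graphC (g : Family AnTriv P) : Family AnTriv (Mbar.prod P) :=
  fun S _ a => (antrivToMbar S a, g S a)

/-- The product `𝕄̄ × P`, with the graphs of `f` and `g`, is an operad over `𝕄̄`. -/
theorem overMbar_graph (hP : IsOperad P) (hf : IsOperadHom f) (hg : IsOperadHom g)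
    (hfg : ∀ (S : Type) [Finite S] (a : FLD1.obj S),
      f S (fld1ToFLD S a) = g S (fld1ToAnTriv S a)) :
    OverMbar (Q := Mbar.prod P) (graphB f) (graphC g) (fun _ _ q => q.1) where
  isOperad := isOperad_Mbar.prod hP
  homB :=
    { map_relabel := fun σ x =>
        Prod.ext (isOperadHom_fldToMbar.map_relabel σ x) (hf.map_relabel σ x)
      map_one := Prod.ext isOperadHom_fldToMbar.map_one hf.map_one
      map_comp := fun s x y =>
        Prod.ext (isOperadHom_fldToMbar.map_comp s x y) (hf.map_comp s x y) }
  homC :=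
    { map_relabel := fun σ x =>
        Prod.ext (isOperadHom_antrivToMbar.map_relabel σ x) (hg.map_relabel σ x)
      map_one := Prod.ext isOperadHom_antrivToMbar.map_one hg.map_one
      map_comp := fun s x y =>
        Prod.ext (isOperadHom_antrivToMbar.map_comp s x y) (hg.map_comp s x y) }
  homπ := ⟨fun _ _ => rfl, rfl, fun _ _ _ => rfl⟩
  comm S _ a := Prod.ext (fld1_comm a) (hfg S a)
  πB _ _ _ := rfl
  πC _ _ _ := rfl

/-- The suboperad of `𝕄̄ × P` generated by the graphs of `f` and `g` is the graph of the morphism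
`𝕄̄ → P`. -/
theorem existsUnique_hom (hP : IsOperad P) (hf : IsOperadHom f) (hg : IsOperadHom g)
    (hfg : ∀ (S : Type) [Finite S] (a : FLD1.obj S),
      f S (fld1ToFLD S a) = g S (fld1ToAnTriv S a)) :
    ∃! h : Family Mbar P, IsOperadHom h ∧
      (∀ (S : Type) [Finite S] (b : FLD.obj S), h S (fldToMbar S b) = f S b) ∧
      (∀ (S : Type) [Finite S] (c : AnTriv.obj S), h S (antrivToMbar S c) = g S c) := by
  have H := overMbar_graph hP hf hg hfg
  have ex : ∀ (S : Type) [Finite S] (z : Mbar.obj S), ∃ p : P.obj S,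
      Gen (Q := Mbar.prod P) (graphB f) (graphC g) (S := S) (z, p) := by
    intro S _ z
    obtain ⟨⟨z', p⟩, hx, rfl⟩ := H.exists_gen_mbar z
    exact ⟨p, hx⟩
  choose h hh using ex
  have key : ∀ {S : Type} [Finite S] {z : Mbar.obj S} {p : P.obj S},
      Gen (Q := Mbar.prod P) (graphB f) (graphC g) (S := S) (z, p) → h S z = p := by
    intro S _ z p hp
    exact congrArg Prod.snd (H.gen_unique _ (hh S z) hp rfl rfl)
  refine ⟨fun S _ z => h S z, ⟨⟨?_, ?_, ?_⟩, ?_, ?_⟩, ?_⟩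
  · intro S T _ _ σ z
    exact key (H.gen_relabel σ (hh S z))
  · exact key H.gen_one
  · intro S S' _ _ s x y
    exact key (H.gen_comp (hh S x) (hh S' y) s)
  · intro S _ b
    exact key (Gen.base b)
  · intro S _ c
    exact key (H.gen_annulus c)
  · rintro h' ⟨hom, hB, hC⟩
    funext S _ z
    have claim : ∀ {S : Type} [Finite S] {q : (Mbar.prod P).obj S},
        Gen (Q := Mbar.prod P) (graphB f) (graphC g) (S := S) q → h' S q.1 = q.2 := by
      intro S _ q hq
      induction hq with
      | base b => exact hB _ b
      | cap t σ u _ ih =>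
        refine (hom.map_relabel σ _).trans (congrArg _ ((hom.map_comp t _ _).trans ?_))
        refine congrArg₂ _ ih ((hom.map_act _ _).trans ?_)
        exact congrArg₂ _ (hC _ _) (hB _ _)
    exact claim (hh S z)

theorem isPushoutOfOperads : IsPushoutOfOperads.{0, 1, u}
    fld1ToFLD fld1ToAnTriv fldToMbar antrivToMbar where
  isOperad := ⟨isOperad_FLD1, isOperad_FLD, isOperad_AnTriv, isOperad_Mbar⟩
  isHom := ⟨isTopOperadHom_fld1ToFLD.isOperadHom, isTopOperadHom_fld1ToAnTriv.isOperadHom,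
    isOperadHom_fldToMbar, isOperadHom_antrivToMbar⟩
  comm _ _ a := fld1_comm a
  universal _ hP _ _ hf hg hfg := existsUnique_hom hP hf hg hfg

end

end TrivDisks

namespace TrivDisks
open Topology Filter DTree

/-! ### Continuity of the induced morphism -/

section

variable {P : OperadData.{u}} [tP : ∀ (S : Type) [Finite S], TopologicalSpace (P.obj S)]

theorem IsTopOperad.continuous_act (hP : IsTopOperad P fun S _ => tP S) {S : Type} [Finite S] :
    Continuous fun p : P.obj Unit × P.obj S => P.act p.1 p.2 :=
  (hP.continuous_relabel _).comp (hP.continuous_comp _)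

theorem IsTopOperad.continuous_glue (hP : IsTopOperad P fun S _ => tP S) {S : Type} [Finite S]
    (A : Set S) : Continuous fun p : P.obj (Collapse A) × P.obj A => P.glue A p.1 p.2 :=
  (hP.continuous_relabel _).comp (hP.continuous_comp _)

variable {f : Family FLD P} {g : Family AnTriv P} {h : Family Mbar P}

/-- The configurations of disks form an open subset of `𝕄̄(S)`, on which the inverse of the map
from `FLD(S)` is continuous. -/
theorem continuousAt_of_kmap {S : Type} [Finite S] {α : Type*} [TopologicalSpace α]
    {F : MbarObj S → α} (hF : @Continuous _ _ (FLD.top S) _ fun x => F (kmap x)) {z : MbarObj S}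
    (hz : ∀ s, ((crd z).1 s).2 ≠ 0) : ContinuousAt F z := by
  let _ := FLD.top S
  have hV : {z : MbarObj S | ∀ s, ((crd z).1 s).2 ≠ 0} ∈ 𝓝 z := by
    have : ∀ᶠ z' in 𝓝 z, ∀ s, ((crd z').1 s).2 ≠ 0 := eventually_all.2 fun s =>
      ContinuousAt.eventually_ne (Continuous.continuousAt (by
        have := continuous_crd (S := S)
        fun_prop)) (hz s)
    exact this
  refine ContinuousOn.continuousAt (continuousOn_iff_continuous_domRestrict.2 ?_) hV
  choose φ hφ using fun z : {z : MbarObj S | ∀ s, ((crd z).1 s).2 ≠ 0} => exists_kmap z.2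
  have hc : Continuous φ := by
    refine continuous_FLD_iff.2 ?_
    rw [show (fun z => (φ z).1) = fun z => (crd z.1).1 from funext fun z => by
      rw [← crd_kmap_abs, ← hφ]]
    exact continuous_fst.comp (continuous_crd.comp continuous_subtype_val)
  rw [show Set.domRestrict _ F = fun z => F (kmap (φ z)) from funext fun z => by
    rw [← hφ]
    rfl]
  exact hF.comp hc

theorem DTree.pruneSucc_withDec {S : Type} {X : DTree S} {w : X.V} {A : Set S}
    (hw : X.Terminal w A) (d : X.V ⊕ S → ℂ × ℂ) :
    pruneSucc (X := X.withDec d) hw = pruneSucc hw := by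
  funext x
  rcases x with x | x | x <;> rfl

/-- The shape of the pruned tree does not depend on the decorations. -/
theorem DTree.withDec_prune {S : Type} {X : DTree S} {w : X.V} {A : Set S}
    (hw : X.Terminal w A) (d : X.V ⊕ S → ℂ × ℂ) (p p' : ℂ × ℂ) :
    (X.withDec d).prune hw p = (X.prune hw p').withDec (pruneDec (X := X.withDec d) w A p) := by
  have := pruneSucc_withDec hw d
  unfold DTree.prune
  congr

/-- For decorations near those of `X`, the terminal vertex can still be pruned with the radius `r`. -/
theorem eventually_prunable {S : Type} [Finite S] {X : DTree S} {w : X.V} {r : ℂ}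
    {c : ℂ} (hr : X.PruneOK w (c, r)) (hc : X.dec (Sum.inl w) = (c, 0))
    (h1 : ‖c‖ + ‖r‖ < 1) :
    ∀ᶠ d in 𝓝 X.dec, (X.withDec d).PruneOK w ((d (Sum.inl w)).1, r) ∧
      ‖(d (Sum.inl w)).2 / r‖ ≤ 1 := by
  have := X.finite
  have e1 : ∀ᶠ d in 𝓝 X.dec, ∀ y, X.IsInput y (X.succ (Sum.inl w)) → y ≠ Sum.inl w →
      Apart ((d (Sum.inl w)).1, r) (d y) := by
    refine eventually_all.2 fun y => ?_
    by_cases hy : X.IsInput y (X.succ (Sum.inl w)) ∧ y ≠ Sum.inl w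
    · have h := hr.apart y hy.1 hy.2
      have : ContinuousAt (fun d : X.V ⊕ S → ℂ × ℂ => ‖r‖ + ‖(d y).2‖) X.dec :=
        continuousAt_const.add (continuous_apply y).snd.norm.continuousAt
      have h' : ContinuousAt (fun d : X.V ⊕ S → ℂ × ℂ => ‖(d (Sum.inl w)).1 - (d y).1‖) X.dec := by
        fun_prop
      filter_upwards [this.eventually_lt h' (by rw [hc]; exact h)] with d hd _ _ using hd
    · exact Eventually.of_forall fun d a b => absurd ⟨a, b⟩ hy
  have e2 : ∀ᶠ d in 𝓝 X.dec, ‖(d (Sum.inl w)).1‖ + ‖r‖ < 1 := by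
    have : ContinuousAt (fun d : X.V ⊕ S → ℂ × ℂ => ‖(d (Sum.inl w)).1‖ + ‖r‖) X.dec :=
      (continuous_apply _).fst.norm.continuousAt.add continuousAt_const
    exact this.eventually_lt continuousAt_const (by rw [hc]; exact h1)
  have e3 : ∀ᶠ d in 𝓝 X.dec, ‖(d (Sum.inl w)).2 / r‖ < 1 := by
    have : ContinuousAt (fun d : X.V ⊕ S → ℂ × ℂ => ‖(d (Sum.inl w)).2 / r‖) X.dec :=
      (((continuous_apply _).snd).div_const r).norm.continuousAt
    exact this.eventually_lt continuousAt_const (by rw [hc]; simp)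
  filter_upwards [e1, e2, e3] with d h1 h2 h3
  exact ⟨⟨hr.ne, h1, fun _ => ⟨h2.le, fun _ => h2⟩⟩, h3.le⟩

/-- By induction on the number of vertices. Near a tree with more than one vertex, the elements of
`𝕄̄` are compositions of an element near the pruned tree, an annulus of radius near `0`, and framed
little disks, all of which depend continuously on the decorations. -/
theorem continuousAt_hom (hP : IsTopOperad P fun S _ => tP S) (hh : IsOperadHom h)
    (hf : ∀ (S : Type) [Finite S], @Continuous _ _ (FLD.top S) _ (f S))
    (hg : ∀ (S : Type) [Finite S], @Continuous _ _ (AnTriv.top S) _ (g S))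
    (hB : ∀ (S : Type) [Finite S] (b : FLD.obj S), h S (fldToMbar S b) = f S b)
    (hC : ∀ (S : Type) [Finite S] (c : AnTriv.obj S), h S (antrivToMbar S c) = g S c) (n : ℕ) :
    ∀ {S : Type} [Finite S] (X : DTree S) (hX : X.Valid), Nat.card X.V = n →
      ContinuousAt (X := MbarObj S) (h S) (toMbar X hX) := by
  induction n with
  | zero =>
    intro S _ X hX hn
    have := X.finite
    have : IsEmpty X.V := Finite.card_eq_zero_iff.1 hn
    exact isEmptyElim X.root
  | succ n ih =>
    intro S _ X hX hn
    -- a tree with a single vertex is a configuration of framed little disks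
    by_cases hr : ∀ a : X.V, a = X.root
    · refine continuousAt_of_kmap (F := h S) ?_ fun s => ?_
      · rw [show (fun x => h S (kmap x)) = f S from funext fun x => hB S x]
        exact hf S
      · rw [crd_toMbar]
        exact hX.abs_snd_ne.2 (hr _)
    · push Not at hr
      obtain ⟨a, ha⟩ := hr
      classical
      let ord : LinearOrder S :=
        have := Fintype.ofFinite S
        LinearOrder.lift' (Fintype.equivFin S) (Fintype.equivFin S).injective
      have hN := hX.normDec_valid ord
      obtain ⟨w, A, hw⟩ := exists_terminal (X.withDec (X.normDec ord)) ha
      have hw0 : (X.normDec ord (Sum.inl w)).2 = 0 := hN.internal hw.1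
      have hwd : X.normDec ord (Sum.inl w) ∈ InDisk :=
        hX.normDec_inDisk ord fun e => hw.1 (Sum.inl_injective e)
      set c := (X.normDec ord (Sum.inl w)).1 with hc
      obtain ⟨r, hr, hcr⟩ : ∃ r, (X.withDec (X.normDec ord)).PruneOK w (c, r) ∧
          ‖c‖ + ‖r‖ < 1 := by
        have h1 : ContinuousAt (fun r : ℂ => ‖c‖ + ‖r‖) 0 := by fun_prop
        exact ((eventually_pruneOK hN.good hw hw0).and (eventually_nhdsWithin_of_eventually_nhds
          (h1.eventually_lt continuousAt_const (by simpa using norm_fst_lt_one hwd)))).exists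
      set Y := (X.withDec (X.normDec ord)).prune hw (c, r)
      have hY : Y.Valid := hN.prune hw hr
      have hcard : Nat.card Y.V = n := by
        have := X.finite
        change Nat.card {a : X.V // a ≠ w} = n
        rw [show Nat.card {a : X.V // a ≠ w} = Nat.card X.V - 1 from by
          have := Fintype.ofFinite X.V
          rw [Nat.card_eq_fintype_card, Nat.card_eq_fintype_card]
          exact Set.card_ne_eq w, hn, Nat.add_sub_cancel]
      have hu : ∀ b ∈ A, (X.withDec (X.normDec ord)).dec (Sum.inr b) ∈ InDisk :=
        fun b _ => hX.normDec_inDisk ord Sum.inr_ne_inl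
      -- `h` on the elements with the shape of `X`, decorations `d` and a terminal vertex that can
      -- be pruned with radius `r`
      have glued : ∀ {d : X.V ⊕ S → ℂ × ℂ} (hd : (X.withDec d).Good)
          (hu : ∀ b ∈ A, d (Sum.inr b) ∈ InDisk)
          (hp : (X.withDec d).PruneOK w ((d (Sum.inl w)).1, r))
          (hq : ‖(d (Sum.inl w)).2 / r‖ ≤ 1) {x : MbarObj S} (hx : crd x = (X.withDec d).coord)
          {x0 : MbarObj (Collapse A)}
          (hx0 : crd x0 = ((X.withDec d).prune hw ((d (Sum.inl w)).1, r)).coord),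
          h S x = P.glue A (h _ x0) (P.act (g Unit (annulus _ hq))
            (f A (hd.top (X := X.withDec d) hw hu))) := by
        intro d hd hu hp hq x hx x0 hx0
        have hdw : (X.withDec d).dec (Sum.inl w) =
            ((d (Sum.inl w)).1, r * ((d (Sum.inl w)).2 / r)) :=
          Prod.ext rfl (mul_div_cancel₀ _ hr.ne).symm
        rw [eq_glue hd hw hdw hp hq hu hx hx0]
        refine (hh.map_glue A _ _).trans (congrArg _ ((hh.map_act _ _).trans ?_))
        exact congrArg₂ _ (hC _ _) (hB _ _)
      let _ := FLD.top A
      let _ := AnTriv.top Unit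
      have hq0 : ‖(X.normDec ord (Sum.inl w)).2 / r‖ ≤ 1 := by simp [hw0]
      set y0 := toMbar Y hY
      set a0 := annulus _ hq0
      set u0 : FLD.obj A := hN.good.top hw hu
      have hx0 : h S (toMbar X hX) = P.glue A (h _ y0) (P.act (g Unit a0) (f A u0)) :=
        glued hN.good hu hr hq0 ((crd_toMbar hX).trans (by
          rw [← crd_toMbar hX, hX.toMbar_normDec ord, crd_toMbar])) (crd_toMbar hY)
      have hΦ : ContinuousAt (fun p : MbarObj (Collapse A) × AnTriv.obj Unit × FLD.obj A =>
          P.glue A (h _ p.1) (P.act (g Unit p.2.1) (f A p.2.2))) (y0, a0, u0) := by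
        have ih' : ContinuousAt (fun y : MbarObj (Collapse A) => h _ y) y0 := ih Y hY hcard
        have c1 : ContinuousAt (fun p : MbarObj (Collapse A) × AnTriv.obj Unit × FLD.obj A =>
            h _ p.1) (y0, a0, u0) :=
          ContinuousAt.comp (f := Prod.fst) (x := (y0, a0, u0)) ih' continuousAt_fst
        have c2 : Continuous (fun p : MbarObj (Collapse A) × AnTriv.obj Unit × FLD.obj A =>
            P.act (g Unit p.2.1) (f A p.2.2)) :=
          hP.continuous_act.comp (((hg Unit).comp (continuous_fst.comp continuous_snd)).prodMk
            ((hf A).comp (continuous_snd.comp continuous_snd)))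
        exact (hP.continuous_glue A).continuousAt.comp (c1.prodMk c2.continuousAt)
      intro N hNx
      rw [hx0] at hNx
      obtain ⟨N1, hN1, N23, hN23, hsub⟩ := mem_nhds_prod_iff.1 (hΦ hNx)
      obtain ⟨N2, hN2, N3, hN3, hsub'⟩ := mem_nhds_prod_iff.1 hN23
      obtain ⟨O1, hO1, hO1N⟩ := (mem_nhds_induced crd y0 N1).1 hN1
      obtain ⟨O2, hO2, hO2N⟩ := (mem_nhds_induced (fun a : AnTriv.obj Unit => a.1) a0 N2).1 hN2
      obtain ⟨O3, hO3, hO3N⟩ := (mem_nhds_induced (fun u : FLD.obj A => u.1) u0 N3).1 hN3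
      have t0 := eventually_prunable (X := X.withDec (X.normDec ord)) hr
        (Prod.ext hc.symm hw0) hcr
      -- `t1`, `t2`, `t3`: the three factors depend continuously on `d`
      have t1 : ∀ᶠ d in 𝓝 (X.normDec ord),
          ((X.withDec d).prune hw ((d (Sum.inl w)).1, r)).coord ∈ O1 := by
        let D : (X.V ⊕ S → ℂ × ℂ) → {a : X.V // a ≠ w} ⊕ Collapse A → ℂ × ℂ :=
          fun d => (X.withDec d).pruneDec w A ((d (Sum.inl w)).1, r)
        have h1 : ContinuousAt D (X.normDec ord) := by
          refine continuousAt_pi.2 ?_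
          rintro (b | s | _) 
          · exact continuousAt_apply (Sum.inl b.1) _
          · exact continuousAt_apply (Sum.inr s.1) _
          · exact ((continuous_apply _).fst.prodMk continuous_const).continuousAt
        have h2 : ContinuousAt (fun d => (Y.withDec (D d)).coord) (X.normDec ord) :=
          ContinuousAt.comp (g := fun d' => (Y.withDec d').coord)
            (continuousAt_coord hY.good) h1
        rw [crd_toMbar] at hO1
        filter_upwards [h2.eventually_mem hO1] with d hd
        have e : (X.withDec d).prune hw ((d (Sum.inl w)).1, r) = Y.withDec (D d) :=
          withDec_prune (X := X.withDec (X.normDec ord)) hw d _ _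
        rwa [e]
      have t2 : ∀ᶠ d in 𝓝 (X.normDec ord), (fun _ : Unit => ((0 : ℂ), (d (Sum.inl w)).2 / r)) ∈ O2 := by
        have : ContinuousAt (fun (d : X.V ⊕ S → ℂ × ℂ) (_ : Unit) =>
            ((0 : ℂ), (d (Sum.inl w)).2 / r)) (X.normDec ord) :=
          continuousAt_pi.2 fun _ => continuousAt_const.prodMk
            ((continuous_apply _).snd.div_const r).continuousAt
        exact this hO2
      have t3 : ∀ᶠ d in 𝓝 (X.normDec ord), (fun b : A => d (Sum.inr b.1)) ∈ O3 := by
        have : ContinuousAt (fun (d : X.V ⊕ S → ℂ × ℂ) (b : A) => d (Sum.inr b.1))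
            (X.normDec ord) := continuousAt_pi.2 fun b => continuousAt_apply _ _
        exact this hO3
      obtain ⟨U, hU, hUT⟩ := exists_nbhd_dec ord hX (t0.and (t1.and (t2.and t3)))
      refine mem_map.2 (mem_of_superset (basicNbhd_mem_nhds ord hX hU) fun x hx => ?_)
      obtain ⟨d, ⟨⟨hp, hq⟩, d1, d2, d3⟩, hd, hdisk, hxd⟩ := hUT x hx
      have hud : ∀ b ∈ A, d (Sum.inr b) ∈ InDisk := fun b _ => hdisk _ Sum.inr_ne_inl
      obtain ⟨x0, hx0⟩ := (hd.prune hw hp).exists_mbar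
        (nearlyStable_prune (X := X.withDec d) hX.nearlyStable hw _)
      change h S x ∈ N
      rw [glued hd hud hp hq hxd hx0]
      exact hsub (show (x0, annulus _ hq, hd.top (X := X.withDec d) hw hud) ∈ N1 ×ˢ N23 from
        ⟨hO1N (by rw [Set.mem_preimage, hx0]; exact d1),
          hsub' ⟨hO2N d2, hO3N d3⟩⟩)

theorem isPushoutOfTopOperads : IsPushoutOfTopOperads.{0, 1, u} FLD1.top FLD.top AnTriv.top Mbar.top
    fld1ToFLD fld1ToAnTriv fldToMbar antrivToMbar where
  isTopOperad := ⟨isTopOperad_FLD1, isTopOperad_FLD, isTopOperad_AnTriv, isTopOperad_Mbar⟩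
  isTopHom := ⟨isTopOperadHom_fld1ToFLD, isTopOperadHom_fld1ToAnTriv, isTopOperadHom_fldToMbar,
    isTopOperadHom_antrivToMbar⟩
  comm _ _ a := fld1_comm a
  universal P tP hP f g hf hg hfg := by
    obtain ⟨h, ⟨hh, hB, hC⟩, huniq⟩ :=
      existsUnique_hom hP.isOperad hf.isOperadHom hg.isOperadHom hfg
    refine ⟨h, ⟨⟨hh, fun S _ => ?_⟩, hB, hC⟩, fun h' h1 =>
      huniq h' ⟨h1.1.isOperadHom, h1.2.1, h1.2.2⟩⟩
    let _ : ∀ (S : Type) [Finite S], TopologicalSpace (P.obj S) := tP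
    let _ := Mbar.top S
    refine continuous_iff_continuousAt.2 fun x => ?_
    obtain ⟨X, hX, rfl⟩ := exists_toMbar x
    exact continuousAt_hom hP hh (fun S _ => hf.continuous S) (fun S _ => hg.continuous S) hB hC _ X
      hX rfl

end

end TrivDisks

theorem mainTheorem7 :
    TrivDisks.IsPushoutOfOperads.{0, 1, w}
      TrivDisks.fld1ToFLD TrivDisks.fld1ToAnTriv TrivDisks.fldToMbar TrivDisks.antrivToMbar ∧
    ∃ t : TrivDisks.OperadTop TrivDisks.Mbar,
      TrivDisks.HasBasicNbhds t ∧
      TrivDisks.IsTopOperad TrivDisks.Mbar t ∧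
      (∀ (S : Type) [Finite S], Function.Injective (TrivDisks.fldToMbar S) ∧
        Function.Injective (TrivDisks.antrivToMbar S)) ∧
      TrivDisks.IsTopOperadHom TrivDisks.FLD.top t TrivDisks.fldToMbar ∧
      TrivDisks.IsTopOperadHom TrivDisks.AnTriv.top t TrivDisks.antrivToMbar ∧
      TrivDisks.IsPushoutOfTopOperads.{0, 1, w}
        TrivDisks.FLD1.top TrivDisks.FLD.top TrivDisks.AnTriv.top t
        TrivDisks.fld1ToFLD TrivDisks.fld1ToAnTriv TrivDisks.fldToMbar
        TrivDisks.antrivToMbar := by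
  exact ⟨TrivDisks.isPushoutOfOperads, TrivDisks.Mbar.top, TrivDisks.hasBasicNbhds_top,
    TrivDisks.isTopOperad_Mbar,
    fun S _ => ⟨TrivDisks.fldToMbar_injective, TrivDisks.antrivToMbar_injective⟩,
    TrivDisks.isTopOperadHom_fldToMbar, TrivDisks.isTopOperadHom_antrivToMbar,
    TrivDisks.isPushoutOfTopOperads⟩
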